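/- **Setting.** For $(x,v)\in\mathbb R^3\times\mathbb R^3$, $x\neq0$, put $H=\frac{|v|^2}{2}-\frac1{|x|}$, $\mathbf L=x\times v$, $L=|\mathbf L|^2=|x|^2|v|^2-(x\cdot v)^2$, $\mathbf n=(0,0,1)\times\mathbf L$, $\mathbf e=\big(|v|^2-\frac1{|x|}\big)x-(x\cdot v)v$. Given $\mathfrak c_0,\mathfrak h_0,\mathfrak l_1,\mathfrak l_2,\mathfrak n_0,\mathfrak n_1>0$ let $$\mathcal S^{\rm lin}_0=\Big\{(x,v):-\tfrac1{2L}+\mathfrak c_0\le H\le-\mathfrak h_0,\ \mathfrak l_1\le L\le\mathfrak l_2,\ |\mathbf n|>\mathfrak n_0,\ -1+\mathfrak n_1\le\tfrac{\mathbf n\cdot\mathbf e}{|\mathbf n||\mathbf e|}\le1-\mathfrak n_1\Big\}.$$ The Delaunay variables, defined on $\mathcal D=\{x\ne0,\ H<0,\ \mathbf n\neq0,\ \mathbf e\ne0\}$, are the actions $J=(-2H)^{-1/2}$, $\mathfrak L_z=(0,0,1)\cdot\mathbf L$, $\mathfrak L=|\mathbf L|$ and three angles in $\mathbb R/2\pi\mathbb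 Z$: $Q=E-|\mathbf e|\sin E$, where $|\mathbf e|(\cos E,\sin E)=\big(|v|^2|x|-1,\ (x\cdot v)\sqrt{2/|x|-|v|^2}\big)$; $\theta_{\mathfrak L_z}$ with $\cos\theta_{\mathfrak L_z}=\frac{\mathbf n\cdot\mathbf e}{|\mathbf n||\mathbf e|}$, $\sin\theta_{\mathfrak L_z}=\frac{(\mathbf L\times\mathbf n)\cdot\mathbf e}{|\mathbf L||\mathbf n||\mathbf e|}$; and $\theta_{\mathfrak L}$ with $(\cos\theta_{\mathfrak L},\sin\theta_{\mathfrak L})=\frac{(n_1,n_2)}{|\mathbf n|}$. Write $\langle s\rangle=\sqrt{1+s^2}$, and let $\Delta^{-1}h(x)=-\frac1{4\pi}\int_{\mathbb R^3}\frac{h(y)}{|x-y|}\,dy$. **Theorem.** Let $N\ge1$ be an integer, $A>0$, and let $f_{\rm in}\in C^N(\mathbb R^3\times\mathbb R^3)$ satisfy $\operatorname{supp}f_{\rm in}\subset\mathcal S^{\rm lin}_0$ and $\sum_{|\alpha|+|\beta|\le N}\sup_{x,v}|\partial_x^\alpha\partial_v^\beta f_{\rm in}|\le A$. Let $f$ be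 continuous on $[0,\infty)\times\mathbb R^3\times\mathbb R^3$, $C^1$ where $x\neq0$, with $f|_{s=0}=f_{\rm in}$ and, where $x\ne0$, $$\partial_sf+\sum_{i=1}^3v_i\partial_{x_i}f-\sum_{i=1}^3\partial_{x_i}\Phi\,\partial_{v_i}f=0,\qquad\Phi(x)=-\frac1{|x|}.$$ Put $\rho(s,x)=\int_{\mathbb R^3}f(s,x,v)\,dv$ and $\varphi(s,\cdot)=\Delta^{-1}\rho(s,\cdot)$. Then, for every $s\ge0$, $f(s,\cdot)$ is $C^N$ with compact support, $\rho$ and $\varphi$ are differentiable in $s$, $\partial_s\rho(s,\cdot)\in C^{N-1}$, $\partial_s\varphi(s,\cdot)\in C^N$, and the following holds, where the implicit constants in $\lesssim$ depend only on $\mathfrak c_0,\mathfrak h_0,\mathfrak l_1,\mathfrak l_2,\mathfrak n_0,\mathfrak n_1,N$. 1. For all $s\ge0$ and $|\alpha|+|\beta|\le N$: $\ \sup_{x,v}|\partial_x^\alpha\partial_v^\beta f|(s,x,v)\lesssim A\langle s\rangle^{|\alpha|+|\beta|}$. 2. $\mathcal S^{\rm lin}_0\subset\mathcal D$, and the Delaunay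 variables are action–angle coordinates on $\mathcal D$: they are injective there, and there is a smooth map $X$ with image $\mathcal D$, defined for $|\mathfrak L_z|<\mathfrak L<J$ and real angles, such that the point $X(J,\mathfrak L_z,\mathfrak L,Q,\theta_{\mathfrak L_z},\theta_{\mathfrak L})$ has these Delaunay variables (angles modulo $2\pi$) and $$X^*\Big(\sum_i dx_i\wedge dv_i\Big)=dQ\wedge dJ+d\theta_{\mathfrak L_z}\wedge d\mathfrak L+d\theta_{\mathfrak L}\wedge d\mathfrak L_z.$$ In these coordinates (that is, for $f(t,\cdot)\circ X$), for all $t\ge0$ and $i_1+\dots+i_6\le N$, $$\sup\big|\partial_J^{i_1}\partial_{\mathfrak L_z}^{i_2}\partial_{\mathfrak L}^{i_3}\partial_Q^{i_4}\partial_{\theta_{\mathfrak L_z}}^{i_5}\partial_{\theta_{\mathfrak L}}^{i_6}f\big|(t,\cdot)\lesssim A\langle t\rangle^{i_1}.$$ 3. For all $s\ge0$: $\ \sup_{x}|\partial_x^\alpha\partial_s\rho(s,x)|\lesssim A\langle s\rangle^{-(N-|\alpha|)}$ for $|\alpha|\le N-2$; and, for all $p\in[1,\infty)$ and $R>0$,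 $\ \|\partial_x^\alpha\partial_s\varphi(s,\cdot)\|_{L^p(|x|\le R)}\lesssim_{p,R}A\langle s\rangle^{-\min\{N-|\alpha|+2,\,N\}}$ for $|\alpha|\le N$, where the constant may depend also on $p$ and $R$. -/

import Mathlib

open Set MeasureTheory
open scoped ContDiff ENNReal

noncomputable section

namespace KeplerVlasov

/-- Physical space, with the Euclidean norm. -/
abbrev E3 : Type := EuclideanSpace ℝ (Fin 3)

/-- Phase space; a point is a pair `(x, v)` of a position and a velocity. -/
abbrev Phase : Type := E3 × E3

/-- The Japanese bracket `⟨s⟩ = (1 + s²)^(1/2)`. -/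
def bracket (s : ℝ) : ℝ := Real.sqrt (1 + s ^ 2)

/-! ### Partial derivatives -/

/-- `∂ᵅ g`, where the `i`-th partial derivative is the derivative in the direction `b i`. -/
def partialDeriv {V : Type*} [NormedAddCommGroup V] [NormedSpace ℝ V] {n : ℕ}
    (b : Fin n → V) (α : Fin n → ℕ) (g : V → ℝ) : V → ℝ :=
  (List.finRange n).foldr (fun i h => (fun k y => fderiv ℝ k y (b i))^[α i] h) g

/-- The standard basis of physical space. -/
def basisE3 (i : Fin 3) : E3 := EuclideanSpace.single i 1

/-- The coordinate directions `∂/∂xᵢ` of phase space. -/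
def dirX (i : Fin 3) : Phase := (basisE3 i, 0)

/-- The coordinate directions `∂/∂vᵢ` of phase space. -/
def dirV (i : Fin 3) : Phase := (0, basisE3 i)

/-- `∂ₓᵅ ∂ᵥᵝ g` on phase space. -/
def phaseDeriv (α β : Fin 3 → ℕ) (g : Phase → ℝ) : Phase → ℝ :=
  partialDeriv dirX α (partialDeriv dirV β g)

/-- The length `|α|` of a multi-index. -/
def order {n : ℕ} (α : Fin n → ℕ) : ℕ := ∑ i, α i

/-- The finite set of all pairs `(α, β)` of multi-indices with `|α| + |β| ≤ N`. -/
def multiIndexPairs (N : ℕ) : Finset ((Fin 3 → ℕ) × (Fin 3 → ℕ)) :=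
  (Fintype.piFinset (fun _ : Fin 3 => Finset.range (N + 1)) ×ˢ
    Fintype.piFinset (fun _ : Fin 3 => Finset.range (N + 1))).filter
    (fun p => order p.1 + order p.2 ≤ N)

/-- `∑_{|α|+|β| ≤ N} sup_{x,v} |∂ₓᵅ ∂ᵥᵝ g|`, as an extended nonnegative number. -/
def cNorm (N : ℕ) (g : Phase → ℝ) : ℝ≥0∞ :=
  ∑ p ∈ multiIndexPairs N, ⨆ z : Phase, ‖phaseDeriv p.1 p.2 g z‖ₑ

/-! ### Kepler problem -/

/-- The Kepler potential `Φ(x) = -1/|x|`. -/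
def keplerPotential (x : E3) : ℝ := -1 / ‖x‖

/-- The cross product on physical space. -/
def cross (a b : E3) : E3 := WithLp.toLp 2 (crossProduct a.ofLp b.ofLp)

/-- The Kepler energy `H = |v|²/2 - 1/|x|`. -/
def energy (z : Phase) : ℝ := ‖z.2‖ ^ 2 / 2 - 1 / ‖z.1‖

/-- `L = |x|²|v|² - (x·v)²`, the square of the length of the angular momentum. -/
def angMomSq (z : Phase) : ℝ := ‖z.1‖ ^ 2 * ‖z.2‖ ^ 2 - (inner ℝ z.1 z.2) ^ 2

/-- The angular momentum vector `x × v`. -/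
def angMom (z : Phase) : E3 := cross z.1 z.2

/-- The vector `n = (0,0,1) × (x × v)`, pointing to the ascending node. -/
def nodeVec (z : Phase) : E3 := cross (basisE3 2) (angMom z)

/-- The eccentricity vector `e = (|v|² - 1/|x|) x - (x·v) v`. -/
def eccVec (z : Phase) : E3 :=
  (‖z.2‖ ^ 2 - 1 / ‖z.1‖) • z.1 - (inner ℝ z.1 z.2 : ℝ) • z.2

/-- The trapped region of phase space. -/
def trappedRegion (c₀ h₀ l₁ l₂ n₀ n₁ : ℝ) : Set Phase :=
  {z | -1 / (2 * angMomSq z) + c₀ ≤ energy z ∧ energy z ≤ -h₀ ∧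
    l₁ ≤ angMomSq z ∧ angMomSq z ≤ l₂ ∧ n₀ < ‖nodeVec z‖ ∧
    -1 + n₁ ≤ inner ℝ (nodeVec z) (eccVec z) / (‖nodeVec z‖ * ‖eccVec z‖) ∧
    inner ℝ (nodeVec z) (eccVec z) / (‖nodeVec z‖ * ‖eccVec z‖) ≤ 1 - n₁}

/-! ### The linear transport equation, its density and its potential -/

/-- `f` is a classical solution, on `[0, ∞) × ℝ³ × ℝ³`, of
`∂ₛ f + v · ∇ₓ f - ∇Φ · ∇ᵥ f = 0` with initial value `g`. The equation, whose coefficients are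
singular at `x = 0`, is imposed where `x ≠ 0`; across `x = 0` only continuity is required. -/
structure IsClassicalSolution (f : ℝ → Phase → ℝ) (g : Phase → ℝ) : Prop where
  continuousOn : ContinuousOn (fun p : ℝ × Phase => f p.1 p.2) (Ici 0 ×ˢ univ)
  contDiffOn : ContDiffOn ℝ 1 (fun p : ℝ × Phase => f p.1 p.2) (Ici 0 ×ˢ {z | z.1 ≠ 0})
  initial : f 0 = g
  transport : ∀ s : ℝ, 0 ≤ s → ∀ x v : E3, x ≠ 0 →
    derivWithin (fun τ => f τ (x, v)) (Ici 0) s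
      + ∑ i, v i * fderiv ℝ (f s) (x, v) (dirX i)
      - ∑ i, fderiv ℝ keplerPotential x (basisE3 i) * fderiv ℝ (f s) (x, v) (dirV i) = 0

/-- The macroscopic density `ρ(s, x) = ∫ f(s, x, v) dv`. -/
def density (f : ℝ → Phase → ℝ) (s : ℝ) (x : E3) : ℝ := ∫ v : E3, f s (x, v)

/-- `Δ⁻¹` on `ℝ³`: convolution with the fundamental solution `-1 / (4π|x|)` of the Laplacian. -/
def invLaplacian (h : E3 → ℝ) (x : E3) : ℝ := -(1 / (4 * Real.pi)) * ∫ y : E3, h y / ‖x - y‖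

/-- The macroscopic potential `φ(s, ·) = Δ⁻¹ ρ(s, ·)`. -/
def potential (f : ℝ → Phase → ℝ) (s : ℝ) (x : E3) : ℝ := invLaplacian (density f s) x

/-- `∂ₛ u(s, x)` for `u` defined for times in `[0, ∞)` (one-sided at `s = 0`). -/
def timeDeriv (u : ℝ → E3 → ℝ) (s : ℝ) (x : E3) : ℝ := derivWithin (fun τ => u τ x) (Ici 0) s

/-! ### Delaunay variables -/

/-- The action `J = (-2H)^(-1/2)`. -/
def actionJ (z : Phase) : ℝ := 1 / Real.sqrt (-2 * energy z)

/-- The action `𝔏_z = (0,0,1) · (x × v)`. -/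
def actionLz (z : Phase) : ℝ := inner ℝ (basisE3 2) (angMom z)

/-- The action `𝔏 = |x × v|`. -/
def actionL (z : Phase) : ℝ := ‖angMom z‖

/-- The eccentric anomaly `E`, an angle modulo `2π`, with
`|e| (cos E, sin E) = (|v|²|x| - 1, (x·v) (2/|x| - |v|²)^(1/2))`. -/
def eccAnomaly (z : Phase) : Real.Angle :=
  (Complex.arg ⟨‖z.2‖ ^ 2 * ‖z.1‖ - 1,
    inner ℝ z.1 z.2 * Real.sqrt (2 / ‖z.1‖ - ‖z.2‖ ^ 2)⟩ : ℝ)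

/-- The mean anomaly `Q = E - |e| sin E`, an angle modulo `2π`. -/
def angleQ (z : Phase) : Real.Angle :=
  eccAnomaly z - ((‖eccVec z‖ * (eccAnomaly z).sin : ℝ) : Real.Angle)

/-- The argument of the pericentre, an angle modulo `2π`: the oriented angle from `n` to `e` in the
plane orthogonal to the angular momentum `𝐋`. Its cosine is `n·e / (|n||e|)` and its sine is
`(𝐋 × n)·e / (|𝐋||n||e|)`. -/
def anglePeri (z : Phase) : Real.Angle :=
  (Complex.arg ⟨inner ℝ (nodeVec z) (eccVec z),
    inner ℝ (cross (angMom z) (nodeVec z)) (eccVec z) / ‖angMom z‖⟩ : ℝ)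

/-- The longitude of the ascending node, an angle modulo `2π`, with cosine `n₁/|n|` and
sine `n₂/|n|`. -/
def angleNode (z : Phase) : Real.Angle :=
  (Complex.arg ⟨nodeVec z 0, nodeVec z 1⟩ : ℝ)

/-- The Delaunay variables `(J, 𝔏_z, 𝔏, Q, pericentre, node)` of a point of phase space. -/
def delaunay (z : Phase) : ℝ × ℝ × ℝ × Real.Angle × Real.Angle × Real.Angle :=
  (actionJ z, actionLz z, actionL z, angleQ z, anglePeri z, angleNode z)

/-- The points of phase space on noncircular and nonhorizontal Kepler ellipses. -/
def delaunayDomain : Set Phase :=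
  {z | z.1 ≠ 0 ∧ energy z < 0 ∧ nodeVec z ≠ 0 ∧ eccVec z ≠ 0}

/-- The range of the Delaunay variables, with the angles lifted to `ℝ`. -/
def delaunayRange : Set (Fin 6 → ℝ) := {y | |y 1| < y 2 ∧ y 2 < y 0}

/-- The symplectic form `∑ dxᵢ ∧ dvᵢ` on phase space. -/
def symplecticForm (a b : Phase) : ℝ := inner ℝ a.1 b.2 - inner ℝ a.2 b.1

/-- The form `dQ ∧ dJ + d(pericentre) ∧ d𝔏 + d(node) ∧ d𝔏_z`. -/
def actionAngleForm (ξ η : Fin 6 → ℝ) : ℝ :=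
  (ξ 3 * η 0 - ξ 0 * η 3) + (ξ 4 * η 2 - ξ 2 * η 4) + (ξ 5 * η 1 - ξ 1 * η 5)

/-- `X` expresses a point of phase space through its Delaunay variables
`y = (J, 𝔏_z, 𝔏, Q, pericentre, node)`, where the angles are lifted to `ℝ`, and these variables form
a smooth canonical (action-angle) coordinate system. -/
structure IsDelaunayCoordinates (X : (Fin 6 → ℝ) → Phase) : Prop where
  smooth : ContDiffOn ℝ ∞ X delaunayRange
  image_eq : X '' delaunayRange = delaunayDomain
  delaunay_eq : ∀ y ∈ delaunayRange,
    delaunay (X y) = (y 0, y 1, y 2, (y 3 : Real.Angle), (y 4 : Real.Angle), (y 5 : Real.Angle))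
  injOn : InjOn delaunay delaunayDomain
  canonical : ∀ y ∈ delaunayRange, ∀ ξ η : Fin 6 → ℝ,
    symplecticForm (fderiv ℝ X y ξ) (fderiv ℝ X y η) = actionAngleForm ξ η

/-- The coordinate directions of the space of (lifted) Delaunay variables. -/
def dirDelaunay (i : Fin 6) : Fin 6 → ℝ := Pi.single i 1

end KeplerVlasov

end

noncomputable section

namespace KeplerVlasov

section

/-! ### Coordinates in physical space -/

theorem inner_eq (x y : E3) : inner ℝ x y = x 0 * y 0 + x 1 * y 1 + x 2 * y 2 := by
  simp [PiLp.inner_apply, Fin.sum_univ_three, mul_comm]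

theorem norm_sq_eq (x : E3) : ‖x‖ ^ 2 = x 0 ^ 2 + x 1 ^ 2 + x 2 ^ 2 := by
  rw [EuclideanSpace.real_norm_sq_eq, Fin.sum_univ_three]

theorem cross_zero (a b : E3) : cross a b 0 = a 1 * b 2 - a 2 * b 1 := by
  simp [cross, cross_apply]

theorem cross_one (a b : E3) : cross a b 1 = a 2 * b 0 - a 0 * b 2 := by
  simp [cross, cross_apply]

theorem cross_two (a b : E3) : cross a b 2 = a 0 * b 1 - a 1 * b 0 := by
  simp [cross, cross_apply]

theorem e3_ext {x y : E3} (h0 : x 0 = y 0) (h1 : x 1 = y 1) (h2 : x 2 = y 2) : x = y := by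
  ext i; fin_cases i <;> assumption

theorem angMomSq_eq (z : Phase) : angMomSq z = ‖angMom z‖ ^ 2 := by
  rw [angMomSq, norm_sq_eq, norm_sq_eq, norm_sq_eq, inner_eq, angMom, cross_zero, cross_one,
    cross_two]
  ring

theorem nodeVec_zero (z : Phase) : nodeVec z 0 = -angMom z 1 := by
  simp [nodeVec, cross_zero, basisE3]

theorem nodeVec_one (z : Phase) : nodeVec z 1 = angMom z 0 := by
  simp [nodeVec, cross_one, basisE3]

theorem nodeVec_two (z : Phase) : nodeVec z 2 = 0 := by
  simp [nodeVec, cross_two, basisE3]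

theorem actionLz_eq (z : Phase) : actionLz z = angMom z 2 := by
  simp [actionLz, inner_eq, basisE3]

theorem norm_nodeVec_sq (z : Phase) : ‖nodeVec z‖ ^ 2 = actionL z ^ 2 - actionLz z ^ 2 := by
  rw [norm_sq_eq, nodeVec_zero, nodeVec_one, nodeVec_two, actionL, norm_sq_eq, actionLz_eq]
  ring

theorem norm_eccVec_sq {z : Phase} (hz : z.1 ≠ 0) :
    ‖eccVec z‖ ^ 2 = 1 + 2 * energy z * angMomSq z := by
  have hr : ‖z.1‖ ≠ 0 := norm_ne_zero_iff.2 hz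
  have h : ‖eccVec z‖ ^ 2 = (‖z.2‖ ^ 2 - 1 / ‖z.1‖) ^ 2 * ‖z.1‖ ^ 2
      - 2 * (‖z.2‖ ^ 2 - 1 / ‖z.1‖) * inner ℝ z.1 z.2 * inner ℝ z.1 z.2
      + (inner ℝ z.1 z.2) ^ 2 * ‖z.2‖ ^ 2 := by
    rw [eccVec, norm_sub_sq_real, norm_smul, norm_smul, mul_pow, mul_pow, inner_smul_left,
      inner_smul_right]
    simp
    ring
  rw [h, energy, angMomSq]
  field_simp
  ring

/-! ### The position and velocity on a Kepler ellipse -/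

/-- The orthonormal frames of physical space. -/
structure IsFrame (u w m : E3) : Prop where
  uu : inner ℝ u u = (1 : ℝ)
  ww : inner ℝ w w = (1 : ℝ)
  mm : inner ℝ m m = (1 : ℝ)
  uw : inner ℝ u w = (0 : ℝ)
  um : inner ℝ u m = (0 : ℝ)
  wm : inner ℝ w m = (0 : ℝ)
  cross_uw : cross u w = m

theorem IsFrame.inner_comb {u w m : E3} (h : IsFrame u w m) (a b c a' b' c' : ℝ) :
    inner ℝ (a • u + b • w + c • m) (a' • u + b' • w + c' • m) = a * a' + b * b' + c * c' := by
  have hwu := real_inner_comm u w ▸ h.uw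
  have hmu := real_inner_comm u m ▸ h.um
  have hmw := real_inner_comm w m ▸ h.wm
  simp only [inner_add_left, inner_add_right, real_inner_smul_left, real_inner_smul_right,
    h.uu, h.ww, h.mm, h.uw, h.um, h.wm, hwu, hmu, hmw]
  ring

theorem IsFrame.inner_comb₂ {u w m : E3} (h : IsFrame u w m) (a b a' b' : ℝ) :
    inner ℝ (a • u + b • w) (a' • u + b' • w) = a * a' + b * b' := by
  simpa using h.inner_comb a b 0 a' b' 0

theorem cross_comb (u w : E3) (a b a' b' : ℝ) :
    cross (a • u + b • w) (a' • u + b' • w) = (a * b' - b * a') • cross u w := by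
  apply e3_ext <;> simp [cross_zero, cross_one, cross_two] <;> ring

/-- The point of phase space with coordinates `q` and `p` in the plane spanned by `u` and `w`, for
an ellipse with actions `J`, `J k` and eccentricity `e` at eccentric anomaly with cosine `c` and
sine `s`. -/
def orbitPoint (u w : E3) (J k e c s : ℝ) : Phase :=
  ((J ^ 2 * (c - e)) • u + (J ^ 2 * k * s) • w,
    (-s / (J * (1 - e * c))) • u + (k * c / (J * (1 - e * c))) • w)

section Orbit

variable {u w m : E3} {J k e c s : ℝ}

theorem orbitPoint_norm (h : IsFrame u w m) (hk : k ^ 2 = 1 - e ^ 2)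
    (hcs : c ^ 2 + s ^ 2 = 1) (hD : 0 < 1 - e * c) :
    ‖(orbitPoint u w J k e c s).1‖ = J ^ 2 * (1 - e * c) := by
  have h1 : ‖(orbitPoint u w J k e c s).1‖ ^ 2 = (J ^ 2 * (1 - e * c)) ^ 2 := by
    rw [← real_inner_self_eq_norm_sq, orbitPoint, h.inner_comb₂]
    linear_combination J ^ 4 * s ^ 2 * hk + J ^ 4 * (1 - e ^ 2) * hcs
  exact (pow_left_inj₀ (norm_nonneg _) (by positivity) two_ne_zero).1 h1

theorem orbitPoint_vel (h : IsFrame u w m) (hJ : J ≠ 0) (hk : k ^ 2 = 1 - e ^ 2)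
    (hcs : c ^ 2 + s ^ 2 = 1) (hD : 0 < 1 - e * c) :
    ‖(orbitPoint u w J k e c s).2‖ ^ 2 = (1 + e * c) / (J ^ 2 * (1 - e * c)) := by
  have := hD.ne'
  rw [← real_inner_self_eq_norm_sq, orbitPoint, h.inner_comb₂]
  field_simp
  linear_combination c ^ 2 * hk + hcs

theorem orbitPoint_inner (h : IsFrame u w m) (hJ : J ≠ 0) (hk : k ^ 2 = 1 - e ^ 2)
    (hD : 0 < 1 - e * c) :
    inner ℝ (orbitPoint u w J k e c s).1 (orbitPoint u w J k e c s).2 = J * e * s := by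
  have := hD.ne'
  rw [orbitPoint, h.inner_comb₂]
  field_simp
  grind

theorem orbitPoint_angMom (h : IsFrame u w m) (hJ : J ≠ 0)
    (hcs : c ^ 2 + s ^ 2 = 1) (hD : 0 < 1 - e * c) :
    angMom (orbitPoint u w J k e c s) = (J * k) • m := by
  have := hD.ne'
  rw [angMom, orbitPoint, cross_comb, h.cross_uw]
  congr 1
  field_simp
  grind

theorem orbitPoint_energy (h : IsFrame u w m) (hJ : J ≠ 0) (hk : k ^ 2 = 1 - e ^ 2)
    (hcs : c ^ 2 + s ^ 2 = 1) (hD : 0 < 1 - e * c) :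
    energy (orbitPoint u w J k e c s) = -1 / (2 * J ^ 2) := by
  have := hD.ne'
  rw [energy, orbitPoint_vel h hJ hk hcs hD, orbitPoint_norm h hk hcs hD]
  field_simp
  ring

theorem orbitPoint_ecc (h : IsFrame u w m) (hJ : J ≠ 0) (hk : k ^ 2 = 1 - e ^ 2)
    (hcs : c ^ 2 + s ^ 2 = 1) (hD : 0 < 1 - e * c) :
    eccVec (orbitPoint u w J k e c s) = e • u := by
  have := hD.ne'
  rw [eccVec, orbitPoint_inner h hJ hk hD, orbitPoint_vel h hJ hk hcs hD,
    orbitPoint_norm h hk hcs hD, orbitPoint, smul_add, smul_add, smul_smul, smul_smul, smul_smul,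
    smul_smul, add_sub_add_comm, ← sub_smul, ← sub_smul]
  have h1 : ((1 + e * c) / (J ^ 2 * (1 - e * c)) - 1 / (J ^ 2 * (1 - e * c))) * (J ^ 2 * (c - e)) -
      J * e * s * (-s / (J * (1 - e * c))) = e := by
    field_simp
    grind
  have h2 : ((1 + e * c) / (J ^ 2 * (1 - e * c)) - 1 / (J ^ 2 * (1 - e * c))) * (J ^ 2 * k * s) -
      J * e * s * (k * c / (J * (1 - e * c))) = 0 := by
    field_simp
    ring
  rw [h1, h2, zero_smul, add_zero]

end Orbit

/-- The pericentre direction of the orbit with inclination of cosine `a` and sine `b`, argument of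
the pericentre `θ` and longitude of the node `Ω`. -/
def frameU (a b θ Ω : ℝ) : E3 :=
  !₂[Real.cos Ω * Real.cos θ - Real.sin Ω * Real.sin θ * a,
    Real.sin Ω * Real.cos θ + Real.cos Ω * Real.sin θ * a, Real.sin θ * b]

/-- The direction orthogonal to `frameU` in the plane of the orbit. -/
def frameW (a b θ Ω : ℝ) : E3 :=
  !₂[-(Real.cos Ω * Real.sin θ) - Real.sin Ω * Real.cos θ * a,
    -(Real.sin Ω * Real.sin θ) + Real.cos Ω * Real.cos θ * a, Real.cos θ * b]

/-- The direction orthogonal to the plane of the orbit. -/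
def frameM (a b Ω : ℝ) : E3 := !₂[Real.sin Ω * b, -(Real.cos Ω * b), a]

theorem isFrame_frame {a b : ℝ} (hab : a ^ 2 + b ^ 2 = 1) (θ Ω : ℝ) :
    IsFrame (frameU a b θ Ω) (frameW a b θ Ω) (frameM a b Ω) := by
  have h1 := Real.cos_sq_add_sin_sq θ
  have h2 := Real.cos_sq_add_sin_sq Ω
  constructor
  all_goals first
    | (simp only [inner_eq, frameU, frameW, frameM]
       simp
       grind)
    | skip
  apply e3_ext <;> simp [cross_zero, cross_one, cross_two, frameU, frameW, frameM] <;> grind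

/-- The area form of the plane, in terms of the mean anomaly and the first action. -/
theorem planar_canonical {J k e c s D j₁ e₁ f₁ k₁ j₂ e₂ f₂ k₂ : ℝ} (hJ : J ≠ 0) (hk : k ≠ 0)
    (hke : k ^ 2 = 1 - e ^ 2) (hcs : c ^ 2 + s ^ 2 = 1) (hD : D = 1 - e * c) (hD0 : D ≠ 0)
    (hk₁ : k * k₁ = -(e * e₁)) (hk₂ : k * k₂ = -(e * e₂)) :
    (2 * J * j₁ * (c - e) + J ^ 2 * (-s * f₁ - e₁)) *
        (-(c * f₂) / (J * D) + s * (j₂ * D + J * (e * s * f₂ - e₂ * c)) / (J * D) ^ 2) +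
      (2 * J * j₁ * k * s + J ^ 2 * (k₁ * s + k * c * f₁)) *
        ((k₂ * c - k * s * f₂) / (J * D) -
          k * c * (j₂ * D + J * (e * s * f₂ - e₂ * c)) / (J * D) ^ 2) -
      ((2 * J * j₂ * (c - e) + J ^ 2 * (-s * f₂ - e₂)) *
        (-(c * f₁) / (J * D) + s * (j₁ * D + J * (e * s * f₁ - e₁ * c)) / (J * D) ^ 2) +
      (2 * J * j₂ * k * s + J ^ 2 * (k₂ * s + k * c * f₂)) *
        ((k₁ * c - k * s * f₁) / (J * D) -
          k * c * (j₁ * D + J * (e * s * f₁ - e₁ * c)) / (J * D) ^ 2)) =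
      (D * f₁ - e₁ * s) * j₂ - j₁ * (D * f₂ - e₂ * s) := by
  obtain rfl : k₁ = -(e * e₁) / k := by field_simp; linarith
  obtain rfl : k₂ = -(e * e₂) / k := by field_simp; linarith
  have hs : s ^ 2 = 1 - c ^ 2 := by linarith
  field_simp
  grind

end

section

open Filter Topology

theorem exists_contDiffAt_rightInverse {E F : Type*} [NormedAddCommGroup E] [NormedSpace ℝ E]
    [NormedAddCommGroup F] [NormedSpace ℝ F] [FiniteDimensional ℝ E] [FiniteDimensional ℝ F]
    {f : E → F} {a : E} (hf : ContDiffAt ℝ ∞ f a)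
    (hdim : Module.finrank ℝ E = Module.finrank ℝ F)
    (hinj : ∀ x, fderiv ℝ f a x = 0 → x = 0) :
    ∃ φ : F → E, ContDiffAt ℝ ∞ φ (f a) ∧ φ (f a) = a ∧ ∀ᶠ z in 𝓝 (f a), f (φ z) = z := by
  have hinj' : Function.Injective (fderiv ℝ f a : E →ₗ[ℝ] F) :=
    (injective_iff_map_eq_zero _).2 hinj
  let f' : E ≃L[ℝ] F :=
    (LinearEquiv.toContinuousLinearEquiv
      (LinearMap.linearEquivOfInjective (fderiv ℝ f a : E →ₗ[ℝ] F) hinj' hdim))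
  have hf' : HasFDerivAt f (f' : E →L[ℝ] F) a := by
    have h : (f' : E →L[ℝ] F) = fderiv ℝ f a := by
      ext x
      exact LinearMap.linearEquivOfInjective_apply hinj' hdim x
    rw [h]
    exact (hf.differentiableAt (by simp)).hasFDerivAt
  have : CompleteSpace E := FiniteDimensional.complete ℝ E
  exact ⟨hf.localInverse hf' (by simp), hf.to_localInverse hf' (by simp),
    hf.localInverse_apply_image hf' (by simp),
    (hf.hasStrictFDerivAt' hf' (by simp)).eventually_right_inverse⟩

/-! ### Kepler's equation -/

theorem one_sub_mul_cos_pos {e : ℝ} (he : |e| < 1) (E : ℝ) : 0 < 1 - e * Real.cos E := by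
  have h : |e * Real.cos E| < 1 := by
    rw [abs_mul]
    exact (mul_le_of_le_one_right (abs_nonneg e) (Real.abs_cos_le_one E)).trans_lt he
  linarith [(abs_lt.1 h).2]

theorem strictMono_kepler {e : ℝ} (he : |e| < 1) :
    StrictMono fun E : ℝ => E - e * Real.sin E := by
  refine strictMono_of_deriv_pos fun E => ?_
  have h : HasDerivAt (fun E : ℝ => E - e * Real.sin E) (1 - e * Real.cos E) E :=
    (hasDerivAt_id E).sub ((Real.hasDerivAt_sin E).const_mul e)
  rw [h.deriv]
  exact one_sub_mul_cos_pos he E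

/-- The eccentric anomaly, the solution `E` of Kepler's equation `Q = E - e sin E`. -/
def keplerE (e Q : ℝ) : ℝ := Function.invFun (fun E : ℝ => E - e * Real.sin E) Q

theorem keplerE_spec {e : ℝ} (he : |e| < 1) (Q : ℝ) :
    keplerE e Q - e * Real.sin (keplerE e Q) = Q := by
  have hb : ∀ E : ℝ, |e * Real.sin E| ≤ 1 := fun E => by
    rw [abs_mul]
    exact (mul_le_of_le_one_right (abs_nonneg e) (Real.abs_sin_le_one E)).trans he.le
  have hc : Continuous fun E : ℝ => E - e * Real.sin E := by fun_prop
  have h := intermediate_value_Icc (show Q - 1 ≤ Q + 1 by linarith) hc.continuousOn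
  obtain ⟨E, -, hE⟩ := h (show Q ∈ _ by
    constructor
    · have := (abs_le.1 (hb (Q - 1))).1
      linarith
    · have := (abs_le.1 (hb (Q + 1))).2
      linarith)
  exact Function.invFun_eq (f := fun E : ℝ => E - e * Real.sin E) ⟨E, hE⟩

theorem keplerE_eq {e E Q : ℝ} (he : |e| < 1) (h : E - e * Real.sin E = Q) : keplerE e Q = E :=
  (strictMono_kepler he).injective ((keplerE_spec he Q).trans h.symm)

theorem contDiffAt_keplerE {p : ℝ × ℝ} (hp : |p.1| < 1) :
    ContDiffAt ℝ ∞ (fun q : ℝ × ℝ => keplerE q.1 q.2) p := by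
  set E := keplerE p.1 p.2
  let κ : ℝ × ℝ → ℝ × ℝ := fun q => (q.1, q.2 - q.1 * Real.sin q.2)
  have hκ : ContDiff ℝ ∞ κ := by fun_prop
  have hp' : κ (p.1, E) = p := Prod.ext rfl (keplerE_spec hp p.2)
  have hd : HasFDerivAt κ ((ContinuousLinearMap.fst ℝ ℝ ℝ).prod
      (ContinuousLinearMap.snd ℝ ℝ ℝ - (p.1 • (Real.cos E • ContinuousLinearMap.snd ℝ ℝ ℝ) +
        Real.sin E • ContinuousLinearMap.fst ℝ ℝ ℝ))) (p.1, E) := by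
    have h1 : HasFDerivAt (fun q : ℝ × ℝ => q.1) (ContinuousLinearMap.fst ℝ ℝ ℝ) (p.1, E) :=
      hasFDerivAt_fst
    have h2 : HasFDerivAt (fun q : ℝ × ℝ => q.2) (ContinuousLinearMap.snd ℝ ℝ ℝ) (p.1, E) :=
      hasFDerivAt_snd
    exact h1.prodMk (h2.sub (h1.mul h2.sin))
  obtain ⟨φ, hφ, -, hφ'⟩ := exists_contDiffAt_rightInverse (a := (p.1, E)) hκ.contDiffAt rfl (by
    rw [hd.fderiv]
    rintro ⟨x, y⟩ h
    simp only [ContinuousLinearMap.prod_apply, Prod.mk_eq_zero] at h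
    obtain ⟨h1, h2⟩ := h
    simp at h1 h2
    subst h1
    have h3 : (1 - p.1 * Real.cos E) * y = 0 := by linear_combination h2
    rcases mul_eq_zero.1 h3 with h4 | h4
    · exact absurd h4 (one_sub_mul_cos_pos hp E).ne'
    · simp [h4])
  rw [hp'] at hφ hφ'
  refine (contDiff_snd.contDiffAt.comp p hφ).congr_of_eventuallyEq ?_
  have hn : ∀ᶠ q : ℝ × ℝ in 𝓝 p, |q.1| < 1 :=
    (continuous_abs.comp continuous_fst).continuousAt.eventually_lt_const hp
  filter_upwards [hφ', hn] with q hq hq'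
  refine keplerE_eq hq' ?_
  have h1 : (κ (φ q)).1 = q.1 := by rw [hq]
  have h2 : (κ (φ q)).2 = q.2 := by rw [hq]
  simp only [κ] at h1 h2
  rw [h1] at h2
  exact h2

/-! ### The Delaunay map -/

/-- The eccentricity as a function of the Delaunay variables. -/
def eccOf (y : Fin 6 → ℝ) : ℝ := Real.sqrt (1 - (y 2 / y 0) ^ 2)

/-- The eccentric anomaly as a function of the Delaunay variables. -/
def anomOf (y : Fin 6 → ℝ) : ℝ := keplerE (eccOf y) (y 3)

/-- The sine of the inclination as a function of the Delaunay variables. -/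
def sinIncl (y : Fin 6 → ℝ) : ℝ := Real.sqrt (1 - (y 1 / y 2) ^ 2)

/-- The point of phase space with given Delaunay variables. -/
def delaunayX (y : Fin 6 → ℝ) : Phase :=
  orbitPoint (frameU (y 1 / y 2) (sinIncl y) (y 4) (y 5))
    (frameW (y 1 / y 2) (sinIncl y) (y 4) (y 5)) (y 0) (y 2 / y 0) (eccOf y)
    (Real.cos (anomOf y)) (Real.sin (anomOf y))

theorem isOpen_delaunayRange : IsOpen delaunayRange :=
  (isOpen_lt (by fun_prop) (by fun_prop)).and (isOpen_lt (by fun_prop) (by fun_prop))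

section Range

variable {y : Fin 6 → ℝ}

theorem range_L_pos (hy : y ∈ delaunayRange) : 0 < y 2 := (abs_nonneg _).trans_lt hy.1

theorem range_J_pos (hy : y ∈ delaunayRange) : 0 < y 0 := (range_L_pos hy).trans hy.2

theorem one_sub_incl_pos (hy : y ∈ delaunayRange) : 0 < 1 - (y 1 / y 2) ^ 2 := by
  have hL := range_L_pos hy
  have h : |y 1 / y 2| < 1 := by
    rw [abs_div, abs_of_pos hL, div_lt_one hL]
    exact hy.1
  have := (sq_lt_one_iff_abs_lt_one _).2 h
  linarith

theorem one_sub_ratio_pos (hy : y ∈ delaunayRange) : 0 < 1 - (y 2 / y 0) ^ 2 := by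
  have hL := range_L_pos hy
  have hJ := range_J_pos hy
  have h : |y 2 / y 0| < 1 := by
    rw [abs_div, abs_of_pos hL, abs_of_pos hJ, div_lt_one hJ]
    exact hy.2
  have := (sq_lt_one_iff_abs_lt_one _).2 h
  linarith

theorem sinIncl_pos (hy : y ∈ delaunayRange) : 0 < sinIncl y :=
  Real.sqrt_pos.2 (one_sub_incl_pos hy)

theorem incl_sq (hy : y ∈ delaunayRange) : (y 1 / y 2) ^ 2 + sinIncl y ^ 2 = 1 := by
  rw [sinIncl, Real.sq_sqrt (one_sub_incl_pos hy).le]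
  ring

theorem eccOf_pos (hy : y ∈ delaunayRange) : 0 < eccOf y :=
  Real.sqrt_pos.2 (one_sub_ratio_pos hy)

theorem ratio_sq (hy : y ∈ delaunayRange) : (y 2 / y 0) ^ 2 = 1 - eccOf y ^ 2 := by
  rw [eccOf, Real.sq_sqrt (one_sub_ratio_pos hy).le]
  ring

theorem abs_eccOf_lt (hy : y ∈ delaunayRange) : |eccOf y| < 1 := by
  rw [← sq_lt_one_iff_abs_lt_one]
  have h : 0 < (y 2 / y 0) ^ 2 := by
    have := range_L_pos hy
    have := range_J_pos hy
    positivity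
  linarith [ratio_sq hy]

theorem anomOf_spec (hy : y ∈ delaunayRange) :
    anomOf y - eccOf y * Real.sin (anomOf y) = y 3 :=
  keplerE_spec (abs_eccOf_lt hy) _

theorem contDiffAt_sinIncl (hy : y ∈ delaunayRange) : ContDiffAt ℝ ∞ sinIncl y := by
  have hL := (range_L_pos hy).ne'
  refine ContDiffAt.sqrt ?_ (one_sub_incl_pos hy).ne'
  fun_prop (disch := assumption)

theorem contDiffAt_eccOf (hy : y ∈ delaunayRange) : ContDiffAt ℝ ∞ eccOf y := by
  have hJ := (range_J_pos hy).ne'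
  refine ContDiffAt.sqrt ?_ (one_sub_ratio_pos hy).ne'
  fun_prop (disch := assumption)

theorem contDiffAt_anomOf (hy : y ∈ delaunayRange) : ContDiffAt ℝ ∞ anomOf y := by
  have h1 := contDiffAt_keplerE (p := (eccOf y, y 3)) (abs_eccOf_lt hy)
  have h2 : ContDiffAt ℝ ∞ (fun y : Fin 6 → ℝ => (eccOf y, y 3)) y :=
    (contDiffAt_eccOf hy).prodMk (by fun_prop)
  exact h1.comp y h2

theorem contDiffAt_delaunayX (hy : y ∈ delaunayRange) : ContDiffAt ℝ ∞ delaunayX y := by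
  have hJ := (range_J_pos hy).ne'
  have hL := (range_L_pos hy).ne'
  have h1 := contDiffAt_sinIncl hy
  have h2 := contDiffAt_eccOf hy
  have h3 := contDiffAt_anomOf hy
  have hD : y 0 * (1 - eccOf y * Real.cos (anomOf y)) ≠ 0 :=
    mul_ne_zero hJ (one_sub_mul_cos_pos (abs_eccOf_lt hy) _).ne'
  have hc := h3.cos
  have hs := h3.sin
  have hu : ContDiffAt ℝ ∞ (fun y => frameU (y 1 / y 2) (sinIncl y) (y 4) (y 5)) y := by
    rw [contDiffAt_euclidean]
    intro i
    fin_cases i <;> simp [frameU] <;> fun_prop (disch := assumption)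
  have hw : ContDiffAt ℝ ∞ (fun y => frameW (y 1 / y 2) (sinIncl y) (y 4) (y 5)) y := by
    rw [contDiffAt_euclidean]
    intro i
    fin_cases i <;> simp [frameW] <;> fun_prop (disch := assumption)
  unfold delaunayX orbitPoint
  fun_prop (disch := assumption)

end Range

end

section

open Filter Topology

theorem hasDerivAt_e3 {f : ℝ → E3} {f' : E3} {t : ℝ} (h0 : HasDerivAt (fun t => f t 0) (f' 0) t)
    (h1 : HasDerivAt (fun t => f t 1) (f' 1) t) (h2 : HasDerivAt (fun t => f t 2) (f' 2) t) :
    HasDerivAt f f' t := by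
  rw [hasDerivAt_iff_hasFDerivAt, ← hasFDerivWithinAt_univ, hasFDerivWithinAt_euclidean]
  intro i
  rw [hasFDerivWithinAt_univ]
  fin_cases i
  · exact h0.hasFDerivAt
  · exact h1.hasFDerivAt
  · exact h2.hasFDerivAt

section Frame

variable {a b θ Ω : ℝ → ℝ} {i₁ θ₁ Ω₁ t : ℝ}

theorem hasDerivAt_frameU (ha : HasDerivAt a (-(b t * i₁)) t) (hb : HasDerivAt b (a t * i₁) t)
    (hθ : HasDerivAt θ θ₁ t) (hΩ : HasDerivAt Ω Ω₁ t) (hab : a t ^ 2 + b t ^ 2 = 1) :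
    HasDerivAt (fun t => frameU (a t) (b t) (θ t) (Ω t))
      ((θ₁ + a t * Ω₁) • frameW (a t) (b t) (θ t) (Ω t) +
        (Real.sin (θ t) * i₁ - Real.cos (θ t) * b t * Ω₁) • frameM (a t) (b t) (Ω t)) t := by
  have hb2 : b t ^ 2 = 1 - a t ^ 2 := by linarith
  refine hasDerivAt_e3 ?_ ?_ ?_
  · convert! (hΩ.cos.mul hθ.cos).sub ((hΩ.sin.mul hθ.sin).mul ha) using 1
    simp [frameW, frameM]
    ring_nf
    rw [hb2]
    ring
  · convert! (hΩ.sin.mul hθ.cos).add ((hΩ.cos.mul hθ.sin).mul ha) using 1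
    simp [frameW, frameM]
    ring_nf
    rw [hb2]
    ring
  · convert! hθ.sin.mul hb using 1
    simp [frameW, frameM]
    ring

theorem hasDerivAt_frameW (ha : HasDerivAt a (-(b t * i₁)) t) (hb : HasDerivAt b (a t * i₁) t)
    (hθ : HasDerivAt θ θ₁ t) (hΩ : HasDerivAt Ω Ω₁ t) (hab : a t ^ 2 + b t ^ 2 = 1) :
    HasDerivAt (fun t => frameW (a t) (b t) (θ t) (Ω t))
      (-(θ₁ + a t * Ω₁) • frameU (a t) (b t) (θ t) (Ω t) +
        (Real.cos (θ t) * i₁ + Real.sin (θ t) * b t * Ω₁) • frameM (a t) (b t) (Ω t)) t := by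
  have hb2 : b t ^ 2 = 1 - a t ^ 2 := by linarith
  refine hasDerivAt_e3 ?_ ?_ ?_
  · convert! (hΩ.cos.mul hθ.sin).neg.sub ((hΩ.sin.mul hθ.cos).mul ha) using 1
    simp [frameU, frameM]
    ring_nf
    rw [hb2]
    ring
  · convert! (hΩ.sin.mul hθ.sin).neg.add ((hΩ.cos.mul hθ.cos).mul ha) using 1
    simp [frameU, frameM]
    ring_nf
    rw [hb2]
    ring
  · convert! hθ.cos.mul hb using 1
    simp [frameU, frameM]
    ring

end Frame

theorem hasDerivAt_comb {q₁ q₂ : ℝ → ℝ} {u w : ℝ → E3} {q₁' q₂' t A B C : ℝ} {m : E3}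
    (h1 : HasDerivAt q₁ q₁' t) (h2 : HasDerivAt q₂ q₂' t)
    (hu : HasDerivAt u (A • w t + B • m) t) (hw : HasDerivAt w (-A • u t + C • m) t) :
    HasDerivAt (fun t => q₁ t • u t + q₂ t • w t)
      ((q₁' - A * q₂ t) • u t + (q₂' + A * q₁ t) • w t + (B * q₁ t + C * q₂ t) • m) t := by
  convert! (h1.smul hu).add (h2.smul hw) using 1
  module

/-- The derivative of the planar coordinates along a curve. -/
theorem hasDerivAt_planar {J k e E : ℝ → ℝ} {j₁ k₁ e₁ f₁ t : ℝ} (hJ : HasDerivAt J j₁ t)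
    (hk : HasDerivAt k k₁ t) (he : HasDerivAt e e₁ t) (hE : HasDerivAt E f₁ t)
    (hJ0 : J t ≠ 0) (hD : 1 - e t * Real.cos (E t) ≠ 0) :
    HasDerivAt (fun t => J t ^ 2 * (Real.cos (E t) - e t))
      (2 * J t * j₁ * (Real.cos (E t) - e t) + J t ^ 2 * (-Real.sin (E t) * f₁ - e₁)) t ∧
    HasDerivAt (fun t => J t ^ 2 * k t * Real.sin (E t))
      (2 * J t * j₁ * k t * Real.sin (E t) +
        J t ^ 2 * (k₁ * Real.sin (E t) + k t * Real.cos (E t) * f₁)) t ∧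
    HasDerivAt (fun t => -Real.sin (E t) / (J t * (1 - e t * Real.cos (E t))))
      (-(Real.cos (E t) * f₁) / (J t * (1 - e t * Real.cos (E t))) +
        Real.sin (E t) * (j₁ * (1 - e t * Real.cos (E t)) +
          J t * (e t * Real.sin (E t) * f₁ - e₁ * Real.cos (E t))) /
          (J t * (1 - e t * Real.cos (E t))) ^ 2) t ∧
    HasDerivAt (fun t => k t * Real.cos (E t) / (J t * (1 - e t * Real.cos (E t))))
      ((k₁ * Real.cos (E t) - k t * Real.sin (E t) * f₁) / (J t * (1 - e t * Real.cos (E t))) -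
        k t * Real.cos (E t) * (j₁ * (1 - e t * Real.cos (E t)) +
          J t * (e t * Real.sin (E t) * f₁ - e₁ * Real.cos (E t))) /
          (J t * (1 - e t * Real.cos (E t))) ^ 2) t := by
  have hd := hJ.mul ((hasDerivAt_const t (1 : ℝ)).sub (he.mul hE.cos))
  have h0 : J t * (1 - e t * Real.cos (E t)) ≠ 0 := mul_ne_zero hJ0 hD
  refine ⟨?_, ?_, ?_, ?_⟩
  · convert! (hJ.pow 2).mul (hE.cos.sub he) using 1
    simp
  · convert! ((hJ.pow 2).mul hk).mul hE.sin using 1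
    simp
    ring
  · convert! hE.sin.neg.div hd h0 using 1
    simp
    field_simp
    ring
  · convert! (hk.mul hE.cos).div hd h0 using 1
    simp
    field_simp
    ring

set_option maxHeartbeats 1000000 in
/-- The derivative of the Delaunay map in the moving frame. -/
theorem fderiv_delaunayX {y : Fin 6 → ℝ} (hy : y ∈ delaunayRange) (ξ : Fin 6 → ℝ) :
    ∃ k₁ e₁ f₁ i₁ A B C : ℝ,
      y 2 / y 0 * k₁ = -(eccOf y * e₁) ∧
      (1 - eccOf y * Real.cos (anomOf y)) * f₁ - e₁ * Real.sin (anomOf y) = ξ 3 ∧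
      ξ 2 = ξ 0 * (y 2 / y 0) + y 0 * k₁ ∧
      ξ 1 = ξ 2 * (y 1 / y 2) - y 2 * (sinIncl y * i₁) ∧
      A = ξ 4 + y 1 / y 2 * ξ 5 ∧
      B = Real.sin (y 4) * i₁ - Real.cos (y 4) * sinIncl y * ξ 5 ∧
      C = Real.cos (y 4) * i₁ + Real.sin (y 4) * sinIncl y * ξ 5 ∧
      ∃ q₁ q₂ p₁ p₂ dq₁ dq₂ dp₁ dp₂ : ℝ,
        q₁ = y 0 ^ 2 * (Real.cos (anomOf y) - eccOf y) ∧
        q₂ = y 0 ^ 2 * (y 2 / y 0) * Real.sin (anomOf y) ∧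
        p₁ = -Real.sin (anomOf y) / (y 0 * (1 - eccOf y * Real.cos (anomOf y))) ∧
        p₂ = y 2 / y 0 * Real.cos (anomOf y) / (y 0 * (1 - eccOf y * Real.cos (anomOf y))) ∧
        dq₁ = 2 * y 0 * ξ 0 * (Real.cos (anomOf y) - eccOf y) +
          y 0 ^ 2 * (-Real.sin (anomOf y) * f₁ - e₁) ∧
        dq₂ = 2 * y 0 * ξ 0 * (y 2 / y 0) * Real.sin (anomOf y) +
          y 0 ^ 2 * (k₁ * Real.sin (anomOf y) + y 2 / y 0 * Real.cos (anomOf y) * f₁) ∧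
        dp₁ = -(Real.cos (anomOf y) * f₁) / (y 0 * (1 - eccOf y * Real.cos (anomOf y))) +
          Real.sin (anomOf y) * (ξ 0 * (1 - eccOf y * Real.cos (anomOf y)) +
          y 0 * (eccOf y * Real.sin (anomOf y) * f₁ - e₁ * Real.cos (anomOf y))) /
          (y 0 * (1 - eccOf y * Real.cos (anomOf y))) ^ 2 ∧
        dp₂ = (k₁ * Real.cos (anomOf y) - y 2 / y 0 * Real.sin (anomOf y) * f₁) /
            (y 0 * (1 - eccOf y * Real.cos (anomOf y))) -
          y 2 / y 0 * Real.cos (anomOf y) * (ξ 0 * (1 - eccOf y * Real.cos (anomOf y)) +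
          y 0 * (eccOf y * Real.sin (anomOf y) * f₁ - e₁ * Real.cos (anomOf y))) /
          (y 0 * (1 - eccOf y * Real.cos (anomOf y))) ^ 2 ∧
        fderiv ℝ delaunayX y ξ =
          ((dq₁ - A * q₂) • frameU (y 1 / y 2) (sinIncl y) (y 4) (y 5) +
            (dq₂ + A * q₁) • frameW (y 1 / y 2) (sinIncl y) (y 4) (y 5) +
            (B * q₁ + C * q₂) • frameM (y 1 / y 2) (sinIncl y) (y 5),
          (dp₁ - A * p₂) • frameU (y 1 / y 2) (sinIncl y) (y 4) (y 5) +
            (dp₂ + A * p₁) • frameW (y 1 / y 2) (sinIncl y) (y 4) (y 5) +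
            (B * p₁ + C * p₂) • frameM (y 1 / y 2) (sinIncl y) (y 5)) := by
  have hJ0 := (range_J_pos hy).ne'
  have hL0 := (range_L_pos hy).ne'
  have hb0 := (sinIncl_pos hy).ne'
  have he0 := (eccOf_pos hy).ne'
  have hD0 := (one_sub_mul_cos_pos (abs_eccOf_lt hy) (anomOf y)).ne'
  let γ : ℝ → Fin 6 → ℝ := fun t => y + t • ξ
  have hγ0 : γ 0 = y := by simp [γ]
  have hγ : HasDerivAt γ ξ 0 := by
    have h := ((hasDerivAt_id (0 : ℝ)).smul_const ξ).const_add y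
    rw [one_smul] at h
    exact h
  have hγi : ∀ i, HasDerivAt (fun t => γ t i) (ξ i) 0 := fun i => (hasDerivAt_pi.1 hγ) i
  have hev : ∀ᶠ t in 𝓝 (0 : ℝ), γ t ∈ delaunayRange :=
    hγ.continuousAt.eventually_mem (by rw [hγ0]; exact isOpen_delaunayRange.mem_nhds hy)
  have hcomp : ∀ {g : (Fin 6 → ℝ) → ℝ}, ContDiffAt ℝ ∞ g y →
      HasDerivAt (fun t => g (γ t)) (fderiv ℝ g y ξ) 0 := fun {g} hg => by
    have h1 := (hg.differentiableAt (by simp)).hasFDerivAt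
    rw [← hγ0] at h1
    exact (h1.comp_hasDerivAt 0 hγ).congr_deriv (by rw [hγ0])
  have hk := (hγi 2).div (hγi 0) (by rw [hγ0]; exact hJ0)
  have ha := (hγi 1).div (hγi 2) (by rw [hγ0]; exact hL0)
  have he := hcomp (contDiffAt_eccOf hy)
  have hb := hcomp (contDiffAt_sinIncl hy)
  have hE := hcomp (contDiffAt_anomOf hy)
  set k₁ := (ξ 2 * γ 0 0 - γ 0 2 * ξ 0) / γ 0 0 ^ 2 with hk₁
  set a₁ := (ξ 1 * γ 0 2 - γ 0 1 * ξ 2) / γ 0 2 ^ 2 with ha₁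
  rw [hγ0] at hk₁ ha₁
  set e₁ := fderiv ℝ eccOf y ξ
  set b₁ := fderiv ℝ sinIncl y ξ
  set f₁ := fderiv ℝ anomOf y ξ
  have r1 : y 2 / y 0 * k₁ = -(eccOf y * e₁) := by
    have h1 := ((hk.pow 2).add (he.pow 2))
    have h2 : HasDerivAt (fun t => (γ t 2 / γ t 0) ^ 2 + eccOf (γ t) ^ 2) 0 0 := by
      refine (hasDerivAt_const (0 : ℝ) (1 : ℝ)).congr_of_eventuallyEq ?_
      filter_upwards [hev] with t ht
      rw [ratio_sq ht]
      ring
    have h3 := h1.unique h2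
    simp [hγ0] at h3
    linarith
  have r2 : y 1 / y 2 * a₁ = -(sinIncl y * b₁) := by
    have h1 := ((ha.pow 2).add (hb.pow 2))
    have h2 : HasDerivAt (fun t => (γ t 1 / γ t 2) ^ 2 + sinIncl (γ t) ^ 2) 0 0 := by
      refine (hasDerivAt_const (0 : ℝ) (1 : ℝ)).congr_of_eventuallyEq ?_
      filter_upwards [hev] with t ht
      rw [incl_sq ht]
    have h3 := h1.unique h2
    simp [hγ0] at h3
    linarith
  have r3 : (1 - eccOf y * Real.cos (anomOf y)) * f₁ - e₁ * Real.sin (anomOf y) = ξ 3 := by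
    have h1 := hE.sub (he.mul hE.sin)
    have h2 : HasDerivAt (fun t => anomOf (γ t) - eccOf (γ t) * Real.sin (anomOf (γ t)))
        (ξ 3) 0 := by
      refine (hγi 3).congr_of_eventuallyEq ?_
      filter_upwards [hev] with t ht
      rw [anomOf_spec ht]
    have h3 := h1.unique h2
    simp [hγ0] at h3
    linarith
  have hi : a₁ = -(sinIncl y * (-a₁ / sinIncl y)) := by field_simp
  have hi' : b₁ = y 1 / y 2 * (-a₁ / sinIncl y) := by
    rw [eq_comm, ← mul_div_assoc, div_eq_iff hb0]
    linarith
  have ha' : HasDerivAt (fun t => γ t 1 / γ t 2) (-(sinIncl (γ 0) * (-a₁ / sinIncl y))) 0 := by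
    rw [hγ0, ← hi]
    exact ha
  have hb' : HasDerivAt (fun t => sinIncl (γ t)) (γ 0 1 / γ 0 2 * (-a₁ / sinIncl y)) 0 := by
    rw [hγ0, ← hi']
    exact hb
  have hab : (γ 0 1 / γ 0 2) ^ 2 + sinIncl (γ 0) ^ 2 = 1 := by
    rw [hγ0]
    exact incl_sq hy
  have hu := hasDerivAt_frameU (a := fun t => γ t 1 / γ t 2) (b := fun t => sinIncl (γ t))
    (θ := fun t => γ t 4) (Ω := fun t => γ t 5) ha' hb' (hγi 4) (hγi 5) hab
  have hw := hasDerivAt_frameW (a := fun t => γ t 1 / γ t 2) (b := fun t => sinIncl (γ t))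
    (θ := fun t => γ t 4) (Ω := fun t => γ t 5) ha' hb' (hγi 4) (hγi 5) hab
  obtain ⟨h1, h2, h3, h4⟩ := hasDerivAt_planar (J := fun t => γ t 0)
    (k := fun t => γ t 2 / γ t 0) (e := fun t => eccOf (γ t)) (E := fun t => anomOf (γ t)) (t := 0)
    (hγi 0) hk he hE (by simpa only [hγ0] using hJ0) (by simpa only [hγ0] using hD0)
  have hx := hasDerivAt_comb (u := fun t => frameU (γ t 1 / γ t 2) (sinIncl (γ t)) (γ t 4) (γ t 5))
    (w := fun t => frameW (γ t 1 / γ t 2) (sinIncl (γ t)) (γ t 4) (γ t 5)) (t := 0)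
    h1 h2 hu hw
  have hv := hasDerivAt_comb (u := fun t => frameU (γ t 1 / γ t 2) (sinIncl (γ t)) (γ t 4) (γ t 5))
    (w := fun t => frameW (γ t 1 / γ t 2) (sinIncl (γ t)) (γ t 4) (γ t 5)) (t := 0)
    h3 h4 hu hw
  have hX : HasDerivAt (fun t => delaunayX (γ t)) (fderiv ℝ delaunayX y ξ) 0 := by
    have h1 := ((contDiffAt_delaunayX hy).differentiableAt (by simp)).hasFDerivAt
    rw [← hγ0] at h1
    exact (h1.comp_hasDerivAt 0 hγ).congr_deriv (by rw [hγ0])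
  have hX' := hX.unique (hx.prodMk hv)
  simp only [hγ0] at hX'
  refine ⟨k₁, e₁, f₁, -a₁ / sinIncl y, _, _, _, r1, r3, ?_, ?_, rfl, rfl, rfl, _, _, _, _, _, _, _,
    _, rfl, rfl, rfl, rfl, rfl, rfl, rfl, rfl, hX'⟩
  · rw [hk₁]
    field_simp
    ring
  · have : y 2 * a₁ = ξ 1 - y 1 / y 2 * ξ 2 := by
      rw [ha₁]
      field_simp
    linear_combination -this + y 2 * hi

theorem delaunayX_canonical {y : Fin 6 → ℝ} (hy : y ∈ delaunayRange) (ξ η : Fin 6 → ℝ) :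
    symplecticForm (fderiv ℝ delaunayX y ξ) (fderiv ℝ delaunayX y η) = actionAngleForm ξ η := by
  have hJ0 := (range_J_pos hy).ne'
  have hk0 : y 2 / y 0 ≠ 0 := div_ne_zero (range_L_pos hy).ne' hJ0
  have hD0 := (one_sub_mul_cos_pos (abs_eccOf_lt hy) (anomOf y)).ne'
  have hfr := isFrame_frame (incl_sq hy) (y 4) (y 5)
  have hcs := Real.cos_sq_add_sin_sq (anomOf y)
  have hcs' := Real.cos_sq_add_sin_sq (y 4)
  obtain ⟨k₁, e₁, f₁, i₁, A₁, B₁, C₁, h1, h2, h3, h4, h5, h6, h7, q₁, q₂, p₁, p₂, x₁, x₂, v₁, v₂,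
    hq₁, hq₂, hp₁, hp₂, hx₁, hx₂, hv₁, hv₂, hX⟩ := fderiv_delaunayX hy ξ
  obtain ⟨k₂, e₂, f₂, i₂, A₂, B₂, C₂, g1, g2, g3, g4, g5, g6, g7, q₁', q₂', p₁', p₂', x₁', x₂', v₁',
    v₂', hq₁', hq₂', hp₁', hp₂', hx₁', hx₂', hv₁', hv₂', hX'⟩ := fderiv_delaunayX hy η
  rw [← hq₁] at hq₁'
  rw [← hq₂] at hq₂'
  rw [← hp₁] at hp₁'
  rw [← hp₂] at hp₂'
  subst q₁' q₂' p₁' p₂'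
  have hplan := planar_canonical (j₁ := ξ 0) (j₂ := η 0) (f₁ := f₁) (f₂ := f₂) hJ0 hk0 (ratio_sq hy)
    hcs rfl hD0 h1 g1
  rw [← hx₁, ← hx₂, ← hv₁, ← hv₂, ← hx₁', ← hx₂', ← hv₁', ← hv₂', h2, g2] at hplan
  have hL : q₁ * p₂ - q₂ * p₁ = y 2 := by
    rw [hq₁, hq₂, hp₁, hp₂]
    field_simp
    grind
  have hdL : ∀ {k₁ e₁ f₁ x₁ x₂ v₁ v₂ : ℝ} {ξ : Fin 6 → ℝ}, 
      y 2 / y 0 * k₁ = -(eccOf y * e₁) → ξ 2 = ξ 0 * (y 2 / y 0) + y 0 * k₁ →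
      x₁ = 2 * y 0 * ξ 0 * (Real.cos (anomOf y) - eccOf y) +
          y 0 ^ 2 * (-Real.sin (anomOf y) * f₁ - e₁) →
      x₂ = 2 * y 0 * ξ 0 * (y 2 / y 0) * Real.sin (anomOf y) +
          y 0 ^ 2 * (k₁ * Real.sin (anomOf y) + y 2 / y 0 * Real.cos (anomOf y) * f₁) →
      v₁ = -(Real.cos (anomOf y) * f₁) / (y 0 * (1 - eccOf y * Real.cos (anomOf y))) +
          Real.sin (anomOf y) * (ξ 0 * (1 - eccOf y * Real.cos (anomOf y)) +
          y 0 * (eccOf y * Real.sin (anomOf y) * f₁ - e₁ * Real.cos (anomOf y))) /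
          (y 0 * (1 - eccOf y * Real.cos (anomOf y))) ^ 2 →
      v₂ = (k₁ * Real.cos (anomOf y) - y 2 / y 0 * Real.sin (anomOf y) * f₁) /
            (y 0 * (1 - eccOf y * Real.cos (anomOf y))) -
          y 2 / y 0 * Real.cos (anomOf y) * (ξ 0 * (1 - eccOf y * Real.cos (anomOf y)) +
          y 0 * (eccOf y * Real.sin (anomOf y) * f₁ - e₁ * Real.cos (anomOf y))) /
          (y 0 * (1 - eccOf y * Real.cos (anomOf y))) ^ 2 →
      x₁ * p₂ + q₁ * v₂ - x₂ * p₁ - q₂ * v₁ = ξ 2 := by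
    intro k₁ e₁ f₁ x₁ x₂ v₁ v₂ ξ h1 h3 hx₁ hx₂ hv₁ hv₂
    rw [h3, hx₁, hx₂, hv₁, hv₂, hq₁, hq₂, hp₁, hp₂]
    clear * - hJ0 hk0 hD0 hcs h1
    generalize y 2 / y 0 = k at *
    generalize eccOf y = e at *
    generalize Real.cos (anomOf y) = c at *
    generalize Real.sin (anomOf y) = s at *
    generalize hDD : 1 - e * c = D at *
    field_simp
    grind
  have d1 := hdL h1 h3 hx₁ hx₂ hv₁ hv₂
  have d2 := hdL g1 g3 hx₁' hx₂' hv₁' hv₂'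
  rw [hX, hX', symplecticForm, hfr.inner_comb, hfr.inner_comb, actionAngleForm]
  have hBC : B₁ * C₂ - C₁ * B₂ = sinIncl y * (i₁ * η 5 - ξ 5 * i₂) := by
    rw [h6, h7, g6, g7]
    linear_combination sinIncl y * (i₁ * η 5 - ξ 5 * i₂) * hcs'
  linear_combination hplan + A₁ * d2 - A₂ * d1 + (B₁ * C₂ - C₁ * B₂) * hL + y 2 * hBC + h5 * η 2 -
    g5 * ξ 2 - ξ 5 * g4 + η 5 * h4

end

section

open Filter Topology

theorem arg_coe_eq {r θ a b : ℝ} (hr : 0 < r) (ha : a = r * Real.cos θ)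
    (hb : b = r * Real.sin θ) : ((Complex.arg ⟨a, b⟩ : ℝ) : Real.Angle) = (θ : Real.Angle) := by
  have h := Complex.arg_mul_cos_add_sin_mul_I_coe_angle hr (θ : Real.Angle)
  rw [← h]
  congr 2
  apply Complex.ext
  · simpa [ha] using Or.inl (Complex.cos_ofReal_re θ).symm
  · simpa [hb] using Or.inl (Complex.sin_ofReal_re θ).symm

theorem eq_of_arg_coe_eq {r θ a b : ℝ} (hr : 0 < r) (h : a ^ 2 + b ^ 2 = r ^ 2)
    (hθ : ((Complex.arg ⟨a, b⟩ : ℝ) : Real.Angle) = (θ : Real.Angle)) :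
    a = r * Real.cos θ ∧ b = r * Real.sin θ := by
  have hn : ‖(⟨a, b⟩ : ℂ)‖ = r := by
    rw [Complex.norm_eq_sqrt_sq_add_sq]
    simp only
    rw [h, Real.sqrt_sq hr.le]
  have hc : Real.cos (Complex.arg ⟨a, b⟩) = Real.cos θ := by
    rw [← Real.Angle.cos_coe, hθ, Real.Angle.cos_coe]
  have hs : Real.sin (Complex.arg ⟨a, b⟩) = Real.sin θ := by
    rw [← Real.Angle.sin_coe, hθ, Real.Angle.sin_coe]
  have h1 := Complex.norm_mul_cos_arg ⟨a, b⟩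
  have h2 := Complex.norm_mul_sin_arg ⟨a, b⟩
  rw [hn, hc] at h1
  rw [hn, hs] at h2
  exact ⟨h1.symm, h2.symm⟩

theorem cross_cross (a b c : E3) :
    cross (cross a b) c = (inner ℝ a c : ℝ) • b - (inner ℝ b c : ℝ) • a := by
  apply e3_ext <;> simp [cross_zero, cross_one, cross_two, inner_eq] <;> ring

theorem cross_smul_left (t : ℝ) (a b : E3) : cross (t • a) b = t • cross a b := by
  apply e3_ext <;> simp [cross_zero, cross_one, cross_two] <;> ring

theorem cross_smul_right (t : ℝ) (a b : E3) : cross a (t • b) = t • cross a b := by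
  apply e3_ext <;> simp [cross_zero, cross_one, cross_two] <;> ring

theorem cross_sub_right (a b c : E3) : cross a (b - c) = cross a b - cross a c := by
  apply e3_ext <;> simp [cross_zero, cross_one, cross_two] <;> ring

theorem IsFrame.cross_mu {u w m : E3} (h : IsFrame u w m) : cross m u = w := by
  rw [← h.cross_uw, cross_cross, h.uu, real_inner_comm, h.uw, one_smul, zero_smul, sub_zero]

theorem angMom_ne_zero_of_nodeVec {z : Phase} (h : nodeVec z ≠ 0) : angMom z ≠ 0 := by
  intro h0
  apply h
  apply e3_ext
  · rw [nodeVec_zero, h0]; simp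
  · rw [nodeVec_one, h0]; simp
  · rw [nodeVec_two]; simp

section Values

variable {y : Fin 6 → ℝ}

theorem delaunayX_node (hy : y ∈ delaunayRange) :
    angMom (delaunayX y) = y 2 • frameM (y 1 / y 2) (sinIncl y) (y 5) ∧
    nodeVec (delaunayX y) = (y 2 * sinIncl y) • !₂[Real.cos (y 5), Real.sin (y 5), 0] := by
  have hJ := (range_J_pos hy).ne'
  have h : angMom (delaunayX y) = y 2 • frameM (y 1 / y 2) (sinIncl y) (y 5) := by
    rw [delaunayX, orbitPoint_angMom (isFrame_frame (incl_sq hy) _ _) hJ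
      (Real.cos_sq_add_sin_sq _) (one_sub_mul_cos_pos (abs_eccOf_lt hy) _)]
    congr 1
    field_simp
  refine ⟨h, ?_⟩
  apply e3_ext
  · rw [nodeVec_zero, h]
    simp [frameM]
    ring
  · rw [nodeVec_one, h]
    simp [frameM]
    ring
  · rw [nodeVec_two]
    simp

theorem delaunayX_mem (hy : y ∈ delaunayRange) : delaunayX y ∈ delaunayDomain := by
  have hJ := range_J_pos hy
  have hL := range_L_pos hy
  have hfr := isFrame_frame (incl_sq hy) (y 4) (y 5)
  have hD := one_sub_mul_cos_pos (abs_eccOf_lt hy) (anomOf y)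
  have hcs := Real.cos_sq_add_sin_sq (anomOf y)
  refine ⟨?_, ?_, ?_, ?_⟩
  · rw [← norm_pos_iff, delaunayX, orbitPoint_norm hfr (ratio_sq hy) hcs hD]
    positivity
  · rw [delaunayX, orbitPoint_energy hfr hJ.ne' (ratio_sq hy) hcs hD]
    exact div_neg_of_neg_of_pos (by norm_num) (by positivity)
  · rw [(delaunayX_node hy).2]
    refine smul_ne_zero (mul_pos hL (sinIncl_pos hy)).ne' fun h => ?_
    have h0 := congrArg (fun v : E3 => v 0) h
    have h1 := congrArg (fun v : E3 => v 1) h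
    simp at h0 h1
    have := Real.cos_sq_add_sin_sq (y 5)
    rw [h0, h1] at this
    norm_num at this
  · rw [delaunayX, orbitPoint_ecc hfr hJ.ne' (ratio_sq hy) hcs hD]
    refine smul_ne_zero (eccOf_pos hy).ne' fun h => ?_
    have := hfr.uu
    rw [h] at this
    simp at this

theorem delaunay_delaunayX (hy : y ∈ delaunayRange) :
    delaunay (delaunayX y) =
      (y 0, y 1, y 2, (y 3 : Real.Angle), (y 4 : Real.Angle), (y 5 : Real.Angle)) := by
  have hJ := range_J_pos hy
  have hL := range_L_pos hy
  have hb := sinIncl_pos hy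
  have he := eccOf_pos hy
  have hab := incl_sq hy
  have hfr := isFrame_frame hab (y 4) (y 5)
  have hD := one_sub_mul_cos_pos (abs_eccOf_lt hy) (anomOf y)
  have hcs := Real.cos_sq_add_sin_sq (anomOf y)
  have hcs5 := Real.cos_sq_add_sin_sq (y 5)
  obtain ⟨hM, hn⟩ := delaunayX_node hy
  have hH : energy (delaunayX y) = -1 / (2 * y 0 ^ 2) :=
    orbitPoint_energy hfr hJ.ne' (ratio_sq hy) hcs hD
  have hecc : eccVec (delaunayX y) = eccOf y • frameU (y 1 / y 2) (sinIncl y) (y 4) (y 5) :=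
    orbitPoint_ecc hfr hJ.ne' (ratio_sq hy) hcs hD
  have hr : ‖(delaunayX y).1‖ = y 0 ^ 2 * (1 - eccOf y * Real.cos (anomOf y)) :=
    orbitPoint_norm hfr (ratio_sq hy) hcs hD
  have hv : ‖(delaunayX y).2‖ ^ 2 = (1 + eccOf y * Real.cos (anomOf y)) /
      (y 0 ^ 2 * (1 - eccOf y * Real.cos (anomOf y))) :=
    orbitPoint_vel hfr hJ.ne' (ratio_sq hy) hcs hD
  have hxv : inner ℝ (delaunayX y).1 (delaunayX y).2 = y 0 * eccOf y * Real.sin (anomOf y) :=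
    orbitPoint_inner hfr hJ.ne' (ratio_sq hy) hD
  have hnormM : ‖angMom (delaunayX y)‖ = y 2 := by
    have h1 : ‖frameM (y 1 / y 2) (sinIncl y) (y 5)‖ = 1 := by
      rw [norm_eq_sqrt_real_inner, hfr.mm, Real.sqrt_one]
    rw [hM, norm_smul, h1, mul_one, Real.norm_of_nonneg hL.le]
  have hnormE : ‖eccVec (delaunayX y)‖ = eccOf y := by
    have h1 : ‖frameU (y 1 / y 2) (sinIncl y) (y 4) (y 5)‖ = 1 := by
      rw [norm_eq_sqrt_real_inner, hfr.uu, Real.sqrt_one]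
    rw [hecc, norm_smul, h1, mul_one, Real.norm_of_nonneg he.le]
  have hE : eccAnomaly (delaunayX y) = (anomOf y : Real.Angle) := by
    refine arg_coe_eq he ?_ ?_
    · rw [hv, hr]
      field_simp
      ring
    · have h1 : 2 / ‖(delaunayX y).1‖ - ‖(delaunayX y).2‖ ^ 2 = (1 / y 0) ^ 2 := by
        rw [hv, hr]
        field_simp
        ring
      rw [h1, Real.sqrt_sq (by positivity), hxv]
      field_simp
  simp only [delaunay, Prod.mk.injEq]
  refine ⟨?_, ?_, hnormM, ?_, ?_, ?_⟩
  · have h1 : -2 * energy (delaunayX y) = (1 / y 0) ^ 2 := by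
      rw [hH]
      field_simp
    rw [actionJ, h1, Real.sqrt_sq (by positivity), one_div_one_div]
  · rw [actionLz_eq, hM]
    simp [frameM]
    field_simp
  · rw [angleQ, hE, hnormE, Real.Angle.sin_coe, ← Real.Angle.coe_sub, anomOf_spec hy]
  · refine arg_coe_eq (r := y 2 * sinIncl y * eccOf y) (by positivity) ?_ ?_
    · rw [hn, hecc, inner_eq]
      simp [frameU]
      linear_combination y 2 * sinIncl y * eccOf y * Real.cos (y 4) * hcs5
    · rw [hnormM, hn, hecc, hM, div_eq_iff hL.ne', inner_eq]
      simp [frameU, frameM, cross_zero, cross_one, cross_two]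
      generalize y 1 / y 2 = a at *
      grind
  · refine arg_coe_eq (r := y 2 * sinIncl y) (by positivity) ?_ ?_
    · rw [hn]
      simp
    · rw [hn]
      simp

end Values

theorem cross_angMom_eccVec {z : Phase} (hx : z.1 ≠ 0) :
    cross (angMom z) (eccVec z) =
      (angMomSq z - ‖z.1‖) • z.2 + (inner ℝ z.1 z.2 / ‖z.1‖ : ℝ) • z.1 := by
  have hr : ‖z.1‖ ≠ 0 := norm_ne_zero_iff.2 hx
  rw [eccVec, cross_sub_right, cross_smul_right, cross_smul_right, angMom, cross_cross, cross_cross,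
    angMomSq, real_inner_self_eq_norm_sq, real_inner_self_eq_norm_sq, real_inner_comm z.1 z.2]
  match_scalars
  · field_simp
    ring
  · field_simp
    ring

theorem inner_eccVec_angMom (z : Phase) : inner ℝ (eccVec z) (angMom z) = (0 : ℝ) := by
  rw [eccVec, angMom, inner_sub_left, real_inner_smul_left, real_inner_smul_left]
  simp only [inner_eq, cross_zero, cross_one, cross_two]
  ring

theorem plane_norm_sq {a b c s p q t : ℝ} (hab : a ^ 2 + b ^ 2 = 1) (hcs : c ^ 2 + s ^ 2 = 1)
    (h : p * (s * b) - q * (c * b) + t * a = 0) :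
    (c * p + s * q) ^ 2 + (-(a * s) * p + a * c * q + b * t) ^ 2 = p ^ 2 + q ^ 2 + t ^ 2 := by
  grind

theorem plane_coords {a b c s p q t α β : ℝ} (hab : a ^ 2 + b ^ 2 = 1) (hcs : c ^ 2 + s ^ 2 = 1)
    (h : p * (s * b) - q * (c * b) + t * a = 0) (hα : c * p + s * q = α)
    (hβ : -(a * s) * p + a * c * q + b * t = β) :
    p = c * α - s * β * a ∧ q = s * α + c * β * a ∧ t = β * b := by
  refine ⟨?_, ?_, ?_⟩ <;> grind

theorem mem_range_of_delaunay_eq {z : Phase} (hz : z ∈ delaunayDomain) {y : Fin 6 → ℝ}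
    (h0 : actionJ z = y 0) (h1 : actionLz z = y 1) (h2 : actionL z = y 2) :
    y ∈ delaunayRange := by
  obtain ⟨hx, hH, hn, he⟩ := hz
  have hL : 0 < y 2 := by
    rw [← h2]
    exact norm_pos_iff.2 (angMom_ne_zero_of_nodeVec hn)
  have hJ : 0 < y 0 := by
    rw [← h0, actionJ]
    have : 0 < -2 * energy z := by linarith
    positivity
  have hJ2 : y 0 ^ 2 * (-2 * energy z) = 1 := by
    have : 0 < -2 * energy z := by linarith
    rw [← h0, actionJ, div_pow, Real.sq_sqrt this.le, one_pow, one_div_mul_cancel this.ne']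
  have hn' : 0 < ‖nodeVec z‖ ^ 2 := by
    have := norm_pos_iff.2 hn
    positivity
  have he' : 0 < ‖eccVec z‖ ^ 2 := by
    have := norm_pos_iff.2 he
    positivity
  rw [norm_nodeVec_sq, h1, h2] at hn'
  rw [norm_eccVec_sq hx, angMomSq_eq, ← actionL, h2] at he'
  constructor
  · exact abs_lt_of_sq_lt_sq (by linarith) hL.le
  · refine lt_of_pow_lt_pow_left₀ 2 hJ.le ?_
    nlinarith [mul_pos (pow_pos hJ 2) he']

theorem delaunayX_eq_of_delaunay_eq {z : Phase} (hz : z ∈ delaunayDomain) {y : Fin 6 → ℝ}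
    (h : delaunay z =
      (y 0, y 1, y 2, (y 3 : Real.Angle), (y 4 : Real.Angle), (y 5 : Real.Angle))) :
    delaunayX y = z := by
  simp only [delaunay, Prod.mk.injEq] at h
  obtain ⟨h0, h1, h2, h3, h4, h5⟩ := h
  have hy := mem_range_of_delaunay_eq hz h0 h1 h2
  obtain ⟨hx, hH, hn, he⟩ := hz
  have hJ := range_J_pos hy
  have hL := range_L_pos hy
  have hb := sinIncl_pos hy
  have hab := incl_sq hy
  have hr : 0 < ‖z.1‖ := norm_pos_iff.2 hx
  have hε : 0 < ‖eccVec z‖ := norm_pos_iff.2 he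
  have hn' : 0 < ‖nodeVec z‖ := norm_pos_iff.2 hn
  have hfr := isFrame_frame hab (y 4) (y 5)
  have hcs5 := Real.cos_sq_add_sin_sq (y 5)
  have hL2 : angMomSq z = y 2 ^ 2 := by rw [angMomSq_eq, ← h2, actionL]
  have hHpos : 0 < -2 * energy z := by linarith
  have hJs : Real.sqrt (-2 * energy z) = 1 / y 0 := by
    rw [← h0, actionJ, one_div_one_div]
  have hJ2 : -2 * energy z = 1 / y 0 ^ 2 := by
    rw [← Real.sq_sqrt hHpos.le, hJs]
    ring
  have hε2 := norm_eccVec_sq hx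
  have hecc : eccOf y = ‖eccVec z‖ := by
    refine (pow_left_inj₀ (eccOf_pos hy).le hε.le two_ne_zero).1 ?_
    have := ratio_sq hy
    have h6 : eccOf y ^ 2 = 1 - (y 2 / y 0) ^ 2 := by linarith
    rw [h6, hε2, hL2, div_pow]
    linear_combination y 2 ^ 2 * hJ2
  set ε := ‖eccVec z‖
  set r := ‖z.1‖
  set σ : ℝ := inner ℝ z.1 z.2
  set V := ‖z.2‖ ^ 2 with hV
  have hHV : energy z = V / 2 - 1 / r := rfl
  have hLV : angMomSq z = r ^ 2 * V - σ ^ 2 := rfl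
  have hsq : Real.sqrt (2 / r - V) = 1 / y 0 := by
    rw [← hJs, hHV]
    congr 1
    ring
  -- the eccentric anomaly
  obtain ⟨hc, hs⟩ : ε * Real.cos (anomOf y) = V * r - 1 ∧
      ε * Real.sin (anomOf y) = σ / y 0 := by
    have hE : eccAnomaly z = ((Complex.arg ⟨V * r - 1, σ * Real.sqrt (2 / r - V)⟩ : ℝ) :
      Real.Angle) := rfl
    set E₀ := Complex.arg ⟨V * r - 1, σ * Real.sqrt (2 / r - V)⟩ with hE₀
    have hab' : (V * r - 1) ^ 2 + (σ * Real.sqrt (2 / r - V)) ^ 2 = ε ^ 2 := by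
      rw [mul_pow, hsq, hε2, div_pow, one_pow, ← hJ2, hLV, hHV]
      field_simp
      ring
    obtain ⟨hc, hs⟩ := eq_of_arg_coe_eq hε hab' (θ := E₀) rfl
    rw [hsq] at hs
    rw [angleQ, hE, Real.Angle.sin_coe, ← Real.Angle.coe_sub] at h3
    obtain ⟨k, hk⟩ := Real.Angle.angle_eq_iff_two_pi_dvd_sub.1 h3.symm
    have hEy : anomOf y = E₀ + k * (2 * Real.pi) := by
      rw [anomOf]
      refine keplerE_eq (abs_eccOf_lt hy) ?_
      rw [Real.sin_add_int_mul_two_pi, hecc]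
      linarith
    rw [hEy, Real.cos_add_int_mul_two_pi, Real.sin_add_int_mul_two_pi, ← hc, ← hs]
    exact ⟨rfl, by ring⟩
  -- the plane of the orbit
  have hnL : ‖nodeVec z‖ = y 2 * sinIncl y := by
    refine (pow_left_inj₀ hn'.le (by positivity) two_ne_zero).1 ?_
    rw [norm_nodeVec_sq, h1, h2]
    have h6 : sinIncl y ^ 2 = 1 - (y 1 / y 2) ^ 2 := by linarith
    rw [mul_pow, h6]
    field_simp
  obtain ⟨hn0, hn1⟩ := eq_of_arg_coe_eq hn' (by
    rw [norm_sq_eq (nodeVec z), nodeVec_two]; ring) h5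
  have hM : angMom z = y 2 • frameM (y 1 / y 2) (sinIncl y) (y 5) := by
    apply e3_ext
    · rw [← nodeVec_one, hn1, hnL]
      simp [frameM]
      ring
    · have : angMom z 1 = -nodeVec z 0 := by rw [nodeVec_zero, neg_neg]
      rw [this, hn0, hnL]
      simp [frameM]
      ring
    · rw [← actionLz_eq, h1]
      simp [frameM]
      field_simp
  have hu : eccVec z = ε • frameU (y 1 / y 2) (sinIncl y) (y 4) (y 5) := by
    have hperp := inner_eccVec_angMom z
    rw [hM, inner_smul_right, mul_eq_zero, or_iff_right hL.ne', inner_eq] at hperp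
    have hεsq := norm_sq_eq (eccVec z)
    have hp1 : inner ℝ (nodeVec z) (eccVec z) =
        ‖nodeVec z‖ * (Real.cos (y 5) * eccVec z 0 + Real.sin (y 5) * eccVec z 1) := by
      rw [inner_eq, hn0, hn1, nodeVec_two]
      ring
    have hp2 : inner ℝ (cross (angMom z) (nodeVec z)) (eccVec z) / ‖angMom z‖ =
        ‖nodeVec z‖ * (-(y 1 / y 2 * Real.sin (y 5)) * eccVec z 0 +
          y 1 / y 2 * Real.cos (y 5) * eccVec z 1 + sinIncl y * eccVec z 2) := by
      rw [← actionL, h2, div_eq_iff hL.ne', inner_eq, cross_zero, cross_one, cross_two, hM, hn0,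
        hn1, nodeVec_two]
      simp [frameM]
      linear_combination ‖nodeVec z‖ * y 2 * sinIncl y * eccVec z 2 * hcs5
    have hperp' : eccVec z 0 * (Real.sin (y 5) * sinIncl y) -
        eccVec z 1 * (Real.cos (y 5) * sinIncl y) + eccVec z 2 * (y 1 / y 2) = 0 := by
      simp [frameM] at hperp
      linarith
    clear hperp
    have hsum : inner ℝ (nodeVec z) (eccVec z) ^ 2 +
        (inner ℝ (cross (angMom z) (nodeVec z)) (eccVec z) / ‖angMom z‖) ^ 2 =
        (‖nodeVec z‖ * ε) ^ 2 := by
      rw [hp1, hp2, mul_pow, mul_pow, mul_pow, hεsq, ← mul_add]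
      congr 1
      exact plane_norm_sq hab hcs5 hperp'
    obtain ⟨hα, hβ⟩ := eq_of_arg_coe_eq (mul_pos hn' hε) hsum h4
    rw [hp1] at hα
    rw [hp2] at hβ
    have hα' := mul_left_cancel₀ hn'.ne' (hα.trans (mul_assoc _ _ _))
    have hβ' := mul_left_cancel₀ hn'.ne' (hβ.trans (mul_assoc _ _ _))
    obtain ⟨e0, e1, e2⟩ := plane_coords hab hcs5 hperp' hα' hβ'
    apply e3_ext
    · rw [e0]
      simp [frameU]
      ring
    · rw [e1]
      simp [frameU]
      ring
    · rw [e2]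
      simp [frameU]
      ring
  have hw := cross_angMom_eccVec hx
  rw [hM, hu, cross_smul_left, cross_smul_right, hfr.cross_mu] at hw
  have hD : 1 - ε * Real.cos (anomOf y) = r / y 0 ^ 2 := by
    rw [hc, div_eq_mul_one_div, ← hJ2, hHV]
    field_simp
    ring
  have hkey : (angMomSq z - r) * (V - 1 / r) + σ ^ 2 / r = ε ^ 2 := by
    rw [hε2, hHV, hLV]
    field_simp
    ring
  have hone : ((angMomSq z - r) * (V - 1 / r) + σ ^ 2 / r) / ε ^ 2 = 1 := by
    rw [hkey, div_self (pow_ne_zero 2 hε.ne')]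
  have hq : (y 0 ^ 2 * (V * r - 1 - ε ^ 2)) = angMomSq z - r := by
    have : V = 2 * energy z + 2 / r := by rw [hHV]; ring
    rw [hε2, this]
    have h6 : 2 * energy z = -(1 / y 0 ^ 2) := by linarith
    rw [h6]
    field_simp
    ring
  have hu' : frameU (y 1 / y 2) (sinIncl y) (y 4) (y 5) = (1 / ε) • eccVec z := by
    rw [hu, smul_smul, one_div_mul_cancel hε.ne', one_smul]
  have hw' : frameW (y 1 / y 2) (sinIncl y) (y 4) (y 5) =
      (1 / (y 2 * ε)) • ((angMomSq z - r) • z.2 + (σ / r) • z.1) := by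
    rw [← hw, smul_smul, smul_smul]
    have : 1 / (y 2 * ε) * (y 2 * ε) = 1 := by field_simp
    rw [mul_assoc, this, one_smul]
  have hc' : Real.cos (anomOf y) = (V * r - 1) / ε := by
    rw [← hc]
    field_simp
  have hs' : Real.sin (anomOf y) = σ / (y 0 * ε) := by
    rw [mul_comm, ← eq_div_iff hε.ne'] at hs
    rw [hs]
    field_simp
  rw [delaunayX, orbitPoint, hecc, hD, hu', hw', hc', hs']
  have hecc' : eccVec z = (V - 1 / r) • z.1 - σ • z.2 := rfl
  refine Prod.ext ?_ ?_
  · have h6 : y 0 ^ 2 * ((V * r - 1) / ε - ε) * (1 / ε) = (angMomSq z - r) / ε ^ 2 := by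
      rw [← hq]
      field_simp
    have h7 : y 0 ^ 2 * (y 2 / y 0) * (σ / (y 0 * ε)) * (1 / (y 2 * ε)) = σ / ε ^ 2 := by
      field_simp
    simp only [smul_smul]
    rw [h6, h7, hecc']
    simp only [smul_sub, smul_add, smul_smul]
    match_scalars
    · linear_combination hone
    · ring
  · have h6 : -(σ / (y 0 * ε)) / (y 0 * (r / y 0 ^ 2)) * (1 / ε) = -(σ / r) / ε ^ 2 := by
      field_simp
    have h7 : y 2 / y 0 * ((V * r - 1) / ε) / (y 0 * (r / y 0 ^ 2)) * (1 / (y 2 * ε)) =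
        (V - 1 / r) / ε ^ 2 := by
      field_simp
    simp only [smul_smul]
    rw [h6, h7, hecc']
    simp only [smul_sub, smul_add, smul_smul]
    match_scalars
    · ring
    · linear_combination hone

theorem exists_lift (a b c : ℝ) (α β γ : Real.Angle) : ∃ y : Fin 6 → ℝ,
    (a, b, c, α, β, γ) =
      (y 0, y 1, y 2, (y 3 : Real.Angle), (y 4 : Real.Angle), (y 5 : Real.Angle)) := by
  induction α using Real.Angle.induction_on with | _ α =>
  induction β using Real.Angle.induction_on with | _ β =>
  induction γ using Real.Angle.induction_on with | _ γ =>
  exact ⟨![a, b, c, α, β, γ], rfl⟩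

theorem isDelaunayCoordinates_delaunayX : IsDelaunayCoordinates delaunayX where
  smooth := fun y hy => (contDiffAt_delaunayX hy).contDiffWithinAt
  image_eq := by
    refine Subset.antisymm (image_subset_iff.2 fun y hy => delaunayX_mem hy) fun z hz => ?_
    obtain ⟨y, hy⟩ := exists_lift (actionJ z) (actionLz z) (actionL z) (angleQ z) (anglePeri z)
      (angleNode z)
    have hy' := hy
    simp only [Prod.mk.injEq] at hy'
    exact ⟨y, mem_range_of_delaunay_eq hz hy'.1 hy'.2.1 hy'.2.2.1,
      delaunayX_eq_of_delaunay_eq hz hy⟩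
  delaunay_eq := fun y hy => delaunay_delaunayX hy
  injOn := by
    intro z hz z' hz' h
    obtain ⟨y, hy⟩ := exists_lift (actionJ z) (actionLz z) (actionL z) (angleQ z) (anglePeri z)
      (angleNode z)
    rw [← delaunayX_eq_of_delaunay_eq hz hy, ← delaunayX_eq_of_delaunay_eq hz' (h.symm.trans hy)]
  canonical := fun y hy ξ η => delaunayX_canonical hy ξ η

end

section

open Filter Topology

/-! ### Iterated directional derivatives -/

section Directional

variable {V : Type*} [NormedAddCommGroup V] [NormedSpace ℝ V]

/-- The iterated directional derivative along a list of directions, the head being applied last. -/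
def dlist (l : List V) (g : V → ℝ) : V → ℝ := l.foldr (fun w h y => fderiv ℝ h y w) g

@[simp] theorem dlist_nil (g : V → ℝ) : dlist [] g = g := rfl

theorem dlist_cons (w : V) (l : List V) (g : V → ℝ) :
    dlist (w :: l) g = fun y => fderiv ℝ (dlist l g) y w := rfl

theorem dlist_append (l l' : List V) (g : V → ℝ) : dlist (l ++ l') g = dlist l (dlist l' g) := by
  simp [dlist]

theorem dlist_replicate (k : ℕ) (w : V) (g : V → ℝ) :
    dlist (List.replicate k w) g = (fun h y => fderiv ℝ h y w)^[k] g := by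
  induction k with
  | zero => rfl
  | succ k ih => rw [List.replicate_succ, dlist_cons, ih, Function.iterate_succ_apply']

/-- The list of directions of the multi-index `α`. -/
def dirList {n : ℕ} (b : Fin n → V) (α : Fin n → ℕ) : List V :=
  (List.finRange n).flatMap fun i => List.replicate (α i) (b i)

theorem partialDeriv_eq_dlist {n : ℕ} (b : Fin n → V) (α : Fin n → ℕ) (g : V → ℝ) :
    partialDeriv b α g = dlist (dirList b α) g := by
  rw [partialDeriv, dirList]
  induction List.finRange n with
  | nil => rfl
  | cons i l ih => rw [List.foldr_cons, ih, List.flatMap_cons, dlist_append, dlist_replicate]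

theorem length_dirList {n : ℕ} (b : Fin n → V) (α : Fin n → ℕ) :
    (dirList b α).length = order α := by
  simp [dirList, order, List.length_flatMap, Fin.sum_univ_def]

theorem mem_dirList {n : ℕ} {b : Fin n → V} {α : Fin n → ℕ} {w : V} (h : w ∈ dirList b α) :
    ∃ i, w = b i := by
  simp only [dirList, List.mem_flatMap, List.mem_replicate] at h
  obtain ⟨i, -, -, rfl⟩ := h
  exact ⟨i, rfl⟩

theorem dlist_eq_iteratedFDeriv {g : V → ℝ} (l : List V) {y : V}
    (hg : ContDiffAt ℝ l.length g y) :
    dlist l g y = iteratedFDeriv ℝ l.length g y l.get := by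
  induction l generalizing y with
  | nil => simp
  | cons w l ih =>
    have hg' : ContDiffAt ℝ l.length g y := hg.of_le (by norm_cast; simp)
    have hev : dlist l g =ᶠ[𝓝 y] fun y => iteratedFDeriv ℝ l.length g y l.get :=
      (hg'.eventually (by simp)).mono fun x hx => ih hx
    have hd : DifferentiableAt ℝ (iteratedFDeriv ℝ l.length g) y :=
      hg.differentiableAt_iteratedFDeriv (by norm_cast; simp)
    rw [dlist_cons]
    simp only
    rw [hev.fderiv_eq]
    exact (hd.iteratedFDeriv_succ_apply_left' (m := (w :: l).get)).symm

theorem abs_dlist_le {g : V → ℝ} {l : List V} (hl : ∀ w ∈ l, ‖w‖ ≤ 1) {y : V}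
    (hg : ContDiffAt ℝ l.length g y) : |dlist l g y| ≤ ‖iteratedFDeriv ℝ l.length g y‖ := by
  rw [dlist_eq_iteratedFDeriv l hg, ← Real.norm_eq_abs]
  refine (ContinuousMultilinearMap.le_opNorm _ _).trans ?_
  refine mul_le_of_le_one_right (norm_nonneg _) ?_
  exact Finset.prod_le_one (fun _ _ => norm_nonneg _) fun i _ => hl _ (List.get_mem l i)

theorem contDiffAt_dlist {g : V → ℝ} (l : List V) {y : V} {m : ℕ}
    (hg : ContDiffAt ℝ (m + l.length : ℕ) g y) : ContDiffAt ℝ m (dlist l g) y := by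
  induction l generalizing m with
  | nil => simpa using hg
  | cons w l ih =>
    have h : ContDiffAt ℝ (m + 1 : ℕ) (dlist l g) y :=
      ih (hg.of_le (by norm_cast; simp; omega))
    rw [dlist_cons]
    exact (h.fderiv_right (m := m) (by norm_cast)).clm_apply contDiffAt_const

theorem dlist_perm {g : V → ℝ} {l l' : List V} (h : l.Perm l') {y : V}
    (hg : ContDiffAt ℝ l.length g y) : dlist l g y = dlist l' g y := by
  induction h generalizing y with
  | nil => rfl
  | cons w _ ih =>
    rename_i l₁ l₂ _
    have hg' : ContDiffAt ℝ l₁.length g y := hg.of_le (by norm_cast; simp)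
    have hev : dlist l₁ g =ᶠ[𝓝 y] dlist l₂ g :=
      (hg'.eventually (by simp)).mono fun x hx => ih hx
    rw [dlist_cons, dlist_cons]
    simp only
    rw [hev.fderiv_eq]
  | swap a b l =>
    have h2 : ContDiffAt ℝ 2 (dlist l g) y :=
      contDiffAt_dlist (m := 2) l (hg.of_le (by norm_cast; simp; omega))
    have hd : DifferentiableAt ℝ (fderiv ℝ (dlist l g)) y :=
      (h2.fderiv_right (m := 1) (by norm_num)).differentiableAt (by simp)
    have hs := h2.isSymmSndFDerivAt (by simp)
    have e : ∀ a b : V, dlist (b :: a :: l) g y = fderiv ℝ (fderiv ℝ (dlist l g)) y b a := by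
      intro a b
      rw [dlist_cons, dlist_cons]
      simp only
      rw [fderiv_clm_apply hd (differentiableAt_const a)]
      simp
    rw [e, e]
    exact hs.eq b a
  | trans h₁ h₂ ih₁ ih₂ =>
    rw [ih₁ hg, ih₂ (h₁.length_eq ▸ hg)]

end Directional

theorem norm_multilinear_le_of_basis {V ι : Type*} [NormedAddCommGroup V] [NormedSpace ℝ V]
    [FiniteDimensional ℝ V] [Fintype ι] (b : Module.Basis ι ℝ V) (k : ℕ) :
    ∃ C : ℝ, 0 ≤ C ∧ ∀ (M : ContinuousMultilinearMap ℝ (fun _ : Fin k => V) ℝ) (A : ℝ), 0 ≤ A →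
      (∀ j : Fin k → ι, |M (fun i => b (j i))| ≤ A) → ‖M‖ ≤ C * A := by
  classical
  obtain ⟨c, hc0, hc⟩ : ∃ c : ℝ, 0 ≤ c ∧ ∀ (i : ι) (v : V), |b.repr v i| ≤ c * ‖v‖ := by
    refine ⟨∑ i, ‖LinearMap.toContinuousLinearMap (b.coord i)‖,
      Finset.sum_nonneg fun _ _ => norm_nonneg _, fun i v => ?_⟩
    have h1 := (LinearMap.toContinuousLinearMap (b.coord i)).le_opNorm v
    refine le_trans h1 (mul_le_mul_of_nonneg_right ?_ (norm_nonneg _))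
    exact Finset.single_le_sum (f := fun i => ‖LinearMap.toContinuousLinearMap (b.coord i)‖)
      (fun _ _ => norm_nonneg _) (Finset.mem_univ i)
  refine ⟨Fintype.card (Fin k → ι) * c ^ k, by positivity, fun M A hA h => ?_⟩
  refine ContinuousMultilinearMap.opNorm_le_bound (by positivity) fun v => ?_
  have hv : v = fun i => ∑ j, b.repr (v i) j • b j := by
    funext i
    exact (b.sum_repr (v i)).symm
  have hsum : M v = ∑ j : Fin k → ι, (∏ i, b.repr (v i) (j i)) * M (fun i => b (j i)) := by
    conv_lhs => rw [hv]
    rw [ContinuousMultilinearMap.map_sum]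
    refine Finset.sum_congr rfl fun j _ => ?_
    rw [ContinuousMultilinearMap.map_smul_univ, smul_eq_mul]
  rw [hsum]
  refine (norm_sum_le _ _).trans ?_
  have hj : ∀ j ∈ (Finset.univ : Finset (Fin k → ι)),
      ‖(∏ i, b.repr (v i) (j i)) * M (fun i => b (j i))‖ ≤ c ^ k * A * ∏ i, ‖v i‖ := by
    intro j _
    rw [norm_mul, norm_prod]
    have h1 : ∏ i, ‖b.repr (v i) (j i)‖ ≤ c ^ k * ∏ i, ‖v i‖ := by
      calc ∏ i, ‖b.repr (v i) (j i)‖ ≤ ∏ i, (c * ‖v i‖) :=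
            Finset.prod_le_prod (fun _ _ => norm_nonneg _) fun i _ => hc (j i) (v i)
        _ = c ^ k * ∏ i, ‖v i‖ := by rw [Finset.prod_mul_distrib]; simp
    calc _ ≤ (c ^ k * ∏ i, ‖v i‖) * A := mul_le_mul h1 (h j) (abs_nonneg _) (by positivity)
      _ = _ := by ring
  refine (Finset.sum_le_card_nsmul _ _ _ hj).trans ?_
  rw [nsmul_eq_mul, Finset.card_univ]
  exact le_of_eq (by ring)

/-! ### Phase space derivatives -/

/-- The coordinate directions of phase space. -/
def dirPhase : Fin 3 ⊕ Fin 3 → Phase := Sum.elim dirX dirV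

/-- The coordinate directions of phase space, as a basis. -/
def basisPhase : Module.Basis (Fin 3 ⊕ Fin 3) ℝ Phase :=
  (EuclideanSpace.basisFun (Fin 3) ℝ).toBasis.prod (EuclideanSpace.basisFun (Fin 3) ℝ).toBasis

theorem basisPhase_apply (i : Fin 3 ⊕ Fin 3) : basisPhase i = dirPhase i := by
  rcases i with i | i <;> simp [basisPhase, dirPhase, dirX, dirV, basisE3]

theorem norm_basisE3 (i : Fin 3) : ‖basisE3 i‖ = 1 := by simp [basisE3]

theorem norm_dirX (i : Fin 3) : ‖dirX i‖ = 1 := by simp [dirX, Prod.norm_def, norm_basisE3]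

theorem norm_dirV (i : Fin 3) : ‖dirV i‖ = 1 := by simp [dirV, Prod.norm_def, norm_basisE3]

theorem phaseDeriv_eq_dlist (α β : Fin 3 → ℕ) (g : Phase → ℝ) :
    phaseDeriv α β g = dlist (dirList dirX α ++ dirList dirV β) g := by
  rw [phaseDeriv, partialDeriv_eq_dlist, partialDeriv_eq_dlist, dlist_append]

theorem exists_perm_dirList {V : Type*} [NormedAddCommGroup V] [NormedSpace ℝ V] {n : ℕ}
    (b : Fin n → V) (l : List (Fin n)) :
    ∃ α : Fin n → ℕ, (l.map b).Perm (dirList b α) := by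
  refine ⟨fun i => l.count i, ?_⟩
  have h : l.Perm ((List.finRange n).flatMap fun i => List.replicate (l.count i) i) := by
    rw [List.perm_iff_count]
    intro a
    rw [List.count_flatMap]
    simp only [Function.comp_def, List.count_replicate]
    rw [← Fin.sum_univ_def]
    simp
  refine (h.map b).trans (List.Perm.of_eq ?_)
  simp [dirList, List.map_flatMap]

theorem exists_perm_phase (l : List (Fin 3 ⊕ Fin 3)) :
    ∃ α β : Fin 3 → ℕ, (l.map dirPhase).Perm (dirList dirX α ++ dirList dirV β) := by
  obtain ⟨l₁, l₂, h⟩ : ∃ l₁ l₂ : List (Fin 3),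
      (l.map dirPhase).Perm (l₁.map dirX ++ l₂.map dirV) := by
    induction l with
    | nil => exact ⟨[], [], List.Perm.refl _⟩
    | cons i l ih =>
      obtain ⟨l₁, l₂, h⟩ := ih
      rcases i with i | i
      · exact ⟨i :: l₁, l₂, h.cons _⟩
      · exact ⟨l₁, i :: l₂, (h.cons (dirV i)).trans List.perm_middle.symm⟩
  obtain ⟨α, hα⟩ := exists_perm_dirList dirX l₁
  obtain ⟨β, hβ⟩ := exists_perm_dirList dirV l₂
  exact ⟨α, β, h.trans (hα.append hβ)⟩

theorem abs_phaseDeriv_le_of_cNorm {N : ℕ} {g : Phase → ℝ} {A : ℝ} (hA : 0 ≤ A)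
    (h : cNorm N g ≤ ENNReal.ofReal A) {α β : Fin 3 → ℕ} (hαβ : order α + order β ≤ N)
    (z : Phase) : |phaseDeriv α β g z| ≤ A := by
  have hle : ∀ (α : Fin 3 → ℕ) (i : Fin 3), α i ≤ order α := fun α i =>
    Finset.single_le_sum (f := α) (fun _ _ => Nat.zero_le _) (Finset.mem_univ i)
  have hmem : (α, β) ∈ multiIndexPairs N := by
    simp only [multiIndexPairs, Finset.mem_filter, Finset.mem_product, Fintype.mem_piFinset,
      Finset.mem_range]
    exact ⟨⟨fun i => by have := hle α i; omega, fun i => by have := hle β i; omega⟩, hαβ⟩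
  have h1 : ‖phaseDeriv α β g z‖ₑ ≤ ENNReal.ofReal A :=
    ((le_iSup (fun z => ‖phaseDeriv α β g z‖ₑ) z).trans
      (Finset.single_le_sum (f := fun p : (Fin 3 → ℕ) × (Fin 3 → ℕ) =>
        ⨆ z : Phase, ‖phaseDeriv p.1 p.2 g z‖ₑ) (fun _ _ => bot_le) hmem)).trans h
  rw [Real.enorm_eq_ofReal_abs] at h1
  exact (ENNReal.ofReal_le_ofReal_iff hA).1 h1

theorem exists_norm_iteratedFDeriv_le (N : ℕ) : ∃ C : ℝ, 0 ≤ C ∧ ∀ (g : Phase → ℝ) (A : ℝ), 0 ≤ A →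
    ContDiff ℝ N g → cNorm N g ≤ ENNReal.ofReal A → ∀ k ≤ N, ∀ z,
      ‖iteratedFDeriv ℝ k g z‖ ≤ C * A := by
  choose C hC0 hC using fun k => norm_multilinear_le_of_basis basisPhase k
  refine ⟨∑ k ∈ Finset.range (N + 1), C k, Finset.sum_nonneg fun k _ => hC0 k,
    fun g A hA hg hgA k hk z => ?_⟩
  have h1 : ‖iteratedFDeriv ℝ k g z‖ ≤ C k * A := by
    refine hC k _ A hA fun j => ?_
    have hl : (List.ofFn j).length = k := List.length_ofFn
    have hgk : ContDiff ℝ k g := hg.of_le (by exact_mod_cast hk)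
    obtain ⟨α, β, hp⟩ := exists_perm_phase (List.ofFn j)
    have h2 : dlist ((List.ofFn j).map dirPhase) g z =
        iteratedFDeriv ℝ k g z fun i => basisPhase (j i) := by
      rw [List.map_ofFn]
      have h3 := dlist_eq_iteratedFDeriv (g := g) (List.ofFn (dirPhase ∘ j)) (y := z)
        (by rw [List.length_ofFn]; exact hgk.contDiffAt)
      rw [h3]
      have h4 : ∀ (m : ℕ) (hm : m = k) (w : Fin m → Phase)
          (hw : ∀ i, w i = dirPhase (j (Fin.cast hm i))), iteratedFDeriv ℝ m g z w =
          iteratedFDeriv ℝ k g z fun i => basisPhase (j i) := by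
        intro m hm w hw
        subst hm
        congr 1
        funext i
        rw [hw, basisPhase_apply]
        rfl
      exact h4 _ List.length_ofFn _ fun i => by simp; rfl
    rw [← h2, dlist_perm hp (by rw [List.length_map, hl]; exact hgk.contDiffAt),
      ← phaseDeriv_eq_dlist]
    refine abs_phaseDeriv_le_of_cNorm hA hgA ?_ z
    have := hp.length_eq
    simp only [List.length_map, List.length_append, length_dirList, List.length_ofFn] at this
    omega
  refine h1.trans (mul_le_mul_of_nonneg_right ?_ hA)
  exact Finset.single_le_sum (f := C) (fun k _ => hC0 k) (Finset.mem_range.2 (by omega))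

end

section

open Filter Topology

/-! ### Smooth cutoffs and parametric integrals -/

theorem contDiff_smul_of_tsupport {V W : Type*} [NormedAddCommGroup V] [NormedSpace ℝ V]
    [NormedAddCommGroup W] [NormedSpace ℝ W] {n : WithTop ℕ∞} {χ : V → ℝ} {f : V → W} {U : Set V}
    (hχ : ContDiff ℝ n χ) (hU : IsOpen U) (hf : ContDiffOn ℝ n f U) (hs : tsupport χ ⊆ U) :
    ContDiff ℝ n fun z => χ z • f z := by
  rw [contDiff_iff_contDiffAt]
  intro z
  by_cases hz : z ∈ U
  · exact hχ.contDiffAt.smul (hf.contDiffAt (hU.mem_nhds hz))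
  · have h0 : (fun z => χ z • f z) =ᶠ[𝓝 z] fun _ => 0 := by
      filter_upwards [(isClosed_tsupport χ).isOpen_compl.mem_nhds fun h => hz (hs h)] with y hy
      rw [image_eq_zero_of_notMem_tsupport hy, zero_smul]
    exact contDiffAt_const.congr_of_eventuallyEq h0

theorem exists_cutoff {V : Type*} [NormedAddCommGroup V] [NormedSpace ℝ V] [FiniteDimensional ℝ V]
    {K U : Set V} (hK : IsCompact K) (hU : IsOpen U) (hKU : K ⊆ U) :
    ∃ χ : V → ℝ, ContDiff ℝ ∞ χ ∧ HasCompactSupport χ ∧ tsupport χ ⊆ U ∧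
      ∃ O, IsOpen O ∧ K ⊆ O ∧ ∀ z ∈ O, χ z = 1 := by
  obtain ⟨K₁, hK₁, hKK₁, hK₁U⟩ := exists_compact_between hK hU hKU
  obtain ⟨f, h1, h2, -⟩ := exists_contMDiffMap_one_nhds_of_subset_interior
    (modelWithCornersSelf ℝ V) (n := (⊤ : ℕ∞)) hK.isClosed hKK₁
  obtain ⟨O, hO, hKO, hO1⟩ := eventually_nhdsSet_iff_exists.1 h1
  have hsupp : tsupport (f : V → ℝ) ⊆ K₁ :=
    closure_minimal (fun x hx => by_contra fun h => hx (h2 x h)) hK₁.isClosed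
  exact ⟨f, f.contMDiff.contDiff, hK₁.of_isClosed_subset (isClosed_tsupport _) hsupp,
    hsupp.trans hK₁U, O, hO, hKO, hO1⟩

theorem exists_bound_iteratedFDeriv {V W : Type*} [NormedAddCommGroup V] [NormedSpace ℝ V]
    [NormedAddCommGroup W] [NormedSpace ℝ W] {f : V → W} (hf : ContDiff ℝ ∞ f)
    (hs : HasCompactSupport f) (n : ℕ) :
    ∃ C : ℝ, 0 ≤ C ∧ ∀ j ≤ n, ∀ z, ‖iteratedFDeriv ℝ j f z‖ ≤ C := by
  have h : ∀ j : ℕ, ∃ C : ℝ, ∀ z, ‖iteratedFDeriv ℝ j f z‖ ≤ C := fun j =>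
    ((hf.continuous_iteratedFDeriv (m := j) (by exact_mod_cast le_top))).bounded_above_of_compact_support
      (hs.iteratedFDeriv j)
  choose C hC using h
  refine ⟨∑ j ∈ Finset.range (n + 1), |C j|, Finset.sum_nonneg fun _ _ => abs_nonneg _,
    fun j hj z => ((hC j z).trans (le_abs_self _)).trans ?_⟩
  exact Finset.single_le_sum (f := fun j => |C j|) (fun _ _ => abs_nonneg _)
    (Finset.mem_range.2 (by omega))

section Parametric

variable {V E W : Type} [NormedAddCommGroup V] [NormedSpace ℝ V] [FiniteDimensional ℝ V]
  [NormedAddCommGroup E] [NormedSpace ℝ E] [MeasurableSpace E] [BorelSpace E]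
  [SecondCountableTopology E]
  [NormedAddCommGroup W] [NormedSpace ℝ W] [CompleteSpace W]
  {μ : Measure E} [IsLocallyFiniteMeasure μ] {k : Set E}

theorem hasFDerivAt_setIntegral {F : V × E → W} (hF : ContDiff ℝ 1 F) (hk : IsCompact k) (x : V) :
    HasFDerivAt (fun x => ∫ a in k, F (x, a) ∂μ)
      (∫ a in k, (fderiv ℝ F (x, a)).comp (ContinuousLinearMap.inl ℝ V E) ∂μ) x := by
  have : ProperSpace V := FiniteDimensional.proper ℝ V
  have hF' : Continuous fun p : V × E =>
      (fderiv ℝ F p).comp (ContinuousLinearMap.inl ℝ V E) :=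
    (hF.continuous_fderiv (by simp)).clm_comp continuous_const
  obtain ⟨B, hB⟩ := ((isCompact_closedBall x 1).prod hk).exists_bound_of_continuousOn
    hF'.continuousOn
  refine hasFDerivAt_integral_of_dominated_of_fderiv_le (bound := fun _ => B)
    (F' := fun x a => (fderiv ℝ F (x, a)).comp (ContinuousLinearMap.inl ℝ V E))
    (Metric.closedBall_mem_nhds x one_pos) ?_ ?_ ?_ ?_ ?_ ?_
  · refine Eventually.of_forall fun y => ?_
    exact (hF.continuous.comp (Continuous.prodMk_right y)).aestronglyMeasurable
  · exact (hF.continuous.comp (Continuous.prodMk_right x)).continuousOn.integrableOn_compact hk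
  · exact (hF'.comp (Continuous.prodMk_right x)).aestronglyMeasurable
  · filter_upwards [ae_restrict_mem hk.measurableSet] with a ha y hy
    exact hB (y, a) ⟨hy, ha⟩
  · exact integrableOn_const (hs := hk.measure_lt_top.ne)
  · refine Eventually.of_forall fun a y _ => ?_
    have h1 : HasFDerivAt F (fderiv ℝ F (y, a)) (y, a) :=
      (hF.differentiable (by simp) _).hasFDerivAt
    exact h1.comp y (hasFDerivAt_prodMk_left y a)

theorem continuous_setIntegral {F : V × E → W} (hF : Continuous F) (hk : IsCompact k) :
    Continuous fun x => ∫ a in k, F (x, a) ∂μ := by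
  have : ProperSpace V := FiniteDimensional.proper ℝ V
  exact continuous_parametric_integral_of_continuous (f := fun x a => F (x, a)) hF hk

end Parametric

theorem contDiff_setIntegral {V E : Type} [NormedAddCommGroup V] [NormedSpace ℝ V]
    [FiniteDimensional ℝ V] [NormedAddCommGroup E] [NormedSpace ℝ E] [MeasurableSpace E]
    [BorelSpace E] [SecondCountableTopology E] {μ : Measure E} [IsLocallyFiniteMeasure μ]
    {k : Set E} (hk : IsCompact k) (n : ℕ) : ∀ {W : Type} [NormedAddCommGroup W] [NormedSpace ℝ W]
    [CompleteSpace W] {F : V × E → W}, ContDiff ℝ n F →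
      ContDiff ℝ n fun x => ∫ a in k, F (x, a) ∂μ := by
  induction n with
  | zero =>
    intro W _ _ _ F hF
    exact contDiff_zero.2 (continuous_setIntegral hF.continuous hk)
  | succ n ih =>
    intro W _ _ _ F hF
    have h1 : ContDiff ℝ 1 F := hF.of_le (by norm_cast; omega)
    refine contDiff_succ_iff_hasFDerivAt.2 ⟨_, ?_, fun x => hasFDerivAt_setIntegral h1 hk x⟩
    refine ih (F := fun p => (fderiv ℝ F p).comp (ContinuousLinearMap.inl ℝ V E)) ?_
    exact (hF.fderiv_right (m := n) (by norm_cast)).clm_comp contDiff_const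

/-! ### Averages of phase space functions over velocities -/

section Velocity

variable {K : Set Phase} {G : Phase → ℝ}

theorem setIntegral_eq_integral_velocity (h0 : ∀ z ∉ K, G z = 0) (x : E3) :
    ∫ v in Prod.snd '' K, G (x, v) = ∫ v, G (x, v) := by
  refine setIntegral_eq_integral_of_forall_compl_eq_zero fun v hv => h0 _ fun h => hv ?_
  exact ⟨_, h, rfl⟩

theorem contDiff_integral_velocity (hK : IsCompact K) (h0 : ∀ z ∉ K, G z = 0) {n : ℕ}
    (hG : ContDiff ℝ n G) : ContDiff ℝ n fun x => ∫ v : E3, G (x, v) := by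
  have h := contDiff_setIntegral (μ := (volume : Measure E3)) (hK.image continuous_snd) n hG
  simpa only [setIntegral_eq_integral_velocity h0] using h

theorem fderiv_eq_zero_of_notMem {V W : Type*} [NormedAddCommGroup V] [NormedSpace ℝ V]
    [NormedAddCommGroup W] [NormedSpace ℝ W] {K : Set V} (hK : IsClosed K) {G : V → W}
    (h0 : ∀ z ∉ K, G z = 0) {z : V} (hz : z ∉ K) : fderiv ℝ G z = 0 := by
  have : G =ᶠ[𝓝 z] fun _ => 0 := by
    filter_upwards [hK.isOpen_compl.mem_nhds hz] with y hy using h0 y hy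
  rw [this.fderiv_eq]
  simp

theorem integrable_velocity (hK : IsCompact K) (h0 : ∀ z ∉ K, G z = 0) (hG : Continuous G)
    (x : E3) : Integrable fun v : E3 => G (x, v) := by
  refine (hG.comp (Continuous.prodMk_right x)).integrable_of_hasCompactSupport ?_
  refine HasCompactSupport.intro (hK.image continuous_snd) fun v hv => h0 _ fun h => hv ?_
  exact ⟨_, h, rfl⟩

theorem fderiv_integral_velocity (hK : IsCompact K) (h0 : ∀ z ∉ K, G z = 0)
    (hG : ContDiff ℝ 1 G) (x w : E3) :
    fderiv ℝ (fun x => ∫ v : E3, G (x, v)) x w = ∫ v : E3, fderiv ℝ G (x, v) (w, 0) := by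
  have hk := hK.image continuous_snd
  have h := hasFDerivAt_setIntegral (μ := (volume : Measure E3)) hG hk x
  simp only [setIntegral_eq_integral_velocity h0] at h
  have hc : Continuous fun v => (fderiv ℝ G (x, v)).comp (ContinuousLinearMap.inl ℝ E3 E3) :=
    ((hG.continuous_fderiv (by simp)).comp (Continuous.prodMk_right x)).clm_comp continuous_const
  rw [h.fderiv, ContinuousLinearMap.integral_apply (hc.continuousOn.integrableOn_compact hk)]
  simp only [ContinuousLinearMap.comp_apply, ContinuousLinearMap.inl_apply]
  refine setIntegral_eq_integral_velocity (G := fun z => fderiv ℝ G z (w, 0)) (fun z hz => ?_) x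
  rw [fderiv_eq_zero_of_notMem hK.isClosed h0 hz]
  rfl

theorem integral_fderiv_velocity (hK : IsCompact K) (h0 : ∀ z ∉ K, G z = 0)
    (hG : ContDiff ℝ 1 G) (x w : E3) : ∫ v : E3, fderiv ℝ G (x, v) (0, w) = 0 := by
  have h0' : ∀ z ∉ K, fderiv ℝ G z (0, w) = 0 := fun z hz => by
    rw [fderiv_eq_zero_of_notMem hK.isClosed h0 hz]
    rfl
  have hc : Continuous fun z => fderiv ℝ G z (0, w) :=
    (hG.continuous_fderiv (by simp)).clm_apply continuous_const
  have h := integral_bilinear_hasLineDerivAt_right_eq_neg_left_of_integrable (μ := volume)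
    (f := fun _ : E3 => (1 : ℝ)) (f' := fun _ => 0) (g := fun v : E3 => G (x, v))
    (g' := fun v => fderiv ℝ G (x, v) (0, w)) (v := w) (B := ContinuousLinearMap.mul ℝ ℝ)
    (by simp) (by simpa using integrable_velocity hK h0' hc x)
    (by simpa using integrable_velocity hK h0 hG.continuous x)
    (fun v _ => by simpa using (hasFDerivAt_const (1 : ℝ) v).hasLineDerivAt w) (fun v _ => by
      have h1 : HasFDerivAt G (fderiv ℝ G (x, v)) (x, v) :=
        (hG.differentiable (by simp) _).hasFDerivAt
      have h2 := (h1.comp v (hasFDerivAt_prodMk_right x v)).hasLineDerivAt w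
      simpa [Function.comp_def] using h2)
  simpa using h

end Velocity

end

section

open Filter Topology

/-! ### Oscillating functions -/

/-- Functions of class `C^n` of an angle and of a point of phase space, supported over `K`, whose
derivatives up to order `n` are bounded by `M`. -/
structure IsOsc (K : Set Phase) (n : ℕ) (M : ℝ) (b : ℝ × Phase → ℝ) : Prop where
  contDiff : ContDiff ℝ n b
  support : ∀ p : ℝ × Phase, p.2 ∉ K → b p = 0
  bound : ∀ j ≤ n, ∀ p, ‖iteratedFDeriv ℝ j b p‖ ≤ M
  periodic : ∀ θ z, b (θ + 2 * Real.pi, z) = b (θ, z)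

variable {K : Set Phase} {n : ℕ} {M M' : ℝ} {b b' : ℝ × Phase → ℝ}

theorem IsOsc.nonneg (h : IsOsc K n M b) : 0 ≤ M :=
  (norm_nonneg _).trans (h.bound 0 (Nat.zero_le _) 0)

theorem IsOsc.abs_le (h : IsOsc K n M b) (p : ℝ × Phase) : |b p| ≤ M := by
  simpa using h.bound 0 (Nat.zero_le _) p

theorem IsOsc.of_le (h : IsOsc K n M b) {m : ℕ} (hm : m ≤ n) : IsOsc K m M b where
  contDiff := h.contDiff.of_le (by exact_mod_cast hm)
  support := h.support
  bound := fun j hj => h.bound j (hj.trans hm)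
  periodic := h.periodic

theorem IsOsc.mono (h : IsOsc K n M b) (hM : M ≤ M') : IsOsc K n M' b where
  contDiff := h.contDiff
  support := h.support
  bound := fun j hj p => (h.bound j hj p).trans hM
  periodic := h.periodic

theorem IsOsc.add (h : IsOsc K n M b) (h' : IsOsc K n M' b') :
    IsOsc K n (M + M') fun p => b p + b' p where
  contDiff := h.contDiff.add h'.contDiff
  support := fun p hp => by rw [h.support p hp, h'.support p hp, add_zero]
  bound := fun j hj p => by
    have e := iteratedFDeriv_add_apply (i := j) (x := p)
      (h.contDiff.contDiffAt.of_le (by exact_mod_cast hj))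
      (h'.contDiff.contDiffAt.of_le (by exact_mod_cast hj))
    have e' : (fun p => b p + b' p) = b + b' := rfl
    rw [e', e]
    exact (norm_add_le _ _).trans (add_le_add (h.bound j hj p) (h'.bound j hj p))
  periodic := fun θ z => by rw [h.periodic, h'.periodic]

theorem IsOsc.neg (h : IsOsc K n M b) : IsOsc K n M fun p => -b p where
  contDiff := h.contDiff.neg
  support := fun p hp => by rw [h.support p hp, neg_zero]
  bound := fun j hj p => by
    have e' : (fun p => -b p) = -b := rfl
    rw [e', iteratedFDeriv_neg_apply, norm_neg]
    exact h.bound j hj p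
  periodic := fun θ z => by rw [h.periodic]

theorem IsOsc.sub (h : IsOsc K n M b) (h' : IsOsc K n M' b') :
    IsOsc K n (M + M') fun p => b p - b' p := by
  simpa only [sub_eq_add_neg] using h.add h'.neg

theorem exists_isOsc_mul (K : Set Phase) (n : ℕ) {m : Phase → ℝ} (hm : ContDiff ℝ ∞ m)
    (hs : HasCompactSupport m) : ∃ C : ℝ, 0 ≤ C ∧ ∀ M b, IsOsc K n M b →
      IsOsc K n (C * M) fun p => m p.2 * b p := by
  obtain ⟨B, hB0, hB⟩ := exists_bound_iteratedFDeriv hm hs n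
  have hB' : ∀ j ≤ n, ∀ p : ℝ × Phase, ‖iteratedFDeriv ℝ j (fun p : ℝ × Phase => m p.2) p‖ ≤ B := by
    intro j hj p
    have e := (ContinuousLinearMap.snd ℝ ℝ Phase).iteratedFDeriv_comp_right (i := j) hm p
      (by exact_mod_cast le_top)
    have e' : (fun p : ℝ × Phase => m p.2) = m ∘ (ContinuousLinearMap.snd ℝ ℝ Phase) := rfl
    rw [e', e]
    refine (ContinuousMultilinearMap.norm_compContinuousLinearMap_le _ _).trans ?_
    refine (mul_le_of_le_one_right (norm_nonneg _) ?_).trans (hB j hj _)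
    exact Finset.prod_le_one (fun _ _ => norm_nonneg _) fun _ _ =>
      ContinuousLinearMap.norm_snd_le ℝ ℝ Phase
  have hm' : ContDiff ℝ ∞ fun p : ℝ × Phase => m p.2 := hm.comp contDiff_snd
  refine ⟨2 ^ n * B, by positivity, fun M b h => ⟨?_, ?_, ?_, ?_⟩⟩
  · exact (hm'.of_le (by exact_mod_cast le_top)).mul h.contDiff
  · intro p hp
    rw [h.support p hp, mul_zero]
  · intro j hj p
    have h1 := norm_iteratedFDeriv_mul_le (N := n) (hm'.of_le (by exact_mod_cast le_top))
      h.contDiff p (n := j) (by exact_mod_cast hj)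
    refine h1.trans ?_
    have h2 : ∀ i ∈ Finset.range (j + 1), (j.choose i : ℝ) *
        ‖iteratedFDeriv ℝ i (fun p : ℝ × Phase => m p.2) p‖ * ‖iteratedFDeriv ℝ (j - i) b p‖ ≤
        (j.choose i : ℝ) * (B * M) := by
      intro i hi
      rw [Finset.mem_range] at hi
      rw [mul_assoc]
      refine mul_le_mul_of_nonneg_left ?_ (by positivity)
      exact mul_le_mul (hB' i (by omega) p) (h.bound _ (by omega) p) (norm_nonneg _) hB0
    refine (Finset.sum_le_sum h2).trans ?_
    rw [← Finset.sum_mul, ← Nat.cast_sum, Nat.sum_range_choose]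
    have h3 : ((2 ^ j : ℕ) : ℝ) ≤ 2 ^ n := by
      push_cast
      exact pow_le_pow_right₀ (by norm_num) hj
    calc ((2 ^ j : ℕ) : ℝ) * (B * M) ≤ 2 ^ n * (B * M) :=
          mul_le_mul_of_nonneg_right h3 (mul_nonneg hB0 h.nonneg)
      _ = _ := by ring
  · intro θ z
    simp only
    rw [h.periodic]

theorem IsOsc.fderiv_apply (hK : IsClosed K) (h : IsOsc K (n + 1) M b) (w : ℝ × Phase) :
    IsOsc K n (‖w‖ * M) fun p => fderiv ℝ b p w where
  contDiff := (h.contDiff.fderiv_right (m := n) (by norm_cast)).clm_apply contDiff_const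
  support := fun p hp => by
    rw [fderiv_eq_zero_of_notMem (K := Prod.snd ⁻¹' K) (hK.preimage continuous_snd)
      (fun p hp => h.support p hp) hp]
    rfl
  bound := fun j hj p => by
    have h1 : ContDiffAt ℝ n (fderiv ℝ b) p :=
      (h.contDiff.fderiv_right (m := n) (by norm_cast)).contDiffAt
    refine (norm_iteratedFDeriv_clm_apply_const h1 (by exact_mod_cast hj)).trans ?_
    rw [norm_iteratedFDeriv_fderiv]
    exact mul_le_mul_of_nonneg_left (h.bound (j + 1) (by omega) p) (norm_nonneg _)
  periodic := fun θ z => by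
    have h1 : (fun p => b (p + (2 * Real.pi, 0))) = b := by
      funext p
      have := h.periodic p.1 p.2
      simpa [Prod.add_def] using this
    have h2 := fderiv_comp_add_right (𝕜 := ℝ) (f := b) (x := (θ, z)) (2 * Real.pi, (0 : Phase))
    rw [h1] at h2
    rw [h2]
    simp

/-- The derivative with respect to the angle. -/
def angDeriv (b : ℝ × Phase → ℝ) (p : ℝ × Phase) : ℝ := fderiv ℝ b p (1, 0)

/-- The divergence in the velocities of `v μ b`. -/
def velDiv (μ : Phase → ℝ) (b : ℝ × Phase → ℝ) (p : ℝ × Phase) : ℝ :=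
  ∑ i, fderiv ℝ (fun q : ℝ × Phase => (q.2.2 i * μ q.2) * b q) p (0, dirV i)

/-- The average over the velocities of an oscillating function evaluated at the angle `-s ν`. -/
def velAvg (ν : Phase → ℝ) (b : ℝ × Phase → ℝ) (s : ℝ) (x : E3) : ℝ :=
  ∫ v : E3, b (-(s * ν (x, v)), (x, v))

theorem exists_isOsc_velDiv (hK : IsClosed K) (n : ℕ) {μ : Phase → ℝ} (hμ : ContDiff ℝ ∞ μ)
    (hs : HasCompactSupport μ) : ∃ C : ℝ, 0 ≤ C ∧ ∀ M b, IsOsc K (n + 1) M b →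
      IsOsc K n (C * M) (velDiv μ b) := by
  have hm : ∀ i : Fin 3, ContDiff ℝ ∞ fun z : Phase => z.2 i * μ z := fun i =>
    ContDiff.mul (by fun_prop) hμ
  choose C hC0 hC using fun i : Fin 3 => exists_isOsc_mul K (n + 1) (hm i) hs.mul_left
  refine ⟨C 0 + C 1 + C 2, add_nonneg (add_nonneg (hC0 0) (hC0 1)) (hC0 2), fun M b h => ?_⟩
  have hi : ∀ i, IsOsc K n (C i * M)
      fun p => fderiv ℝ (fun q : ℝ × Phase => (q.2.2 i * μ q.2) * b q) p (0, dirV i) := fun i => by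
    have h1 := (hC i M b h).fderiv_apply hK (0, dirV i)
    have h2 : ‖((0 : ℝ), dirV i)‖ = 1 := by simp [Prod.norm_def (x := ((0 : ℝ), dirV i)), norm_dirV]
    rwa [h2, one_mul] at h1
  have h3 := ((hi 0).add (hi 1)).add (hi 2)
  have h4 : velDiv μ b = fun p => fderiv ℝ (fun q : ℝ × Phase => (q.2.2 0 * μ q.2) * b q) p
      (0, dirV 0) + fderiv ℝ (fun q : ℝ × Phase => (q.2.2 1 * μ q.2) * b q) p (0, dirV 1) +
      fderiv ℝ (fun q : ℝ × Phase => (q.2.2 2 * μ q.2) * b q) p (0, dirV 2) := by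
    funext p
    rw [velDiv, Fin.sum_univ_three]
  rw [h4, add_mul, add_mul]
  exact h3

section Evaluate

variable {ν : Phase → ℝ} {s : ℝ}

theorem contDiff_clock (hν : ContDiff ℝ ∞ ν) (s : ℝ) (n : ℕ) :
    ContDiff ℝ n fun z : Phase => (-(s * ν z), z) := by
  have := hν.of_le (m := n) (by exact_mod_cast le_top)
  fun_prop

theorem fderiv_comp_clock (hν : ContDiff ℝ ∞ ν) {c : ℝ × Phase → ℝ} (hc : ContDiff ℝ 1 c)
    (z w : Phase) : fderiv ℝ (fun z => c (-(s * ν z), z)) z w =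
      fderiv ℝ c (-(s * ν z), z) (0, w) - s * fderiv ℝ ν z w * angDeriv c (-(s * ν z), z) := by
  have h1 : HasFDerivAt ν (fderiv ℝ ν z) z :=
    (hν.differentiable (by simp) z).hasFDerivAt
  have h2 : HasFDerivAt (fun z => (-(s * ν z), z))
      ((-(s • fderiv ℝ ν z)).prod (ContinuousLinearMap.id ℝ Phase)) z :=
    ((h1.const_mul s).neg).prodMk (hasFDerivAt_id z)
  have h3 : HasFDerivAt c (fderiv ℝ c (-(s * ν z), z)) (-(s * ν z), z) :=
    (hc.differentiable (by simp) _).hasFDerivAt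
  have h4 : HasFDerivAt (c ∘ fun z => (-(s * ν z), z)) _ z := HasFDerivAt.comp (f := fun z => (-(s * ν z), z)) z h3 h2
  have h5 : (fun z => c (-(s * ν z), z)) = c ∘ fun z => (-(s * ν z), z) := rfl
  rw [h5, h4.fderiv, angDeriv]
  simp only [ContinuousLinearMap.comp_apply, ContinuousLinearMap.prod_apply,
    ContinuousLinearMap.id_apply, neg_apply, smul_apply,
    smul_eq_mul]
  have h6 : ((-(s * fderiv ℝ ν z w), w) : ℝ × Phase) =
      (0, w) - (s * fderiv ℝ ν z w) • ((1, 0) : ℝ × Phase) := by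
    simp
  rw [h6, map_sub, map_smul, smul_eq_mul]

theorem contDiff_eval (hν : ContDiff ℝ ∞ ν) (h : ContDiff ℝ n b) (s : ℝ) :
    ContDiff ℝ n fun z => b (-(s * ν z), z) := h.comp (contDiff_clock hν s n)

theorem IsOsc.eval_eq_zero (h : IsOsc K n M b) {z : Phase} (hz : z ∉ K) :
    b (-(s * ν z), z) = 0 := h.support _ hz

theorem contDiff_velAvg (hK : IsCompact K) (hν : ContDiff ℝ ∞ ν) (h : IsOsc K n M b) (s : ℝ) :
    ContDiff ℝ n (velAvg ν b s) :=
  contDiff_integral_velocity hK (fun _ hz => h.eval_eq_zero hz) (contDiff_eval hν h.contDiff s)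

theorem integrable_eval (hK : IsCompact K) (hν : ContDiff ℝ ∞ ν) (h : IsOsc K n M b) (s : ℝ)
    (x : E3) : Integrable fun v : E3 => b (-(s * ν (x, v)), (x, v)) :=
  integrable_velocity (G := fun z => b (-(s * ν z), z)) hK (fun _ hz => h.eval_eq_zero hz)
    (contDiff_eval hν h.contDiff s).continuous x

theorem exists_abs_velAvg_le (hK : IsCompact K) (ν : Phase → ℝ) : ∃ C : ℝ, 0 ≤ C ∧
    ∀ n M b, IsOsc K n M b → ∀ s x, |velAvg ν b s x| ≤ C * M := by
  refine ⟨volume.real (Prod.snd '' K), measureReal_nonneg, fun n M b h s x => ?_⟩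
  have h1 := setIntegral_eq_integral_velocity (G := fun z => b (-(s * ν z), z)) (K := K)
    (fun _ hz => h.eval_eq_zero hz) x
  rw [velAvg, ← h1, mul_comm]
  have hk : volume (Prod.snd '' K) < ⊤ := (hK.image continuous_snd).measure_lt_top
  exact norm_setIntegral_le_of_norm_le_const (f := fun v : E3 => b (-(s * ν (x, v)), (x, v)))
    (C := M) hk fun v _ => h.abs_le _

theorem velAvg_eq_zero (h : IsOsc K n M b) {x : E3} (hx : x ∉ Prod.fst '' K) :
    velAvg ν b s x = 0 := by
  have : ∀ v : E3, b (-(s * ν (x, v)), (x, v)) = 0 := fun v =>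
    h.support _ fun hv => hx ⟨_, hv, rfl⟩
  simp [velAvg, this]

theorem sum_smul_dirV (w : E3) : ∑ i, w i • dirV i = ((0, w) : Phase) := by
  refine Prod.ext ?_ ?_
  · simp [dirV, Prod.fst_sum]
  · rw [Prod.snd_sum]
    ext j
    fin_cases j <;> simp [dirV, basisE3, Fin.sum_univ_three]

end Evaluate

end

section

open Filter Topology

/-! ### The antiderivative in the angle -/

/-- For a `2π`-periodic function, the antiderivative of zero mean in the angle, up to a function
independent of the angle. -/
def angAnti {W : Type} [NormedAddCommGroup W] [NormedSpace ℝ W] (b : ℝ × Phase → W)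
    (p : ℝ × Phase) : W :=
  ∫ τ in Icc 0 (2 * Real.pi), (τ / (2 * Real.pi)) • b (p.1 + τ, p.2)

section Antiderivative

variable {W : Type} [NormedAddCommGroup W] [NormedSpace ℝ W]

theorem contDiff_angAnti_integrand {n : ℕ} {b : ℝ × Phase → W} (hb : ContDiff ℝ n b) :
    ContDiff ℝ n fun q : (ℝ × Phase) × ℝ =>
      (q.2 / (2 * Real.pi)) • b (q.1.1 + q.2, q.1.2) := by
  fun_prop

theorem contDiff_angAnti [CompleteSpace W] {n : ℕ} {b : ℝ × Phase → W} (hb : ContDiff ℝ n b) :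
    ContDiff ℝ n (angAnti b) :=
  contDiff_setIntegral (μ := (volume : Measure ℝ)) isCompact_Icc n (contDiff_angAnti_integrand hb)

theorem fderiv_angAnti [CompleteSpace W] {b : ℝ × Phase → W} (hb : ContDiff ℝ 1 b) :
    fderiv ℝ (angAnti b) = angAnti (fderiv ℝ b) := by
  funext p
  have hF := contDiff_angAnti_integrand (n := 1) (by exact_mod_cast hb)
  have h := (hasFDerivAt_setIntegral (μ := (volume : Measure ℝ)) (k := Icc 0 (2 * Real.pi))
    (by exact_mod_cast hF) isCompact_Icc p).fderiv
  refine h.trans ?_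
  rw [angAnti]
  congr 1
  funext τ
  have h1 : HasFDerivAt (fun q : ℝ × Phase => (q.1 + τ, q.2))
      (ContinuousLinearMap.id ℝ (ℝ × Phase)) p := by
    have := (hasFDerivAt_id (𝕜 := ℝ) p).add_const ((τ, 0) : ℝ × Phase)
    refine this.congr_of_eventuallyEq (Eventually.of_forall fun q => ?_)
    simp [Prod.ext_iff]
  have h2 : HasFDerivAt b (fderiv ℝ b (p.1 + τ, p.2)) (p.1 + τ, p.2) :=
    (hb.differentiable (by simp) _).hasFDerivAt
  have h3 := (HasFDerivAt.comp (f := fun q : ℝ × Phase => (q.1 + τ, q.2)) p h2 h1).const_smul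
    (τ / (2 * Real.pi))
  have h4 := HasFDerivAt.comp (f := fun q : ℝ × Phase => (q, τ)) p
    (hF.differentiable (by simp) (p, τ)).hasFDerivAt
    (hasFDerivAt_prodMk_left p τ)
  have h5 := h4.unique (h3.congr_of_eventuallyEq (Eventually.of_forall fun q => rfl))
  rw [h5]
  rfl

theorem norm_angAnti_le {b : ℝ × Phase → W} {M : ℝ} (hM : ∀ p, ‖b p‖ ≤ M) (p : ℝ × Phase) :
    ‖angAnti b p‖ ≤ 2 * Real.pi * M := by
  have h := norm_setIntegral_le_of_norm_le_const (μ := (volume : Measure ℝ))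
    (s := Icc 0 (2 * Real.pi)) (C := M) (f := fun τ => (τ / (2 * Real.pi)) • b (p.1 + τ, p.2))
    isCompact_Icc.measure_lt_top fun τ hτ => ?_
  · have hv : volume.real (Icc 0 (2 * Real.pi)) = 2 * Real.pi := by
      rw [Real.volume_real_Icc_of_le Real.two_pi_pos.le, sub_zero]
    rw [hv, mul_comm M] at h
    exact h
  · have hpi := Real.two_pi_pos
    rw [norm_smul, Real.norm_eq_abs, abs_of_nonneg (div_nonneg hτ.1 hpi.le)]
    have h1 : τ / (2 * Real.pi) ≤ 1 := (div_le_one hpi).2 hτ.2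
    exact (mul_le_of_le_one_left (norm_nonneg _) h1).trans (hM _)

end Antiderivative

theorem norm_iteratedFDeriv_angAnti_le (n : ℕ) :
    ∀ {W : Type} [NormedAddCommGroup W] [NormedSpace ℝ W] [CompleteSpace W]
      {b : ℝ × Phase → W} {M : ℝ}, ContDiff ℝ n b → (∀ p, ‖iteratedFDeriv ℝ n b p‖ ≤ M) →
      ∀ p, ‖iteratedFDeriv ℝ n (angAnti b) p‖ ≤ 2 * Real.pi * M := by
  induction n with
  | zero =>
    intro W _ _ _ b M _ hM p
    rw [norm_iteratedFDeriv_zero]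
    exact norm_angAnti_le (fun p => by simpa using hM p) p
  | succ n ih =>
    intro W _ _ _ b M hb hM p
    rw [← norm_iteratedFDeriv_fderiv, fderiv_angAnti (hb.of_le (by norm_cast; omega))]
    exact ih (hb.fderiv_right (m := n) (by norm_cast))
      (fun p => by rw [norm_iteratedFDeriv_fderiv]; exact hM p) p

variable {K : Set Phase} {n : ℕ} {M : ℝ} {b : ℝ × Phase → ℝ}

theorem IsOsc.angAnti (h : IsOsc K n M b) : IsOsc K n (2 * Real.pi * M) (angAnti b) where
  contDiff := contDiff_angAnti h.contDiff
  support := fun p hp => by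
    have : ∀ τ : ℝ, b (p.1 + τ, p.2) = 0 := fun τ => h.support _ hp
    simp [KeplerVlasov.angAnti, this]
  bound := fun j hj p => norm_iteratedFDeriv_angAnti_le j
    (h.contDiff.of_le (by exact_mod_cast hj)) (h.bound j hj) p
  periodic := fun θ z => by
    have : ∀ τ : ℝ, b (θ + 2 * Real.pi + τ, z) = b (θ + τ, z) := fun τ => by
      rw [add_right_comm, h.periodic]
    simp [KeplerVlasov.angAnti, this]

theorem angDeriv_angAnti (hb : ContDiff ℝ 1 b) : angDeriv (angAnti b) = angAnti (angDeriv b) := by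
  funext p
  rw [angDeriv, fderiv_angAnti hb, angAnti, ContinuousLinearMap.integral_apply]
  · rfl
  · refine Continuous.integrableOn_Icc ?_
    have := hb.continuous_fderiv (by simp)
    fun_prop

theorem IsOsc.angDeriv (hK : IsClosed K) (h : IsOsc K (n + 1) M b) : IsOsc K n M (angDeriv b) := by
  have h1 := h.fderiv_apply hK ((1 : ℝ), (0 : Phase))
  have h2 : ‖((1 : ℝ), (0 : Phase))‖ = 1 := by simp [Prod.norm_def]
  rwa [h2, one_mul] at h1

theorem hasDerivAt_angle (hb : ContDiff ℝ 1 b) (θ : ℝ) (z : Phase) (τ : ℝ) :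
    HasDerivAt (fun τ => b (θ + τ, z)) (angDeriv b (θ + τ, z)) τ := by
  have h1 : HasFDerivAt b (fderiv ℝ b (θ + τ, z)) (θ + τ, z) :=
    (hb.differentiable (by simp) _).hasFDerivAt
  have h2 : HasDerivAt (fun τ : ℝ => (θ + τ, z)) ((1 : ℝ), (0 : Phase)) τ :=
    ((hasDerivAt_id τ).const_add θ).prodMk (hasDerivAt_const τ z)
  exact h1.comp_hasDerivAt τ h2

theorem angDeriv_angDeriv_angAnti (hK : IsClosed K) (h : IsOsc K 2 M b) :
    angDeriv (angDeriv (angAnti b)) = angDeriv b := by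
  have h1 : IsOsc K 1 M (angDeriv b) := h.angDeriv hK
  rw [angDeriv_angAnti (h.contDiff.of_le (by norm_cast)), angDeriv_angAnti h1.contDiff]
  funext ⟨θ, z⟩
  have hpi := Real.two_pi_pos
  have hd := hasDerivAt_angle h1.contDiff θ z
  have hd0 := hasDerivAt_angle (h.contDiff.of_le (by norm_cast)) θ z
  have hc : Continuous (angDeriv (angDeriv b)) := (h1.angDeriv (n := 0) hK).contDiff.continuous
  have hc1 : Continuous (angDeriv b) := h1.contDiff.continuous
  have e : angAnti (angDeriv (angDeriv b)) (θ, z) =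
      ∫ τ in (0 : ℝ)..2 * Real.pi, (τ / (2 * Real.pi)) * angDeriv (angDeriv b) (θ + τ, z) := by
    rw [intervalIntegral.integral_of_le hpi.le, ← integral_Icc_eq_integral_Ioc]
    rfl
  have hint := intervalIntegral.integral_mul_deriv_eq_deriv_mul
    (a := 0) (b := 2 * Real.pi) (u := fun τ : ℝ => τ / (2 * Real.pi))
    (u' := fun _ => 1 / (2 * Real.pi)) (v := fun τ => angDeriv b (θ + τ, z))
    (v' := fun τ => angDeriv (angDeriv b) (θ + τ, z))
    (fun τ _ => (hasDerivAt_id τ).div_const _) (fun τ _ => hd τ)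
    intervalIntegrable_const (Continuous.intervalIntegrable (by fun_prop) _ _)
  have hint2 : ∫ τ in (0 : ℝ)..2 * Real.pi, angDeriv b (θ + τ, z) = 0 := by
    rw [intervalIntegral.integral_eq_sub_of_hasDerivAt (fun τ _ => hd0 τ)
      (Continuous.intervalIntegrable (by fun_prop) _ _), h.periodic, add_zero, sub_self]
  rw [e, hint, intervalIntegral.integral_const_mul, hint2, h1.periodic]
  field_simp
  ring

/-! ### Gain of powers of the time -/

theorem velDiv_angDeriv {μ : Phase → ℝ} (hμ : ContDiff ℝ ∞ μ) (hb : ContDiff ℝ 2 b) :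
    velDiv μ (angDeriv b) = angDeriv (velDiv μ b) := by
  have hb1 : ContDiff ℝ 1 b := hb.of_le (by norm_cast)
  have hc : ∀ i : Fin 3, ContDiff ℝ 2 fun q : ℝ × Phase => (q.2.2 i * μ q.2) * b q := fun i => by
    have : ContDiff ℝ 2 μ := contDiff_infty.1 hμ 2
    fun_prop
  have hm : ∀ i : Fin 3, ContDiff ℝ 1 fun q : ℝ × Phase => q.2.2 i * μ q.2 := fun i => by
    have := hμ.of_le (m := 1) (by exact_mod_cast le_top)
    fun_prop
  have key : ∀ i : Fin 3, (fun q : ℝ × Phase => (q.2.2 i * μ q.2) * angDeriv b q) =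
      fun q => fderiv ℝ (fun q : ℝ × Phase => (q.2.2 i * μ q.2) * b q) q (1, 0) := fun i => by
    funext q
    have h1 : HasFDerivAt b (fderiv ℝ b q) q := (hb1.differentiable (by simp) q).hasFDerivAt
    have h2 : HasFDerivAt (fun q : ℝ × Phase => q.2.2 i * μ q.2)
      (fderiv ℝ (fun q : ℝ × Phase => q.2.2 i * μ q.2) q) q :=
      ((hm i).differentiable (by simp) q).hasFDerivAt
    rw [(h2.fun_mul h1).fderiv]
    have h3 : fderiv ℝ (fun q : ℝ × Phase => q.2.2 i * μ q.2) q (1, 0) = 0 := by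
      have hμ1 : ContDiff ℝ 1 fun z : Phase => z.2 i * μ z := by
        have := hμ.of_le (m := 1) (by exact_mod_cast le_top)
        fun_prop
      have h4 : HasFDerivAt (fun q : ℝ × Phase => q.2.2 i * μ q.2)
          ((fderiv ℝ (fun z : Phase => z.2 i * μ z) q.2).comp
            (ContinuousLinearMap.snd ℝ ℝ Phase)) q :=
        HasFDerivAt.comp (g := fun z : Phase => z.2 i * μ z) q
          (hμ1.differentiable (by simp) q.2).hasFDerivAt hasFDerivAt_snd
      rw [h4.fderiv]
      simp
    simp [h3, angDeriv]
  funext p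
  rw [angDeriv]
  have hsum : HasFDerivAt (velDiv μ b) (∑ i, fderiv ℝ (fun p => fderiv ℝ
      (fun q : ℝ × Phase => (q.2.2 i * μ q.2) * b q) p (0, dirV i)) p) p := by
    refine HasFDerivAt.fun_sum fun i _ => DifferentiableAt.hasFDerivAt ?_
    exact (((hc i).fderiv_right (m := 1) (by norm_cast)).clm_apply
      contDiff_const).differentiable (by simp) p
  rw [hsum.fderiv, sum_apply, velDiv]
  refine Finset.sum_congr rfl fun i _ => ?_
  rw [key i]
  have hd : DifferentiableAt ℝ (fderiv ℝ fun q : ℝ × Phase => (q.2.2 i * μ q.2) * b q) p :=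
    ((hc i).fderiv_right (m := 1) (by norm_cast)).differentiable (by simp) p
  have hs : IsSymmSndFDerivAt ℝ (fun q : ℝ × Phase => (q.2.2 i * μ q.2) * b q) p :=
    (hc i).contDiffAt.isSymmSndFDerivAt (by simp)
  rw [fderiv_clm_apply hd (differentiableAt_const _), fderiv_clm_apply hd (differentiableAt_const _)]
  simpa using hs (0, dirV i) (1, 0)

/-- A smooth frequency `ν` which, over the compact set `K`, is strictly monotone along the
dilations of the velocity, with the inverse `μ` of its derivative. -/
structure IsClock (K : Set Phase) (ν μ : Phase → ℝ) : Prop where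
  compact : IsCompact K
  smooth : ContDiff ℝ ∞ ν
  support : HasCompactSupport ν
  smooth_inv : ContDiff ℝ ∞ μ
  support_inv : HasCompactSupport μ
  mul_eq_one : ∀ z ∈ K, μ z * fderiv ℝ ν z (0, z.2) = 1

section Clock

variable {ν μ : Phase → ℝ}

theorem IsClock.velAvg_velDiv (hc : IsClock K ν μ) (h : IsOsc K 1 M b) (s : ℝ) (x : E3) :
    velAvg ν (velDiv μ b) s x = s * velAvg ν (angDeriv b) s x := by
  have hK := hc.compact
  have hb : ContDiff ℝ 1 b := h.contDiff
  have hμ1 := hc.smooth_inv.of_le (m := 1) (by exact_mod_cast le_top)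
  have hci : ∀ i : Fin 3, ContDiff ℝ 1 fun q : ℝ × Phase => (q.2.2 i * μ q.2) * b q := fun i => by
    fun_prop
  have hG : ∀ i : Fin 3, ContDiff ℝ 1 fun z : Phase => (z.2 i * μ z) * b (-(s * ν z), z) :=
    fun i => (hci i).comp (contDiff_clock hc.smooth s 1)
  have hG0 : ∀ i : Fin 3, ∀ z ∉ K, (z.2 i * μ z) * b (-(s * ν z), z) = 0 := fun i z hz => by
    rw [h.support _ hz, mul_zero]
  have hint := fun i => integral_fderiv_velocity hK (hG0 i) (hG i) x (basisE3 i)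
  have hintg : ∀ i : Fin 3, Integrable fun v : E3 =>
      fderiv ℝ (fun z : Phase => (z.2 i * μ z) * b (-(s * ν z), z)) (x, v) (0, basisE3 i) :=
    fun i => integrable_velocity
      (G := fun z => fderiv ℝ (fun z : Phase => (z.2 i * μ z) * b (-(s * ν z), z)) z
        (0, basisE3 i)) hK
      (fun z hz => by rw [fderiv_eq_zero_of_notMem hK.isClosed (hG0 i) hz]; rfl)
      (((hG i).continuous_fderiv (by simp)).clm_apply continuous_const) x
  have hsum : ∀ v : E3, ∑ i, fderiv ℝ (fun z : Phase => (z.2 i * μ z) * b (-(s * ν z), z)) (x, v)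
      (0, basisE3 i) = velDiv μ b (-(s * ν (x, v)), (x, v)) -
        s * angDeriv b (-(s * ν (x, v)), (x, v)) := by
    intro v
    have hang : ∀ (i : Fin 3) (q : ℝ × Phase), angDeriv
        (fun q : ℝ × Phase => (q.2.2 i * μ q.2) * b q) q = (q.2.2 i * μ q.2) * angDeriv b q := by
      intro i q
      have h1 := hasDerivAt_angle (hci i) 0 q.2 q.1
      have h2 := (hasDerivAt_angle hb 0 q.2 q.1).const_mul (q.2.2 i * μ q.2)
      simpa using h1.unique h2
    have h1 : ∀ i : Fin 3, fderiv ℝ (fun z : Phase => (z.2 i * μ z) * b (-(s * ν z), z)) (x, v)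
      (0, basisE3 i) = fderiv ℝ (fun q : ℝ × Phase => (q.2.2 i * μ q.2) * b q)
        (-(s * ν (x, v)), (x, v)) (0, dirV i) - s * fderiv ℝ ν (x, v) (dirV i) *
          ((v i * μ (x, v)) * angDeriv b (-(s * ν (x, v)), (x, v))) := fun i => by
      have := fderiv_comp_clock (s := s) hc.smooth (hci i) (x, v) (dirV i)
      rw [hang] at this
      exact this
    rw [Finset.sum_congr rfl fun i _ => h1 i, Finset.sum_sub_distrib]
    rw [velDiv]
    congr 1
    by_cases hz : (x, v) ∈ K
    · have h2 := hc.mul_eq_one _ hz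
      rw [← sum_smul_dirV, map_sum] at h2
      simp only [map_smul, smul_eq_mul, Fin.sum_univ_three] at h2 ⊢
      linear_combination (s * angDeriv b (-(s * ν (x, v)), (x, v))) * h2
    · have h3 : angDeriv b (-(s * ν (x, v)), (x, v)) = 0 :=
        (h.angDeriv (n := 0) hK.isClosed).support _ hz
      simp [h3]
  have h4 : ∫ v : E3, ∑ i, fderiv ℝ (fun z : Phase => (z.2 i * μ z) * b (-(s * ν z), z)) (x, v)
      (0, basisE3 i) = 0 := by
    rw [integral_finsetSum _ fun i _ => hintg i]
    exact Finset.sum_eq_zero fun i _ => hint i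
  obtain ⟨C, -, hC⟩ := exists_isOsc_velDiv hK.isClosed 0 hc.smooth_inv hc.support_inv
  have i1 := integrable_eval hK hc.smooth (hC M b h) s x
  have i2 := integrable_eval hK hc.smooth (h.angDeriv (n := 0) hK.isClosed) s x
  rw [integral_congr_ae (Eventually.of_forall hsum), integral_sub i1 (i2.const_mul s),
    integral_const_mul] at h4
  exact sub_eq_zero.1 h4

theorem IsClock.exists_fderiv_velAvg (hc : IsClock K ν μ) (n : ℕ) (w : E3) :
    ∃ C : ℝ, 0 ≤ C ∧ ∀ M b, IsOsc K (n + 1) M b → ∃ b', IsOsc K n (C * M) b' ∧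
      ∀ s, (fun x => fderiv ℝ (velAvg ν b s) x w) = velAvg ν b' s := by
  have hK := hc.compact
  have hdν : ContDiff ℝ ∞ fun z => fderiv ℝ ν z (w, 0) :=
    (hc.smooth.fderiv_right (m := ∞) (by simp)).clm_apply contDiff_const
  obtain ⟨C₁, h01, hC₁⟩ := exists_isOsc_mul K (n + 1) hdν (hc.support.fderiv_apply ℝ (w, 0))
  obtain ⟨C₂, h02, hC₂⟩ := exists_isOsc_velDiv hK.isClosed n hc.smooth_inv hc.support_inv
  refine ⟨‖((0 : ℝ), ((w, 0) : Phase))‖ + C₂ * C₁, by positivity, fun M b h => ?_⟩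
  have h1 := hC₁ M b h
  have h2 := hC₂ _ _ h1
  have h3 := h.fderiv_apply hK.isClosed (0, (w, 0))
  refine ⟨_, (h3.sub h2).mono (le_of_eq (by ring)), fun s => ?_⟩
  have h1' := h1.of_le (m := 1) (by omega)
  have hb : ContDiff ℝ 1 b := h.contDiff.of_le (by norm_cast; omega)
  funext x
  have e1 : fderiv ℝ (velAvg ν b s) x w = _ :=
    fderiv_integral_velocity (G := fun z => b (-(s * ν z), z)) hK (fun _ hz => h.eval_eq_zero hz)
      ((contDiff_eval hc.smooth hb s)) x w
  have hang : ∀ q : ℝ × Phase, angDeriv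
      (fun q : ℝ × Phase => fderiv ℝ ν q.2 (w, 0) * b q) q =
        fderiv ℝ ν q.2 (w, 0) * angDeriv b q := by
    intro q
    have h1 := hasDerivAt_angle h1'.contDiff 0 q.2 q.1
    have h2 := (hasDerivAt_angle hb 0 q.2 q.1).const_mul (fderiv ℝ ν q.2 (w, 0))
    simpa using h1.unique h2
  have e2 : ∀ v : E3, fderiv ℝ (fun z => b (-(s * ν z), z)) (x, v) (w, 0) =
      fderiv ℝ b (-(s * ν (x, v)), (x, v)) (0, (w, 0)) -
        s * angDeriv (fun q : ℝ × Phase => fderiv ℝ ν q.2 (w, 0) * b q)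
          (-(s * ν (x, v)), (x, v)) := fun v => by
    rw [fderiv_comp_clock hc.smooth hb, hang, mul_assoc]
  have i1 := integrable_eval hK hc.smooth h3 s x
  have i2 := integrable_eval hK hc.smooth (h1'.angDeriv (n := 0) hK.isClosed) s x
  have i3 := integrable_eval hK hc.smooth h2 s x
  have e3 := hc.velAvg_velDiv h1' s x
  rw [e1, integral_congr_ae (Eventually.of_forall e2), integral_sub i1 (i2.const_mul s),
    integral_const_mul]
  rw [velAvg, velAvg] at e3
  rw [← e3, ← integral_sub i1 i3]
  rfl

theorem IsClock.exists_dlist_velAvg (hc : IsClock K ν μ) (l : List E3) : ∀ n : ℕ,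
    ∃ C : ℝ, 0 ≤ C ∧ ∀ M b, IsOsc K (n + l.length) M b → ∃ b', IsOsc K n (C * M) b' ∧
      ∀ s, dlist l (velAvg ν b s) = velAvg ν b' s := by
  induction l with
  | nil => exact fun n => ⟨1, zero_le_one, fun M b h => ⟨b, by simpa using h, fun s => rfl⟩⟩
  | cons w l ih =>
    intro n
    obtain ⟨C₁, h01, hC₁⟩ := ih (n + 1)
    obtain ⟨C₂, h02, hC₂⟩ := hc.exists_fderiv_velAvg n w
    refine ⟨C₂ * C₁, by positivity, fun M b h => ?_⟩
    obtain ⟨b₁, hb₁, e₁⟩ := hC₁ M b (by convert h using 1; simp; omega)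
    obtain ⟨b₂, hb₂, e₂⟩ := hC₂ _ b₁ hb₁
    refine ⟨b₂, by rwa [mul_assoc], fun s => ?_⟩
    rw [dlist_cons, e₁, e₂]

theorem IsClock.exists_mul_velAvg (hc : IsClock K ν μ) (n : ℕ) :
    ∃ C : ℝ, 0 ≤ C ∧ ∀ M c, IsOsc K (n + 2) M c → ∃ c', IsOsc K (n + 1) (C * M) c' ∧
      ∀ s x, s * velAvg ν (angDeriv c) s x = velAvg ν (angDeriv c') s x := by
  have hK := hc.compact
  obtain ⟨C, h0, hC⟩ := exists_isOsc_velDiv hK.isClosed (n + 1) hc.smooth_inv hc.support_inv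
  refine ⟨C * (2 * Real.pi), by positivity, fun M c h => ?_⟩
  have h1 := h.angAnti
  refine ⟨velDiv μ (angAnti c), by rw [mul_assoc]; exact hC _ _ h1, fun s x => ?_⟩
  rw [← velDiv_angDeriv hc.smooth_inv (h1.contDiff.of_le (by norm_cast; omega)),
    hc.velAvg_velDiv ((h1.angDeriv hK.isClosed).of_le (m := 1) (by omega)),
    angDeriv_angDeriv_angAnti hK.isClosed (h.of_le (by omega))]

theorem IsClock.exists_pow_mul_velAvg (hc : IsClock K ν μ) (n k : ℕ) :
    ∃ C : ℝ, 0 ≤ C ∧ ∀ M c, IsOsc K (n + (k + 1)) M c → ∃ b, IsOsc K n (C * M) b ∧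
      ∀ s x, s ^ (k + 1) * velAvg ν (angDeriv c) s x = velAvg ν b s x := by
  induction k with
  | zero =>
    obtain ⟨C, h0, hC⟩ := exists_isOsc_velDiv hc.compact.isClosed n hc.smooth_inv hc.support_inv
    refine ⟨C, h0, fun M c h => ⟨_, hC M c h, fun s x => ?_⟩⟩
    rw [zero_add, pow_one, hc.velAvg_velDiv (h.of_le (by omega))]
  | succ k ih =>
    obtain ⟨C₁, h01, hC₁⟩ := hc.exists_mul_velAvg (n + k)
    obtain ⟨C₂, h02, hC₂⟩ := ih
    refine ⟨C₂ * C₁, by positivity, fun M c h => ?_⟩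
    obtain ⟨c', hc', e'⟩ := hC₁ M c h
    obtain ⟨b, hb, e⟩ := hC₂ _ c' hc'
    refine ⟨b, by rwa [mul_assoc], fun s x => ?_⟩
    rw [← e, ← e', pow_succ]
    ring

end Clock

theorem bracket_pos (s : ℝ) : 0 < bracket s := Real.sqrt_pos.2 (by positivity)

theorem one_le_bracket (s : ℝ) : 1 ≤ bracket s := Real.one_le_sqrt.2 (by nlinarith [sq_nonneg s])

theorem abs_le_bracket (s : ℝ) : |s| ≤ bracket s := by
  rw [← Real.sqrt_sq_eq_abs]
  exact Real.sqrt_le_sqrt (by linarith)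

theorem bracket_le (s : ℝ) : bracket s ≤ 1 + |s| := by
  rw [bracket, Real.sqrt_le_left (by positivity)]
  nlinarith [sq_abs s, abs_nonneg s]

theorem bracket_pow_le (s : ℝ) (k : ℕ) : bracket s ^ k ≤ 2 ^ k * (1 + |s| ^ k) := by
  have h0 := abs_nonneg s
  refine (pow_le_pow_left₀ (bracket_pos s).le (bracket_le s) k).trans ?_
  rcases le_total |s| 1 with h | h
  · calc (1 + |s|) ^ k ≤ 2 ^ k := pow_le_pow_left₀ (by positivity) (by linarith) k
      _ ≤ _ := le_mul_of_one_le_right (by positivity) (by simp [pow_nonneg h0])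
  · calc (1 + |s|) ^ k ≤ (2 * |s|) ^ k := pow_le_pow_left₀ (by positivity) (by linarith) k
      _ = 2 ^ k * |s| ^ k := mul_pow _ _ _
      _ ≤ _ := mul_le_mul_of_nonneg_left (by linarith) (by positivity)

theorem IsClock.exists_abs_dlist_velAvg_le {ν μ : Phase → ℝ} (hc : IsClock K ν μ) (N : ℕ)
    (l : List E3) (hl : l.length + 1 ≤ N) :
    ∃ C : ℝ, 0 ≤ C ∧ ∀ M c, IsOsc K N M c → ∀ s x,
      |dlist l (velAvg ν (angDeriv c) s) x| ≤ C * M * bracket s ^ (-((N : ℤ) - l.length)) := by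
  obtain ⟨k, rfl⟩ : ∃ k, N = l.length + (k + 1) := ⟨N - l.length - 1, by omega⟩
  have hK := hc.compact
  obtain ⟨B, hB0, hB⟩ := exists_abs_velAvg_le hK ν
  obtain ⟨C₁, h01, hC₁⟩ := hc.exists_dlist_velAvg l 0
  obtain ⟨C₂, h02, hC₂⟩ := hc.exists_pow_mul_velAvg l.length k
  refine ⟨2 ^ (k + 1) * (B * C₁ + B * C₁ * C₂), by positivity, fun M c h s x => ?_⟩
  have hM := h.nonneg
  have hd : IsOsc K (0 + l.length) M (angDeriv c) := by
    rw [zero_add]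
    exact (IsOsc.angDeriv (n := l.length + k) hK.isClosed h).of_le (by omega)
  obtain ⟨b₁, hb₁, e₁⟩ := hC₁ _ _ hd
  obtain ⟨b₂, hb₂, e₂⟩ := hC₂ _ _ h
  obtain ⟨b₃, hb₃, e₃⟩ := hC₁ _ _ ((zero_add l.length).symm ▸ hb₂)
  have hpow : s ^ (k + 1) * dlist l (velAvg ν (angDeriv c) s) x = velAvg ν b₃ s x := by
    rw [← e₃ s]
    have e : velAvg ν b₂ s = fun x => s ^ (k + 1) * velAvg ν (angDeriv c) s x := by
      funext x
      exact (e₂ s x).symm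
    have hcd : ContDiff ℝ l.length (velAvg ν (angDeriv c) s) := by
      have := contDiff_velAvg hK hc.smooth hd s
      simpa using this
    rw [e, dlist_eq_iteratedFDeriv l hcd.contDiffAt,
      dlist_eq_iteratedFDeriv l (contDiffAt_const.mul hcd.contDiffAt)]
    have e' : (fun x => s ^ (k + 1) * velAvg ν (angDeriv c) s x) =
      s ^ (k + 1) • velAvg ν (angDeriv c) s := rfl
    rw [e', iteratedFDeriv_const_smul_apply hcd.contDiffAt]
    rfl
  have b1 : |dlist l (velAvg ν (angDeriv c) s) x| ≤ B * C₁ * M := by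
    rw [e₁ s, mul_assoc]
    exact hB _ _ _ hb₁ s x
  have b2 : |s| ^ (k + 1) * |dlist l (velAvg ν (angDeriv c) s) x| ≤ B * C₁ * C₂ * M := by
    rw [← abs_pow, ← abs_mul, hpow]
    refine (hB _ _ _ hb₃ s x).trans (le_of_eq (by ring))
  have e4 : (-(((l.length + (k + 1) : ℕ) : ℤ) - l.length)) = -((k + 1 : ℕ) : ℤ) := by
    push_cast
    ring
  rw [e4, zpow_neg, zpow_natCast, ← div_eq_mul_inv, le_div_iff₀ (pow_pos (bracket_pos s) _)]
  calc |dlist l (velAvg ν (angDeriv c) s) x| * bracket s ^ (k + 1)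
      ≤ |dlist l (velAvg ν (angDeriv c) s) x| * (2 ^ (k + 1) * (1 + |s| ^ (k + 1))) :=
        mul_le_mul_of_nonneg_left (bracket_pow_le s _) (abs_nonneg _)
    _ = 2 ^ (k + 1) * (|dlist l (velAvg ν (angDeriv c) s) x| +
        |s| ^ (k + 1) * |dlist l (velAvg ν (angDeriv c) s) x|) := by ring
    _ ≤ 2 ^ (k + 1) * (B * C₁ * M + B * C₁ * C₂ * M) := by gcongr
    _ = _ := by ring

end

section

open Filter Topology

/-! ### Characteristics -/

/-- The Hamiltonian vector field of the Kepler problem. -/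
def keplerField (z : Phase) : Phase := (z.2, -((1 / ‖z.1‖ ^ 3) • z.1))

theorem hasFDerivAt_keplerPotential {x : E3} (hx : x ≠ 0) :
    HasFDerivAt keplerPotential ((1 / ‖x‖ ^ 3) • innerSL ℝ x) x := by
  have hr : ‖x‖ ≠ 0 := norm_ne_zero_iff.2 hx
  have h1 : HasFDerivAt (fun x : E3 => ‖x‖ ^ 2) (2 • innerSL ℝ x) x :=
    (hasStrictFDerivAt_norm_sq x).hasFDerivAt
  have h2 := h1.sqrt (pow_ne_zero 2 hr)
  simp only [Real.sqrt_sq (norm_nonneg _)] at h2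
  have h3 : HasDerivAt (fun t : ℝ => -1 / t) (1 / ‖x‖ ^ 2) ‖x‖ := by
    have := (hasDerivAt_inv hr).const_mul (-1)
    refine (this.congr_deriv (by field_simp)).congr_of_eventuallyEq
      (Eventually.of_forall fun t => ?_)
    simp [div_eq_mul_inv]
  have h4 := h3.comp_hasFDerivAt x h2
  refine h4.congr_fderiv ?_
  ext w
  simp only [smul_apply, nsmul_eq_mul, smul_eq_mul, innerSL_apply_apply]
  field_simp
  simp

theorem fderiv_keplerPotential {x : E3} (hx : x ≠ 0) (w : E3) :
    fderiv ℝ keplerPotential x w = inner ℝ x w / ‖x‖ ^ 3 := by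
  rw [(hasFDerivAt_keplerPotential hx).fderiv]
  simp
  ring

theorem hasFDerivAt_energy {z : Phase} (hz : z.1 ≠ 0) :
    HasFDerivAt energy ((innerSL ℝ z.2).comp (ContinuousLinearMap.snd ℝ E3 E3) +
      ((1 / ‖z.1‖ ^ 3) • innerSL ℝ z.1).comp (ContinuousLinearMap.fst ℝ E3 E3)) z := by
  have h1 : HasFDerivAt (fun x : E3 => ‖x‖ ^ 2) (2 • innerSL ℝ z.2) z.2 :=
    (hasStrictFDerivAt_norm_sq z.2).hasFDerivAt
  have h2 := (h1.comp (f := fun z : Phase => z.2) z hasFDerivAt_snd).const_mul (1 / 2)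
  have h3 := (hasFDerivAt_keplerPotential hz).comp (f := fun z : Phase => z.1) z hasFDerivAt_fst
  refine ((h2.add h3).congr_of_eventuallyEq (Eventually.of_forall fun w => ?_)).congr_fderiv ?_
  · simp [energy, keplerPotential]
    ring
  · ext w <;> simp

theorem hasDerivWithinAt_energy {γ : ℝ → Phase} {γ' : Phase} {I : Set ℝ} {τ : ℝ}
    (h : HasDerivWithinAt γ γ' I τ) (hx : (γ τ).1 ≠ 0) :
    HasDerivWithinAt (fun τ => energy (γ τ))
      (inner ℝ (γ τ).2 γ'.2 + inner ℝ (γ τ).1 γ'.1 / ‖(γ τ).1‖ ^ 3) I τ := by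
  have := (hasFDerivAt_energy hx).comp_hasDerivWithinAt τ h
  refine this.congr_deriv ?_
  simp
  ring

theorem hasDerivWithinAt_angMom {γ : ℝ → Phase} {I : Set ℝ} {τ : ℝ}
    (h : HasDerivWithinAt γ (keplerField (γ τ)) I τ) :
    HasDerivWithinAt (fun τ => angMom (γ τ)) 0 I τ := by
  have h1 : ∀ i, HasDerivWithinAt (fun τ => (γ τ).1 i) ((γ τ).2 i) I τ := fun i =>
    ((EuclideanSpace.proj (𝕜 := ℝ) i).comp (ContinuousLinearMap.fst ℝ E3 E3)).hasFDerivAt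
      |>.comp_hasDerivWithinAt τ h
  have h2 : ∀ i, HasDerivWithinAt (fun τ => (γ τ).2 i)
      (-((1 / ‖(γ τ).1‖ ^ 3) * (γ τ).1 i)) I τ := fun i =>
    ((EuclideanSpace.proj (𝕜 := ℝ) i).comp (ContinuousLinearMap.snd ℝ E3 E3)).hasFDerivAt
      |>.comp_hasDerivWithinAt τ h
  have h3 : ∀ i, HasDerivWithinAt (fun τ => angMom (γ τ) i) 0 I τ := by
    intro i
    fin_cases i
    · refine ((((h1 1).fun_mul (h2 2)).fun_sub ((h1 2).fun_mul (h2 1))).congr_deriv (by ring)).congr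
        (fun t _ => cross_zero _ _) (cross_zero _ _)
    · refine ((((h1 2).fun_mul (h2 0)).fun_sub ((h1 0).fun_mul (h2 2))).congr_deriv (by ring)).congr
        (fun t _ => cross_one _ _) (cross_one _ _)
    · refine ((((h1 0).fun_mul (h2 1)).fun_sub ((h1 1).fun_mul (h2 0))).congr_deriv (by ring)).congr
        (fun t _ => cross_two _ _) (cross_two _ _)
  exact hasFDerivWithinAt_euclidean.2 fun i => by
    refine (h3 i).hasFDerivWithinAt.congr_fderiv ?_
    ext
    simp

theorem IsClassicalSolution.hasDerivWithinAt {f : ℝ → Phase → ℝ} {g : Phase → ℝ}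
    (hf : IsClassicalSolution f g) {γ : ℝ → Phase} {I : Set ℝ} (hI : I ⊆ Ici 0) {τ : ℝ}
    (hτ : τ ∈ I) (hx : ∀ τ ∈ I, (γ τ).1 ≠ 0)
    (h : HasDerivWithinAt γ (keplerField (γ τ)) I τ) :
    HasDerivWithinAt (fun τ => f τ (γ τ)) 0 I τ := by
  set F : ℝ × Phase → ℝ := fun p => f p.1 p.2 with hF
  set S : Set (ℝ × Phase) := Ici 0 ×ˢ {z | z.1 ≠ 0} with hS
  have hτ0 : 0 ≤ τ := hI hτ
  set z := γ τ with hz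
  have hzx : z.1 ≠ 0 := hx τ hτ
  have hU : IsOpen {z : Phase | z.1 ≠ 0} := isOpen_ne_fun continuous_fst continuous_const
  have hd : HasFDerivWithinAt F (fderivWithin ℝ F S (τ, z)) S (τ, z) :=
    (hf.contDiffOn.differentiableOn (by simp) (τ, z) ⟨hτ0, hzx⟩).hasFDerivWithinAt
  have h1 : HasDerivWithinAt (fun τ => (τ, γ τ)) ((1 : ℝ), keplerField z) I τ :=
    (hasDerivWithinAt_id τ I).prodMk h
  have h2 := hd.comp_hasDerivWithinAt (f := fun τ => (τ, γ τ)) τ h1 fun t ht => ⟨hI ht, hx t ht⟩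
  refine h2.congr_deriv ?_
  have e1 : derivWithin (fun τ => f τ z) (Ici 0) τ = fderivWithin ℝ F S (τ, z) (1, 0) := by
    have h3 : HasDerivWithinAt (fun τ : ℝ => (τ, z)) ((1 : ℝ), (0 : Phase)) (Ici 0) τ :=
      (hasDerivWithinAt_id τ _).prodMk (hasDerivWithinAt_const τ _ z)
    have h4 := hd.comp_hasDerivWithinAt (f := fun τ => (τ, z)) τ h3 fun t ht => ⟨ht, hzx⟩
    exact h4.derivWithin (uniqueDiffOn_Ici 0 τ hτ0)
  have e2 : ∀ w, fderiv ℝ (f τ) z w = fderivWithin ℝ F S (τ, z) (0, w) := by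
    intro w
    have h4 := (hd.comp z (f := fun z : Phase => (τ, z)) (s := {z : Phase | z.1 ≠ 0})
      (hasFDerivAt_prodMk_right τ z).hasFDerivWithinAt fun w hw => ⟨hτ0, hw⟩).hasFDerivAt
        (hU.mem_nhds hzx)
    have h5 : fderiv ℝ (f τ) z = _ := h4.fderiv
    rw [h5]
    rfl
  have ht := hf.transport τ hτ0 z.1 z.2 hzx
  rw [Prod.mk.eta, e1] at ht
  simp only [e2, fderiv_keplerPotential hzx] at ht
  have e3 : ((1 : ℝ), keplerField z) = ((1 : ℝ), (0 : Phase)) +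
      ∑ i, z.2 i • ((0 : ℝ), dirX i) -
      ∑ i, (inner ℝ z.1 (basisE3 i) / ‖z.1‖ ^ 3) • ((0 : ℝ), dirV i) := by
    refine Prod.ext (by simp [Prod.fst_sum]) (Prod.ext ?_ ?_)
    · simp only [Prod.snd_add, Prod.snd_sub, Prod.snd_sum, Prod.fst_sum, Prod.fst_add, Prod.fst_sub]
      apply e3_ext <;> simp [keplerField, dirX, dirV, Fin.sum_univ_three, basisE3]
    · simp only [Prod.snd_add, Prod.snd_sub, Prod.snd_sum]
      apply e3_ext <;>
        simp [keplerField, dirX, dirV, Fin.sum_univ_three, basisE3, inner_eq] <;> ring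
  rw [e3, map_sub, map_add, map_sum, map_sum]
  simp only [map_smul, smul_eq_mul]
  exact ht

theorem IsClassicalSolution.eq_of_characteristic {f : ℝ → Phase → ℝ} {g : Phase → ℝ}
    (hf : IsClassicalSolution f g) {γ : ℝ → Phase} {a b : ℝ} (ha : 0 ≤ a) (hab : a ≤ b)
    (hx : ∀ τ ∈ Icc a b, (γ τ).1 ≠ 0)
    (h : ∀ τ ∈ Icc a b, HasDerivWithinAt γ (keplerField (γ τ)) (Icc a b) τ) :
    f b (γ b) = f a (γ a) := by
  have hd : ∀ τ ∈ Icc a b, HasDerivWithinAt (fun τ => f τ (γ τ)) 0 (Icc a b) τ := fun τ hτ =>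
    hf.hasDerivWithinAt (fun t ht => ha.trans ht.1) hτ hx (h τ hτ)
  rcases hab.eq_or_lt with rfl | hlt
  · rfl
  exact constant_of_derivWithin_zero (fun τ hτ => (hd τ hτ).differentiableWithinAt)
    (fun τ hτ => (hd τ (Ico_subset_Icc_self hτ)).derivWithin
      (uniqueDiffOn_Icc hlt τ (Ico_subset_Icc_self hτ))) b (right_mem_Icc.2 hab)

/-- The points with given energy and angular momentum. -/
def levelSet (E : ℝ) (m : E3) : Set Phase := {z | energy z = E ∧ angMom z = m}

theorem fst_ne_zero_of_angMom {z : Phase} (h : angMom z ≠ 0) : z.1 ≠ 0 := by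
  intro h0
  apply h
  apply e3_ext <;> simp [angMom, cross_zero, cross_one, cross_two, h0]

theorem mem_levelSet_of_characteristic {E : ℝ} {m : E3} {γ : ℝ → Phase} {a b : ℝ} (hab : a ≤ b)
    (hx : ∀ τ ∈ Icc a b, (γ τ).1 ≠ 0)
    (h : ∀ τ ∈ Icc a b, HasDerivWithinAt γ (keplerField (γ τ)) (Icc a b) τ)
    (hb : γ b ∈ levelSet E m) : γ a ∈ levelSet E m := by
  rcases hab.eq_or_lt with rfl | hlt
  · exact hb
  have h1 : ∀ τ ∈ Icc a b, HasDerivWithinAt (fun τ => energy (γ τ)) 0 (Icc a b) τ := fun τ hτ => by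
    refine (hasDerivWithinAt_energy (h τ hτ) (hx τ hτ)).congr_deriv ?_
    simp only [keplerField, inner_neg_right, real_inner_smul_right]
    rw [real_inner_comm]
    ring
  have h2 := fun τ hτ => hasDerivWithinAt_angMom (h τ hτ)
  have hu := fun τ hτ => uniqueDiffOn_Icc hlt τ (Ico_subset_Icc_self hτ)
  have e1 := constant_of_derivWithin_zero (fun τ hτ => (h1 τ hτ).differentiableWithinAt)
    (fun τ hτ => (h1 τ (Ico_subset_Icc_self hτ)).derivWithin (hu τ hτ)) b (right_mem_Icc.2 hab)
  have e2 := constant_of_derivWithin_zero (fun τ hτ => (h2 τ hτ).differentiableWithinAt)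
    (fun τ hτ => (h2 τ (Ico_subset_Icc_self hτ)).derivWithin (hu τ hτ)) b (right_mem_Icc.2 hab)
  exact ⟨e1.symm.trans hb.1, e2.symm.trans hb.2⟩

theorem exists_bounds_levelSet (E : ℝ) {m : E3} (hm : m ≠ 0) :
    ∃ r c : ℝ, 0 < r ∧ 0 < c ∧ ∀ z ∈ levelSet E m, r ≤ ‖z.1‖ ∧ ‖z.2‖ ≤ c := by
  have hm0 : 0 < ‖m‖ := norm_pos_iff.2 hm
  set k := 2 * (|E| + 1) with hk
  have hk0 : 0 < k := by positivity
  set r := min 1 (‖m‖ ^ 2 / k) with hr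
  have hr0 : 0 < r := lt_min one_pos (by positivity)
  refine ⟨r, 1 + 2 * (|E| + 1 / r), hr0, by positivity, fun z hz => ?_⟩
  have hx : 0 < ‖z.1‖ := norm_pos_iff.2 (fst_ne_zero_of_angMom (by rw [hz.2]; exact hm))
  have hv : ‖z.2‖ ^ 2 = 2 * (E + 1 / ‖z.1‖) := by
    have := hz.1
    rw [energy] at this
    linarith
  have hL : ‖m‖ ^ 2 ≤ ‖z.1‖ ^ 2 * ‖z.2‖ ^ 2 := by
    have := angMomSq_eq z
    rw [hz.2, angMomSq] at this
    nlinarith [sq_nonneg (inner ℝ z.1 z.2 : ℝ)]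
  have hrx : r ≤ ‖z.1‖ := by
    by_contra hlt
    push Not at hlt
    have h1 : ‖z.1‖ < 1 := hlt.trans_le (min_le_left _ _)
    have h2 : ‖z.1‖ * k < ‖m‖ ^ 2 := (lt_div_iff₀ hk0).1 (hlt.trans_le (min_le_right _ _))
    have h3 : ‖z.1‖ ^ 2 * ‖z.2‖ ^ 2 = 2 * (E * ‖z.1‖ + 1) * ‖z.1‖ := by
      rw [hv]
      field_simp
    have h4 : E * ‖z.1‖ ≤ |E| := by
      calc E * ‖z.1‖ ≤ |E| * ‖z.1‖ := mul_le_mul_of_nonneg_right (le_abs_self E) hx.le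
        _ ≤ |E| := mul_le_of_le_one_right (abs_nonneg _) h1.le
    nlinarith
  refine ⟨hrx, ?_⟩
  have h5 : ‖z.2‖ ^ 2 ≤ 2 * (|E| + 1 / r) := by
    rw [hv]
    have := one_div_le_one_div_of_le hr0 hrx
    linarith [le_abs_self E]
  nlinarith [sq_nonneg (‖z.2‖ - 1), norm_nonneg z.2]

theorem norm_inv_cube_smul_sub_le {ρ : ℝ} (hρ : 0 < ρ) {x y : E3} (hx : ρ ≤ ‖x‖) (hy : ρ ≤ ‖y‖) :
    ‖(1 / ‖x‖ ^ 3) • x - (1 / ‖y‖ ^ 3) • y‖ ≤ 4 / ρ ^ 3 * ‖x - y‖ := by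
  set a := ‖x‖ with ha
  set b := ‖y‖ with hb
  have ha0 : 0 < a := hρ.trans_le hx
  have hb0 : 0 < b := hρ.trans_le hy
  have e : (1 / a ^ 3) • x - (1 / b ^ 3) • y =
      (1 / a ^ 3) • (x - y) + (1 / a ^ 3 - 1 / b ^ 3) • y := by
    rw [smul_sub, sub_smul]
    abel
  have hab : |a - b| ≤ ‖x - y‖ := abs_norm_sub_norm_le x y
  have h1 : 1 / a ^ 3 ≤ 1 / ρ ^ 3 := one_div_le_one_div_of_le (by positivity) (by gcongr)
  have h2 : |1 / a ^ 3 - 1 / b ^ 3| * b ≤ 3 / ρ ^ 3 * |a - b| := by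
    have e2 : 1 / a ^ 3 - 1 / b ^ 3 = -((a - b) * (a ^ 2 + a * b + b ^ 2) / (a ^ 3 * b ^ 3)) := by
      field_simp
      ring
    rw [e2, abs_neg, abs_div, abs_mul, abs_of_pos (show 0 < a ^ 2 + a * b + b ^ 2 by positivity),
      abs_of_pos (show 0 < a ^ 3 * b ^ 3 by positivity)]
    have h3 : (a ^ 2 + a * b + b ^ 2) / (a ^ 3 * b ^ 3) * b ≤ 3 / ρ ^ 3 := by
      rw [div_mul_eq_mul_div, div_le_div_iff₀ (by positivity) (by positivity)]
      have i1 : ρ ^ 3 ≤ a ^ 3 := by gcongr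
      have i2 : ρ ^ 3 ≤ a ^ 2 * b := by
        calc ρ ^ 3 = ρ ^ 2 * ρ := by ring
          _ ≤ a ^ 2 * b := by gcongr
      have i3 : ρ ^ 3 ≤ a * b ^ 2 := by
        calc ρ ^ 3 = ρ * ρ ^ 2 := by ring
          _ ≤ a * b ^ 2 := by gcongr
      have j1 := mul_le_mul_of_nonneg_left i1 (show 0 ≤ b ^ 3 by positivity)
      have j2 := mul_le_mul_of_nonneg_left i2 (show 0 ≤ a * b ^ 2 by positivity)
      have j3 := mul_le_mul_of_nonneg_left i3 (show 0 ≤ a ^ 2 * b by positivity)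
      nlinarith
    calc |a - b| * (a ^ 2 + a * b + b ^ 2) / (a ^ 3 * b ^ 3) * b
        = |a - b| * ((a ^ 2 + a * b + b ^ 2) / (a ^ 3 * b ^ 3) * b) := by ring
      _ ≤ |a - b| * (3 / ρ ^ 3) := mul_le_mul_of_nonneg_left h3 (abs_nonneg _)
      _ = _ := mul_comm _ _
  rw [e]
  refine (norm_add_le _ _).trans ?_
  rw [norm_smul, norm_smul, Real.norm_eq_abs, Real.norm_eq_abs, abs_of_pos (by positivity), ← hb]
  calc 1 / a ^ 3 * ‖x - y‖ + |1 / a ^ 3 - 1 / b ^ 3| * b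
      ≤ 1 / ρ ^ 3 * ‖x - y‖ + 3 / ρ ^ 3 * ‖x - y‖ :=
        add_le_add (mul_le_mul_of_nonneg_right h1 (norm_nonneg _))
          (h2.trans (mul_le_mul_of_nonneg_left hab (by positivity)))
    _ = _ := by ring

theorem exists_characteristic (E : ℝ) {m : E3} (hm : m ≠ 0) : ∃ h : ℝ, 0 < h ∧
    ∀ z ∈ levelSet E m, ∀ s : ℝ, ∃ γ : ℝ → Phase, γ s = z ∧ ∀ τ ∈ Icc (s - h) s,
      (γ τ).1 ≠ 0 ∧ HasDerivWithinAt γ (keplerField (γ τ)) (Icc (s - h) s) τ := by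
  obtain ⟨r, c, hr, hc, hb⟩ := exists_bounds_levelSet E hm
  set ρ := r / 2 with hρ
  have hρ0 : 0 < ρ := by positivity
  set L := c + ρ + 1 / ρ ^ 2 with hL
  have hL0 : 0 < L := by positivity
  refine ⟨ρ / L, by positivity, fun z hz s => ?_⟩
  obtain ⟨hzr, hzc⟩ := hb z hz
  have hball : ∀ y ∈ Metric.closedBall z ρ, ρ ≤ ‖y.1‖ ∧ ‖y.2‖ ≤ c + ρ := by
    intro y hy
    rw [mem_closedBall_iff_norm] at hy
    have h1 : ‖y.1 - z.1‖ ≤ ρ := (norm_fst_le (y - z)).trans hy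
    have h2 : ‖y.2 - z.2‖ ≤ ρ := (norm_snd_le (y - z)).trans hy
    constructor
    · have := norm_sub_norm_le z.1 y.1
      rw [norm_sub_rev] at this
      linarith
    · have := norm_sub_norm_le y.2 z.2
      linarith
  have hh : 0 < ρ / L := by positivity
  have hs : s ∈ Icc (s - ρ / L) s := ⟨by linarith, le_rfl⟩
  obtain ⟨ρ', hρ'⟩ : ∃ q : NNReal, (q : ℝ) = ρ := ⟨⟨ρ, hρ0.le⟩, rfl⟩
  obtain ⟨L', hL'⟩ : ∃ q : NNReal, (q : ℝ) = L := ⟨⟨L, hL0.le⟩, rfl⟩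
  obtain ⟨k, hk⟩ : ∃ q : NNReal, (q : ℝ) = 1 + 4 / ρ ^ 3 := ⟨⟨1 + 4 / ρ ^ 3, by positivity⟩, rfl⟩
  have hpl : IsPicardLindelof (fun _ => keplerField) (⟨s, hs⟩ : Icc (s - ρ / L) s) z
      ρ' 0 L' k := by
    refine IsPicardLindelof.of_time_independent (fun y hy => ?_) ?_ ?_
    · rw [hρ'] at hy
      rw [hL']
      obtain ⟨h1, h2⟩ := hball y hy
      have h0 : 0 < ‖y.1‖ := hρ0.trans_le h1
      refine norm_prod_le_iff.2 ⟨?_, ?_⟩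
      · have : 0 ≤ 1 / ρ ^ 2 := by positivity
        simp only [keplerField]
        linarith
      · simp only [keplerField]
        rw [norm_neg, norm_smul, Real.norm_eq_abs, abs_of_pos (by positivity)]
        have e : 1 / ‖y.1‖ ^ 3 * ‖y.1‖ = 1 / ‖y.1‖ ^ 2 := by field_simp
        rw [e]
        have : 1 / ‖y.1‖ ^ 2 ≤ 1 / ρ ^ 2 :=
          one_div_le_one_div_of_le (by positivity) (by gcongr)
        linarith
    · refine LipschitzOnWith.of_dist_le_mul fun y hy y' hy' => ?_
      rw [hρ'] at hy hy'
      rw [dist_eq_norm, dist_eq_norm, hk]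
      have h1 := norm_inv_cube_smul_sub_le hρ0 (hball y hy).1 (hball y' hy').1
      have h3 := norm_fst_le (y - y')
      have h4 := norm_snd_le (y - y')
      have h5 : 0 ≤ 4 / ρ ^ 3 := by positivity
      refine norm_prod_le_iff.2 ⟨?_, ?_⟩
      · simp only [keplerField, Prod.fst_sub]
        refine h4.trans (le_mul_of_one_le_left (norm_nonneg _) (by linarith))
      · simp only [keplerField, Prod.snd_sub]
        rw [neg_sub_neg, norm_sub_rev]
        refine h1.trans (mul_le_mul (by linarith) h3 (norm_nonneg _) (by positivity))
    · simp only [hρ', hL', sub_self, sub_sub_cancel, NNReal.coe_zero, sub_zero]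
      rw [max_eq_right hh.le]
      exact (mul_div_cancel₀ _ hL0.ne').le
  obtain ⟨α, hα⟩ := ODE.FunSpace.exists_isFixedPt_next hpl (Metric.mem_closedBall_self le_rfl)
  have hmem : ∀ t, α.compProj t ∈ Metric.closedBall z ρ := fun t => by
    have := ODE.FunSpace.compProj_mem_closedBall α hpl.mul_max_le (t := t)
    rwa [hρ'] at this
  refine ⟨α.compProj, ?_, fun τ hτ => ⟨?_, ?_⟩⟩
  · have := ODE.FunSpace.compProj_val (α := α) (t := ⟨s, hs⟩)
    rw [this, ← hα, ODE.FunSpace.next_apply₀]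
  · exact norm_pos_iff.1 (hρ0.trans_le (hball _ (hmem τ)).1)
  · have h1 := ODE.hasDerivWithinAt_picard_Icc (f := fun _ : ℝ => keplerField)
      (u := Metric.closedBall z ρ') hs hpl.continuousOn_uncurry α.continuous_compProj.continuousOn
      (fun t _ => by rw [hρ']; exact hmem t) z hτ
    refine h1.congr_of_mem (fun t ht => ?_) hτ
    have h2 := (ODE.FunSpace.isFixedPt_next_iff hpl (Metric.mem_closedBall_self le_rfl)).1 hα ⟨t, ht⟩
    rw [← h2, ODE.FunSpace.compProj_of_mem ht]

theorem IsClassicalSolution.eq_zero_of_levelSet {f : ℝ → Phase → ℝ} {g : Phase → ℝ}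
    (hf : IsClassicalSolution f g) {E : ℝ} {m : E3} (hm : m ≠ 0)
    (hg : ∀ z ∈ levelSet E m, g z = 0) {s : ℝ} (hs : 0 ≤ s) {z : Phase} (hz : z ∈ levelSet E m) :
    f s z = 0 := by
  obtain ⟨h, hh, H⟩ := exists_characteristic E hm
  have hstep : ∀ n : ℕ, ∀ s, 0 ≤ s → s ≤ n * h → ∀ z ∈ levelSet E m, f s z = 0 := by
    intro n
    induction n with
    | zero =>
      intro s hs hs' z hz
      have : s = 0 := le_antisymm (by simpa using hs') hs
      rw [this, hf.initial, hg z hz]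
    | succ n ih =>
      intro s hs hs' z hz
      obtain ⟨γ, hγ, hγ'⟩ := H z hz s
      set a := max 0 (s - h) with ha
      have hsub : Icc a s ⊆ Icc (s - h) s := Icc_subset_Icc_left (le_max_right _ _)
      have has : a ≤ s := max_le hs (by linarith)
      have hx : ∀ τ ∈ Icc a s, (γ τ).1 ≠ 0 := fun τ hτ => (hγ' τ (hsub hτ)).1
      have hd : ∀ τ ∈ Icc a s, HasDerivWithinAt γ (keplerField (γ τ)) (Icc a s) τ :=
        fun τ hτ => (hγ' τ (hsub hτ)).2.mono hsub
      have h1 := hf.eq_of_characteristic (le_max_left _ _) has hx hd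
      rw [hγ] at h1
      rw [h1]
      refine ih a (le_max_left _ _) ?_ _
        (mem_levelSet_of_characteristic has hx hd (by rw [hγ]; exact hz))
      push_cast at hs'
      exact max_le (by positivity) (by linarith)
  obtain ⟨n, hn⟩ := exists_nat_ge (s / h)
  exact hstep n s hs ((div_le_iff₀ hh).1 hn) z hz

theorem dense_angMom_ne_zero : Dense {z : Phase | angMom z ≠ 0} := by
  intro z
  by_cases hc : angMom z 2 = 0
  · have hc' : z.1 0 * z.2 1 - z.1 1 * z.2 0 = 0 := by rwa [angMom, cross_two] at hc
    have hcont : Continuous fun t : ℝ => z + t • ((basisE3 0, basisE3 1) : Phase) := by fun_prop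
    have hlim : Tendsto (fun t : ℝ => z + t • ((basisE3 0, basisE3 1) : Phase)) (𝓝[≠] 0) (𝓝 z) := by
      have := (hcont.tendsto 0).mono_left (nhdsWithin_le_nhds (s := {0}ᶜ))
      simpa using this
    refine mem_closure_of_tendsto hlim ?_
    have hne : ∀ᶠ t : ℝ in 𝓝[≠] 0, t + (z.1 0 + z.2 1) ≠ 0 := by
      by_cases hb : z.1 0 + z.2 1 = 0
      · filter_upwards [self_mem_nhdsWithin] with t ht
        simpa [hb] using ht
      · have : ∀ᶠ t : ℝ in 𝓝 0, t + (z.1 0 + z.2 1) ≠ 0 :=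
          (continuous_id.add continuous_const).continuousAt.eventually_ne (by simpa using hb)
        exact this.filter_mono nhdsWithin_le_nhds
    filter_upwards [hne, self_mem_nhdsWithin] with t h1 h2 h3
    have h4 : angMom (z + t • ((basisE3 0, basisE3 1) : Phase)) 2 = t * (t + (z.1 0 + z.2 1)) := by
      simp only [angMom, cross_two]
      simp [basisE3]
      linear_combination hc'
    rw [h3] at h4
    exact mul_ne_zero h2 h1 (by simpa using h4.symm)
  · exact subset_closure fun h => hc (by rw [h]; rfl)

theorem IsClassicalSolution.continuous {f : ℝ → Phase → ℝ} {g : Phase → ℝ}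
    (hf : IsClassicalSolution f g) {s : ℝ} (hs : 0 ≤ s) : Continuous (f s) := by
  rw [← continuousOn_univ]
  exact hf.continuousOn.comp (f := fun z : Phase => (s, z)) (by fun_prop) fun z _ => ⟨hs, trivial⟩

/-- A set of phase space which contains the trapped region and is defined by conditions on the
energy and on the angular momentum only. -/
def orbitRegion (c₀ h₀ l₁ l₂ n₀ : ℝ) : Set Phase :=
  {z | -1 / (2 * angMomSq z) + c₀ ≤ energy z ∧ energy z ≤ -h₀ ∧
    l₁ ≤ angMomSq z ∧ angMomSq z ≤ l₂ ∧ n₀ ≤ ‖nodeVec z‖}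

section Region

variable {c₀ h₀ l₁ l₂ n₀ n₁ : ℝ}

theorem trappedRegion_subset_orbitRegion :
    trappedRegion c₀ h₀ l₁ l₂ n₀ n₁ ⊆ orbitRegion c₀ h₀ l₁ l₂ n₀ :=
  fun _ h => ⟨h.1, h.2.1, h.2.2.1, h.2.2.2.1, h.2.2.2.2.1.le⟩

theorem orbitRegion_subset (hc₀ : 0 < c₀) (hh₀ : 0 < h₀) (hl₁ : 0 < l₁) (hn₀ : 0 < n₀) :
    orbitRegion c₀ h₀ l₁ l₂ n₀ ⊆ delaunayDomain := by
  rintro z ⟨h1, h2, h3, -, h5⟩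
  have hL : 0 < angMomSq z := hl₁.trans_le h3
  have hx : z.1 ≠ 0 := fst_ne_zero_of_angMom fun h => by
    rw [angMomSq_eq, h] at hL
    simp at hL
  refine ⟨hx, by linarith, norm_pos_iff.1 (hn₀.trans_le h5), fun he => ?_⟩
  have h6 := norm_eccVec_sq hx
  rw [he, norm_zero] at h6
  have h7 := mul_le_mul_of_nonneg_right h1 (show 0 ≤ 2 * angMomSq z by positivity)
  have h8 : (-1 / (2 * angMomSq z) + c₀) * (2 * angMomSq z) = -1 + c₀ * (2 * angMomSq z) := by
    field_simp
  nlinarith [mul_pos hc₀ hL]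

theorem isCompact_orbitRegion (hh₀ : 0 < h₀) (hl₁ : 0 < l₁) :
    IsCompact (orbitRegion c₀ h₀ l₁ l₂ n₀) := by
  set B : Set Phase := {z | l₁ / 2 ≤ ‖z.1‖} with hB
  have hBc : IsClosed B := isClosed_le continuous_const (by fun_prop)
  have hBx : ∀ z ∈ B, ‖z.1‖ ≠ 0 := fun z hz => ((half_pos hl₁).trans_le hz).ne'
  have hbd : ∀ z ∈ orbitRegion c₀ h₀ l₁ l₂ n₀,
      l₁ / 2 ≤ ‖z.1‖ ∧ ‖z.1‖ ≤ 1 / h₀ ∧ ‖z.2‖ ≤ 1 + 4 / l₁ := by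
    rintro z ⟨-, h2, h3, -, -⟩
    have hL : 0 < angMomSq z := hl₁.trans_le h3
    have hx : 0 < ‖z.1‖ := norm_pos_iff.2 (fst_ne_zero_of_angMom fun h => by
      rw [angMomSq_eq, h] at hL
      simp at hL)
    have hE : energy z = ‖z.2‖ ^ 2 / 2 - 1 / ‖z.1‖ := rfl
    have h4 : angMomSq z ≤ ‖z.1‖ ^ 2 * ‖z.2‖ ^ 2 := by
      rw [angMomSq]
      nlinarith [sq_nonneg (inner ℝ z.1 z.2 : ℝ)]
    have h5 : ‖z.2‖ ^ 2 ≤ 2 * (1 / ‖z.1‖) := by linarith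
    have h6 : ‖z.1‖ ^ 2 * ‖z.2‖ ^ 2 ≤ 2 * ‖z.1‖ := by
      calc ‖z.1‖ ^ 2 * ‖z.2‖ ^ 2 ≤ ‖z.1‖ ^ 2 * (2 * (1 / ‖z.1‖)) :=
            mul_le_mul_of_nonneg_left h5 (by positivity)
        _ = 2 * ‖z.1‖ := by field_simp
    have h7 : l₁ / 2 ≤ ‖z.1‖ := by linarith
    refine ⟨h7, ?_, ?_⟩
    · rw [le_div_iff₀ hh₀]
      have h8 : h₀ ≤ 1 / ‖z.1‖ := by nlinarith [sq_nonneg ‖z.2‖]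
      rw [le_div_iff₀ hx] at h8
      linarith
    · have h8 : 1 / ‖z.1‖ ≤ 1 / (l₁ / 2) := one_div_le_one_div_of_le (by positivity) h7
      have h9 : 1 / (l₁ / 2) = 2 / l₁ := by field_simp
      have h10 : 2 * (2 / l₁) = 4 / l₁ := by ring
      nlinarith [sq_nonneg (‖z.2‖ - 1), norm_nonneg z.2]
  have hcompact : IsCompact (B ∩ (Metric.closedBall (0 : E3) (1 / h₀) ×ˢ
      Metric.closedBall (0 : E3) (1 + 4 / l₁))) :=
    ((isCompact_closedBall _ _).prod (isCompact_closedBall _ _)).inter_left hBc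
  have hL : Continuous angMomSq := by
    unfold angMomSq
    fun_prop
  have hn : Continuous nodeVec := by
    unfold nodeVec angMom cross
    refine (PiLp.continuous_toLp 2 _).comp ?_
    simp only [cross_apply]
    refine continuous_pi fun i => ?_
    fin_cases i <;> simp <;> fun_prop
  have hE : ContinuousOn energy B := by
    unfold energy
    refine ContinuousOn.sub (by fun_prop) (ContinuousOn.div continuousOn_const (by fun_prop) hBx)
  have hset : orbitRegion c₀ h₀ l₁ l₂ n₀ = (B ∩ (Metric.closedBall (0 : E3) (1 / h₀) ×ˢ
      Metric.closedBall (0 : E3) (1 + 4 / l₁))) ∩ (B ∩ (fun z => (energy z, z)) ⁻¹'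
        (({p | -1 + c₀ * (2 * angMomSq p.2) ≤ p.1 * (2 * angMomSq p.2)} ∩ {p | p.1 ≤ -h₀}) ∩
          (({p | l₁ ≤ angMomSq p.2} ∩ {p | angMomSq p.2 ≤ l₂}) ∩ {p | n₀ ≤ ‖nodeVec p.2‖}))) := by
    have hiff : ∀ z : Phase, l₁ ≤ angMomSq z → (-1 / (2 * angMomSq z) + c₀ ≤ energy z ↔
        -1 + c₀ * (2 * angMomSq z) ≤ energy z * (2 * angMomSq z)) := by
      intro z hz
      have hp : 0 < 2 * angMomSq z := by linarith
      rw [← mul_le_mul_iff_left₀ hp, add_mul, div_mul_cancel₀ _ hp.ne']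
    ext z
    constructor
    · intro hz
      obtain ⟨b1, b2, b3⟩ := hbd z hz
      obtain ⟨h1, h2, h3, h4, h5⟩ := hz
      exact ⟨⟨b1, by simpa using b2, by simpa using b3⟩, b1, ⟨(hiff z h3).1 h1, h2⟩, ⟨h3, h4⟩, h5⟩
    · rintro ⟨-, -, ⟨h1, h2⟩, ⟨h3, h4⟩, h5⟩
      exact ⟨(hiff z h3).2 h1, h2, h3, h4, h5⟩
  rw [hset]
  refine hcompact.inter_right ((hE.prodMk continuousOn_id).preimage_isClosed_of_isClosed hBc ?_)
  refine IsClosed.inter (IsClosed.inter (isClosed_le ?_ ?_) (isClosed_le ?_ ?_))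
    (IsClosed.inter (IsClosed.inter (isClosed_le ?_ ?_) (isClosed_le ?_ ?_)) (isClosed_le ?_ ?_)) <;>
  fun_prop

theorem IsClassicalSolution.eq_zero {f : ℝ → Phase → ℝ} {g : Phase → ℝ}
    (hf : IsClassicalSolution f g) (hh₀ : 0 < h₀) (hl₁ : 0 < l₁)
    (hg : ∀ z ∉ orbitRegion c₀ h₀ l₁ l₂ n₀, g z = 0) {s : ℝ} (hs : 0 ≤ s) {z : Phase}
    (hz : z ∉ orbitRegion c₀ h₀ l₁ l₂ n₀) : f s z = 0 := by
  have hO : IsOpen (orbitRegion c₀ h₀ l₁ l₂ n₀)ᶜ :=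
    (isCompact_orbitRegion hh₀ hl₁).isClosed.isOpen_compl
  have h1 : ∀ z ∈ (orbitRegion c₀ h₀ l₁ l₂ n₀)ᶜ ∩ {z | angMom z ≠ 0}, f s z = 0 := by
    rintro z ⟨hz, hm⟩
    refine hf.eq_zero_of_levelSet (E := energy z) hm (fun w hw => hg w fun hwK => hz ?_) hs ⟨rfl, rfl⟩
    have e1 : angMomSq w = angMomSq z := by rw [angMomSq_eq, angMomSq_eq, hw.2]
    have e2 : nodeVec w = nodeVec z := by rw [nodeVec, nodeVec, hw.2]
    have e3 : energy w = energy z := hw.1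
    simpa only [orbitRegion, mem_ofPred_eq, e1, e2, e3] using hwK
  have h2 : z ∈ closure ((orbitRegion c₀ h₀ l₁ l₂ n₀)ᶜ ∩ {z | angMom z ≠ 0}) :=
    hO.inter_closure ⟨hz, dense_angMom_ne_zero z⟩
  exact closure_minimal h1 (isClosed_eq (hf.continuous hs) continuous_const) h2

end Region

/-! ### The flow in the action-angle variables -/

section Flow

variable {X : (Fin 6 → ℝ) → Phase}

theorem IsDelaunayCoordinates.mem (hX : IsDelaunayCoordinates X) {y : Fin 6 → ℝ}
    (hy : y ∈ delaunayRange) : X y ∈ delaunayDomain := by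
  rw [← hX.image_eq]
  exact mem_image_of_mem X hy

theorem IsDelaunayCoordinates.contDiffAt (hX : IsDelaunayCoordinates X) {y : Fin 6 → ℝ}
    (hy : y ∈ delaunayRange) : ContDiffAt ℝ ∞ X y :=
  hX.smooth.contDiffAt (isOpen_delaunayRange.mem_nhds hy)

theorem IsDelaunayCoordinates.energy_eq (hX : IsDelaunayCoordinates X) {y : Fin 6 → ℝ}
    (hy : y ∈ delaunayRange) : energy (X y) = -(1 / 2) * (y 0 ^ 2)⁻¹ := by
  have h1 := congrArg Prod.fst (hX.delaunay_eq y hy)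
  have h2 : energy (X y) < 0 := (hX.mem hy).2.1
  simp only [delaunay, actionJ] at h1
  rw [← h1, div_pow, Real.sq_sqrt (by linarith), one_pow]
  simp

theorem IsDelaunayCoordinates.fderiv_injective (hX : IsDelaunayCoordinates X) {y : Fin 6 → ℝ}
    (hy : y ∈ delaunayRange) {ξ : Fin 6 → ℝ} (h : fderiv ℝ X y ξ = 0) : ξ = 0 := by
  have h1 : ∀ η, actionAngleForm ξ η = 0 := fun η => by
    rw [← hX.canonical y hy, h]
    simp [symplecticForm]
  have h0 := h1 (dirDelaunay 0)
  have h2 := h1 (dirDelaunay 1)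
  have h3 := h1 (dirDelaunay 2)
  have h4 := h1 (dirDelaunay 3)
  have h5 := h1 (dirDelaunay 4)
  have h6 := h1 (dirDelaunay 5)
  simp [actionAngleForm, dirDelaunay] at h0 h2 h3 h4 h5 h6
  funext i
  fin_cases i <;> assumption

theorem finrank_phase : Module.finrank ℝ (Fin 6 → ℝ) = Module.finrank ℝ Phase := by
  simp [Phase, E3]

theorem IsDelaunayCoordinates.fderiv_surjective (hX : IsDelaunayCoordinates X) {y : Fin 6 → ℝ}
    (hy : y ∈ delaunayRange) : Function.Surjective (fderiv ℝ X y) := by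
  have hi : Function.Injective (fderiv ℝ X y).toLinearMap := by
    rw [injective_iff_map_eq_zero]
    exact fun ξ hξ => hX.fderiv_injective hy hξ
  exact (LinearMap.injective_iff_surjective_of_finrank_eq_finrank finrank_phase).1 hi

theorem IsDelaunayCoordinates.fderiv_angle (hX : IsDelaunayCoordinates X) {y : Fin 6 → ℝ}
    (hy : y ∈ delaunayRange) :
    fderiv ℝ X y (dirDelaunay 3) = (y 0 ^ 3) • keplerField (X y) := by
  have hJ : y 0 ≠ 0 := (range_J_pos hy).ne'
  have hx : (X y).1 ≠ 0 := (hX.mem hy).1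
  have hXd : HasFDerivAt X (fderiv ℝ X y) y :=
    ((hX.contDiffAt hy).differentiableAt (by simp)).hasFDerivAt
  have hE : ∀ η, inner ℝ (X y).2 (fderiv ℝ X y η).2 +
      inner ℝ (X y).1 (fderiv ℝ X y η).1 / ‖(X y).1‖ ^ 3 = (y 0 ^ 3)⁻¹ * η 0 := by
    intro η
    have h1 := (hasFDerivAt_energy hx).comp y hXd
    have h2 : HasFDerivAt (fun y : Fin 6 → ℝ => -(1 / 2) * (y 0 ^ 2)⁻¹)
        ((y 0 ^ 3)⁻¹ • ContinuousLinearMap.proj (R := ℝ) (φ := fun _ : Fin 6 => ℝ) 0) y := by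
      have h3 : HasDerivAt (fun t : ℝ => -(1 / 2) * (t ^ 2)⁻¹) ((y 0 ^ 3)⁻¹) (y 0) := by
        have := ((hasDerivAt_pow 2 (y 0)).fun_inv (pow_ne_zero 2 hJ)).const_mul (-(1 / 2))
        refine this.congr_deriv ?_
        field_simp
        norm_num
      exact h3.comp_hasFDerivAt (f := fun y : Fin 6 → ℝ => y 0) y
        (ContinuousLinearMap.proj (R := ℝ) (φ := fun _ : Fin 6 => ℝ) 0).hasFDerivAt
    have h4 : energy ∘ X =ᶠ[𝓝 y] fun y : Fin 6 → ℝ => -(1 / 2) * (y 0 ^ 2)⁻¹ := by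
      filter_upwards [isOpen_delaunayRange.mem_nhds hy] with y' hy' using hX.energy_eq hy'
    have h5 := h1.unique (h2.congr_of_eventuallyEq h4)
    have h6 := congrArg (fun T : (Fin 6 → ℝ) →L[ℝ] ℝ => T η) h5
    simp at h6
    rw [← h6]
    ring
  rw [← sub_eq_zero]
  set w := fderiv ℝ X y (dirDelaunay 3) - (y 0 ^ 3) • keplerField (X y) with hw
  have hw0 : ∀ η, symplecticForm w (fderiv ℝ X y η) = 0 := by
    intro η
    have h1 := hX.canonical y hy (dirDelaunay 3) η
    have h2 := hE η
    have h3 : actionAngleForm (dirDelaunay 3) η = η 0 := by simp [actionAngleForm, dirDelaunay]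
    have h4 : symplecticForm ((y 0 ^ 3) • keplerField (X y)) (fderiv ℝ X y η) = η 0 := by
      simp only [symplecticForm, keplerField, Prod.smul_fst, Prod.smul_snd, real_inner_smul_left,
        inner_neg_left, smul_neg]
      have h5 : η 0 = y 0 ^ 3 * ((y 0 ^ 3)⁻¹ * η 0) := by field_simp
      rw [h5, ← h2]
      ring
    have h6 : ∀ a b c : Phase, symplecticForm (a - b) c = symplecticForm a c - symplecticForm b c := by
      intro a b c
      simp only [symplecticForm, Prod.fst_sub, Prod.snd_sub, inner_sub_left]
      ring
    rw [hw, h6, h1, h3, h4, sub_self]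
  have hw1 : ∀ b, symplecticForm w b = 0 := fun b => by
    obtain ⟨η, rfl⟩ := hX.fderiv_surjective hy b
    exact hw0 η
  have h1 := hw1 (0, w.1)
  have h2 := hw1 (w.2, 0)
  simp [symplecticForm] at h1 h2
  exact Prod.ext h1 h2

theorem add_smul_mem_delaunayRange {y : Fin 6 → ℝ} (hy : y ∈ delaunayRange) (t : ℝ) :
    y + t • dirDelaunay 3 ∈ delaunayRange := by
  simpa [delaunayRange, dirDelaunay] using hy

theorem IsClassicalSolution.comp_delaunay (hX : IsDelaunayCoordinates X) {f : ℝ → Phase → ℝ}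
    {g : Phase → ℝ} (hf : IsClassicalSolution f g) {t : ℝ} (ht : 0 ≤ t) {y : Fin 6 → ℝ}
    (hy : y ∈ delaunayRange) :
    f t (X y) = g (X (y + (-(t * (y 0 ^ 3)⁻¹)) • dirDelaunay 3)) := by
  have hJ : y 0 ≠ 0 := (range_J_pos hy).ne'
  set γ : ℝ → Phase := fun τ => X (y + ((τ - t) * (y 0 ^ 3)⁻¹) • dirDelaunay 3) with hγ
  have hd : ∀ τ, HasDerivAt γ (keplerField (γ τ)) τ := by
    intro τ
    have hy' := add_smul_mem_delaunayRange hy ((τ - t) * (y 0 ^ 3)⁻¹)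
    have h1 : HasDerivAt (fun τ : ℝ => y + ((τ - t) * (y 0 ^ 3)⁻¹) • dirDelaunay 3)
        (((y 0 ^ 3)⁻¹) • dirDelaunay 3) τ := by
      have := ((((hasDerivAt_id τ).sub_const t).mul_const (y 0 ^ 3)⁻¹).smul_const
        (dirDelaunay 3)).const_add y
      simpa using this
    have h2 := ((hX.contDiffAt hy').differentiableAt (by simp)).hasFDerivAt.comp_hasDerivAt τ h1
    refine h2.congr_deriv ?_
    rw [map_smul, hX.fderiv_angle hy', smul_smul]
    have h3 : (y + ((τ - t) * (y 0 ^ 3)⁻¹) • dirDelaunay 3) 0 = y 0 := by simp [dirDelaunay]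
    rw [h3, inv_mul_cancel₀ (pow_ne_zero 3 hJ), one_smul]
  have h := hf.eq_of_characteristic (γ := γ) le_rfl ht
    (fun τ _ => (hX.mem (add_smul_mem_delaunayRange hy _)).1)
    (fun τ _ => (hd τ).hasDerivWithinAt)
  simpa [hγ, hf.initial] using h

end Flow

end

section

open Filter Topology

/-! ### Rotation of the mean anomaly -/

section Rotation

variable {X : (Fin 6 → ℝ) → Phase}

theorem IsDelaunayCoordinates.coords_eq (hX : IsDelaunayCoordinates X) {y : Fin 6 → ℝ}
    (hy : y ∈ delaunayRange) : angMomSq (X y) = y 2 ^ 2 ∧ ‖nodeVec (X y)‖ ^ 2 = y 2 ^ 2 - y 1 ^ 2 := by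
  have h := hX.delaunay_eq y hy
  simp only [delaunay, Prod.mk.injEq] at h
  obtain ⟨-, h1, h2, -⟩ := h
  have h3 := norm_nodeVec_sq (X y)
  rw [h1, h2] at h3
  exact ⟨by rw [angMomSq_eq, ← h2]; rfl, h3⟩

theorem add_mem_delaunayRange_of_eq {y y' u : Fin 6 → ℝ} (h0 : y 0 = y' 0) (h1 : y 1 = y' 1)
    (h2 : y 2 = y' 2) (hu : y + u ∈ delaunayRange) : y' + u ∈ delaunayRange := by
  simpa [delaunayRange, h0, h1, h2] using hu

theorem IsDelaunayCoordinates.add_eq_of_eq (hX : IsDelaunayCoordinates X) {y y' u : Fin 6 → ℝ}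
    (hy : y ∈ delaunayRange) (hy' : y' ∈ delaunayRange) (h : X y = X y')
    (hu : y + u ∈ delaunayRange) : X (y + u) = X (y' + u) := by
  have e := (hX.delaunay_eq y hy).symm.trans ((congrArg delaunay h).trans (hX.delaunay_eq y' hy'))
  simp only [Prod.mk.injEq] at e
  obtain ⟨e0, e1, e2, e3, e4, e5⟩ := e
  have hu' := add_mem_delaunayRange_of_eq e0 e1 e2 hu
  refine hX.injOn (hX.mem hu) (hX.mem hu') ?_
  rw [hX.delaunay_eq _ hu, hX.delaunay_eq _ hu']
  simp only [Pi.add_apply, Real.Angle.coe_add, e0, e1, e2, e3, e4, e5]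

theorem IsDelaunayCoordinates.add_two_pi (hX : IsDelaunayCoordinates X) {y : Fin 6 → ℝ}
    (hy : y ∈ delaunayRange) : X (y + (2 * Real.pi) • dirDelaunay 3) = X y := by
  have hu := add_smul_mem_delaunayRange hy (2 * Real.pi)
  refine hX.injOn (hX.mem hu) (hX.mem hy) ?_
  rw [hX.delaunay_eq _ hu, hX.delaunay_eq _ hy]
  simp [dirDelaunay]

theorem IsDelaunayCoordinates.exists_localInverse (hX : IsDelaunayCoordinates X) {y : Fin 6 → ℝ}
    (hy : y ∈ delaunayRange) : ∃ φ : Phase → Fin 6 → ℝ, ContDiffAt ℝ ∞ φ (X y) ∧ φ (X y) = y ∧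
      ∀ᶠ z in 𝓝 (X y), φ z ∈ delaunayRange ∧ X (φ z) = z := by
  obtain ⟨φ, h1, h2, h3⟩ := exists_contDiffAt_rightInverse (hX.contDiffAt hy) finrank_phase
    fun ξ hξ => hX.fderiv_injective hy hξ
  refine ⟨φ, h1, h2, ?_⟩
  have h4 : ∀ᶠ z in 𝓝 (X y), φ z ∈ delaunayRange :=
    h1.continuousAt.eventually_mem (by rw [h2]; exact isOpen_delaunayRange.mem_nhds hy)
  exact h4.and h3

theorem IsDelaunayCoordinates.exists_eq (hX : IsDelaunayCoordinates X) {z : Phase}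
    (hz : z ∈ delaunayDomain) : ∃ y ∈ delaunayRange, X y = z := by
  rw [← hX.image_eq] at hz
  exact hz

theorem IsDelaunayCoordinates.isOpen_domain (hX : IsDelaunayCoordinates X) :
    IsOpen delaunayDomain := by
  rw [isOpen_iff_mem_nhds]
  intro z hz
  obtain ⟨y, hy, rfl⟩ := hX.exists_eq hz
  obtain ⟨φ, -, -, h⟩ := hX.exists_localInverse hy
  filter_upwards [h] with w hw
  rw [← hw.2]
  exact hX.mem hw.1

open Classical in
/-- The rotation of the mean anomaly by the angle `p.1`, extended by the identity. -/
def rotation (X : (Fin 6 → ℝ) → Phase) (p : ℝ × Phase) : Phase :=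
  if h : ∃ y ∈ delaunayRange, X y = p.2 then X (h.choose + p.1 • dirDelaunay 3) else p.2

theorem IsDelaunayCoordinates.rotation_apply (hX : IsDelaunayCoordinates X) {y : Fin 6 → ℝ}
    (hy : y ∈ delaunayRange) (θ : ℝ) : rotation X (θ, X y) = X (y + θ • dirDelaunay 3) := by
  have h : ∃ y' ∈ delaunayRange, X y' = X y := ⟨y, hy, rfl⟩
  rw [rotation, dif_pos h]
  exact hX.add_eq_of_eq h.choose_spec.1 hy h.choose_spec.2
    (add_smul_mem_delaunayRange h.choose_spec.1 θ)

theorem IsDelaunayCoordinates.rotation_of_notMem (hX : IsDelaunayCoordinates X) {z : Phase}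
    (hz : z ∉ delaunayDomain) (θ : ℝ) : rotation X (θ, z) = z := by
  rw [rotation, dif_neg]
  rintro ⟨y, hy, h⟩
  exact hz (by simpa [h] using hX.mem hy)

theorem IsDelaunayCoordinates.rotation_two_pi (hX : IsDelaunayCoordinates X) (θ : ℝ) (z : Phase) :
    rotation X (θ + 2 * Real.pi, z) = rotation X (θ, z) := by
  by_cases hz : z ∈ delaunayDomain
  · obtain ⟨y, hy, rfl⟩ := hX.exists_eq hz
    rw [hX.rotation_apply hy, hX.rotation_apply hy, add_smul, ← add_assoc,
      hX.add_two_pi (add_smul_mem_delaunayRange hy θ)]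
  · rw [hX.rotation_of_notMem hz, hX.rotation_of_notMem hz]

theorem IsDelaunayCoordinates.contDiffAt_rotation (hX : IsDelaunayCoordinates X) {p : ℝ × Phase}
    (hp : p.2 ∈ delaunayDomain) : ContDiffAt ℝ ∞ (rotation X) p := by
  obtain ⟨θ, z⟩ := p
  obtain ⟨y, hy, rfl⟩ := hX.exists_eq hp
  obtain ⟨φ, h1, h2, h3⟩ := hX.exists_localInverse hy
  have h4 : rotation X =ᶠ[𝓝 (θ, X y)] fun p => X (φ p.2 + p.1 • dirDelaunay 3) := by
    filter_upwards [(continuous_snd.tendsto (θ, X y)).eventually h3] with p hp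
    rw [← hX.rotation_apply hp.1, hp.2]
  refine ContDiffAt.congr_of_eventuallyEq ?_ h4
  refine ContDiffAt.comp (g := X) (θ, X y) ?_ ?_
  · exact hX.contDiffAt (by rw [h2]; exact add_smul_mem_delaunayRange hy θ)
  · have h5 : ContDiffAt ℝ ∞ (fun p : ℝ × Phase => φ p.2) (θ, X y) :=
      ContDiffAt.comp (g := φ) (θ, X y) h1 contDiffAt_snd
    exact h5.add (contDiffAt_fst.smul contDiffAt_const)

variable {c₀ h₀ l₁ l₂ n₀ : ℝ}

theorem IsDelaunayCoordinates.mem_orbitRegion_iff (hX : IsDelaunayCoordinates X) {y y' : Fin 6 → ℝ}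
    (hy : y ∈ delaunayRange) (hy' : y' ∈ delaunayRange) (h0 : y 0 = y' 0) (h1 : y 1 = y' 1)
    (h2 : y 2 = y' 2) :
    X y ∈ orbitRegion c₀ h₀ l₁ l₂ n₀ ↔ X y' ∈ orbitRegion c₀ h₀ l₁ l₂ n₀ := by
  have e1 : ‖nodeVec (X y)‖ = ‖nodeVec (X y')‖ := by
    rw [← sq_eq_sq₀ (norm_nonneg _) (norm_nonneg _), (hX.coords_eq hy).2, (hX.coords_eq hy').2, h1,
      h2]
  simp only [orbitRegion, mem_ofPred_eq, (hX.coords_eq hy).1, (hX.coords_eq hy').1, hX.energy_eq hy,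
    hX.energy_eq hy', h0, h2, e1]

theorem IsDelaunayCoordinates.rotation_mem_iff (hX : IsDelaunayCoordinates X) (θ : ℝ) (z : Phase) :
    rotation X (θ, z) ∈ orbitRegion c₀ h₀ l₁ l₂ n₀ ↔ z ∈ orbitRegion c₀ h₀ l₁ l₂ n₀ := by
  by_cases hz : z ∈ delaunayDomain
  · obtain ⟨y, hy, rfl⟩ := hX.exists_eq hz
    rw [hX.rotation_apply hy]
    exact hX.mem_orbitRegion_iff (add_smul_mem_delaunayRange hy θ) hy (by simp [dirDelaunay])
      (by simp [dirDelaunay]) (by simp [dirDelaunay])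
  · rw [hX.rotation_of_notMem hz]

end Rotation

theorem exists_bound_of_periodic {W : Type*} [NormedAddCommGroup W] [NormedSpace ℝ W]
    {F : ℝ × Phase → W} (hF : ContDiff ℝ ∞ F) (hper : ∀ θ z, F (θ + 2 * Real.pi, z) = F (θ, z))
    {K : Set Phase} (hK : IsCompact K) (n : ℕ) :
    ∃ B : ℝ, 0 ≤ B ∧ ∀ j ≤ n, ∀ p : ℝ × Phase, p.2 ∈ K → ‖iteratedFDeriv ℝ j F p‖ ≤ B := by
  have h : ∀ j : ℕ, ∃ C : ℝ, ∀ p ∈ Icc 0 (2 * Real.pi) ×ˢ K, ‖iteratedFDeriv ℝ j F p‖ ≤ C :=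
    fun j => (isCompact_Icc.prod hK).exists_bound_of_continuousOn
      (hF.continuous_iteratedFDeriv (m := j) (by exact_mod_cast le_top)).continuousOn
  choose C hC using h
  refine ⟨∑ j ∈ Finset.range (n + 1), |C j|, Finset.sum_nonneg fun _ _ => abs_nonneg _,
    fun j hj p hp => ?_⟩
  have hpj : ∀ z, Function.Periodic (fun θ => iteratedFDeriv ℝ j F (θ, z)) (2 * Real.pi) := by
    intro z θ
    have h1 : (fun p => F (p + (2 * Real.pi, 0))) = F := by
      funext p
      have := hper p.1 p.2
      simpa [Prod.add_def] using this
    have h2 := iteratedFDeriv_comp_add_right (𝕜 := ℝ) (f := F) j (2 * Real.pi, (0 : Phase)) (θ, z)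
    rw [h1] at h2
    simp only
    rw [h2]
    simp
  obtain ⟨θ, hθ, hθ'⟩ := (hpj p.2).exists_mem_Ico₀ Real.two_pi_pos p.1
  have h3 : iteratedFDeriv ℝ j F p = iteratedFDeriv ℝ j F (θ, p.2) := hθ'
  rw [h3]
  refine (hC j (θ, p.2) ⟨Ico_subset_Icc_self hθ, hp⟩).trans ((le_abs_self _).trans ?_)
  exact Finset.single_le_sum (f := fun j => |C j|) (fun _ _ => abs_nonneg _)
    (Finset.mem_range.2 (by omega))

section Solution

variable {X : (Fin 6 → ℝ) → Phase} {c₀ h₀ l₁ l₂ n₀ : ℝ}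

theorem IsDelaunayCoordinates.exists_isOsc (hX : IsDelaunayCoordinates X) (hc₀ : 0 < c₀)
    (hh₀ : 0 < h₀) (hl₁ : 0 < l₁) (hn₀ : 0 < n₀) (N : ℕ) : ∃ C : ℝ, 0 ≤ C ∧
    ∀ (A : ℝ) (g : Phase → ℝ), 0 ≤ A → ContDiff ℝ N g →
      (∀ z ∉ orbitRegion c₀ h₀ l₁ l₂ n₀, g z = 0) → (∀ k ≤ N, ∀ z, ‖iteratedFDeriv ℝ k g z‖ ≤ A) →
      IsOsc (orbitRegion c₀ h₀ l₁ l₂ n₀) N (C * A) fun p => g (rotation X p) := by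
  set K := orbitRegion c₀ h₀ l₁ l₂ n₀ with hKdef
  have hK : IsCompact K := isCompact_orbitRegion hh₀ hl₁
  have hKD : K ⊆ delaunayDomain := orbitRegion_subset hc₀ hh₀ hl₁ hn₀
  obtain ⟨χ, hχ, -, hχD, O, hO, hKO, hχ1⟩ := exists_cutoff hK hX.isOpen_domain hKD
  set F : ℝ × Phase → Phase := fun p => χ p.2 • rotation X p with hF
  have hFs : ContDiff ℝ ∞ F := by
    refine contDiff_smul_of_tsupport (χ := fun p : ℝ × Phase => χ p.2) (U := Prod.snd ⁻¹' delaunayDomain)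
      (hχ.comp contDiff_snd) (hX.isOpen_domain.preimage continuous_snd)
      (fun p hp => (hX.contDiffAt_rotation hp).contDiffWithinAt) ?_
    exact (tsupport_comp_subset_preimage χ continuous_snd).trans (preimage_mono hχD)
  have hFper : ∀ θ z, F (θ + 2 * Real.pi, z) = F (θ, z) := fun θ z => by
    simp only [hF, hX.rotation_two_pi]
  obtain ⟨B, hB0, hB⟩ := exists_bound_of_periodic hFs hFper hK N
  refine ⟨(N.factorial : ℝ) * (1 + B) ^ N, by positivity, fun A g hA hg hg0 hgA => ?_⟩
  have hFeq : ∀ p : ℝ × Phase, p.2 ∈ O → rotation X =ᶠ[𝓝 p] F := fun p hp => by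
    filter_upwards [(hO.preimage continuous_snd).mem_nhds hp] with q hq
    simp only [hF, hχ1 _ hq, one_smul]
  have h0 : ∀ p : ℝ × Phase, p.2 ∉ K → g (rotation X p) = 0 := fun p hp =>
    hg0 _ (by rwa [hKdef, hX.rotation_mem_iff p.1 p.2])
  have hev : ∀ p : ℝ × Phase, p.2 ∈ K → (fun p => g (rotation X p)) =ᶠ[𝓝 p] g ∘ F := fun p hp => by
    filter_upwards [hFeq p (hKO hp)] with q hq
    rw [hq]
    rfl
  have hev0 : ∀ p : ℝ × Phase, p.2 ∉ K → (fun p => g (rotation X p)) =ᶠ[𝓝 p] fun _ => 0 :=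
    fun p hp => by
      filter_upwards [(hK.isClosed.isOpen_compl.preimage continuous_snd).mem_nhds hp] with q hq
      exact h0 q hq
  refine ⟨?_, h0, fun j hj p => ?_, fun θ z => ?_⟩
  · rw [contDiff_iff_contDiffAt]
    intro p
    by_cases hp : p.2 ∈ K
    · exact ((hg.comp (hFs.of_le (by exact_mod_cast le_top))).contDiffAt).congr_of_eventuallyEq
        (hev p hp)
    · exact contDiffAt_const.congr_of_eventuallyEq (hev0 p hp)
  · by_cases hp : p.2 ∈ K
    · rw [((hev p hp).iteratedFDeriv ℝ j).eq_of_nhds]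
      have h1 := norm_iteratedFDeriv_comp_le hg (hFs.of_le (by exact_mod_cast le_top))
        (n := j) (by exact_mod_cast hj) p (C := A) (D := 1 + B)
        (fun i hi => hgA i (hi.trans hj) _) fun i hi1 hi2 => ?_
      · refine h1.trans ?_
        have h2 : (j.factorial : ℝ) ≤ N.factorial := by exact_mod_cast Nat.factorial_le hj
        have h3 : (1 + B) ^ j ≤ (1 + B) ^ N := pow_le_pow_right₀ (by linarith) hj
        calc (j.factorial : ℝ) * A * (1 + B) ^ j ≤ N.factorial * A * (1 + B) ^ N := by gcongr
          _ = _ := by ring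
      · refine (hB i (hi2.trans hj) p hp).trans ?_
        calc B ≤ (1 + B) ^ 1 := by linarith
          _ ≤ _ := pow_le_pow_right₀ (by linarith) hi1
    · rw [((hev0 p hp).iteratedFDeriv ℝ j).eq_of_nhds]
      have : iteratedFDeriv ℝ j (fun _ : ℝ × Phase => (0 : ℝ)) p = 0 := by
        have := iteratedFDeriv_fun_zero (𝕜 := ℝ) (E := ℝ × Phase) (F := ℝ) (n := j)
        exact congrFun this p
      rw [this, norm_zero]
      positivity
  · simp only [hX.rotation_two_pi]

theorem contDiffAt_energy {z : Phase} (hz : z.1 ≠ 0) : ContDiffAt ℝ ∞ energy z := by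
  unfold energy
  have h1 : ContDiffAt ℝ ∞ (fun z : Phase => ‖z.1‖) z := (contDiffAt_norm ℝ hz).comp z contDiffAt_fst
  have h2 : ContDiffAt ℝ ∞ (fun z : Phase => ‖z.2‖ ^ 2) z := (contDiff_snd.norm_sq ℝ).contDiffAt
  exact (h2.div_const 2).sub (contDiffAt_const.div h1 (norm_ne_zero_iff.2 hz))

theorem exists_isClock (hX : IsDelaunayCoordinates X) (hc₀ : 0 < c₀) (hh₀ : 0 < h₀) (hl₁ : 0 < l₁)
    (hn₀ : 0 < n₀) : ∃ ν μ : Phase → ℝ, IsClock (orbitRegion c₀ h₀ l₁ l₂ n₀) ν μ ∧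
      ∀ z ∈ orbitRegion c₀ h₀ l₁ l₂ n₀, ν z = Real.sqrt (-2 * energy z) ^ 3 := by
  set K := orbitRegion c₀ h₀ l₁ l₂ n₀ with hKdef
  have hK : IsCompact K := isCompact_orbitRegion hh₀ hl₁
  have hKD : K ⊆ delaunayDomain := orbitRegion_subset hc₀ hh₀ hl₁ hn₀
  obtain ⟨χ, hχ, hχs, hχD, O, hO, hKO, hχ1⟩ := exists_cutoff hK hX.isOpen_domain hKD
  have hv : ∀ z ∈ delaunayDomain, z.2 ≠ 0 := fun z hz h => by
    apply angMom_ne_zero_of_nodeVec hz.2.2.1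
    apply e3_ext <;> simp [angMom, cross_zero, cross_one, cross_two, h]
  have hH : ∀ z ∈ delaunayDomain, -2 * energy z ≠ 0 := fun z hz => by
    have := hz.2.1
    linarith
  have hsq : ∀ z ∈ delaunayDomain, ContDiffAt ℝ ∞ (fun z => Real.sqrt (-2 * energy z)) z :=
    fun z hz => (contDiffAt_const.mul (contDiffAt_energy hz.1)).sqrt (hH z hz)
  refine ⟨fun z => χ z • Real.sqrt (-2 * energy z) ^ 3,
    fun z => χ z • (-(3 * Real.sqrt (-2 * energy z) * ‖z.2‖ ^ 2))⁻¹, ⟨hK, ?_, ?_, ?_, ?_, ?_⟩, ?_⟩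
  · exact contDiff_smul_of_tsupport hχ hX.isOpen_domain
      (fun z hz => ((hsq z hz).pow 3).contDiffWithinAt) hχD
  · exact hχs.smul_right
  · refine contDiff_smul_of_tsupport hχ hX.isOpen_domain (fun z hz => ContDiffAt.contDiffWithinAt ?_) hχD
    have h2 : ContDiffAt ℝ ∞ (fun z : Phase => ‖z.2‖ ^ 2) z := (contDiff_snd.norm_sq ℝ).contDiffAt
    refine ((contDiffAt_const.mul (hsq z hz)).mul h2).neg.inv ?_
    have h3 : 0 < Real.sqrt (-2 * energy z) := Real.sqrt_pos.2 (by have := hz.2.1; linarith)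
    have h4 : 0 < ‖z.2‖ := norm_pos_iff.2 (hv z hz)
    exact (neg_neg_of_pos (by positivity)).ne
  · exact hχs.smul_right
  · intro z hz
    have hzD := hKD hz
    have h3 : 0 < Real.sqrt (-2 * energy z) := Real.sqrt_pos.2 (by have := hzD.2.1; linarith)
    have h4 : 0 < ‖z.2‖ := norm_pos_iff.2 (hv z hzD)
    have hev : (fun z => χ z • Real.sqrt (-2 * energy z) ^ 3) =ᶠ[𝓝 z]
        fun z => Real.sqrt (-2 * energy z) ^ 3 := by
      filter_upwards [hO.mem_nhds (hKO hz)] with w hw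
      rw [hχ1 w hw, one_smul]
    have hd := (((hasFDerivAt_energy hzD.1).const_mul (-2)).sqrt (hH z hzD)).pow 3
    rw [hev.fderiv_eq, hd.fderiv, hχ1 z (hKO hz)]
    generalize Real.sqrt (-2 * energy z) = r at h3
    simp
    field_simp
  · intro z hz
    simp only
    rw [hχ1 z (hKO hz), one_smul]

theorem IsClassicalSolution.eq_rotation (hX : IsDelaunayCoordinates X) (hc₀ : 0 < c₀) (hh₀ : 0 < h₀)
    (hl₁ : 0 < l₁) (hn₀ : 0 < n₀) {ν : Phase → ℝ}
    (hν : ∀ z ∈ orbitRegion c₀ h₀ l₁ l₂ n₀, ν z = Real.sqrt (-2 * energy z) ^ 3)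
    {f : ℝ → Phase → ℝ} {g : Phase → ℝ} (hf : IsClassicalSolution f g)
    (hg : ∀ z ∉ orbitRegion c₀ h₀ l₁ l₂ n₀, g z = 0) {s : ℝ} (hs : 0 ≤ s) (z : Phase) :
    f s z = g (rotation X (-(s * ν z), z)) := by
  by_cases hz : z ∈ orbitRegion c₀ h₀ l₁ l₂ n₀
  · obtain ⟨y, hy, rfl⟩ := hX.exists_eq (orbitRegion_subset hc₀ hh₀ hl₁ hn₀ hz)
    have hJ := range_J_pos hy
    rw [hX.rotation_apply hy, hν _ hz, hf.comp_delaunay hX hs hy, hX.energy_eq hy]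
    have e : (y 0 ^ 3)⁻¹ = Real.sqrt (-2 * (-(1 / 2) * (y 0 ^ 2)⁻¹)) ^ 3 := by
      have e1 : -2 * (-(1 / 2) * (y 0 ^ 2)⁻¹) = ((y 0)⁻¹) ^ 2 := by ring
      rw [e1, Real.sqrt_sq (by positivity), inv_pow]
    rw [e]
  · rw [hf.eq_zero hh₀ hl₁ hg hs hz, hg _ (by rwa [hX.rotation_mem_iff])]

end Solution

/-! ### Growth of the derivatives in position and velocity -/

theorem norm_iteratedFDeriv_id_le {V : Type*} [NormedAddCommGroup V] [NormedSpace ℝ V] {i : ℕ}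
    (hi : 1 ≤ i) (x : V) : ‖iteratedFDeriv ℝ i (fun x : V => x) x‖ ≤ 1 := by
  obtain ⟨k, rfl⟩ : ∃ k, i = k + 1 := ⟨i - 1, by omega⟩
  rw [← norm_iteratedFDeriv_fderiv]
  have h : fderiv ℝ (fun x : V => x) = fun _ => ContinuousLinearMap.id ℝ V := by
    funext x
    exact fderiv_fun_id
  rw [h]
  rcases k with _ | k
  · rw [norm_iteratedFDeriv_zero]
    exact ContinuousLinearMap.norm_id_le
  · rw [iteratedFDeriv_succ_const]
    simp

theorem IsClock.exists_growth {K : Set Phase} {ν μ : Phase → ℝ} (hc : IsClock K ν μ) (N : ℕ) :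
    ∃ C : ℝ, 0 ≤ C ∧ ∀ M b, IsOsc K N M b → ∀ k ≤ N, ∀ s z,
      ‖iteratedFDeriv ℝ k (fun z => b (-(s * ν z), z)) z‖ ≤ C * M * bracket s ^ k := by
  obtain ⟨B, hB0, hB⟩ := exists_bound_iteratedFDeriv hc.smooth hc.support N
  refine ⟨(N.factorial : ℝ) * (2 + B) ^ N, by positivity, fun M b h k hk s z => ?_⟩
  have hs := one_le_bracket s
  have hD : ∀ i, 1 ≤ i → i ≤ k →
      ‖iteratedFDeriv ℝ i (fun z : Phase => (-(s * ν z), z)) z‖ ≤ ((2 + B) * bracket s) ^ i := by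
    intro i hi hik
    have h1 := iteratedFDeriv_prodMk (𝕜 := ℝ) (f := fun z : Phase => -(s * ν z))
      (g := fun z : Phase => z) (x := z) (n := ∞) (i := i)
      ((contDiff_const.mul hc.smooth).neg.contDiffAt) contDiffAt_id (by exact_mod_cast le_top)
    rw [h1, ContinuousMultilinearMap.opNorm_prod]
    have h2 : (1 : ℝ) ≤ (2 + B) * bracket s := by nlinarith
    have h3 : (2 + B) * bracket s ≤ ((2 + B) * bracket s) ^ i := by
      calc (2 + B) * bracket s = ((2 + B) * bracket s) ^ 1 := (pow_one _).symm
        _ ≤ _ := pow_le_pow_right₀ h2 hi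
    refine max_le ?_ ((norm_iteratedFDeriv_id_le hi z).trans (h2.trans h3))
    have h4 : (fun z : Phase => -(s * ν z)) = (-s) • ν := by
      funext z
      simp
    rw [h4, iteratedFDeriv_const_smul_apply (hc.smooth.contDiffAt.of_le (by exact_mod_cast le_top)),
      norm_smul, Real.norm_eq_abs, abs_neg]
    calc |s| * ‖iteratedFDeriv ℝ i ν z‖ ≤ bracket s * B :=
          mul_le_mul (abs_le_bracket s) (hB i (hik.trans hk) z) (norm_nonneg _) (by linarith)
      _ ≤ (2 + B) * bracket s := by nlinarith
      _ ≤ _ := h3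
  have h5 := norm_iteratedFDeriv_comp_le h.contDiff (contDiff_clock hc.smooth s N)
    (n := k) (by exact_mod_cast hk) z (C := M) (D := (2 + B) * bracket s)
    (fun i hi => h.bound i (hi.trans hk) _) hD
  refine h5.trans ?_
  have h2 : (k.factorial : ℝ) ≤ N.factorial := by exact_mod_cast Nat.factorial_le hk
  have h3 : (2 + B) ^ k ≤ (2 + B) ^ N := pow_le_pow_right₀ (by linarith) hk
  have hM := h.nonneg
  rw [mul_pow]
  calc (k.factorial : ℝ) * M * ((2 + B) ^ k * bracket s ^ k)
      ≤ N.factorial * M * ((2 + B) ^ N * bracket s ^ k) := by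
        have : 0 ≤ bracket s ^ k := pow_nonneg (by linarith) k
        gcongr
    _ = _ := by ring

/-! ### The time derivative of the density -/

theorem IsClock.hasDerivAt_velAvg {K : Set Phase} {ν μ : Phase → ℝ} (hc : IsClock K ν μ) {M : ℝ}
    {b : ℝ × Phase → ℝ} (h : IsOsc K 1 M b) (s : ℝ) (x : E3) :
    HasDerivAt (fun s => velAvg ν b s x)
      (velAvg ν (angDeriv fun p => -(ν p.2 * b p)) s x) s := by
  have hK := hc.compact
  have hb : ContDiff ℝ 1 b := h.contDiff
  have hν1 : ContDiff ℝ 1 ν := hc.smooth.of_le (by exact_mod_cast le_top)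
  set F : ℝ × E3 → ℝ := fun q => b (-(q.1 * ν (x, q.2)), (x, q.2)) with hF
  have hFs : ContDiff ℝ 1 F := by fun_prop
  have h1 := (hasFDerivAt_setIntegral (μ := (volume : Measure E3)) hFs
    (hK.image continuous_snd) s).hasDerivAt
  have e0 : ∀ s, ∫ v in Prod.snd '' K, F (s, v) = velAvg ν b s x := fun s =>
    setIntegral_eq_integral_velocity (G := fun z => b (-(s * ν z), z))
      (fun z hz => h.eval_eq_zero hz) x
  simp only [e0] at h1
  refine h1.congr_deriv ?_
  have hcs : IsOsc K 0 M (angDeriv b) := h.angDeriv hK.isClosed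
  have hang : ∀ q : ℝ × Phase, angDeriv (fun p : ℝ × Phase => -(ν p.2 * b p)) q =
      -(ν q.2 * angDeriv b q) := by
    intro q
    have h1 := hasDerivAt_angle (b := fun p : ℝ × Phase => -(ν p.2 * b p)) (by fun_prop) 0 q.2 q.1
    have h2 := ((hasDerivAt_angle hb 0 q.2 q.1).const_mul (ν q.2)).neg
    simpa using h1.unique h2
  rw [ContinuousLinearMap.integral_apply]
  · rw [velAvg, ← setIntegral_eq_integral_velocity (K := K)
      (G := fun z => angDeriv (fun p => -(ν p.2 * b p)) (-(s * ν z), z))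
      (fun z hz => by rw [hang, hcs.eval_eq_zero hz, mul_zero, neg_zero]) x]
    congr 1
    funext v
    rw [hang]
    have h2 : HasDerivAt (fun s => F (s, v))
        (((fderiv ℝ F (s, v)).comp (ContinuousLinearMap.inl ℝ ℝ E3)) 1) s := by
      have h3 : HasFDerivAt F (fderiv ℝ F (s, v)) (s, v) :=
        (hFs.differentiable (by simp) _).hasFDerivAt
      exact (HasFDerivAt.comp (f := fun s : ℝ => (s, v)) s h3
        (hasFDerivAt_prodMk_left s v)).hasDerivAt
    have h4 := (hasDerivAt_angle hb 0 (x, v) (-(s * ν (x, v))))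
    simp only [zero_add] at h4
    have h5 : HasDerivAt (fun s : ℝ => -(s * ν (x, v))) (-ν (x, v)) s := by
      simpa using ((hasDerivAt_id s).mul_const (ν (x, v))).fun_neg
    have h6 := HasDerivAt.comp (h₂ := fun τ => b (τ, (x, v))) s h4 h5
    rw [h2.unique h6]
    ring
  · refine ContinuousOn.integrableOn_compact (hK.image continuous_snd) (Continuous.continuousOn ?_)
    exact ((hFs.continuous_fderiv (by simp)).comp (Continuous.prodMk_right s)).clm_comp
      continuous_const

end

section

open Filter Topology

/-! ### Estimates in Delaunay variables -/

section DirectionalLists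

variable {V : Type*} [NormedAddCommGroup V] [NormedSpace ℝ V]

theorem dlist_congr {F G : V → ℝ} {y : V} (h : F =ᶠ[𝓝 y] G) (l : List V) :
    dlist l F =ᶠ[𝓝 y] dlist l G := by
  induction l with
  | nil => exact h
  | cons w l ih =>
    filter_upwards [ih.fderiv (𝕜 := ℝ)] with x hx
    rw [dlist_cons, dlist_cons]
    simp only [hx]

theorem norm_iteratedFDeriv_dlist_le {F : V → ℝ} {l : List V} (hl : ∀ w ∈ l, ‖w‖ ≤ 1) {y : V}
    (k : ℕ) (hF : ContDiffAt ℝ (k + l.length : ℕ) F y) :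
    ‖iteratedFDeriv ℝ k (dlist l F) y‖ ≤ ‖iteratedFDeriv ℝ (k + l.length) F y‖ := by
  induction l generalizing k with
  | nil => simp
  | cons w l ih =>
    have e : k + (w :: l).length = k + 1 + l.length := by simp; omega
    rw [e] at hF ⊢
    have h1 : ContDiffAt ℝ (k + 1 : ℕ) (dlist l F) y := contDiffAt_dlist l hF
    have h2 : ContDiffAt ℝ k (fderiv ℝ (dlist l F)) y := h1.fderiv_right (by norm_cast)
    rw [dlist_cons]
    refine (norm_iteratedFDeriv_clm_apply_const h2 le_rfl).trans ?_
    rw [norm_iteratedFDeriv_fderiv]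
    refine (mul_le_of_le_one_left (norm_nonneg _) (hl w (by simp))).trans ?_
    exact ih (fun w hw => hl w (by simp [hw])) (k + 1) hF

theorem dlist_comp_of_fderiv_eq {G : V → ℝ} {σ : V → V} {S : Set V} (hS : IsOpen S)
    (hσ : Differentiable ℝ σ) (hσS : MapsTo σ S S) {l : List V}
    (hl : ∀ w ∈ l, ∀ y, fderiv ℝ σ y w = w) (hG : ∀ y ∈ S, ContDiffAt ℝ l.length G y) :
    ∀ y ∈ S, dlist l (fun y => G (σ y)) y = dlist l G (σ y) := by
  induction l with
  | nil => exact fun y _ => rfl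
  | cons w l ih =>
    intro y hy
    have hG' : ∀ y ∈ S, ContDiffAt ℝ (1 + l.length : ℕ) G y := fun y hy =>
      (hG y hy).of_le (by norm_cast; simp; omega)
    have h1 : dlist l (fun y => G (σ y)) =ᶠ[𝓝 y] fun y => dlist l G (σ y) := by
      filter_upwards [hS.mem_nhds hy] with x hx
      exact ih (fun w hw => hl w (by simp [hw]))
        (fun y hy => (hG' y hy).of_le (by norm_cast; omega)) x hx
    have h2 : HasFDerivAt (dlist l G) (fderiv ℝ (dlist l G) (σ y)) (σ y) :=
      ((contDiffAt_dlist l (hG' _ (hσS hy))).differentiableAt (by simp)).hasFDerivAt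
    have h3 : fderiv ℝ (fun y => dlist l G (σ y)) y = _ :=
      (h2.comp y (hσ y).hasFDerivAt).fderiv
    rw [dlist_cons, dlist_cons]
    simp only
    rw [h1.fderiv_eq, h3, ContinuousLinearMap.comp_apply, hl w (by simp)]

end DirectionalLists

section Estimates

variable {X : (Fin 6 → ℝ) → Phase} {c₀ h₀ l₁ l₂ n₀ : ℝ}

theorem IsDelaunayCoordinates.iteratedFDeriv_eq_of_eq (hX : IsDelaunayCoordinates X)
    {y y' : Fin 6 → ℝ} (hy : y ∈ delaunayRange) (hy' : y' ∈ delaunayRange) (h : X y = X y')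
    (j : ℕ) : iteratedFDeriv ℝ j X y = iteratedFDeriv ℝ j X y' := by
  have h1 : X =ᶠ[𝓝 y] fun w => X (w + (y' - y)) := by
    filter_upwards [isOpen_delaunayRange.mem_nhds hy] with w hw
    have := hX.add_eq_of_eq (u := w - y) hy hy' h (by simpa using hw)
    rw [add_sub_cancel] at this
    rw [this]
    congr 1
    abel
  rw [(h1.iteratedFDeriv ℝ j).eq_of_nhds, iteratedFDeriv_comp_add_right, add_sub_cancel]

theorem IsDelaunayCoordinates.exists_bound (hX : IsDelaunayCoordinates X) {K : Set Phase}
    (hK : IsCompact K) (hKD : K ⊆ delaunayDomain) (n : ℕ) : ∃ B : ℝ, 0 ≤ B ∧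
      ∀ j ≤ n, ∀ y ∈ delaunayRange, X y ∈ K → ‖iteratedFDeriv ℝ j X y‖ ≤ B := by
  have hloc : ∀ j : ℕ, ∃ B : ℝ, ∀ y ∈ delaunayRange, X y ∈ K → ‖iteratedFDeriv ℝ j X y‖ ≤ B := by
    intro j
    refine hK.induction_on (p := fun S => ∃ B : ℝ, ∀ y ∈ delaunayRange, X y ∈ S →
      ‖iteratedFDeriv ℝ j X y‖ ≤ B) ⟨0, fun y _ h => h.elim⟩ ?_ ?_ ?_
    · rintro S S' hS ⟨B, hB⟩
      exact ⟨B, fun y hy h => hB y hy (hS h)⟩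
    · rintro S S' ⟨B, hB⟩ ⟨B', hB'⟩
      refine ⟨max B B', fun y hy h => ?_⟩
      rcases h with h | h
      · exact (hB y hy h).trans (le_max_left _ _)
      · exact (hB' y hy h).trans (le_max_right _ _)
    · intro z hz
      obtain ⟨y₀, hy₀, rfl⟩ := hX.exists_eq (hKD hz)
      obtain ⟨φ, h1, h2, h3⟩ := hX.exists_localInverse hy₀
      have h4 : ContinuousAt (fun z => ‖iteratedFDeriv ℝ j X (φ z)‖) (X y₀) := by
        have h5 : ContinuousAt (iteratedFDeriv ℝ j X) (φ (X y₀)) := by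
          rw [h2]
          exact ((hX.contDiffAt hy₀).iteratedFDeriv_right (m := 0) (i := j)
            (by exact_mod_cast le_top)).continuousAt
        exact (ContinuousAt.comp (f := φ) h5 h1.continuousAt).norm
      have h6 : ∀ᶠ z in 𝓝 (X y₀), ‖iteratedFDeriv ℝ j X (φ z)‖ <
          ‖iteratedFDeriv ℝ j X (φ (X y₀))‖ + 1 := h4.eventually_lt_const (by simp)
      refine ⟨_, mem_nhdsWithin_of_mem_nhds (h6.and h3),
        ‖iteratedFDeriv ℝ j X (φ (X y₀))‖ + 1, fun y hy h => ?_⟩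
      rw [hX.iteratedFDeriv_eq_of_eq hy h.2.1 h.2.2.symm]
      exact h.1.le
  choose C hC using hloc
  refine ⟨∑ j ∈ Finset.range (n + 1), |C j|, Finset.sum_nonneg fun _ _ => abs_nonneg _,
    fun j hj y hy h => (hC j y hy h).trans ((le_abs_self _).trans ?_)⟩
  exact Finset.single_le_sum (f := fun j => |C j|) (fun _ _ => abs_nonneg _)
    (Finset.mem_range.2 (by omega))

theorem IsDelaunayCoordinates.exists_bound_comp (hX : IsDelaunayCoordinates X) {K : Set Phase}
    (hK : IsCompact K) (hKD : K ⊆ delaunayDomain) (N : ℕ) : ∃ C : ℝ, 0 ≤ C ∧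
      ∀ (A : ℝ) (g : Phase → ℝ), 0 ≤ A → ContDiff ℝ N g → (∀ z ∉ K, g z = 0) →
        (∀ k ≤ N, ∀ z, ‖iteratedFDeriv ℝ k g z‖ ≤ A) →
        ∀ j ≤ N, ∀ y ∈ delaunayRange, ‖iteratedFDeriv ℝ j (fun y => g (X y)) y‖ ≤ C * A := by
  obtain ⟨B, hB0, hB⟩ := hX.exists_bound hK hKD N
  refine ⟨(N.factorial : ℝ) * (1 + B) ^ N, by positivity, fun A g hA hg hg0 hgA j hj y hy => ?_⟩
  by_cases hyK : X y ∈ K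
  · have hi := iteratedFDerivWithin_of_isOpen (𝕜 := ℝ) (f := fun y => g (X y)) j
      isOpen_delaunayRange hy
    rw [← hi]
    have h1 := norm_iteratedFDerivWithin_comp_le (𝕜 := ℝ) (g := g) (f := X) (t := univ)
      (s := delaunayRange) (n := j) (N := N) (C := A) (D := 1 + B) hg.contDiffOn
      (hX.smooth.of_le (by exact_mod_cast le_top)) (by exact_mod_cast hj) uniqueDiffOn_univ
      isOpen_delaunayRange.uniqueDiffOn (mapsTo_univ _ _) hy
      (fun i hi => by rw [iteratedFDerivWithin_univ]; exact hgA i (hi.trans hj) _)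
      fun i hi1 hi2 => ?_
    · refine h1.trans ?_
      have h2 : (j.factorial : ℝ) ≤ N.factorial := by exact_mod_cast Nat.factorial_le hj
      have h3 : (1 + B) ^ j ≤ (1 + B) ^ N := pow_le_pow_right₀ (by linarith) hj
      calc (j.factorial : ℝ) * A * (1 + B) ^ j ≤ N.factorial * A * (1 + B) ^ N := by gcongr
        _ = _ := by ring
    · rw [iteratedFDerivWithin_of_isOpen i isOpen_delaunayRange hy]
      refine (hB i (hi2.trans hj) y hy hyK).trans ?_
      calc B ≤ (1 + B) ^ 1 := by linarith
        _ ≤ _ := pow_le_pow_right₀ (by linarith) hi1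
  · have h0 : (fun y => g (X y)) =ᶠ[𝓝 y] fun _ => 0 := by
      filter_upwards [(hX.contDiffAt hy).continuousAt.eventually_mem
        (hK.isClosed.isOpen_compl.mem_nhds hyK)] with w hw using hg0 _ hw
    rw [(h0.iteratedFDeriv ℝ j).eq_of_nhds, iteratedFDeriv_fun_zero]
    simp only [Pi.zero_apply, norm_zero]
    positivity

theorem norm_dirDelaunay (i : Fin 6) : ‖dirDelaunay i‖ = 1 := by
  rw [dirDelaunay, Pi.norm_single, norm_one]

theorem exists_dirList_dirDelaunay (i : Fin 6 → ℕ) : ∃ l : List (Fin 6 → ℝ),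
    dirList dirDelaunay i = List.replicate (i 0) (dirDelaunay 0) ++ l ∧ l.length + i 0 = order i ∧
      ∀ w ∈ l, w 0 = 0 ∧ ‖w‖ ≤ 1 := by
  have h1 : dirList dirDelaunay i = List.replicate (i 0) (dirDelaunay 0) ++
      (List.finRange 5).flatMap fun j => List.replicate (i j.succ) (dirDelaunay j.succ) := by
    rw [dirList, List.finRange_succ, List.flatMap_cons, List.flatMap_map]
  refine ⟨_, h1, ?_, ?_⟩
  · have h2 := length_dirList dirDelaunay i
    rw [h1, List.length_append, List.length_replicate] at h2
    rw [← h2, add_comm]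
  · intro w hw
    simp only [List.mem_flatMap, List.mem_replicate] at hw
    obtain ⟨j, -, -, rfl⟩ := hw
    exact ⟨by simp [dirDelaunay], (norm_dirDelaunay _).le⟩

/-- The flow of a multiple `t h` of the angular direction, where `h` depends on the action. -/
def angleShift (h : ℝ → ℝ) (t : ℝ) (y : Fin 6 → ℝ) : Fin 6 → ℝ :=
  y + (-(t * h (y 0))) • dirDelaunay 3

theorem contDiff_angleShift {h : ℝ → ℝ} (hh : ContDiff ℝ ∞ h) (t : ℝ) :
    ContDiff ℝ ∞ (angleShift h t) := by
  unfold angleShift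
  fun_prop

theorem norm_iteratedFDeriv_angleShift_le {h : ℝ → ℝ} (hh : ContDiff ℝ ∞ h) {n : ℕ} {B : ℝ}
    (hB0 : 0 ≤ B) (hB : ∀ j ≤ n, ∀ r, ‖iteratedFDeriv ℝ j h r‖ ≤ B) (t : ℝ) {i : ℕ} (hi : 1 ≤ i)
    (hin : i ≤ n) (y : Fin 6 → ℝ) :
    ‖iteratedFDeriv ℝ i (angleShift h t) y‖ ≤ ((1 + B) * bracket t) ^ i := by
  set P := ContinuousLinearMap.proj (R := ℝ) (φ := fun _ : Fin 6 => ℝ) 0 with hP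
  set L := ContinuousLinearMap.toSpanSingleton ℝ (dirDelaunay 3) with hL
  have hLn : ‖L‖ = 1 := by
    rw [hL, ContinuousLinearMap.norm_toSpanSingleton, norm_dirDelaunay]
  have hPn : ‖P‖ ≤ 1 := ContinuousLinearMap.opNorm_le_bound _ zero_le_one fun y => by
    rw [one_mul]
    exact norm_le_pi_norm y 0
  have hcomp : ContDiff ℝ ∞ (h ∘ P) := hh.comp P.contDiff
  have e : angleShift h t = fun y => y + (-t) • (L ∘ (h ∘ P)) y := by
    funext y
    simp [angleShift, hL, hP, ContinuousLinearMap.toSpanSingleton_apply, smul_smul]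
  have hLc : ContDiff ℝ ∞ (L ∘ (h ∘ P)) := L.contDiff.comp hcomp
  have h1 : iteratedFDeriv ℝ i (angleShift h t) y = iteratedFDeriv ℝ i (fun y => y) y +
      (-t) • iteratedFDeriv ℝ i (L ∘ (h ∘ P)) y := by
    have hLi : ContDiff ℝ i (L ∘ (h ∘ P)) := hLc.of_le (by exact_mod_cast le_top)
    rw [e, ← iteratedFDeriv_const_smul_apply hLi.contDiffAt]
    exact iteratedFDeriv_add_apply (f := fun y : Fin 6 → ℝ => y) (g := (-t) • (L ∘ (h ∘ P)))
      contDiffAt_id (hLi.const_smul (-t)).contDiffAt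
  have h2 : ‖iteratedFDeriv ℝ i (h ∘ P) y‖ ≤ B := by
    rw [P.iteratedFDeriv_comp_right hh y (by exact_mod_cast le_top)]
    refine (ContinuousMultilinearMap.norm_compContinuousLinearMap_le _ _).trans ?_
    refine (mul_le_of_le_one_right (norm_nonneg _) ?_).trans (hB i hin _)
    exact Finset.prod_le_one (fun _ _ => norm_nonneg _) fun _ _ => hPn
  have h3 : ‖iteratedFDeriv ℝ i (L ∘ (h ∘ P)) y‖ ≤ B := by
    refine (L.norm_iteratedFDeriv_comp_left hcomp.contDiffAt (by exact_mod_cast le_top)).trans ?_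
    rw [hLn, one_mul]
    exact h2
  have hb := one_le_bracket t
  have h4 : (1 : ℝ) ≤ (1 + B) * bracket t := by nlinarith
  rw [h1]
  refine (norm_add_le _ _).trans ?_
  rw [norm_smul, Real.norm_eq_abs, abs_neg]
  calc ‖iteratedFDeriv ℝ i (fun y : Fin 6 → ℝ => y) y‖ + |t| * ‖iteratedFDeriv ℝ i (L ∘ (h ∘ P)) y‖
      ≤ bracket t + bracket t * B := add_le_add ((norm_iteratedFDeriv_id_le hi y).trans hb)
        (mul_le_mul (abs_le_bracket t) h3 (norm_nonneg _) (by linarith))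
    _ = ((1 + B) * bracket t) ^ 1 := by ring
    _ ≤ _ := pow_le_pow_right₀ h4 hi

theorem exists_delaunay_growth (hX : IsDelaunayCoordinates X) (hc₀ : 0 < c₀) (hh₀ : 0 < h₀)
    (hl₁ : 0 < l₁) (hn₀ : 0 < n₀) (N : ℕ) : ∃ C : ℝ, 0 ≤ C ∧
      ∀ (A : ℝ) (g : Phase → ℝ) (f : ℝ → Phase → ℝ), 0 ≤ A → ContDiff ℝ N g →
        (∀ z ∉ orbitRegion c₀ h₀ l₁ l₂ n₀, g z = 0) →
        (∀ k ≤ N, ∀ z, ‖iteratedFDeriv ℝ k g z‖ ≤ A) → IsClassicalSolution f g →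
        ∀ t : ℝ, 0 ≤ t → ∀ i : Fin 6 → ℕ, order i ≤ N → ∀ y ∈ delaunayRange,
          |partialDeriv dirDelaunay i (fun y' => f t (X y')) y| ≤ C * A * bracket t ^ (i 0) := by
  set K := orbitRegion c₀ h₀ l₁ l₂ n₀ with hKdef
  have hK : IsCompact K := isCompact_orbitRegion hh₀ hl₁
  have hKD : K ⊆ delaunayDomain := orbitRegion_subset hc₀ hh₀ hl₁ hn₀
  have hKJ : IsCompact (actionJ '' K) := by
    refine hK.image_of_continuousOn fun z hz => ContinuousAt.continuousWithinAt ?_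
    have h1 : 0 < Real.sqrt (-2 * energy z) := Real.sqrt_pos.2 (by have := (hKD hz).2.1; linarith)
    exact continuousAt_const.div
      ((continuousAt_const.mul (contDiffAt_energy (hKD hz).1).continuousAt).sqrt) h1.ne'
  have hKJ0 : actionJ '' K ⊆ Ioi 0 := by
    rintro _ ⟨z, hz, rfl⟩
    have h1 : 0 < Real.sqrt (-2 * energy z) := Real.sqrt_pos.2 (by have := (hKD hz).2.1; linarith)
    exact one_div_pos.2 h1
  obtain ⟨η, hη, hηs, hη0, O, hO, hKO, hη1⟩ := exists_cutoff hKJ isOpen_Ioi hKJ0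
  set h : ℝ → ℝ := fun r => η r • (r ^ 3)⁻¹ with hh
  have hhs : ContDiff ℝ ∞ h := by
    refine contDiff_smul_of_tsupport hη isOpen_Ioi (fun r hr => ?_) hη0
    exact ((contDiffAt_id.pow 3).inv (pow_ne_zero 3 (ne_of_gt hr))).contDiffWithinAt
  obtain ⟨B, hB0, hB⟩ := exists_bound_iteratedFDeriv hhs hηs.smul_right N
  obtain ⟨C, hC0, hC⟩ := hX.exists_bound_comp hK hKD N
  refine ⟨(N.factorial : ℝ) * C * (1 + B) ^ N, by positivity,
    fun A g f hA hg hg0 hgA hf t ht i hi y hy => ?_⟩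
  obtain ⟨l, hl1, hl2, hl3⟩ := exists_dirList_dirDelaunay i
  have hbr := bracket_pos t
  rw [partialDeriv_eq_dlist]
  by_cases hyK : X y ∈ K
  · set G : (Fin 6 → ℝ) → ℝ := fun y => g (X y) with hG
    have hGs : ∀ y ∈ delaunayRange, ContDiffAt ℝ N G y := fun y hy =>
      ContDiffAt.comp (g := g) y hg.contDiffAt ((hX.contDiffAt hy).of_le (by exact_mod_cast le_top))
    have hσ := contDiff_angleShift hhs t
    have hσ0 : ∀ y, angleShift h t y 0 = y 0 := fun y => by simp [angleShift, dirDelaunay]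
    have hσS : MapsTo (angleShift h t) delaunayRange delaunayRange := fun y hy =>
      add_smul_mem_delaunayRange hy _
    have hy0 : y 0 ∈ O := by
      have h1 := congrArg Prod.fst (hX.delaunay_eq y hy)
      exact hKO ⟨_, hyK, h1⟩
    have hev : (fun y' => f t (X y')) =ᶠ[𝓝 y] fun y => G (angleShift h t y) := by
      filter_upwards [isOpen_delaunayRange.mem_nhds hy,
        (continuous_apply (0 : Fin 6)).continuousAt.eventually_mem (hO.mem_nhds hy0)] with w hw hw0
      rw [hf.comp_delaunay hX ht hw, hG]
      simp only [angleShift, hh]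
      rw [hη1 _ hw0, one_smul]
    have hfd : ∀ w ∈ l, ∀ y, fderiv ℝ (angleShift h t) y w = w := by
      intro w hw y
      have h1 : HasFDerivAt (fun y : Fin 6 → ℝ => h (y 0)) ((fderiv ℝ h (y 0)).comp
          (ContinuousLinearMap.proj (R := ℝ) (φ := fun _ : Fin 6 => ℝ) 0)) y :=
        HasFDerivAt.comp (f := fun y : Fin 6 → ℝ => y 0) y
          (hhs.differentiable (by simp) _).hasFDerivAt
          (ContinuousLinearMap.proj (R := ℝ) (φ := fun _ : Fin 6 => ℝ) 0).hasFDerivAt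
      have h2 := (hasFDerivAt_id (𝕜 := ℝ) y).add (((h1.const_mul t).neg).smul_const (dirDelaunay 3))
      have h3 : fderiv ℝ (angleShift h t) y = _ := h2.fderiv
      rw [h3]
      simp [(hl3 w hw).1]
    have hev2 : dlist l (fun y' => f t (X y')) =ᶠ[𝓝 y] fun y => dlist l G (angleShift h t y) := by
      refine (dlist_congr hev l).trans ?_
      filter_upwards [isOpen_delaunayRange.mem_nhds hy] with w hw
      exact dlist_comp_of_fderiv_eq isOpen_delaunayRange (hσ.differentiable (by simp)) hσS hfd
        (fun y hy => (hGs y hy).of_le (by norm_cast; omega)) w hw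
    have hG1 : ∀ y ∈ delaunayRange, ContDiffAt ℝ (i 0) (dlist l G) y := fun y hy =>
      contDiffAt_dlist l ((hGs y hy).of_le (by norm_cast; omega))
    rw [hl1, dlist_append, (dlist_congr hev2 _).eq_of_nhds]
    have hcd : ContDiffAt ℝ (i 0) (fun y => dlist l G (angleShift h t y)) y :=
      ContDiffAt.comp (g := dlist l G) y (hG1 _ (hσS hy))
        (hσ.contDiffAt.of_le (by exact_mod_cast le_top))
    refine (abs_dlist_le (fun w hw => ?_) (by rw [List.length_replicate]; exact hcd)).trans ?_
    · rw [List.eq_of_mem_replicate hw]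
      exact (norm_dirDelaunay _).le
    rw [List.length_replicate]
    have hiw := iteratedFDerivWithin_of_isOpen (𝕜 := ℝ)
      (f := fun y => dlist l G (angleShift h t y)) (i 0) isOpen_delaunayRange hy
    rw [← hiw]
    have h1 := norm_iteratedFDerivWithin_comp_le (𝕜 := ℝ) (g := dlist l G) (f := angleShift h t)
      (t := delaunayRange) (s := delaunayRange) (n := i 0) (N := (i 0 : ℕ)) (C := C * A)
      (D := (1 + B) * bracket t) (fun y hy => (hG1 y hy).contDiffWithinAt)
      (hσ.of_le (by exact_mod_cast le_top)).contDiffOn le_rfl isOpen_delaunayRange.uniqueDiffOn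
      isOpen_delaunayRange.uniqueDiffOn hσS hy (fun j hj => ?_) fun j hj1 hj2 => ?_
    · refine h1.trans ?_
      have hi0 : i 0 ≤ N := by omega
      have h2 : ((i 0).factorial : ℝ) ≤ N.factorial := by exact_mod_cast Nat.factorial_le hi0
      have h3 : (1 + B) ^ (i 0) ≤ (1 + B) ^ N := pow_le_pow_right₀ (by linarith) hi0
      rw [mul_pow]
      calc ((i 0).factorial : ℝ) * (C * A) * ((1 + B) ^ (i 0) * bracket t ^ (i 0))
          ≤ N.factorial * (C * A) * ((1 + B) ^ N * bracket t ^ (i 0)) := by gcongr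
        _ = _ := by ring
    · rw [iteratedFDerivWithin_of_isOpen j isOpen_delaunayRange (hσS hy)]
      have hjl : j + l.length ≤ N := by omega
      exact (norm_iteratedFDeriv_dlist_le (fun w hw => (hl3 w hw).2) j
        ((hGs _ (hσS hy)).of_le (by exact_mod_cast hjl))).trans
        (hC A g hA hg hg0 hgA _ hjl _ (hσS hy))
    · rw [iteratedFDerivWithin_of_isOpen j isOpen_delaunayRange hy]
      exact norm_iteratedFDeriv_angleShift_le hhs hB0 hB t hj1 (by omega) y
  · have h0 : (fun y' => f t (X y')) =ᶠ[𝓝 y] fun _ => 0 := by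
      filter_upwards [(hX.contDiffAt hy).continuousAt.eventually_mem
        (hK.isClosed.isOpen_compl.mem_nhds hyK)] with w hw using hf.eq_zero hh₀ hl₁ hg0 ht hw
    rw [(dlist_congr h0 _).eq_of_nhds]
    have h1 : ∀ l : List (Fin 6 → ℝ), dlist l (fun _ : Fin 6 → ℝ => (0 : ℝ)) = fun _ => 0 := by
      intro l
      induction l with
      | nil => rfl
      | cons w l ih =>
        rw [dlist_cons, ih]
        simp
    rw [h1, abs_zero]
    positivity

end Estimates

end

section

open Filter Topology
open UnitAddTorus

/-! ### Multipliers of Hilbert transform type on the torus -/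

local instance : MeasureSpace UnitAddCircle := ⟨AddCircle.haarAddCircle⟩

local instance : Measure.IsAddHaarMeasure (volume : Measure UnitAddCircle) :=
  inferInstanceAs (Measure.IsAddHaarMeasure AddCircle.haarAddCircle)

/-- The three-dimensional torus. -/
abbrev Torus3 : Type := UnitAddTorus (Fin 3)

/-- Trigonometric polynomials, as finitely supported families of Fourier coefficients. -/
abbrev TrigPoly : Type := (Fin 3 → ℤ) →₀ ℂ

namespace TrigPoly

/-- The function represented by a trigonometric polynomial. -/
def eval : TrigPoly →ₗ[ℂ] C(Torus3, ℂ) := Finsupp.linearCombination ℂ mFourier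

theorem eval_single (k : Fin 3 → ℤ) (a : ℂ) : eval (Finsupp.single k a) = a • mFourier k := by
  simp [eval]

/-- The Fourier multiplier with symbol `m`. -/
def multiplier (m : (Fin 3 → ℤ) → ℂ) : TrigPoly →ₗ[ℂ] TrigPoly :=
  Finsupp.linearCombination ℂ fun k => Finsupp.single k (m k)

theorem multiplier_single (m : (Fin 3 → ℤ) → ℂ) (k : Fin 3 → ℤ) (a : ℂ) :
    multiplier m (Finsupp.single k a) = Finsupp.single k (a * m k) := by
  simp [multiplier]

theorem multiplier_apply (m : (Fin 3 → ℤ) → ℂ) (c : TrigPoly) (k : Fin 3 → ℤ) :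
    multiplier m c k = m k * c k := by
  induction c using Finsupp.induction_linear with
  | zero => simp
  | add f g hf hg => simp [hf, hg, mul_add]
  | single l a =>
    rw [multiplier_single]
    by_cases h : l = k
    · subst h; simp [mul_comm]
    · simp [h]

/-- Multiplication of trigonometric polynomials. -/
def mul : TrigPoly →ₗ[ℂ] TrigPoly →ₗ[ℂ] TrigPoly :=
  Finsupp.linearCombination ℂ fun k =>
    Finsupp.linearCombination ℂ fun l => Finsupp.single (k + l) 1

theorem mul_single (k l : Fin 3 → ℤ) (a b : ℂ) :
    mul (Finsupp.single k a) (Finsupp.single l b) = Finsupp.single (k + l) (a * b) := by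
  simp [mul]

theorem eval_mul (c d : TrigPoly) : eval (mul c d) = eval c * eval d := by
  induction c using Finsupp.induction_linear with
  | zero => simp
  | add f g hf hg => simp [hf, hg, add_mul]
  | single k a =>
    induction d using Finsupp.induction_linear with
    | zero => simp
    | add f g hf hg => simp only [map_add, hf, hg, mul_add]
    | single l b =>
      rw [mul_single, eval_single, eval_single, eval_single]
      ext t
      simp only [ContinuousMap.smul_apply, ContinuousMap.mul_apply, mFourier_add, smul_eq_mul]
      ring

/-- Symbols of Hilbert transform type. -/
structure IsSign (s : (Fin 3 → ℤ) → ℂ) : Prop where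
  norm_eq : ∀ k, ‖s k‖ = 1
  cotlar : ∀ k l, s k * s l + 1 = s (k + l) * (s k + s l)

/-- The polarised Cotlar identity. -/
theorem IsSign.polarised {s : (Fin 3 → ℤ) → ℂ} (hs : IsSign s) (c d : TrigPoly) :
    mul (multiplier s c) (multiplier s d) + mul c d =
      multiplier s (mul c (multiplier s d)) + multiplier s (mul (multiplier s c) d) := by
  induction c using Finsupp.induction_linear with
  | zero => simp
  | add f g hf hg =>
    simp only [map_add, LinearMap.add_apply]
    rw [add_add_add_comm, hf, hg]
    abel
  | single k a =>
    induction d using Finsupp.induction_linear with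
    | zero => simp
    | add f g hf hg =>
      simp only [map_add] at *
      rw [add_add_add_comm, hf, hg]
      abel
    | single l b =>
      simp only [multiplier_single, mul_single, ← Finsupp.single_add]
      congr 1
      linear_combination (a * b) * hs.cotlar k l

theorem mul_comm' (c d : TrigPoly) : mul c d = mul d c := by
  induction c using Finsupp.induction_linear with
  | zero => simp
  | add f g hf hg => simp only [map_add, LinearMap.add_apply, hf, hg]
  | single k a =>
    induction d using Finsupp.induction_linear with
    | zero => simp
    | add f g hf hg => simp only [map_add, LinearMap.add_apply, hf, hg]
    | single l b => rw [mul_single, mul_single, add_comm, _root_.mul_comm]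

/-- **Cotlar's identity**. -/
theorem IsSign.cotlar_identity {s : (Fin 3 → ℤ) → ℂ} (hs : IsSign s) (c : TrigPoly) (t : Torus3) :
    eval (multiplier s c) t ^ 2 + eval c t ^ 2 =
      2 * eval (multiplier s (mul c (multiplier s c))) t := by
  have h := congrArg (fun x => eval x t) (hs.polarised c c)
  rw [mul_comm' (multiplier s c) c] at h
  simp only [map_add, eval_mul, ContinuousMap.add_apply, ContinuousMap.mul_apply] at h
  linear_combination h

theorem mFourierCoeff_eval (c : TrigPoly) (k : Fin 3 → ℤ) : mFourierCoeff (eval c) k = c k := by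
  induction c using Finsupp.induction_linear with
  | zero => simp [mFourierCoeff]
  | add f g hf hg =>
    rw [Finsupp.add_apply, ← hf, ← hg]
    simp only [mFourierCoeff, map_add, ContinuousMap.add_apply, smul_add]
    refine integral_add ?_ ?_ <;>
    exact Continuous.integrable_of_hasCompactSupport (by fun_prop) (HasCompactSupport.of_compactSpace _)
  | single l a =>
    have h := orthonormal_iff_ite.1 (orthonormal_mFourier (d := Fin 3)) k l
    simp only [ContinuousMap.inner_toLp, ← mFourier_neg] at h
    rw [eval_single, Finsupp.single_apply]
    simp only [mFourierCoeff, ContinuousMap.smul_apply, smul_eq_mul]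
    rw [show (fun t => mFourier (-k) t * (a * mFourier l t)) =
      fun t : Torus3 => a * (mFourier l t * mFourier (-k) t) from funext fun t => by ring,
      integral_const_mul, h]
    by_cases hkl : k = l
    · simp [hkl]
    · simp [hkl, Ne.symm hkl]

end TrigPoly

/-- **Parseval**: smaller Fourier coefficients give a smaller `L²` norm. -/
theorem integral_sq_le_of_mFourierCoeff {F G : Torus3 → ℂ} (hF : MemLp F 2) (hG : MemLp G 2)
    (h : ∀ k, ‖mFourierCoeff G k‖ ≤ ‖mFourierCoeff F k‖) :
    ∫ t, ‖G t‖ ^ 2 ≤ ∫ t, ‖F t‖ ^ 2 := by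
  have key : ∀ {H : Torus3 → ℂ} (hH : MemLp H 2),
      HasSum (fun k => ‖mFourierCoeff H k‖ ^ 2) (∫ t, ‖H t‖ ^ 2) := by
    intro H hH
    have h1 := hasSum_sq_mFourierCoeff (hH.toLp H)
    have h2 : ∀ k, mFourierCoeff (hH.toLp H) k = mFourierCoeff H k := fun k =>
      integral_congr_ae (hH.coeFn_toLp.mono fun t ht => by simp only [ht])
    have h3 : ∫ t, ‖(hH.toLp H) t‖ ^ 2 = ∫ t, ‖H t‖ ^ 2 :=
      integral_congr_ae (hH.coeFn_toLp.mono fun t ht => by simp only [ht])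
    simpa only [h2, h3] using h1
  exact hasSum_le (fun k => by gcongr; exact h k) (key hG) (key hF)

namespace TrigPoly

theorem integrable_norm_pow (c : TrigPoly) (n : ℕ) : Integrable fun t => ‖eval c t‖ ^ n :=
  Continuous.integrable_of_hasCompactSupport (by fun_prop) (HasCompactSupport.of_compactSpace _)

theorem memLp_eval (c : TrigPoly) (p : ℝ≥0∞) : MemLp (eval c) p :=
  (eval c).continuous.memLp_of_hasCompactSupport (HasCompactSupport.of_compactSpace _)

/-- A multiplier of Hilbert transform type is bounded on `L^p` for `p` a power of two. -/
theorem exists_integral_sign_le (n : ℕ) : ∃ C : ℝ, 0 ≤ C ∧ ∀ s, IsSign s → ∀ c : TrigPoly,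
    ∫ t, ‖eval (multiplier s c) t‖ ^ (2 ^ (n + 1)) ≤ C * ∫ t, ‖eval c t‖ ^ (2 ^ (n + 1)) := by
  induction n with
  | zero =>
    refine ⟨1, zero_le_one, fun s hs c => ?_⟩
    rw [one_mul]
    simpa using integral_sq_le_of_mFourierCoeff (memLp_eval c 2) (memLp_eval (multiplier s c) 2)
      fun k => by rw [mFourierCoeff_eval, mFourierCoeff_eval, multiplier_apply, norm_mul,
        hs.norm_eq, one_mul]
  | succ n ih =>
    obtain ⟨C, hC, h⟩ := ih
    set q : ℕ := 2 ^ (n + 1) with hq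
    set D : ℝ := 2 ^ (q - 1) with hD
    have hD0 : 0 < D := by positivity
    set B : ℝ := D * 2 ^ q * C with hB
    have hB0 : 0 ≤ B := by positivity
    refine ⟨2 * D + B ^ 2, by positivity, fun s hs c => ?_⟩
    have hpow : 2 ^ (n + 1 + 1) = 2 * q := by rw [hq, pow_succ 2 (n + 1), _root_.mul_comm]
    rw [hpow]
    set F := fun t => ‖eval c t‖ ^ q with hF
    set G := fun t => ‖eval (multiplier s c) t‖ ^ q with hG
    set P := fun t => ‖eval (multiplier s (mul c (multiplier s c))) t‖ ^ q with hP
    have hF2 : ∀ t, ‖eval c t‖ ^ (2 * q) = F t ^ 2 := fun t => by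
      rw [hF, _root_.mul_comm, pow_mul]
    have hG2 : ∀ t, ‖eval (multiplier s c) t‖ ^ (2 * q) = G t ^ 2 := fun t => by
      rw [hG, _root_.mul_comm, pow_mul]
    have iF : Integrable fun t => F t ^ 2 := by
      simpa only [← hF2] using integrable_norm_pow c (2 * q)
    have iG : Integrable fun t => G t ^ 2 := by
      simpa only [← hG2] using integrable_norm_pow (multiplier s c) (2 * q)
    have iP : Integrable P := integrable_norm_pow _ q
    have iFG : Integrable fun t => F t * G t := by
      simpa only [eval_mul, ContinuousMap.mul_apply, norm_mul, mul_pow] using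
        integrable_norm_pow (mul c (multiplier s c)) q
    have hpt : ∀ t, G t ^ 2 ≤ D * (F t ^ 2 + 2 ^ q * P t) := by
      intro t
      have h1 : ‖eval (multiplier s c) t‖ ^ 2 ≤
          ‖eval c t‖ ^ 2 + 2 * ‖eval (multiplier s (mul c (multiplier s c))) t‖ := by
        rw [← norm_pow, ← norm_pow, eq_sub_of_add_eq (hs.cotlar_identity c t)]
        refine (norm_sub_le _ _).trans ?_
        rw [norm_mul, Complex.norm_ofNat]
        linarith
      have h2 : G t ^ 2 = (‖eval (multiplier s c) t‖ ^ 2) ^ q := by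
        rw [← hG2, pow_mul]
      have h3 : F t ^ 2 = (‖eval c t‖ ^ 2) ^ q := by
        rw [← hF2, pow_mul]
      rw [h2, h3, hP, ← mul_pow]
      exact (pow_le_pow_left₀ (by positivity) h1 q).trans
        (add_pow_le (by positivity) (by positivity) q)
    have hint : ∫ t, G t ^ 2 ≤ D * (∫ t, F t ^ 2) + D * 2 ^ q * ∫ t, P t := by
      calc ∫ t, G t ^ 2 ≤ ∫ t, D * (F t ^ 2 + 2 ^ q * P t) :=
            integral_mono iG ((iF.add (iP.const_mul _)).const_mul _) hpt
        _ = _ := by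
            rw [integral_const_mul, integral_add iF (iP.const_mul _), integral_const_mul]
            ring
    have hPle : ∫ t, P t ≤ C * ∫ t, F t * G t := by
      simpa only [eval_mul, ContinuousMap.mul_apply, norm_mul, mul_pow] using
        h s hs (mul c (multiplier s c))
    have hyoung : B * ∫ t, F t * G t ≤ B ^ 2 / 2 * (∫ t, F t ^ 2) + 1 / 2 * ∫ t, G t ^ 2 := by
      rw [← integral_const_mul, ← integral_const_mul, ← integral_const_mul,
        ← integral_add (iF.const_mul _) (iG.const_mul _)]
      refine integral_mono (iFG.const_mul _) ((iF.const_mul _).add (iG.const_mul _)) fun t => ?_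
      simp only
      nlinarith [sq_nonneg (B * F t - G t)]
    have h5 : D * 2 ^ q * ∫ t, P t ≤ B * ∫ t, F t * G t := by
      rw [hB, mul_assoc (D * 2 ^ q)]
      exact mul_le_mul_of_nonneg_left hPle (by positivity)
    simp only [hF2, hG2]
    nlinarith

end TrigPoly

end

section

open Filter Topology
open UnitAddTorus

/-! ### Riesz transforms on the torus -/

section HalfSpace

/-- The sign of `σ · e`, with value `-1` on the boundary plane. -/
def halfSign (e σ : E3) : ℝ := if 0 < inner ℝ e σ then 1 else -1

theorem abs_halfSign (e σ : E3) : |halfSign e σ| = 1 := by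
  unfold halfSign; split_ifs <;> simp

theorem measurable_halfSign (e : E3) : Measurable (halfSign e) := by
  refine Measurable.ite ?_ measurable_const measurable_const
  exact measurableSet_lt measurable_const (by fun_prop)

theorem halfSign_map (U : E3 ≃ₗᵢ[ℝ] E3) (e σ : E3) : halfSign (U e) (U σ) = halfSign e σ := by
  simp [halfSign]

/-- The mean of `σ` over the unit ball, weighted by the sign of `σ · e`. -/
def halfMean (e : E3) : E3 := ∫ σ in Metric.ball (0 : E3) 1, halfSign e σ • σ

theorem integrableOn_ball_of_bound {V : Type*} [NormedAddCommGroup V] {h : E3 → V} {C : ℝ}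
    (hm : AEStronglyMeasurable h)
    (hb : ∀ σ, ‖σ‖ ≤ 1 → ‖h σ‖ ≤ C) : IntegrableOn h (Metric.ball 0 1) := by
  refine Measure.integrableOn_of_bounded (M := C) measure_ball_lt_top.ne hm ?_
  filter_upwards [self_mem_ae_restrict measurableSet_ball] with σ hσ
  exact hb σ (by simpa using (mem_ball_zero_iff.1 hσ).le)

theorem integrableOn_halfMean (e : E3) :
    IntegrableOn (fun σ => halfSign e σ • σ) (Metric.ball (0 : E3) 1) := by
  refine integrableOn_ball_of_bound (C := 1)
    ((measurable_halfSign e).smul measurable_id).aestronglyMeasurable fun σ hσ => ?_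
  rw [norm_smul, Real.norm_eq_abs, abs_halfSign, one_mul]
  exact hσ

theorem halfMean_map (U : E3 ≃ₗᵢ[ℝ] E3) (e : E3) : halfMean (U e) = U (halfMean e) := by
  have h1 : U (halfMean e) = ∫ σ in Metric.ball (0 : E3) 1, halfSign (U e) (U σ) • U σ := by
    have := U.toContinuousLinearEquiv.integral_comp_comm
      (μ := volume.restrict (Metric.ball (0 : E3) 1)) fun σ => halfSign e σ • σ
    unfold halfMean
    refine Eq.trans this.symm ?_
    simp only [halfSign_map]
    exact integral_congr_ae (Eventually.of_forall fun σ => map_smul U (halfSign e σ) σ)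
  have h2 := (U.measurePreserving).setIntegral_preimage_emb
    U.toHomeomorph.measurableEmbedding (fun σ => halfSign (U e) σ • σ) (Metric.ball (0 : E3) 1)
  have h3 : U ⁻¹' Metric.ball (0 : E3) 1 = Metric.ball 0 1 := by ext; simp
  rw [h3] at h2
  rw [h1, halfMean, ← h2]

theorem inner_halfMean (e : E3) :
    inner ℝ e (halfMean e) = ∫ σ in Metric.ball (0 : E3) 1, |inner ℝ e σ| := by
  unfold halfMean
  rw [← integral_inner (integrableOn_halfMean e)]
  refine integral_congr_ae (Eventually.of_forall fun σ => ?_)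
  simp only [inner_smul_right]
  unfold halfSign
  split_ifs with h
  · rw [abs_of_pos h, one_mul]
  · rw [abs_of_nonpos (not_lt.1 h)]; ring

/-- The constant in the representation of the Riesz transforms through half-space multipliers. -/
def rieszConst : ℝ := ∫ σ in Metric.ball (0 : E3) 1, |inner ℝ (basisE3 0) σ|

theorem rieszConst_pos : 0 < rieszConst := by
  have hc : Continuous fun σ : E3 => |inner ℝ (basisE3 0) σ| := by fun_prop
  unfold rieszConst
  rw [setIntegral_pos_iff_support_of_nonneg_ae (Eventually.of_forall fun _ => abs_nonneg _)
    (hc.continuousOn.integrableOn_compact (isCompact_closedBall 0 1) |>.mono_set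
      Metric.ball_subset_closedBall)]
  have ho : IsOpen (Function.support (fun σ : E3 => |inner ℝ (basisE3 0) σ|) ∩ Metric.ball 0 1) :=
    hc.isOpen_support.inter Metric.isOpen_ball
  refine ho.measure_pos _ ⟨(1 / 2 : ℝ) • basisE3 0, ?_, ?_⟩
  · simp [inner_smul_right, basisE3]
  · simp [norm_smul, basisE3]
    norm_num

theorem halfMean_eq (e : E3) : halfMean e = (rieszConst / ‖e‖) • e := by
  rcases eq_or_ne e 0 with rfl | he
  · have h := halfMean_map (LinearIsometryEquiv.neg ℝ) (0 : E3)
    simp only [LinearIsometryEquiv.coe_neg, neg_zero] at h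
    rw [smul_zero]
    have h2 : (2 : ℝ) • halfMean 0 = 0 := by
      rw [two_smul]
      nth_rewrite 1 [h]
      exact neg_add_cancel _
    exact (smul_eq_zero.1 h2).resolve_left two_ne_zero
  have h1 := halfMean_map (Submodule.reflection (Submodule.span ℝ {e})) e
  rw [Submodule.reflection_eq_self_iff e |>.2 (Submodule.mem_span_singleton_self e)] at h1
  obtain ⟨a, ha⟩ := Submodule.mem_span_singleton.1
    ((Submodule.reflection_eq_self_iff _).1 h1.symm)
  have hpos : 0 < ‖e‖ := norm_pos_iff.2 he
  set u : E3 := ‖e‖ • basisE3 0 with hu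
  have hun : ‖e‖ = ‖u‖ := by rw [hu, norm_smul, norm_norm]; simp [basisE3]
  have h2 : inner ℝ e (halfMean e) = ‖e‖ * rieszConst := by
    have h3 := Submodule.reflection_sub hun
    have h4 := halfMean_map (Submodule.reflection (Submodule.span ℝ {e - u})ᗮ) e
    have h5 : inner ℝ e (halfMean e) = inner ℝ u (halfMean u) := by
      rw [← LinearIsometryEquiv.inner_map_map (Submodule.reflection (Submodule.span ℝ {e - u})ᗮ),
        ← h4, h3]
    rw [h5, inner_halfMean, rieszConst, ← integral_const_mul]
    refine integral_congr_ae (Eventually.of_forall fun σ => ?_)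
    simp only [hu, real_inner_smul_left, abs_mul, abs_norm]
  rw [← ha, inner_smul_right, real_inner_self_eq_norm_sq] at h2
  rw [← ha]
  congr 1
  field_simp
  have : ‖e‖ * (a * ‖e‖) = ‖e‖ * rieszConst := by linarith
  exact mul_left_cancel₀ hpos.ne' this

theorem integral_halfSign_mul (e : E3) (j : Fin 3) :
    ∫ σ in Metric.ball (0 : E3) 1, halfSign e σ * σ j = rieszConst * (e j / ‖e‖) := by
  have h := (EuclideanSpace.proj (𝕜 := ℝ) j : E3 →L[ℝ] ℝ).integral_comp_comm
    (integrableOn_halfMean e)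
  have h2 := congrArg (fun x : E3 => x j) (halfMean_eq e)
  simp only [PiLp.smul_apply, smul_eq_mul] at h2
  calc _ = (halfMean e) j := by simpa [halfMean] using h
    _ = _ := by rw [h2]; ring

end HalfSpace

local instance : MeasureSpace UnitAddCircle := ⟨AddCircle.haarAddCircle⟩

local instance : IsProbabilityMeasure (volume : Measure UnitAddCircle) :=
  inferInstanceAs (IsProbabilityMeasure AddCircle.haarAddCircle)

/-- A frequency as a vector. -/
def freq (k : Fin 3 → ℤ) : E3 := WithLp.toLp 2 fun i => (k i : ℝ)

theorem freq_add (k l : Fin 3 → ℤ) : freq (k + l) = freq k + freq l := by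
  ext i; simp [freq]

theorem isSign_halfSign (σ : E3) : TrigPoly.IsSign fun k => (halfSign (freq k) σ : ℂ) where
  norm_eq k := by rw [Complex.norm_real, Real.norm_eq_abs, abs_halfSign]
  cotlar k l := by
    norm_cast
    rw [freq_add]
    unfold halfSign
    rw [inner_add_left]
    split_ifs <;> first | (exfalso; linarith) | norm_num

namespace TrigPoly

/-- Trigonometric polynomials as elements of `L^p`. -/
def emb (p : ℝ≥0∞) [Fact (1 ≤ p)] : TrigPoly →ₗ[ℂ] Lp ℂ p (volume : Measure Torus3) :=
  (ContinuousMap.toLp (E := ℂ) p volume ℂ).toLinearMap ∘ₗ eval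

theorem coeFn_emb (p : ℝ≥0∞) [Fact (1 ≤ p)] (c : TrigPoly) : emb p c =ᵐ[volume] eval c :=
  ContinuousMap.coeFn_toLp volume (eval c)

theorem norm_emb_pow (q : ℕ) (hq : q ≠ 0) [Fact (1 ≤ (q : ℝ≥0∞))] (c : TrigPoly) :
    ‖emb q c‖ ^ q = ∫ t, ‖eval c t‖ ^ q := by
  rw [Lp.norm_def, eLpNorm_congr_ae (coeFn_emb q c),
    (memLp_eval c q).eLpNorm_eq_integral_rpow_norm (by exact_mod_cast hq) (by simp),
    ENNReal.toReal_ofReal (by positivity)]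
  simp only [ENNReal.toReal_natCast, Real.rpow_natCast]
  exact Real.rpow_inv_natCast_pow (integral_nonneg fun t => by positivity) hq

theorem exists_norm_emb_sign_le (n : ℕ) [Fact (1 ≤ ((2 ^ (n + 1) : ℕ) : ℝ≥0∞))] :
    ∃ C : ℝ, 0 ≤ C ∧ ∀ s, IsSign s → ∀ c : TrigPoly,
      ‖emb (2 ^ (n + 1) : ℕ) (multiplier s c)‖ ≤ C * ‖emb (2 ^ (n + 1) : ℕ) c‖ := by
  obtain ⟨C, hC, h⟩ := exists_integral_sign_le n
  refine ⟨C + 1, by positivity, fun s hs c => ?_⟩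
  have hq : 2 ^ (n + 1) ≠ 0 := by positivity
  refine le_of_pow_le_pow_left₀ hq (by positivity) ?_
  rw [mul_pow, norm_emb_pow _ hq, norm_emb_pow _ hq]
  refine (h s hs c).trans (mul_le_mul_of_nonneg_right ?_ (integral_nonneg fun t => by positivity))
  calc C ≤ C + 1 := by linarith
    _ ≤ (C + 1) ^ 2 ^ (n + 1) := le_self_pow₀ (by linarith) hq

/-- The symbol of the `j`-th Riesz transform. -/
def rieszSymbol (j : Fin 3) (k : Fin 3 → ℤ) : ℂ := ((freq k j / ‖freq k‖ : ℝ) : ℂ)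

theorem riesz_eq_integral {p : ℝ≥0∞} [Fact (1 ≤ p)] (j : Fin 3) (c : TrigPoly) :
    IntegrableOn (fun σ : E3 => ((σ j : ℝ) : ℂ) •
      emb p (multiplier (fun k => (halfSign (freq k) σ : ℂ)) c)) (Metric.ball 0 1) ∧
    ∫ σ in Metric.ball (0 : E3) 1, ((σ j : ℝ) : ℂ) •
      emb p (multiplier (fun k => (halfSign (freq k) σ : ℂ)) c) =
      (rieszConst : ℂ) • emb p (multiplier (rieszSymbol j) c) := by
  induction c using Finsupp.induction_linear with
  | zero => simp
  | add f g hf hg =>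
    simp only [map_add, smul_add]
    exact ⟨hf.1.add hg.1, by rw [integral_add hf.1 hg.1, hf.2, hg.2]⟩
  | single k a =>
    have key : (fun σ : E3 => ((σ j : ℝ) : ℂ) • emb p (multiplier
        (fun k => (halfSign (freq k) σ : ℂ)) (Finsupp.single k a))) = fun σ =>
        (halfSign (freq k) σ * σ j) • emb p (Finsupp.single k a) := by
      funext σ
      rw [multiplier_single, _root_.mul_comm a, ← smul_eq_mul, ← Finsupp.smul_single, map_smul,
        smul_smul, ← Complex.ofReal_mul, _root_.mul_comm]
      exact Complex.coe_smul _ _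
    have hi : IntegrableOn (fun σ : E3 => halfSign (freq k) σ * σ j) (Metric.ball 0 1) := by
      refine integrableOn_ball_of_bound (C := 1)
        ((measurable_halfSign _).mul (by fun_prop)).aestronglyMeasurable fun σ hσ => ?_
      rw [norm_mul, Real.norm_eq_abs, abs_halfSign, one_mul]
      exact (PiLp.norm_apply_le σ j).trans hσ
    rw [key]
    refine ⟨hi.smul_const _, ?_⟩
    rw [integral_smul_const, integral_halfSign_mul, multiplier_single, _root_.mul_comm a,
      ← smul_eq_mul (rieszSymbol j k), ← Finsupp.smul_single, map_smul, smul_smul, rieszSymbol,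
      ← Complex.ofReal_mul]
    exact (Complex.coe_smul _ _).symm

theorem exists_norm_emb_riesz_le (n : ℕ) [Fact (1 ≤ ((2 ^ (n + 1) : ℕ) : ℝ≥0∞))] :
    ∃ C : ℝ, 0 ≤ C ∧ ∀ j, ∀ c : TrigPoly,
      ‖emb (2 ^ (n + 1) : ℕ) (multiplier (rieszSymbol j) c)‖ ≤
        C * ‖emb (2 ^ (n + 1) : ℕ) c‖ := by
  obtain ⟨C, hC, h⟩ := exists_norm_emb_sign_le n
  refine ⟨rieszConst⁻¹ * (C * volume.real (Metric.ball (0 : E3) 1)),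
    mul_nonneg (inv_nonneg.2 rieszConst_pos.le) (by positivity), fun j c => ?_⟩
  have h1 := (riesz_eq_integral (p := (2 ^ (n + 1) : ℕ)) j c).2
  have h2 : ‖∫ σ in Metric.ball (0 : E3) 1, ((σ j : ℝ) : ℂ) •
      emb (2 ^ (n + 1) : ℕ) (multiplier (fun k => (halfSign (freq k) σ : ℂ)) c)‖ ≤
      (C * ‖emb (2 ^ (n + 1) : ℕ) c‖) * volume.real (Metric.ball (0 : E3) 1) := by
    refine norm_setIntegral_le_of_norm_le_const measure_ball_lt_top fun σ hσ => ?_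
    rw [norm_smul, Complex.norm_real]
    have h3 : ‖σ j‖ ≤ 1 := (PiLp.norm_apply_le σ j).trans (mem_ball_zero_iff.1 hσ).le
    calc _ ≤ 1 * _ := mul_le_mul_of_nonneg_right h3 (norm_nonneg _)
      _ ≤ _ := by rw [one_mul]; exact h _ (isSign_halfSign σ) c
  rw [h1, norm_smul, Complex.norm_real, Real.norm_eq_abs, abs_of_pos rieszConst_pos] at h2
  rw [mul_assoc, inv_mul_eq_div, le_div_iff₀ rieszConst_pos]
  linarith

theorem multiplier_multiplier (m m' : (Fin 3 → ℤ) → ℂ) (c : TrigPoly) :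
    multiplier m (multiplier m' c) = multiplier (fun k => m k * m' k) c := by
  ext k : 1
  simp only [multiplier_apply, mul_assoc]

end TrigPoly

/-- The products of Riesz transforms are bounded on `L^p` of the torus, for `p` a power of two. -/
theorem exists_eLpNorm_riesz_le (n : ℕ) : ∃ C : ℝ, 0 ≤ C ∧ ∀ (i j : Fin 3) (F G : Torus3 → ℂ),
    MemLp F (2 ^ (n + 1) : ℕ) → MemLp G 2 →
    (∀ k, mFourierCoeff G k =
      TrigPoly.rieszSymbol i k * TrigPoly.rieszSymbol j k * mFourierCoeff F k) →
    eLpNorm G (2 ^ (n + 1) : ℕ) volume ≤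
      ENNReal.ofReal C * eLpNorm F (2 ^ (n + 1) : ℕ) volume := by
  set p : ℝ≥0∞ := ((2 ^ (n + 1) : ℕ) : ℝ≥0∞) with hp
  have hp2 : 2 ≤ p := by
    rw [hp]
    exact_mod_cast (by rw [pow_succ]; have := Nat.one_le_two_pow (n := n); omega : 2 ≤ 2 ^ (n + 1))
  have : Fact (1 ≤ p) := ⟨le_trans (by norm_num) hp2⟩
  obtain ⟨C, hC, h⟩ := TrigPoly.exists_norm_emb_riesz_le n
  refine ⟨C * C, by positivity, fun i j F G hF hG hFG => ?_⟩
  set m := fun k => TrigPoly.rieszSymbol i k * TrigPoly.rieszSymbol j k with hm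
  have hsymb : ∀ (j : Fin 3) k, ‖TrigPoly.rieszSymbol j k‖ ≤ 1 := by
    intro j k
    rw [TrigPoly.rieszSymbol, Complex.norm_real, norm_div, norm_norm]
    exact div_le_one_of_le₀ (PiLp.norm_apply_le _ j) (norm_nonneg _)
  have hmle : ∀ k, ‖m k‖ ≤ 1 := fun k => by
    rw [hm, norm_mul]
    exact mul_le_one₀ (hsymb i k) (norm_nonneg _) (hsymb j k)
  have hbd : ∀ c : TrigPoly, eLpNorm (TrigPoly.eval (TrigPoly.multiplier m c)) p volume ≤
      ENNReal.ofReal (C * C) * eLpNorm (TrigPoly.eval c) p volume := by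
    intro c
    have h1 : ‖TrigPoly.emb p (TrigPoly.multiplier m c)‖ ≤ C * C * ‖TrigPoly.emb p c‖ := by
      rw [hm, ← TrigPoly.multiplier_multiplier, mul_assoc]
      exact (h i _).trans (mul_le_mul_of_nonneg_left (h j c) hC)
    have h2 : ∀ c : TrigPoly, eLpNorm (TrigPoly.eval c) p volume =
        ENNReal.ofReal ‖TrigPoly.emb p c‖ := fun c => by
      rw [Lp.norm_def, eLpNorm_congr_ae (TrigPoly.coeFn_emb p c),
        ENNReal.ofReal_toReal (TrigPoly.memLp_eval c p).2.ne]
    rw [h2, h2, ← ENNReal.ofReal_mul (by positivity)]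
    exact ENNReal.ofReal_le_ofReal h1
  have hmem : hF.toLp F ∈ closure (range (TrigPoly.emb p)) := by
    have h1 : (Submodule.span ℂ (range (mFourierLp (d := Fin 3) p)) : Set _) =
        range (TrigPoly.emb p) := by
      have : TrigPoly.emb p = Finsupp.linearCombination ℂ (mFourierLp (d := Fin 3) p) := by
        ext k : 2
        simp [TrigPoly.emb, TrigPoly.eval]
      rw [this, ← Finsupp.range_linearCombination, LinearMap.coe_range]
    have h2 := span_mFourierLp_closure_eq_top (d := Fin 3) (p := p) (by simp [hp])
    rw [← h1, ← Submodule.topologicalClosure_coe, h2]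
    exact mem_univ _
  obtain ⟨u, hu, hlim⟩ := mem_closure_iff_seq_limit.1 hmem
  choose c hc using hu
  have hlim0 : Tendsto (fun n => eLpNorm (⇑(TrigPoly.eval (c n)) - F) p volume) atTop (𝓝 0) := by
    have h1 := Lp.tendsto_Lp_iff_tendsto_eLpNorm' u (hF.toLp F) |>.1 hlim
    refine h1.congr fun n => eLpNorm_congr_ae ?_
    rw [← hc n]
    exact (TrigPoly.coeFn_emb p (c n)).sub hF.coeFn_toLp
  have hlim1 : Tendsto (fun n => eLpNorm (TrigPoly.eval (c n)) p volume) atTop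
      (𝓝 (eLpNorm F p volume)) := by
    have h1 := (ENNReal.continuous_ofReal.tendsto _).comp hlim.norm
    rw [Lp.norm_def, eLpNorm_congr_ae hF.coeFn_toLp, ENNReal.ofReal_toReal hF.2.ne] at h1
    refine h1.congr fun n => ?_
    simp only [Function.comp]
    rw [← hc n, Lp.norm_def, eLpNorm_congr_ae (TrigPoly.coeFn_emb p (c n)),
      ENNReal.ofReal_toReal (TrigPoly.memLp_eval _ p).2.ne]
  have hF2 : MemLp F 2 := hF.mono_exponent hp2
  have hsub : ∀ {H H' : Torus3 → ℂ}, MemLp H 2 → MemLp H' 2 → ∀ k,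
      mFourierCoeff (H - H') k = mFourierCoeff H k - mFourierCoeff H' k := by
    intro H H' hH hH' k
    have hi : ∀ {H : Torus3 → ℂ}, MemLp H 2 → Integrable fun t => mFourier (-k) t • H t := by
      intro H hH
      refine (hH.integrable (by norm_num)).bdd_smul 1
        (mFourier (-k)).continuous.aestronglyMeasurable (Eventually.of_forall fun t => ?_)
      exact ((mFourier (-k)).norm_coe_le_norm t).trans mFourier_norm.le
    simp only [mFourierCoeff, Pi.sub_apply, smul_sub]
    exact integral_sub (hi hH) (hi hH')
  have hL2 : Tendsto (fun n => eLpNorm (⇑(TrigPoly.eval (TrigPoly.multiplier m (c n))) - G) 2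
      volume) atTop (𝓝 0) := by
    refine tendsto_of_tendsto_of_tendsto_of_le_of_le tendsto_const_nhds hlim0
      (fun _ => bot_le) fun n => ?_
    have hA := (TrigPoly.memLp_eval (TrigPoly.multiplier m (c n)) 2).sub hG
    have hB := (TrigPoly.memLp_eval (c n) 2).sub hF2
    refine le_trans ?_ (eLpNorm_le_eLpNorm_of_exponent_le hp2 (hB.1))
    rw [hA.eLpNorm_eq_integral_rpow_norm (by norm_num) (by norm_num),
      hB.eLpNorm_eq_integral_rpow_norm (by norm_num) (by norm_num)]
    refine ENNReal.ofReal_le_ofReal (Real.rpow_le_rpow (integral_nonneg fun t => by positivity) ?_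
      (by positivity))
    simp only [ENNReal.toReal_ofNat, Real.rpow_ofNat]
    refine integral_sq_le_of_mFourierCoeff hB hA fun k => ?_
    rw [hsub (TrigPoly.memLp_eval _ 2) hG, hsub (TrigPoly.memLp_eval _ 2) hF2, hFG,
      TrigPoly.mFourierCoeff_eval, TrigPoly.mFourierCoeff_eval, TrigPoly.multiplier_apply]
    change ‖m k * _ - m k * _‖ ≤ _
    rw [← mul_sub, norm_mul]
    exact mul_le_of_le_one_left (norm_nonneg _) (hmle k)
  have hmeas := tendstoInMeasure_of_tendsto_eLpNorm (p := 2) (by norm_num)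
    (fun n => (TrigPoly.memLp_eval (TrigPoly.multiplier m (c n)) 2).1) hG.1 hL2
  obtain ⟨φ, hφ, hae⟩ := hmeas.exists_seq_tendsto_ae
  refine (Lp.eLpNorm_lim_le_liminf_eLpNorm
    (fun n => (TrigPoly.memLp_eval (TrigPoly.multiplier m (c (φ n))) 2).1) G hae).trans ?_
  have hlim2 : Tendsto (fun n => ENNReal.ofReal (C * C) *
      eLpNorm (TrigPoly.eval (c (φ n))) p volume) atTop
      (𝓝 (ENNReal.ofReal (C * C) * eLpNorm F p volume)) :=
    ENNReal.Tendsto.const_mul (hlim1.comp hφ.tendsto_atTop) (Or.inr ENNReal.ofReal_ne_top)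
  rw [← hlim2.liminf_eq]
  exact liminf_le_liminf (Eventually.of_forall fun n => hbd _)

end

section

open Filter Topology
open UnitAddTorus
open scoped FourierTransform

/-! ### Second derivatives of compactly supported functions -/

local instance : MeasureSpace UnitAddCircle := ⟨AddCircle.haarAddCircle⟩

local instance : IsProbabilityMeasure (volume : Measure UnitAddCircle) :=
  inferInstanceAs (IsProbabilityMeasure AddCircle.haarAddCircle)

/-- The Fourier transform of a directional derivative. -/
theorem fourier_dirDeriv {h : E3 → ℝ} (hh : ContDiff ℝ 1 h) (hs : HasCompactSupport h) (w ξ : E3) :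
    𝓕 (fun x => ((fderiv ℝ h x w : ℝ) : ℂ)) ξ =
      2 * Real.pi * Complex.I * inner ℝ w ξ * 𝓕 (fun x => (h x : ℂ)) ξ := by
  set f : E3 → ℂ := fun x => (h x : ℂ) with hf
  have hf1 : ContDiff ℝ 1 f := Complex.ofRealCLM.contDiff.comp hh
  have hfs : HasCompactSupport f := hs.comp_left (g := fun x : ℝ => (x : ℂ)) (by simp)
  have hd : ∀ x, fderiv ℝ f x w = ((fderiv ℝ h x w : ℝ) : ℂ) := fun x => by
    have := Complex.ofRealCLM.hasFDerivAt.comp x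
      ((hh.differentiable one_ne_zero) x).hasFDerivAt
    rw [HasFDerivAt.fderiv (f := f) this]
    rfl
  have hi : Integrable (fderiv ℝ f) :=
    (hf1.continuous_fderiv one_ne_zero).integrable_of_hasCompactSupport (hfs.fderiv ℝ)
  have h1 := congrFun (Real.fourier_fderiv (hf1.continuous.integrable_of_hasCompactSupport hfs)
    (hf1.differentiable one_ne_zero) hi) ξ
  have h2 := congrArg (fun T : E3 →L[ℝ] ℂ => T w) h1
  rw [Real.fourier_eq] at h2
  have hi2 : Integrable fun v : E3 => Real.fourierChar (-inner ℝ v ξ) • fderiv ℝ f v := by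
    exact (Real.fourierIntegral_convergent_iff (μ := volume) (f := fderiv ℝ f) ξ).2 hi
  rw [ContinuousLinearMap.integral_apply hi2] at h2
  rw [Real.fourier_eq]
  simp only [← hd]
  refine h2.trans ?_
  rw [VectorFourier.fourierSMulRight_apply]
  have h3 : (innerSL ℝ ξ) w = inner ℝ w ξ := real_inner_comm w ξ
  simp only [neg_apply, h3, neg_smul, smul_eq_mul, Complex.real_smul]
  ring

section Periodization

variable {E : Type*} [NormedAddCommGroup E] [NormedSpace ℝ E]

/-- A representative of a point of the torus in a centred cube. -/
def torusLift (t : Torus3) : E3 :=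
  WithLp.toLp 2 fun i => (AddCircle.equivIoc (1 : ℝ) (-1 / 2) (t i)).1

theorem measurable_torusLift : Measurable torusLift := by
  refine (MeasurableEquiv.toLp 2 (Fin 3 → ℝ)).measurable.comp (measurable_pi_iff.2 fun i => ?_)
  exact measurable_subtype_coe.comp
    ((AddCircle.measurableEquivIoc (1 : ℝ) (-1 / 2)).measurable.comp (measurable_pi_apply i))

theorem integral_torus_eq {Λ : ℝ} (hΛ : 0 < Λ) {u : Torus3 → E} {ψ : E3 → E}
    (hψ : ∀ x, Λ < ‖x‖ → ψ x = 0)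
    (h : ∀ x : E3, (∀ i, x i ∈ Ioc (-1 / 2 : ℝ) (-1 / 2 + 1)) →
      u (fun i => (x i : UnitAddCircle)) = ψ ((3 * Λ) • x)) :
    ∫ t, u t = ((3 * Λ) ^ 3)⁻¹ • ∫ x, ψ x := by
  have hS : MeasurableSet {x : Fin 3 → ℝ | ∀ i, x i ∈ Ioc (-1 / 2 : ℝ) (-1 / 2 + 1)} :=
    MeasurableSet.univ_pi' fun i => measurableSet_Ioc
  rw [integral_preimage u fun _ => -1 / 2]
  have h1 : ∫ x : Fin 3 → ℝ in {x : Fin 3 → ℝ | ∀ i, x i ∈ Ioc (-1 / 2 : ℝ) (-1 / 2 + 1)},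
      u (fun i => (x i : UnitAddCircle)) = ∫ x : Fin 3 → ℝ, ψ ((3 * Λ) • WithLp.toLp 2 x) := by
    rw [← integral_indicator hS]
    refine integral_congr_ae (Eventually.of_forall fun x => ?_)
    simp only
    by_cases hx : ∀ i, x i ∈ Ioc (-1 / 2 : ℝ) (-1 / 2 + 1)
    · rw [indicator_of_mem (by exact hx)]
      exact h (WithLp.toLp 2 x) hx
    · rw [indicator_of_notMem (by exact hx)]
      refine (hψ _ ?_).symm
      push Not at hx
      obtain ⟨i, hi⟩ := hx
      have h2 : 1 / 2 ≤ |x i| := by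
        by_contra hlt
        rw [not_le, abs_lt] at hlt
        exact hi ⟨by linarith [hlt.1], by linarith [hlt.2]⟩
      have h3 : |x i| ≤ ‖(WithLp.toLp 2 x : E3)‖ := PiLp.norm_apply_le (WithLp.toLp 2 x : E3) i
      rw [norm_smul, Real.norm_of_nonneg (by positivity)]
      nlinarith
  rw [h1]
  have h2 := (PiLp.volume_preserving_toLp (Fin 3)).integral_comp
    (MeasurableEquiv.toLp 2 (Fin 3 → ℝ)).measurableEmbedding
    fun x : EuclideanSpace ℝ (Fin 3) => ψ ((3 * Λ) • x)
  have h3 := Measure.integral_comp_smul_of_nonneg (volume : Measure E3) ψ (3 * Λ)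
    (hR := by positivity)
  rw [finrank_euclideanSpace_fin] at h3
  exact h2.trans h3

theorem torusLift_coe {x : E3} (hx : ∀ i, x i ∈ Ioc (-1 / 2 : ℝ) (-1 / 2 + 1)) :
    torusLift (fun i => (x i : UnitAddCircle)) = x := by
  ext i
  exact AddCircle.equivIoc_coe_of_mem (hx i)

/-- Periodisation of a function supported in the ball of radius `Λ`. -/
def periodize (Λ : ℝ) (h : E3 → ℝ) (t : Torus3) : ℂ := (h ((3 * Λ) • torusLift t) : ℂ)

theorem memLp_periodize {Λ B : ℝ} {h : E3 → ℝ} (hh : Continuous h) (hB : ∀ x, |h x| ≤ B)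
    (p : ℝ≥0∞) : MemLp (periodize Λ h) p := by
  refine MemLp.of_bound (C := B) (Measurable.aestronglyMeasurable ?_)
    (Eventually.of_forall fun t => ?_)
  · exact Complex.measurable_ofReal.comp (hh.measurable.comp (measurable_torusLift.const_smul (3 * Λ)))
  · rw [periodize, Complex.norm_real]
    exact hB _

theorem mFourierCoeff_periodize {Λ : ℝ} (hΛ : 0 < Λ) {h : E3 → ℝ}
    (hs : ∀ x, Λ < ‖x‖ → h x = 0) (k : Fin 3 → ℤ) :
    mFourierCoeff (periodize Λ h) k =
      ((3 * Λ) ^ 3)⁻¹ • 𝓕 (fun x => (h x : ℂ)) ((3 * Λ)⁻¹ • freq k) := by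
  rw [Real.fourier_eq', mFourierCoeff]
  refine integral_torus_eq hΛ (fun x hx => by rw [hs x hx]; simp) fun x hx => ?_
  rw [periodize, torusLift_coe hx]
  congr 1
  simp only [mFourier, ContinuousMap.coe_mk, fourier_coe_apply, ← Complex.exp_sum]
  congr 1
  rw [inner_smul_left, inner_smul_right, PiLp.inner_apply]
  simp only [Fin.sum_univ_three, Pi.neg_apply, freq, RCLike.inner_apply, conj_trivial]
  have : (3 * Λ : ℝ) ≠ 0 := by positivity
  rw [← mul_assoc (3 * Λ), mul_inv_cancel₀ this]
  push_cast
  ring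

end Periodization

/-- The second derivative of `W` in the directions of the `i`-th and `j`-th axes. -/
def hess (W : E3 → ℝ) (i j : Fin 3) (x : E3) : ℝ :=
  fderiv ℝ (fun y => fderiv ℝ W y (basisE3 j)) x (basisE3 i)

theorem continuous_hess {W : E3 → ℝ} (hW : ContDiff ℝ 2 W) (i j : Fin 3) :
    Continuous (hess W i j) := by
  have h1 : ContDiff ℝ 1 fun y => fderiv ℝ W y (basisE3 j) :=
    (hW.fderiv_right (m := 1) (by norm_num)).clm_apply contDiff_const
  exact (h1.continuous_fderiv one_ne_zero).clm_apply continuous_const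

/-- **Calderón–Zygmund estimate** for the second derivatives of compactly supported functions. -/
theorem exists_integral_hess_le (n : ℕ) {Λ : ℝ} (hΛ : 0 < Λ) : ∃ C : ℝ, 0 ≤ C ∧
    ∀ (W : E3 → ℝ) (B : ℝ), 0 ≤ B → ContDiff ℝ 2 W → (∀ x, Λ ≤ ‖x‖ → W x = 0) →
      (∀ x, |∑ i, hess W i i x| ≤ B) → ∀ i j,
      ∫ x, |hess W i j x| ^ (2 ^ (n + 1)) ≤ C * B ^ (2 ^ (n + 1)) := by
  obtain ⟨C, hC, hcz⟩ := exists_eLpNorm_riesz_le n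
  set q : ℕ := 2 ^ (n + 1) with hq
  have hq0 : q ≠ 0 := by positivity
  refine ⟨(3 * Λ) ^ 3 * C ^ q, by positivity, fun W B hB hW hs hlap i j => ?_⟩
  have hz : ∀ x, Λ < ‖x‖ → W =ᶠ[𝓝 x] fun _ => 0 := fun x hx => by
    filter_upwards [(isOpen_lt continuous_const continuous_norm).mem_nhds hx] with y hy
    exact hs y (le_of_lt hy)
  have hz1 : ∀ j x, Λ < ‖x‖ → (fun y => fderiv ℝ W y (basisE3 j)) =ᶠ[𝓝 x] fun _ => 0 :=
    fun j x hx => by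
      filter_upwards [(hz x hx).fderiv (𝕜 := ℝ)] with y hy
      simp [hy]
  have hz2 : ∀ i j x, Λ < ‖x‖ → hess W i j x = 0 := fun i j x hx => by
    simp [hess, (hz1 j x hx).fderiv_eq]
  have hcs : ∀ {u : E3 → ℝ}, (∀ x, Λ < ‖x‖ → u x = 0) → HasCompactSupport u := fun hu =>
    HasCompactSupport.intro (isCompact_closedBall 0 Λ) fun x hx => hu x (by simpa using hx)
  have hW1 : ∀ j, ContDiff ℝ 1 fun y => fderiv ℝ W y (basisE3 j) := fun j =>
    (hW.fderiv_right (m := 1) (by norm_num)).clm_apply contDiff_const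
  have hF : ∀ i j ξ, 𝓕 (fun x => (hess W i j x : ℂ)) ξ =
      (2 * Real.pi * Complex.I) ^ 2 * (ξ i * ξ j : ℝ) * 𝓕 (fun x => (W x : ℂ)) ξ := by
    intro i j ξ
    have h0 : ∀ i, inner ℝ (basisE3 i) ξ = ξ i := fun i => by
      simp [basisE3, EuclideanSpace.inner_single_left]
    have h1 := fourier_dirDeriv (hW1 j) (hcs fun x hx => (hz1 j x hx).eq_of_nhds) (basisE3 i) ξ
    have h2 := fourier_dirDeriv (hW.of_le (by norm_num))
      (hcs fun x hx => (hz x hx).eq_of_nhds) (basisE3 j) ξ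
    rw [h2, h0, h0] at h1
    refine Eq.trans h1 ?_
    push_cast
    ring
  have hlapz : ∀ x, Λ < ‖x‖ → ∑ i, hess W i i x = 0 := fun x hx =>
    Finset.sum_eq_zero fun i _ => hz2 i i x hx
  have hFlap : ∀ ξ, 𝓕 (fun x => ((∑ i, hess W i i x : ℝ) : ℂ)) ξ =
      (2 * Real.pi * Complex.I) ^ 2 * (‖ξ‖ ^ 2 : ℝ) * 𝓕 (fun x => (W x : ℂ)) ξ := by
    intro ξ
    have h1 : 𝓕 (fun x => ((∑ i, hess W i i x : ℝ) : ℂ)) ξ =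
        ∑ i, 𝓕 (fun x => (hess W i i x : ℂ)) ξ := by
      simp only [Real.fourier_eq, Complex.ofReal_sum, Finset.smul_sum]
      refine integral_finsetSum _ fun i _ => ?_
      have hi : Integrable fun x => (hess W i i x : ℂ) :=
        ((continuous_hess hW i i).integrable_of_hasCompactSupport (hcs (hz2 i i))).ofReal
      exact (Real.fourierIntegral_convergent_iff (μ := volume) ξ).2 hi
    rw [h1]
    simp only [hF, Fin.sum_univ_three]
    rw [EuclideanSpace.norm_sq_eq]
    simp only [Fin.sum_univ_three, Real.norm_eq_abs, sq_abs]
    push_cast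
    ring
  have hclap : Continuous fun x => ∑ i, hess W i i x :=
    continuous_finsetSum _ fun i _ => continuous_hess hW i i
  obtain ⟨D, hD⟩ := (continuous_hess hW i j).bounded_above_of_compact_support (hcs (hz2 i j))
  have hmF := memLp_periodize (Λ := Λ) hclap hlap (q : ℝ≥0∞)
  have hmG := memLp_periodize (Λ := Λ) (continuous_hess hW i j) hD
  have key := hcz i j (periodize Λ fun x => ∑ i, hess W i i x) (periodize Λ (hess W i j))
    hmF (hmG 2) fun k => by
      rw [mFourierCoeff_periodize hΛ (hz2 i j), mFourierCoeff_periodize hΛ hlapz, hF, hFlap,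
        mul_smul_comm]
      congr 1
      rw [← mul_assoc]
      congr 1
      rcases eq_or_ne (freq k) 0 with h0 | h0
      · simp [TrigPoly.rieszSymbol, h0]
      have h1 : (‖freq k‖ : ℂ) ≠ 0 := by exact_mod_cast norm_ne_zero_iff.2 h0
      have h2 : (Λ : ℂ) ≠ 0 := by exact_mod_cast hΛ.ne'
      have h3 : ‖(3 * Λ)⁻¹ • freq k‖ = (3 * Λ)⁻¹ * ‖freq k‖ := by
        rw [norm_smul, Real.norm_of_nonneg (by positivity)]
      rw [h3, TrigPoly.rieszSymbol, TrigPoly.rieszSymbol]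
      simp only [PiLp.smul_apply, smul_eq_mul]
      push_cast
      field_simp
  have hFle : eLpNorm (periodize Λ fun x => ∑ i, hess W i i x) (q : ℝ≥0∞) volume ≤
      ENNReal.ofReal B := by
    refine (eLpNorm_le_of_ae_bound (C := B) (Eventually.of_forall fun t => ?_)).trans ?_
    · rw [periodize, Complex.norm_real]
      exact hlap _
    · simp
  have hle := key.trans (mul_le_mul_right hFle _)
  rw [(hmG q).eLpNorm_eq_integral_rpow_norm (by exact_mod_cast hq0) (by simp),
    ← ENNReal.ofReal_mul hC, ENNReal.ofReal_le_ofReal_iff (by positivity)] at hle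
  simp only [ENNReal.toReal_natCast, Real.rpow_natCast] at hle
  have h5 := pow_le_pow_left₀ (by positivity) hle q
  rw [Real.rpow_inv_natCast_pow (integral_nonneg fun t => by positivity) hq0, mul_pow,
    integral_torus_eq hΛ (ψ := fun x => |hess W i j x| ^ q)
      (fun x hx => by rw [hz2 i j x hx]; simp [hq0]) (fun x hx => by
        simp only [periodize, torusLift_coe hx, Complex.norm_real, Real.norm_eq_abs]),
    smul_eq_mul, inv_mul_le_iff₀ (by positivity)] at h5
  linarith

end

section

open Filter Topology

/-! ### Newton potentials -/

section Kernels

variable {V : Type} [NormedAddCommGroup V]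

/-- The majorant `|z|⁻² + 1` of the convolution kernels. -/
def kernelBound (z : E3) : ℝ := ‖z‖⁻¹ ^ 2 + 1

theorem kernelBound_nonneg (z : E3) : 0 ≤ kernelBound z := by unfold kernelBound; positivity

theorem integrableOn_kernelBound (r : ℝ) : IntegrableOn kernelBound (Metric.ball 0 r) := by
  refine (integrableOn_fun_norm_addHaar volume (f := fun y : ℝ => y⁻¹ ^ 2 + 1)).2 ?_
  rw [finrank_euclideanSpace_fin]
  have h : IntegrableOn (fun y : ℝ => 1 + y ^ 2) (Ioo 0 r) :=
    ((by fun_prop : Continuous fun y : ℝ => 1 + y ^ 2).continuousOn.integrableOn_compact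
      (isCompact_Icc (a := 0) (b := r))).mono_set Ioo_subset_Icc_self
  refine h.congr_fun (fun y hy => ?_) measurableSet_Ioo
  have : y ≠ 0 := hy.1.ne'
  simp only [smul_eq_mul]
  field_simp

/-- Kernels with a singularity of order at most two at the origin. -/
structure IsKernel (κ : E3 → V) : Prop where
  meas : AEStronglyMeasurable κ
  bound : ∀ z, z ≠ 0 → ‖κ z‖ ≤ kernelBound z

theorem ae_ne_zero : ∀ᵐ z : E3, z ≠ 0 := by
  simp [ae_iff]

theorem IsKernel.locallyIntegrable {κ : E3 → V} (hκ : IsKernel κ) : LocallyIntegrable κ := by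
  refine locallyIntegrable_iff.2 fun k hk => ?_
  obtain ⟨r, hr⟩ := hk.isBounded.subset_ball 0
  refine IntegrableOn.mono_set ?_ hr
  refine (integrableOn_kernelBound r).mono' hκ.meas.restrict ?_
  filter_upwards [ae_restrict_of_ae ae_ne_zero] with z hz using hκ.bound z hz

theorem IsKernel.sub_integrableOn {κ κ' : E3 → V} (hκ : IsKernel κ) (hκ' : IsKernel κ') (r : ℝ) :
    IntegrableOn (fun z => ‖κ z - κ' z‖) (Metric.ball 0 r) :=
  (((hκ.locallyIntegrable.sub hκ'.locallyIntegrable).integrableOn_isCompact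
    (isCompact_closedBall 0 r)).mono_set Metric.ball_subset_closedBall).norm

variable [NormedSpace ℝ V]

/-- The convolution of the kernel `κ` with the function `h`. -/
def conv (κ : E3 → V) (h : E3 → ℝ) (x : E3) : V := ∫ z, h (x - z) • κ z

theorem conv_eq_convolution (κ : E3 → V) (h : E3 → ℝ) :
    conv κ h = convolution κ h (ContinuousLinearMap.lsmul ℝ ℝ : ℝ →L[ℝ] V →L[ℝ] V).flip volume :=
  rfl

theorem IsKernel.contDiff_conv {κ : E3 → V} (hκ : IsKernel κ) {h : E3 → ℝ} {n : ℕ}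
    (hh : ContDiff ℝ n h) (hs : HasCompactSupport h) : ContDiff ℝ n (conv κ h) := by
  rw [conv_eq_convolution]
  exact hs.contDiff_convolution_right _ hκ.locallyIntegrable hh

theorem hasCompactSupport_comp_sub {h : E3 → ℝ} (hs : HasCompactSupport h) (x : E3) :
    HasCompactSupport fun z => h (x - z) :=
  hs.comp_homeomorph (Homeomorph.subLeft x)

theorem IsKernel.integrable {κ : E3 → V} (hκ : IsKernel κ) {h : E3 → ℝ}
    (hh : Continuous h) (hs : HasCompactSupport h) (x : E3) :
    Integrable fun z => h (x - z) • κ z :=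
  hκ.locallyIntegrable.integrable_smul_left_of_hasCompactSupport
    (hh.comp (continuous_const.sub continuous_id)) (hasCompactSupport_comp_sub hs x)

theorem IsKernel.fderiv_conv {κ : E3 → ℝ} (hκ : IsKernel κ) {h : E3 → ℝ}
    (hh : ContDiff ℝ 1 h) (hs : HasCompactSupport h) (x w : E3) :
    fderiv ℝ (conv κ h) x w = conv κ (fun y => fderiv ℝ h y w) x := by
  rw [conv_eq_convolution, (hs.hasFDerivAt_convolution_right _ hκ.locallyIntegrable hh x).fderiv,
    convolution_precompR_apply _ hκ.locallyIntegrable (hs.fderiv ℝ)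
      (hh.continuous_fderiv one_ne_zero)]
  rfl

/-- The constant in the bound for convolutions with functions supported in a ball. -/
def convConst (r : ℝ) : ℝ :=
  (∫ z in Metric.ball (0 : E3) 1, kernelBound z) + 2 * volume.real (Metric.closedBall (0 : E3) r)

theorem convConst_nonneg (r : ℝ) : 0 ≤ convConst r :=
  add_nonneg (integral_nonneg kernelBound_nonneg) (by positivity)

theorem hasCompactSupport_of_ball {h : E3 → ℝ} {r : ℝ} (h0 : ∀ x, r < ‖x‖ → h x = 0) :
    HasCompactSupport h :=
  HasCompactSupport.intro (isCompact_closedBall 0 r) fun x hx => h0 x (by simpa using hx)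

theorem IsKernel.norm_conv_le {κ : E3 → V} (hκ : IsKernel κ) {h : E3 → ℝ} {r M : ℝ}
    (hh : Continuous h) (h0 : ∀ x, r < ‖x‖ → h x = 0) (hM : ∀ x, |h x| ≤ M) (x : E3) :
    ‖conv κ h x‖ ≤ convConst r * M := by
  have hs := hasCompactSupport_of_ball h0
  have hM0 : 0 ≤ M := (abs_nonneg _).trans (hM 0)
  have i1 : Integrable fun z => (Metric.ball (0 : E3) 1).indicator kernelBound z * M :=
    ((integrableOn_kernelBound 1).integrable_indicator measurableSet_ball).mul_const M
  have i2 : Integrable fun z => 2 * |h (x - z)| :=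
    (((hh.comp (continuous_const.sub continuous_id)).integrable_of_hasCompactSupport
      (hasCompactSupport_comp_sub hs x)).norm).const_mul 2
  have hle : ‖conv κ h x‖ ≤ ∫ z, ((Metric.ball (0 : E3) 1).indicator kernelBound z * M +
      2 * |h (x - z)|) := by
    refine norm_integral_le_of_norm_le (i1.add i2) ?_
    filter_upwards [ae_ne_zero] with z hz
    rw [norm_smul, Real.norm_eq_abs]
    refine (mul_le_mul_of_nonneg_left (hκ.bound z hz) (abs_nonneg _)).trans ?_
    by_cases hz1 : z ∈ Metric.ball (0 : E3) 1
    · rw [indicator_of_mem hz1]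
      have := mul_le_mul_of_nonneg_right (hM (x - z)) (kernelBound_nonneg z)
      have := abs_nonneg (h (x - z))
      linarith
    · rw [indicator_of_notMem hz1, zero_mul, zero_add, mul_comm 2]
      refine mul_le_mul_of_nonneg_left ?_ (abs_nonneg _)
      rw [mem_ball_zero_iff, not_lt] at hz1
      have : ‖z‖⁻¹ ≤ 1 := inv_le_one_of_one_le₀ hz1
      have h2 : ‖z‖⁻¹ ^ 2 ≤ 1 := pow_le_one₀ (by positivity) this
      unfold kernelBound
      linarith
  refine hle.trans ?_
  rw [integral_add i1 i2, integral_mul_const, integral_indicator measurableSet_ball,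
    integral_const_mul, integral_sub_left_eq_self (fun y => |h y|) volume x]
  have h3 : ∫ y, |h y| ≤ M * volume.real (Metric.closedBall (0 : E3) r) := by
    have h4 : ∫ y, |h y| = ∫ y in Metric.closedBall (0 : E3) r, |h y| := by
      refine (setIntegral_eq_integral_of_forall_compl_eq_zero fun y hy => ?_).symm
      rw [h0 y (by simpa using hy), abs_zero]
    rw [h4]
    refine (le_abs_self _).trans ?_
    exact norm_setIntegral_le_of_norm_le_const (C := M) (f := fun y => |h y|)
      measure_closedBall_lt_top fun y _ => by simpa using hM y
  unfold convConst
  nlinarith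

theorem IsKernel.tendsto_conv {κ : ℕ → E3 → V} {κ' : E3 → V} (hκ : ∀ n, IsKernel (κ n))
    (hκ' : IsKernel κ') (hlim : ∀ z, z ≠ 0 → Tendsto (fun n => κ n z) atTop (𝓝 (κ' z)))
    {h : E3 → ℝ} (hh : Continuous h) (hs : HasCompactSupport h) (r : ℝ) :
    TendstoUniformlyOn (fun n => conv (κ n) h) (conv κ' h) atTop (Metric.ball 0 r) := by
  obtain ⟨M, hM⟩ := hh.bounded_above_of_compact_support hs
  obtain ⟨R, hR⟩ := hs.isCompact.isBounded.subset_ball 0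
  have hM0 : 0 ≤ M := (norm_nonneg _).trans (hM 0)
  have hz : ∀ y, R ≤ ‖y‖ → h y = 0 := fun y hy => by
    by_contra hne
    have := hR (subset_tsupport h hne)
    rw [mem_ball_zero_iff] at this
    linarith
  have h1 : Tendsto (fun n => ∫ z in Metric.ball (0 : E3) (r + R), ‖κ n z - κ' z‖) atTop
      (𝓝 0) := by
    have := tendsto_integral_of_dominated_convergence
      (μ := volume.restrict (Metric.ball (0 : E3) (r + R))) (F := fun n z => ‖κ n z - κ' z‖)
      (f := fun _ => (0 : ℝ)) (fun z => 2 * kernelBound z)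
      (fun n => ((hκ n).sub_integrableOn hκ' _).aestronglyMeasurable)
      ((integrableOn_kernelBound _).const_mul 2) (fun n => by
        filter_upwards [ae_restrict_of_ae ae_ne_zero] with z hz
        rw [norm_norm]
        have := (hκ n).bound z hz
        have := hκ'.bound z hz
        have := norm_sub_le (κ n z) (κ' z)
        linarith) (by
        filter_upwards [ae_restrict_of_ae ae_ne_zero] with z hz
        simpa using ((hlim z hz).sub_const (κ' z)).norm)
    simpa using this
  have h2 := h1.mul_const M
  rw [zero_mul] at h2
  rw [Metric.tendstoUniformlyOn_iff]
  intro δ hδ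
  filter_upwards [h2.eventually_lt_const hδ] with n hn x hx
  refine lt_of_le_of_lt ?_ hn
  rw [dist_comm, dist_eq_norm]
  unfold conv
  rw [← integral_sub ((hκ n).integrable hh hs x) (hκ'.integrable hh hs x), ← integral_mul_const,
    ← integral_indicator measurableSet_ball]
  refine norm_integral_le_of_norm_le
    ((integrable_indicator_iff measurableSet_ball).2
      (((hκ n).sub_integrableOn hκ' (r + R)).mul_const M))
    (Eventually.of_forall fun z => ?_)
  rw [← smul_sub, norm_smul]
  by_cases hzz : z ∈ Metric.ball (0 : E3) (r + R)
  · rw [indicator_of_mem hzz, mul_comm]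
    exact mul_le_mul_of_nonneg_left (hM _) (norm_nonneg _)
  · rw [indicator_of_notMem hzz, hz (x - z), norm_zero, zero_mul]
    rw [mem_ball_zero_iff] at hx hzz
    have := norm_sub_norm_le z x
    rw [norm_sub_rev] at this
    linarith

end Kernels

section Newton

/-- The regularised distance to the origin. -/
def regDist (ε : ℝ) (z : E3) : ℝ := √(‖z‖ ^ 2 + ε ^ 2)

/-- The regularised Newton kernel. -/
def newton (ε : ℝ) (z : E3) : ℝ := (regDist ε z)⁻¹

/-- The gradient of the regularised Newton kernel. -/
def newtonGrad (ε : ℝ) (z : E3) : E3 →L[ℝ] ℝ := -((regDist ε z)⁻¹ ^ 3) • innerSL ℝ z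

theorem norm_le_regDist (ε : ℝ) (z : E3) : ‖z‖ ≤ regDist ε z :=
  Real.le_sqrt_of_sq_le (by linarith [sq_nonneg ε])

theorem regDist_pos {ε : ℝ} (hε : ε ≠ 0) (z : E3) : 0 < regDist ε z :=
  Real.sqrt_pos.2 (by positivity)

theorem regDist_sq (ε : ℝ) (z : E3) : regDist ε z ^ 2 = ‖z‖ ^ 2 + ε ^ 2 :=
  Real.sq_sqrt (by positivity)

theorem regDist_zero (z : E3) : regDist 0 z = ‖z‖ := by
  simp [regDist, Real.sqrt_sq (norm_nonneg z)]

theorem continuous_regDist (ε : ℝ) : Continuous (regDist ε) := by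
  unfold regDist; fun_prop

theorem inv_regDist_le {ε : ℝ} {z : E3} (hz : z ≠ 0) : (regDist ε z)⁻¹ ≤ ‖z‖⁻¹ :=
  inv_anti₀ (norm_pos_iff.2 hz) (norm_le_regDist ε z)

theorem measurable_newton (ε : ℝ) : Measurable (newton ε) :=
  (continuous_regDist ε).measurable.inv

theorem norm_newtonGrad_le (ε : ℝ) {z : E3} (hz : z ≠ 0) : ‖newtonGrad ε z‖ ≤ ‖z‖⁻¹ ^ 2 := by
  have h0 : 0 ≤ (regDist ε z)⁻¹ := inv_nonneg.2 (Real.sqrt_nonneg _)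
  rw [newtonGrad, norm_smul, norm_neg, Real.norm_of_nonneg (by positivity), innerSL_apply_norm]
  have h1 : (regDist ε z)⁻¹ ^ 3 ≤ ‖z‖⁻¹ ^ 3 := pow_le_pow_left₀ h0 (inv_regDist_le hz) 3
  calc _ ≤ ‖z‖⁻¹ ^ 3 * ‖z‖ := mul_le_mul_of_nonneg_right h1 (norm_nonneg _)
    _ = _ := by have := norm_pos_iff.2 hz; field_simp

theorem isKernel_newton (ε : ℝ) : IsKernel (newton ε) where
  meas := (measurable_newton ε).aestronglyMeasurable
  bound z hz := by
    have h0 : 0 ≤ (regDist ε z)⁻¹ := inv_nonneg.2 (Real.sqrt_nonneg _)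
    rw [newton, Real.norm_of_nonneg h0]
    have := inv_regDist_le (ε := ε) hz
    unfold kernelBound
    nlinarith [sq_nonneg (‖z‖⁻¹ - 1), sq_nonneg ‖z‖⁻¹]

theorem isKernel_newtonGrad (ε : ℝ) : IsKernel (newtonGrad ε) where
  meas := by
    have : Measurable (newtonGrad ε) :=
      ((measurable_newton ε).pow_const 3).neg.smul (innerSL ℝ).continuous.measurable
    exact this.aestronglyMeasurable
  bound z hz := (norm_newtonGrad_le ε hz).trans (by unfold kernelBound; linarith)

theorem isKernel_newtonGrad_apply (ε : ℝ) (i : Fin 3) :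
    IsKernel fun z => newtonGrad ε z (basisE3 i) where
  meas := (isKernel_newtonGrad ε).meas.apply_continuousLinearMap _
  bound z hz := by
    refine (ContinuousLinearMap.le_opNorm _ _).trans ?_
    rw [norm_basisE3, mul_one]
    exact (isKernel_newtonGrad ε).bound z hz

theorem hasFDerivAt_newton {ε : ℝ} (hε : ε ≠ 0) (z : E3) :
    HasFDerivAt (newton ε) (newtonGrad ε z) z := by
  have h1 : HasFDerivAt (fun z : E3 => ‖z‖ ^ 2 + ε ^ 2) (2 • innerSL ℝ z) z :=
    (hasStrictFDerivAt_norm_sq z).hasFDerivAt.add_const _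
  have hp := regDist_pos hε z
  have h2 := (hasDerivAt_inv hp.ne').comp_hasFDerivAt z (h1.sqrt (by positivity))
  convert! h2 using 1
  ext w
  simp only [newtonGrad, smul_apply, innerSL_apply_apply, smul_eq_mul, nsmul_eq_mul]
  change _ = -(regDist ε z ^ 2)⁻¹ * (1 / (2 * regDist ε z) * ((2 : ℕ) * _))
  push_cast
  field_simp

theorem conv_eq_integral {V : Type} [NormedAddCommGroup V] [NormedSpace ℝ V] (κ : E3 → V)
    (h : E3 → ℝ) (x : E3) : conv κ h x = ∫ y, h y • κ (x - y) := by
  have := integral_sub_left_eq_self (fun z => h (x - z) • κ z) volume x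
  simp only [sub_sub_cancel] at this
  exact this.symm

theorem continuous_newtonGrad {ε : ℝ} (hε : ε ≠ 0) : Continuous (newtonGrad ε) := by
  unfold newtonGrad
  exact ((((continuous_regDist ε).inv₀ fun z => (regDist_pos hε z).ne').pow 3).neg).smul
    (innerSL ℝ).continuous

theorem continuous_newton {ε : ℝ} (hε : ε ≠ 0) : Continuous (newton ε) :=
  (continuous_regDist ε).inv₀ fun z => (regDist_pos hε z).ne'

theorem hasFDerivAt_conv_newton_of_ne {ε : ℝ} (hε : ε ≠ 0) {h : E3 → ℝ} (hh : Continuous h)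
    (hs : HasCompactSupport h) (x : E3) :
    HasFDerivAt (conv (newton ε) h) (conv (newtonGrad ε) h x) x := by
  have e1 : conv (newton ε) h = fun x => ∫ y, h y • newton ε (x - y) :=
    funext fun x => conv_eq_integral _ _ x
  have hb : ∀ z, ‖newtonGrad ε z‖ ≤ |ε|⁻¹ ^ 2 := by
    intro z
    have hp := regDist_pos hε z
    rw [newtonGrad, norm_smul, norm_neg, Real.norm_of_nonneg (by positivity), innerSL_apply_norm]
    have h1 : |ε| ≤ regDist ε z := Real.le_sqrt_of_sq_le (by rw [sq_abs]; nlinarith [sq_nonneg ‖z‖])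
    have h2 : (regDist ε z)⁻¹ ≤ |ε|⁻¹ := inv_anti₀ (abs_pos.2 hε) h1
    calc (regDist ε z)⁻¹ ^ 3 * ‖z‖ ≤ (regDist ε z)⁻¹ ^ 3 * regDist ε z :=
          mul_le_mul_of_nonneg_left (norm_le_regDist ε z) (by positivity)
      _ = (regDist ε z)⁻¹ ^ 2 := by field_simp
      _ ≤ _ := pow_le_pow_left₀ (by positivity) h2 2
  rw [e1, conv_eq_integral]
  have hcs : ∀ {V : Type} [NormedAddCommGroup V] [NormedSpace ℝ V] {κ : E3 → V} (_ : Continuous κ)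
      (x : E3), Continuous fun y => h y • κ (x - y) := fun hκ x =>
    hh.smul (hκ.comp (continuous_const.sub continuous_id))
  refine hasFDerivAt_integral_of_dominated_of_fderiv_le (s := univ) (bound := fun y =>
    |h y| * |ε|⁻¹ ^ 2) (F' := fun x y => h y • newtonGrad ε (x - y)) univ_mem
    (Eventually.of_forall fun x => (hcs (continuous_newton hε) x).aestronglyMeasurable)
    ((hcs (continuous_newton hε) x).integrable_of_hasCompactSupport hs.smul_right)
    (hcs (continuous_newtonGrad hε) x).aestronglyMeasurable
    (Eventually.of_forall fun y x _ => ?_)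
    ((hh.integrable_of_hasCompactSupport hs).norm.mul_const _)
    (Eventually.of_forall fun y x _ => ?_)
  · rw [norm_smul, Real.norm_eq_abs]
    exact mul_le_mul_of_nonneg_left (hb _) (abs_nonneg _)
  · have h1 := (hasFDerivAt_newton hε (x - y)).comp x ((hasFDerivAt_id x).sub_const y)
    exact h1.const_smul (h y)

theorem tendsto_inv_regDist {z : E3} (hz : z ≠ 0) :
    Tendsto (fun n : ℕ => (regDist (1 / ((n : ℝ) + 1)) z)⁻¹) atTop (𝓝 (regDist 0 z)⁻¹) := by
  have hc : Continuous fun ε : ℝ => regDist ε z := by unfold regDist; fun_prop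
  refine ((hc.tendsto 0).comp tendsto_one_div_add_atTop_nhds_zero_nat).inv₀ ?_
  rw [regDist_zero]
  exact norm_ne_zero_iff.2 hz

theorem one_div_succ_ne_zero (n : ℕ) : 1 / ((n : ℝ) + 1) ≠ 0 := by positivity

/-- The Newton potential of a continuous function is differentiable. -/
theorem hasFDerivAt_conv_newton {h : E3 → ℝ} (hh : Continuous h) (hs : HasCompactSupport h)
    (x : E3) : HasFDerivAt (conv (newton 0) h) (conv (newtonGrad 0) h x) x := by
  have hx : x ∈ Metric.ball (0 : E3) (‖x‖ + 1) := by simp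
  refine hasFDerivAt_of_tendstoUniformlyOn (l := atTop)
    (f := fun n : ℕ => conv (newton (1 / ((n : ℝ) + 1))) h) Metric.isOpen_ball
    (IsKernel.tendsto_conv (fun n => isKernel_newtonGrad _) (isKernel_newtonGrad 0)
      (fun z hz => ?_) hh hs (‖x‖ + 1))
    (fun n x _ => hasFDerivAt_conv_newton_of_ne (one_div_succ_ne_zero n) hh hs x)
    (fun y hy => (IsKernel.tendsto_conv (fun n => isKernel_newton _) (isKernel_newton 0)
      (fun z hz => tendsto_inv_regDist hz) hh hs (‖x‖ + 1)).tendsto_at hy) hx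
  exact ((tendsto_inv_regDist hz).pow 3).neg.smul_const _

theorem fderiv_conv_newton {h : E3 → ℝ} (hh : Continuous h) (hs : HasCompactSupport h) :
    fderiv ℝ (conv (newton 0) h) = conv (newtonGrad 0) h :=
  funext fun x => (hasFDerivAt_conv_newton hh hs x).fderiv

theorem contDiff_conv_newton {h : E3 → ℝ} {n : ℕ} (hh : ContDiff ℝ n h)
    (hs : HasCompactSupport h) : ContDiff ℝ (n + 1) (conv (newton 0) h) := by
  rw [contDiff_succ_iff_fderiv]
  refine ⟨fun x => (hasFDerivAt_conv_newton hh.continuous hs x).differentiableAt,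
    fun h => by simp at h, ?_⟩
  rw [fderiv_conv_newton hh.continuous hs]
  exact (isKernel_newtonGrad 0).contDiff_conv hh hs

theorem hess_conv_newton {h : E3 → ℝ} (hh : ContDiff ℝ 1 h) (hs : HasCompactSupport h)
    (i j : Fin 3) (x : E3) : hess (conv (newton 0) h) i j x =
      conv (fun z => newtonGrad 0 z (basisE3 j)) (fun y => fderiv ℝ h y (basisE3 i)) x := by
  have h1 : (fun y => fderiv ℝ (conv (newton 0) h) y (basisE3 j)) =
      conv (fun z => newtonGrad 0 z (basisE3 j)) h := by
    funext y
    rw [fderiv_conv_newton hh.continuous hs, conv, conv,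
      ContinuousLinearMap.integral_apply ((isKernel_newtonGrad 0).integrable hh.continuous hs y)]
    rfl
  rw [hess, h1, (isKernel_newtonGrad_apply 0 j).fderiv_conv hh hs]

theorem hasFDerivAt_newtonGrad_apply {ε : ℝ} (hε : ε ≠ 0) (i : Fin 3) (z : E3) :
    HasFDerivAt (fun z => newtonGrad ε z (basisE3 i))
      ((-(3 * newton ε z ^ 2 * z i)) • newtonGrad ε z -
        newton ε z ^ 3 • (EuclideanSpace.proj i : E3 →L[ℝ] ℝ)) z := by
  have h1 := ((hasFDerivAt_newton hε z).pow 3).fun_neg.mul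
    (EuclideanSpace.proj (𝕜 := ℝ) i : E3 →L[ℝ] ℝ).hasFDerivAt
  have h2 : (fun z => newtonGrad ε z (basisE3 i)) =
      fun z => (-(newton ε z ^ 3)) * (EuclideanSpace.proj (𝕜 := ℝ) i : E3 →L[ℝ] ℝ) z := by
    funext z
    simp [newtonGrad, newton, basisE3, EuclideanSpace.inner_single_right]
  rw [h2]
  convert! h1 using 1
  ext w
  simp
  ring

/-- The Laplacian of the regularised Newton kernel. -/
def newtonLap (ε : ℝ) (z : E3) : ℝ := -(3 * ε ^ 2 * newton ε z ^ 5)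

theorem sum_fderiv_newtonGrad {ε : ℝ} (hε : ε ≠ 0) (z : E3) :
    ∑ i, fderiv ℝ (fun z => newtonGrad ε z (basisE3 i)) z (basisE3 i) = newtonLap ε z := by
  simp only [(hasFDerivAt_newtonGrad_apply hε _ z).fderiv]
  have hp := regDist_pos hε z
  have h1 := regDist_sq ε z
  have h2 : ‖z‖ ^ 2 = z 0 ^ 2 + z 1 ^ 2 + z 2 ^ 2 := by
    rw [EuclideanSpace.norm_sq_eq, Fin.sum_univ_three]
    simp
  have h3 : ∀ i, newtonGrad ε z (basisE3 i) = -(newton ε z ^ 3) * z i := fun i => by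
    simp [newtonGrad, newton, basisE3, EuclideanSpace.inner_single_right]
  have h4 : newton ε z ^ 2 * (‖z‖ ^ 2 + ε ^ 2) = 1 := by
    rw [← h1, newton]; field_simp
  simp only [Fin.sum_univ_three, sub_apply, smul_apply, smul_eq_mul, h3, newtonLap]
  simp [basisE3]
  rw [h2] at h4
  linear_combination (3 * newton ε z ^ 3) * h4

theorem integrable_newton_one_pow : Integrable fun z => newton 1 z ^ 5 := by
  have h := integrable_rpow_neg_one_add_norm_sq (E := E3) (μ := volume) (r := 5)
    (by rw [finrank_euclideanSpace_fin]; norm_num)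
  refine h.congr (Eventually.of_forall fun z => ?_)
  simp only [newton, regDist]
  have h0 : (0 : ℝ) ≤ 1 + ‖z‖ ^ 2 := by positivity
  rw [one_pow, add_comm (‖z‖ ^ 2), Real.sqrt_eq_rpow, ← Real.rpow_neg h0,
    ← Real.rpow_mul_natCast h0]
  norm_num

/-- The total mass of the Laplacian of the regularised Newton kernel. -/
def lapConst : ℝ := ∫ z : E3, |newtonLap 1 z|

theorem integral_newtonLap {ε : ℝ} (hε : 0 < ε) :
    Integrable (fun z => |newtonLap ε z|) ∧ ∫ z, |newtonLap ε z| = lapConst := by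
  have hscale : ∀ z, |newtonLap ε (ε • z)| = (ε ^ 3)⁻¹ * |newtonLap 1 z| := by
    intro z
    have h1 : regDist ε (ε • z) = ε * regDist 1 z := by
      rw [regDist, regDist, norm_smul, Real.norm_of_nonneg hε.le,
        show (ε * ‖z‖) ^ 2 + ε ^ 2 = ε ^ 2 * (‖z‖ ^ 2 + 1 ^ 2) by ring,
        Real.sqrt_mul (by positivity), Real.sqrt_sq hε.le]
    have hp := regDist_pos one_ne_zero z
    rw [newtonLap, newtonLap, newton, newton, h1, abs_neg, abs_neg,
      abs_of_nonneg (by positivity), abs_of_nonneg (by positivity)]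
    field_simp
  have hi : Integrable fun z => |newtonLap 1 z| := by
    unfold newtonLap
    exact ((integrable_newton_one_pow.const_mul (3 * 1 ^ 2)).neg).norm
  constructor
  · refine (integrable_comp_smul_iff volume (fun z => |newtonLap ε z|) hε.ne').1 ?_
    simp only [hscale]
    exact hi.const_mul _
  · have h1 := Measure.integral_comp_smul_of_nonneg (volume : Measure E3)
      (fun z => |newtonLap ε z|) ε (hR := hε.le)
    simp only [hscale] at h1
    rw [integral_const_mul, finrank_euclideanSpace_fin, smul_eq_mul] at h1
    exact (mul_left_cancel₀ (by positivity) h1).symm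

theorem lapConst_nonneg : 0 ≤ lapConst := integral_nonneg fun _ => abs_nonneg _

/-- The Laplacian of a Newton potential is bounded by its density. -/
theorem abs_laplacian_conv_newton_le {h : E3 → ℝ} (hh : ContDiff ℝ 1 h)
    (hs : HasCompactSupport h) {M : ℝ} (hM : ∀ x, |h x| ≤ M) (x : E3) :
    |∑ i, hess (conv (newton 0) h) i i x| ≤ lapConst * M := by
  have hcd : ∀ i, Continuous fun y => fderiv ℝ h y (basisE3 i) := fun i =>
    (hh.continuous_fderiv one_ne_zero).clm_apply continuous_const
  have hcs : ∀ i, HasCompactSupport fun y => fderiv ℝ h y (basisE3 i) := fun i =>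
    hs.fderiv_apply ℝ (basisE3 i)
  have hlim : Tendsto (fun n : ℕ => ∑ i, conv (fun z => newtonGrad (1 / ((n : ℝ) + 1)) z
      (basisE3 i)) (fun y => fderiv ℝ h y (basisE3 i)) x) atTop
      (𝓝 (∑ i, hess (conv (newton 0) h) i i x)) := by
    refine tendsto_finsetSum _ fun i _ => ?_
    rw [hess_conv_newton hh hs]
    refine (IsKernel.tendsto_conv (fun n => isKernel_newtonGrad_apply _ i)
      (isKernel_newtonGrad_apply 0 i) (fun z hz => ?_) (hcd i) (hcs i) (‖x‖ + 1)).tendsto_at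
      (by simp)
    exact ((tendsto_inv_regDist hz).pow 3).neg.mul_const _
  refine le_of_tendsto hlim.abs (Eventually.of_forall fun n => ?_)
  set ε : ℝ := 1 / ((n : ℝ) + 1) with hε
  have hε0 : 0 < ε := by positivity
  set g : E3 → ℝ := fun z => h (x - z) with hg
  have hg1 : ContDiff ℝ 1 g := hh.comp (contDiff_const.sub contDiff_id)
  have hgs : HasCompactSupport g := hasCompactSupport_comp_sub hs x
  have hgd : ∀ z w, fderiv ℝ g z w = -fderiv ℝ h (x - z) w := by
    intro z w
    have h1 : HasFDerivAt (fun z : E3 => x - z) (-(ContinuousLinearMap.id ℝ E3)) z :=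
      (hasFDerivAt_id z).const_sub x
    have h2 := ((hh.differentiable one_ne_zero (x - z)).hasFDerivAt.comp z h1).fderiv
    rw [show g = h ∘ fun z => x - z from rfl, h2]
    simp
  have hκc : ∀ i, Continuous fun z => newtonGrad ε z (basisE3 i) := fun i =>
    (continuous_newtonGrad hε0.ne').clm_apply continuous_const
  have hκd : ∀ i, Continuous fun z =>
      fderiv ℝ (fun z => newtonGrad ε z (basisE3 i)) z (basisE3 i) := by
    intro i
    simp only [(hasFDerivAt_newtonGrad_apply hε0.ne' i _).fderiv]
    have := continuous_newton hε0.ne'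
    have h3 := continuous_newtonGrad hε0.ne'
    simp only [sub_apply, smul_apply]
    fun_prop
  have hint : ∀ i, Integrable fun z =>
      fderiv ℝ (fun z => newtonGrad ε z (basisE3 i)) z (basisE3 i) * g z := fun i =>
    ((hκd i).mul hg1.continuous).integrable_of_hasCompactSupport hgs.mul_left
  have hparts : ∀ i, conv (fun z => newtonGrad ε z (basisE3 i))
      (fun y => fderiv ℝ h y (basisE3 i)) x =
      ∫ z, fderiv ℝ (fun z => newtonGrad ε z (basisE3 i)) z (basisE3 i) * g z := by
    intro i
    have h1 := integral_mul_fderiv_eq_neg_fderiv_mul_of_integrable (μ := volume)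
      (f := fun z => newtonGrad ε z (basisE3 i)) (g := g) (v := basisE3 i) (hint i)
      (((hκc i).mul ((hg1.continuous_fderiv one_ne_zero).clm_apply
        continuous_const)).integrable_of_hasCompactSupport (hgs.fderiv_apply ℝ _).mul_left)
      (((hκc i).mul hg1.continuous).integrable_of_hasCompactSupport hgs.mul_left)
      (fun z _ => (hasFDerivAt_newtonGrad_apply hε0.ne' i z).differentiableAt)
      (fun z _ => hg1.differentiable one_ne_zero z)
    rw [← neg_eq_iff_eq_neg] at h1
    rw [← h1, ← integral_neg, conv]
    refine integral_congr_ae (Eventually.of_forall fun z => ?_)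
    simp only [hgd, smul_eq_mul]
    ring
  simp only [hparts]
  rw [← integral_finsetSum _ fun i _ => hint i]
  simp only [← Finset.sum_mul, sum_fderiv_newtonGrad hε0.ne']
  rw [← (integral_newtonLap hε0).2, ← integral_mul_const, ← Real.norm_eq_abs]
  refine norm_integral_le_of_norm_le ((integral_newtonLap hε0).1.mul_const M)
    (Eventually.of_forall fun z => ?_)
  rw [norm_mul]
  exact mul_le_mul_of_nonneg_left (hM _) (abs_nonneg _)

theorem invLaplacian_eq (h : E3 → ℝ) :
    invLaplacian h = fun x => -(1 / (4 * Real.pi)) * conv (newton 0) h x := by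
  funext x
  rw [conv_eq_integral, invLaplacian]
  simp only [newton, regDist_zero, smul_eq_mul, div_eq_mul_inv]

end Newton

end

section

open Filter Topology

/-! ### Local estimates for Newton potentials -/

theorem hess_mul {χ u : E3 → ℝ} (hχ : ContDiff ℝ 2 χ) (hu : ContDiff ℝ 2 u) (i : Fin 3) (x : E3) :
    hess (fun y => χ y * u y) i i x = χ x * hess u i i x +
      2 * (fderiv ℝ χ x (basisE3 i) * fderiv ℝ u x (basisE3 i)) + u x * hess χ i i x := by
  have hd : ∀ {g : E3 → ℝ}, ContDiff ℝ 2 g → Differentiable ℝ g := fun hg =>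
    hg.differentiable (by norm_num)
  have hd1 : ∀ {g : E3 → ℝ}, ContDiff ℝ 2 g →
      Differentiable ℝ fun y => fderiv ℝ g y (basisE3 i) := fun hg =>
    ((hg.fderiv_right (m := 1) (by norm_num)).clm_apply contDiff_const).differentiable one_ne_zero
  have h1 : (fun y => fderiv ℝ (fun y => χ y * u y) y (basisE3 i)) = fun y =>
      χ y * fderiv ℝ u y (basisE3 i) + u y * fderiv ℝ χ y (basisE3 i) := by
    funext y
    rw [fderiv_fun_mul (hd hχ y) (hd hu y)]
    simp
  have h2 : HasFDerivAt (fun y =>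
      χ y * fderiv ℝ u y (basisE3 i) + u y * fderiv ℝ χ y (basisE3 i)) _ x :=
    ((hd hχ x).hasFDerivAt.mul (hd1 hu x).hasFDerivAt).add
      ((hd hu x).hasFDerivAt.mul (hd1 hχ x).hasFDerivAt)
  rw [hess, h1, h2.fderiv]
  simp only [hess, add_apply, smul_apply, smul_eq_mul]
  ring

theorem abs_fderiv_conv_newton_le {h : E3 → ℝ} {r M : ℝ} (hh : Continuous h)
    (h0 : ∀ x, r < ‖x‖ → h x = 0) (hM : ∀ x, |h x| ≤ M) (i : Fin 3) (x : E3) :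
    |fderiv ℝ (conv (newton 0) h) x (basisE3 i)| ≤ convConst r * M := by
  rw [fderiv_conv_newton hh (hasCompactSupport_of_ball h0)]
  refine (ContinuousLinearMap.le_opNorm (conv (newtonGrad 0) h x) _).trans ?_
  rw [norm_basisE3, mul_one]
  exact (isKernel_newtonGrad 0).norm_conv_le hh h0 hM x

/-- Local `L^p` estimate for the second derivatives of a Newton potential. -/
theorem exists_eLpNorm_hess_le (r : ℝ) {R : ℝ} (hR : 0 < R) {p : ℝ≥0∞} (hp : p ≠ ⊤) :
    ∃ C : ℝ, 0 ≤ C ∧ ∀ (h : E3 → ℝ) (M : ℝ), ContDiff ℝ 1 h → (∀ x, r < ‖x‖ → h x = 0) →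
      (∀ x, |h x| ≤ M) → ∀ i j,
      eLpNorm (hess (conv (newton 0) h) i j) p (volume.restrict (Metric.closedBall 0 R)) ≤
        ENNReal.ofReal (C * M) := by
  obtain ⟨χ, hχ, hχs, -, O, hO, hRO, hχ1⟩ := exists_cutoff (isCompact_closedBall (0 : E3) R)
    isOpen_univ (subset_univ _)
  obtain ⟨Λ', hΛ'⟩ := hχs.isCompact.isBounded.subset_closedBall 0
  set Λ : ℝ := max Λ' 0 + 1 with hΛ
  have hΛ0 : 0 < Λ := by positivity
  have hχz : ∀ x, Λ ≤ ‖x‖ → χ x = 0 := fun x hx => by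
    by_contra hne
    have h1 := hΛ' (subset_tsupport χ hne)
    rw [mem_closedBall_zero_iff] at h1
    linarith [le_max_left Λ' 0]
  have hχ2 : ContDiff ℝ 2 χ := contDiff_infty.1 hχ 2
  have hχd : ∀ i, Continuous fun x => fderiv ℝ χ x (basisE3 i) := fun i =>
    (hχ2.continuous_fderiv (by norm_num)).clm_apply continuous_const
  have hχd1 : ∀ i, HasCompactSupport fun x => fderiv ℝ χ x (basisE3 i) := fun i =>
    hχs.fderiv_apply ℝ (basisE3 i)
  obtain ⟨D₀, hD₀⟩ := hχ2.continuous.bounded_above_of_compact_support hχs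
  have hD₁' : ∀ i, ∃ D, ∀ x, ‖fderiv ℝ χ x (basisE3 i)‖ ≤ D := fun i =>
    (hχd i).bounded_above_of_compact_support (hχd1 i)
  have hD₂' : ∀ i, ∃ D, ∀ x, ‖hess χ i i x‖ ≤ D := fun i =>
    (continuous_hess hχ2 i i).bounded_above_of_compact_support ((hχd1 i).fderiv_apply ℝ (basisE3 i))
  choose D₁ hD₁ using hD₁'
  choose D₂ hD₂ using hD₂'
  have hD₀0 : 0 ≤ D₀ := (norm_nonneg _).trans (hD₀ 0)
  have hD₁0 : ∀ i, 0 ≤ D₁ i := fun i => (norm_nonneg _).trans (hD₁ i 0)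
  have hD₂0 : ∀ i, 0 ≤ D₂ i := fun i => (norm_nonneg _).trans (hD₂ i 0)
  have hcc := convConst_nonneg r
  set B : ℝ := D₀ * lapConst + ∑ i, (2 * (D₁ i * convConst r) + convConst r * D₂ i) with hB
  have hB0 : 0 ≤ B := by
    have := lapConst_nonneg
    exact add_nonneg (by positivity) (Finset.sum_nonneg fun i _ => by
      have := hD₁0 i
      have := hD₂0 i
      positivity)
  obtain ⟨n, hn⟩ : ∃ n : ℕ, p.toReal ≤ (2 ^ (n + 1) : ℕ) := by
    obtain ⟨n, hn⟩ := exists_nat_ge p.toReal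
    refine ⟨n, hn.trans ?_⟩
    exact_mod_cast (Nat.lt_two_pow_self.le.trans (Nat.pow_le_pow_right (by norm_num) n.le_succ) :
      n ≤ 2 ^ (n + 1))
  set q : ℕ := 2 ^ (n + 1) with hq
  have hq0 : q ≠ 0 := by positivity
  have hpq : p ≤ (q : ℝ≥0∞) := by
    rw [← ENNReal.ofReal_toReal hp, ← ENNReal.ofReal_natCast q]
    exact ENNReal.ofReal_le_ofReal hn
  obtain ⟨C, hC, hcz⟩ := exists_integral_hess_le n hΛ0
  set μ := volume.restrict (Metric.closedBall (0 : E3) R) with hμ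
  set v : ℝ≥0∞ := μ univ ^ (1 / p.toReal - 1 / (q : ℝ≥0∞).toReal) with hv
  have hμtop : μ univ ≠ ⊤ := by
    rw [hμ, Measure.restrict_apply_univ]
    exact measure_closedBall_lt_top.ne
  have hμ0 : μ univ ≠ 0 := by
    rw [hμ, Measure.restrict_apply_univ]
    exact (Metric.measure_closedBall_pos volume 0 hR).ne'
  have hvtop : v ≠ ⊤ := by rw [hv]; exact ENNReal.rpow_ne_top_of_ne_zero hμ0 hμtop
  refine ⟨C ^ (q : ℝ)⁻¹ * B * v.toReal, by positivity, fun h M hh h0 hM i j => ?_⟩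
  have hM0 : 0 ≤ M := (abs_nonneg _).trans (hM 0)
  have hs := hasCompactSupport_of_ball h0
  set u := conv (newton 0) h with hu
  have hu2 : ContDiff ℝ 2 u := by
    have := contDiff_conv_newton (n := 1) (by exact_mod_cast hh) hs
    exact_mod_cast this
  set W : E3 → ℝ := fun y => χ y * u y with hW
  have hW2 : ContDiff ℝ 2 W := hχ2.mul hu2
  have hbu : ∀ x, |u x| ≤ convConst r * M := fun x =>
    (isKernel_newton 0).norm_conv_le hh.continuous h0 hM x
  have hlap : ∀ x, |∑ i, hess W i i x| ≤ B * M := by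
    intro x
    simp only [hW, hess_mul hχ2 hu2]
    simp only [add_assoc]
    rw [Finset.sum_add_distrib, ← Finset.mul_sum]
    refine (abs_add_le _ _).trans ?_
    rw [hB, add_mul, Finset.sum_mul]
    refine add_le_add ?_ ((Finset.abs_sum_le_sum_abs _ _).trans (Finset.sum_le_sum fun i _ => ?_))
    · rw [abs_mul, mul_assoc]
      exact mul_le_mul (hD₀ x) (abs_laplacian_conv_newton_le hh hs hM x) (abs_nonneg _) hD₀0
    · refine (abs_add_le _ _).trans ?_
      rw [abs_mul, abs_mul, abs_mul, abs_two, add_mul]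
      refine add_le_add ?_ ?_
      · have := mul_le_mul (hD₁ i x) (abs_fderiv_conv_newton_le hh.continuous h0 hM i x)
          (abs_nonneg _) (hD₁0 i)
        rw [Real.norm_eq_abs] at this
        linarith
      · have := mul_le_mul (hbu x) (hD₂ i x) (norm_nonneg _) (by positivity)
        rw [Real.norm_eq_abs] at this
        linarith
  have hWu : ∀ x ∈ Metric.closedBall (0 : E3) R, hess u i j x = hess W i j x := by
    intro x hx
    have h1 : W =ᶠ[𝓝 x] u := by
      filter_upwards [hO.mem_nhds (hRO hx)] with y hy
      rw [hW]
      simp [hχ1 y hy]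
    have h2 : (fun y => fderiv ℝ W y (basisE3 j)) =ᶠ[𝓝 x] fun y => fderiv ℝ u y (basisE3 j) := by
      filter_upwards [h1.fderiv (𝕜 := ℝ)] with y hy
      rw [hy]
    rw [hess, hess, h2.fderiv_eq]
  have hint := hcz W (B * M) (by positivity) hW2 (fun x hx => by simp [hW, hχz x hx]) hlap i j
  have hWz : HasCompactSupport (hess W i j) :=
    ((hχs.mul_right (f' := u)).fderiv_apply ℝ (basisE3 j)).fderiv_apply ℝ (basisE3 i)
  have hWm : MemLp (hess W i j) (q : ℝ≥0∞) :=
    (continuous_hess hW2 i j).memLp_of_hasCompactSupport hWz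
  have h1 : eLpNorm (hess W i j) (q : ℝ≥0∞) volume ≤
      ENNReal.ofReal (C ^ (q : ℝ)⁻¹ * (B * M)) := by
    rw [hWm.eLpNorm_eq_integral_rpow_norm (by exact_mod_cast hq0) (by simp)]
    refine ENNReal.ofReal_le_ofReal ?_
    simp only [ENNReal.toReal_natCast, Real.rpow_natCast, Real.norm_eq_abs]
    refine (Real.rpow_le_rpow (integral_nonneg fun x => by positivity) hint (by positivity)).trans ?_
    rw [Real.mul_rpow hC (by positivity), Real.pow_rpow_inv_natCast (by positivity) hq0]
  calc eLpNorm (hess u i j) p μ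
      = eLpNorm (hess W i j) p μ := eLpNorm_congr_ae (by
        filter_upwards [self_mem_ae_restrict Metric.isClosed_closedBall.measurableSet] with x hx
        exact hWu x hx)
    _ ≤ eLpNorm (hess W i j) (q : ℝ≥0∞) μ * v :=
        eLpNorm_le_eLpNorm_mul_rpow_measure_univ hpq hWm.1.restrict
    _ ≤ ENNReal.ofReal (C ^ (q : ℝ)⁻¹ * (B * M)) * ENNReal.ofReal v.toReal := by
        rw [ENNReal.ofReal_toReal hvtop]
        exact mul_le_mul_left ((eLpNorm_mono_measure _ Measure.restrict_le_self).trans h1) _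
    _ = _ := by
        rw [← ENNReal.ofReal_mul (by positivity)]
        congr 1
        ring

theorem dlist_eq_zero_of_lt {h : E3 → ℝ} {r : ℝ} (h0 : ∀ x, r < ‖x‖ → h x = 0) (l : List E3) :
    ∀ x, r < ‖x‖ → dlist l h x = 0 := by
  induction l with
  | nil => exact h0
  | cons w l ih =>
    intro x hx
    have : dlist l h =ᶠ[𝓝 x] fun _ => 0 := by
      filter_upwards [(isOpen_lt continuous_const continuous_norm).mem_nhds hx] with y hy
      exact ih y hy
    simp [dlist_cons, this.fderiv_eq]

theorem contDiff_dlist {h : E3 → ℝ} {n m : ℕ} (hh : ContDiff ℝ n h) (l : List E3)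
    (hl : m + l.length ≤ n) : ContDiff ℝ m (dlist l h) :=
  contDiff_iff_contDiffAt.2 fun _ =>
    contDiffAt_dlist l (hh.contDiffAt.of_le (by exact_mod_cast hl))

theorem dlist_conv_newton {h : E3 → ℝ} {r : ℝ} {n : ℕ} (hh : ContDiff ℝ n h)
    (h0 : ∀ x, r < ‖x‖ → h x = 0) (l : List E3) (hl : l.length ≤ n) :
    dlist l (conv (newton 0) h) = conv (newton 0) (dlist l h) := by
  induction l with
  | nil => rfl
  | cons w l ih =>
    rw [List.length_cons] at hl
    funext x
    rw [dlist_cons, ih (by omega)]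
    exact (isKernel_newton 0).fderiv_conv
      (by exact_mod_cast contDiff_dlist (m := 1) hh l (by omega))
      (hasCompactSupport_of_ball (dlist_eq_zero_of_lt h0 l)) x w

/-- Local `L^p` estimate for the derivatives of a Newton potential. -/
theorem exists_eLpNorm_dlist_conv_newton_le (r : ℝ) {R : ℝ} (hR : 0 < R) {p : ℝ≥0∞}
    (hp : p ≠ ⊤) :
    ∃ C : ℝ, 0 ≤ C ∧ ∀ (h : E3 → ℝ) (n : ℕ) (M : ℝ) (l : List E3), ContDiff ℝ n h →
      (∀ x, r < ‖x‖ → h x = 0) → (∀ w ∈ l, ∃ i, w = basisE3 i) → l.length ≤ n + 1 →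
      (∀ x, |dlist (l.drop 2) h x| ≤ M) →
      eLpNorm (dlist l (conv (newton 0) h)) p (volume.restrict (Metric.closedBall 0 R)) ≤
        ENNReal.ofReal (C * M) := by
  obtain ⟨C, hC, hhess⟩ := exists_eLpNorm_hess_le r hR hp
  set μ := volume.restrict (Metric.closedBall (0 : E3) R) with hμ
  set v : ℝ≥0∞ := μ univ ^ p.toReal⁻¹ with hv
  have hμtop : μ univ ≠ ⊤ := by
    rw [hμ, Measure.restrict_apply_univ]
    exact measure_closedBall_lt_top.ne
  have hvtop : v ≠ ⊤ := ENNReal.rpow_ne_top_of_nonneg (by positivity) hμtop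
  have hcc := convConst_nonneg r
  refine ⟨C + v.toReal * convConst r, by positivity, fun h n M l hh h0 hl hn hM => ?_⟩
  have hM0 : 0 ≤ M := (abs_nonneg _).trans (hM 0)
  have hsup : ∀ {g : E3 → ℝ}, (∀ x, |g x| ≤ convConst r * M) →
      eLpNorm g p μ ≤ ENNReal.ofReal ((C + v.toReal * convConst r) * M) := by
    intro g hg
    refine (eLpNorm_le_of_ae_bound (C := convConst r * M) (Eventually.of_forall hg)).trans ?_
    rw [← hv, ← ENNReal.ofReal_toReal hvtop, ← ENNReal.ofReal_mul (by positivity)]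
    refine ENNReal.ofReal_le_ofReal ?_
    rw [ENNReal.toReal_ofReal (by positivity)]
    nlinarith [mul_nonneg hC hM0]
  match l with
  | [] => exact hsup fun x => (isKernel_newton 0).norm_conv_le hh.continuous h0 hM x
  | [w] =>
    obtain ⟨i, rfl⟩ := hl w (by simp)
    exact hsup fun x => abs_fderiv_conv_newton_le hh.continuous h0 hM i x
  | w₁ :: w₂ :: l' =>
    obtain ⟨i, rfl⟩ := hl w₁ (by simp)
    obtain ⟨j, rfl⟩ := hl w₂ (by simp)
    simp only [List.length_cons] at hn
    have h1 := hhess (dlist l' h) M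
      (by exact_mod_cast contDiff_dlist (m := 1) hh l' (by omega))
      (dlist_eq_zero_of_lt h0 l') hM i j
    rw [← dlist_conv_newton hh h0 l' (by omega)] at h1
    refine h1.trans (ENNReal.ofReal_le_ofReal (mul_le_mul_of_nonneg_right ?_ hM0))
    nlinarith [mul_nonneg (ENNReal.toReal_nonneg (a := v)) hcc]

/-- Differentiation of a Newton potential with respect to a parameter. -/
theorem hasDerivAt_conv_newton {ρ ρ' : ℝ → E3 → ℝ} {r M : ℝ} (hρ : ∀ s, Continuous (ρ s))
    (hρ' : ∀ s, Continuous (ρ' s)) (h0 : ∀ s x, r < ‖x‖ → ρ s x = 0)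
    (h0' : ∀ s x, r < ‖x‖ → ρ' s x = 0) (hM : ∀ s x, |ρ' s x| ≤ M)
    (hd : ∀ s x, HasDerivAt (fun s => ρ s x) (ρ' s x) s) (s : ℝ) (x : E3) :
    HasDerivAt (fun s => conv (newton 0) (ρ s) x) (conv (newton 0) (ρ' s) x) s := by
  have hi : ∀ {h : E3 → ℝ}, Continuous h → (∀ x, r < ‖x‖ → h x = 0) →
      Integrable fun z => h (x - z) • newton 0 z := fun hh h0 =>
    (isKernel_newton 0).integrable hh (hasCompactSupport_of_ball h0) x
  refine (hasDerivAt_integral_of_dominated_loc_of_deriv_le (s := univ)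
    (bound := (Metric.ball (0 : E3) (‖x‖ + r + 1)).indicator fun z => M * kernelBound z) univ_mem
    (Eventually.of_forall fun s => (hi (hρ s) (h0 s)).1) (hi (hρ s) (h0 s))
    (F' := fun s z => ρ' s (x - z) • newton 0 z) (hi (hρ' s) (h0' s)).1 ?_
    ((integrable_indicator_iff measurableSet_ball).2 ((integrableOn_kernelBound _).const_mul M))
    (Eventually.of_forall fun z s _ => (hd s (x - z)).smul_const _)).2
  filter_upwards [ae_ne_zero] with z hz s _
  rw [norm_smul]
  by_cases hzz : z ∈ Metric.ball (0 : E3) (‖x‖ + r + 1)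
  · rw [indicator_of_mem hzz]
    exact mul_le_mul (hM _ _) ((isKernel_newton 0).bound z hz) (norm_nonneg _)
      ((abs_nonneg _).trans (hM 0 0))
  · rw [indicator_of_notMem hzz, h0' s (x - z), norm_zero, zero_mul]
    rw [mem_ball_zero_iff, not_lt] at hzz
    have := norm_sub_norm_le z x
    rw [norm_sub_rev] at this
    linarith

end

section

open Filter Topology

/-! ### Decay of the density and of the potential -/

/-- Constants that depend on a multi-index of bounded order can be chosen uniformly. -/
theorem exists_uniform_multiIndex (N : ℕ) {P : (Fin 3 → ℕ) → ℝ → Prop}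
    (hmono : ∀ α C C', P α C → C ≤ C' → P α C') (h : ∀ α, order α ≤ N → ∃ C, P α C) :
    ∃ C, 0 ≤ C ∧ ∀ α, order α ≤ N → P α C := by
  have h' : ∀ α, ∃ C, order α ≤ N → P α C := fun α => by
    by_cases hα : order α ≤ N
    · exact (h α hα).imp fun C hC _ => hC
    · exact ⟨0, fun h => absurd h hα⟩
  choose C hC using h'
  set S : Finset (Fin 3 → ℕ) := Fintype.piFinset fun _ => Finset.range (N + 1) with hS
  refine ⟨∑ α ∈ S, |C α|, Finset.sum_nonneg fun _ _ => abs_nonneg _, fun α hα =>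
    hmono α _ _ (hC α hα) ((le_abs_self _).trans ?_)⟩
  refine Finset.single_le_sum (f := fun α => |C α|) (fun _ _ => abs_nonneg _) ?_
  rw [hS, Fintype.mem_piFinset]
  intro i
  rw [Finset.mem_range]
  have : α i ≤ order α := Finset.single_le_sum (f := α) (fun _ _ => Nat.zero_le _)
    (Finset.mem_univ i)
  omega

/-- The derivative of `f` in the list of directions `l` commutes with constant factors. -/
theorem dlist_const_mul {V : Type*} [NormedAddCommGroup V] [NormedSpace ℝ V] (l : List V) (a : ℝ)
    (g : V → ℝ) : dlist l (fun y => a * g y) = fun y => a * dlist l g y := by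
  induction l with
  | nil => rfl
  | cons w l ih =>
    funext y
    have h1 : fderiv ℝ (fun y => a * dlist l g y) y = a • fderiv ℝ (dlist l g) y :=
      congrFun (fderiv_const_smul_field (𝕜 := ℝ) a (f := dlist l g)) y
    rw [dlist_cons, dlist_cons, ih]
    simp only [h1]
    rfl

section Solution

variable {X : (Fin 6 → ℝ) → Phase} {c₀ h₀ l₁ l₂ n₀ : ℝ}

/-- Solutions as oscillating profiles along the clock. -/
theorem exists_isOsc_solution (hX : IsDelaunayCoordinates X) (hc₀ : 0 < c₀) (hh₀ : 0 < h₀)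
    (hl₁ : 0 < l₁) (hn₀ : 0 < n₀) (N : ℕ) {ν : Phase → ℝ}
    (hν : ∀ z ∈ orbitRegion c₀ h₀ l₁ l₂ n₀, ν z = Real.sqrt (-2 * energy z) ^ 3) :
    ∃ D : ℝ, 0 ≤ D ∧ ∀ (A : ℝ) (g : Phase → ℝ) (f : ℝ → Phase → ℝ), 0 ≤ A → ContDiff ℝ N g →
      (∀ z ∉ orbitRegion c₀ h₀ l₁ l₂ n₀, g z = 0) →
      (∀ k ≤ N, ∀ z, ‖iteratedFDeriv ℝ k g z‖ ≤ A) → IsClassicalSolution f g →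
      ∃ b, IsOsc (orbitRegion c₀ h₀ l₁ l₂ n₀) N (D * A) b ∧
        ∀ s, 0 ≤ s → f s = fun z => b (-(s * ν z), z) := by
  obtain ⟨D, hD, h⟩ := hX.exists_isOsc (l₂ := l₂) hc₀ hh₀ hl₁ hn₀ N
  exact ⟨D, hD, fun A g f hA hg hg0 hgA hf => ⟨_, h A g hA hg hg0 hgA, fun s hs =>
    funext fun z => hf.eq_rotation hX hc₀ hh₀ hl₁ hn₀ hν hg0 hs z⟩⟩

end Solution

section Profile

variable {K : Set Phase} {ν μ : Phase → ℝ} {n : ℕ} {M : ℝ} {b : ℝ × Phase → ℝ}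
  {f : ℝ → Phase → ℝ}

theorem density_eq_velAvg (hf : ∀ s, 0 ≤ s → f s = fun z => b (-(s * ν z), z)) {s : ℝ}
    (hs : 0 ≤ s) : density f s = velAvg ν b s := by
  funext x
  simp only [density, velAvg, hf s hs]

/-- The profile of the time derivative of the density. -/
def timeProfile (ν : Phase → ℝ) (b : ℝ × Phase → ℝ) (p : ℝ × Phase) : ℝ := -(ν p.2 * b p)

theorem exists_isOsc_timeProfile (hc : IsClock K ν μ) (n : ℕ) : ∃ C : ℝ, 0 ≤ C ∧
    ∀ M b, IsOsc K n M b → IsOsc K n (C * M) (timeProfile ν b) := by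
  obtain ⟨C, hC, h⟩ := exists_isOsc_mul K n hc.smooth hc.support
  exact ⟨C, hC, fun M b hb => (h M b hb).neg⟩

theorem hasDerivWithinAt_density (hc : IsClock K ν μ) (hb : IsOsc K 1 M b)
    (hf : ∀ s, 0 ≤ s → f s = fun z => b (-(s * ν z), z)) {s : ℝ} (hs : 0 ≤ s) (x : E3) :
    HasDerivWithinAt (fun s => density f s x) (velAvg ν (angDeriv (timeProfile ν b)) s x)
      (Ici 0) s := by
  refine (hc.hasDerivAt_velAvg hb s x).hasDerivWithinAt.congr (fun τ hτ => ?_) ?_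
  · rw [density_eq_velAvg hf hτ]
  · rw [density_eq_velAvg hf hs]

theorem timeDeriv_density (hc : IsClock K ν μ) (hb : IsOsc K 1 M b)
    (hf : ∀ s, 0 ≤ s → f s = fun z => b (-(s * ν z), z)) {s : ℝ} (hs : 0 ≤ s) :
    timeDeriv (density f) s = velAvg ν (angDeriv (timeProfile ν b)) s :=
  funext fun x => (hasDerivWithinAt_density hc hb hf hs x).derivWithin
    (uniqueDiffOn_Ici 0 s hs)

theorem IsClock.exists_radius (hc : IsClock K ν μ) : ∃ r : ℝ, ∀ n M b, IsOsc K n M b →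
    ∀ s x, r < ‖x‖ → velAvg ν b s x = 0 := by
  obtain ⟨r, hr⟩ := (hc.compact.image continuous_fst).isBounded.subset_closedBall 0
  refine ⟨r, fun n M b hb s x hx => velAvg_eq_zero hb fun hmem => ?_⟩
  have := hr hmem
  rw [mem_closedBall_zero_iff] at this
  linarith

theorem hasDerivWithinAt_potential (hc : IsClock K ν μ) (hb : IsOsc K 1 M b)
    (hf : ∀ s, 0 ≤ s → f s = fun z => b (-(s * ν z), z)) {s : ℝ} (hs : 0 ≤ s) (x : E3) :
    HasDerivWithinAt (fun s => potential f s x)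
      (-(1 / (4 * Real.pi)) *
        conv (newton 0) (velAvg ν (angDeriv (timeProfile ν b)) s) x) (Ici 0) s := by
  obtain ⟨r, hr⟩ := hc.exists_radius
  obtain ⟨C, -, hC⟩ := exists_abs_velAvg_le hc.compact ν
  obtain ⟨D, -, hD⟩ := exists_isOsc_timeProfile hc 1
  have hb' : IsOsc K 0 (D * M) (angDeriv (timeProfile ν b)) :=
    IsOsc.angDeriv hc.compact.isClosed (hD M b hb)
  have h1 := hasDerivAt_conv_newton (ρ := velAvg ν b)
    (ρ' := velAvg ν (angDeriv (timeProfile ν b)))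
    (fun s => (contDiff_velAvg hc.compact hc.smooth hb s).continuous)
    (fun s => (contDiff_velAvg hc.compact hc.smooth hb' s).continuous)
    (hr _ _ _ hb) (hr _ _ _ hb') (hC _ _ _ hb') (fun s x => hc.hasDerivAt_velAvg hb s x) s x
  have h2 : ∀ τ, 0 ≤ τ → potential f τ x =
      -(1 / (4 * Real.pi)) * conv (newton 0) (velAvg ν b τ) x := fun τ hτ => by
    rw [potential, invLaplacian_eq, density_eq_velAvg hf hτ]
  exact (h1.const_mul _).hasDerivWithinAt.congr (fun τ hτ => h2 τ hτ) (h2 s hs)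

theorem timeDeriv_potential (hc : IsClock K ν μ) (hb : IsOsc K 1 M b)
    (hf : ∀ s, 0 ≤ s → f s = fun z => b (-(s * ν z), z)) {s : ℝ} (hs : 0 ≤ s) :
    timeDeriv (potential f) s = fun x => -(1 / (4 * Real.pi)) *
        conv (newton 0) (velAvg ν (angDeriv (timeProfile ν b)) s) x :=
  funext fun x => (hasDerivWithinAt_potential hc hb hf hs x).derivWithin
    (uniqueDiffOn_Ici 0 s hs)

theorem exists_abs_partialDeriv_density_le (hc : IsClock K ν μ) (N : ℕ) :
    ∃ C : ℝ, 0 ≤ C ∧ ∀ (M : ℝ) (b : ℝ × Phase → ℝ) (f : ℝ → Phase → ℝ), 0 ≤ M →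
      IsOsc K N M b → (∀ s, 0 ≤ s → f s = fun z => b (-(s * ν z), z)) → ∀ s, 0 ≤ s →
      ∀ α : Fin 3 → ℕ, order α + 1 ≤ N → ∀ x,
        |partialDeriv basisE3 α (timeDeriv (density f) s) x| ≤
          C * M * bracket s ^ (-((N : ℤ) - order α)) := by
  obtain ⟨D, hD, hprof⟩ := exists_isOsc_timeProfile hc N
  obtain ⟨C, hC, h⟩ := exists_uniform_multiIndex (N - 1) (P := fun α C => ∀ M c, 0 ≤ M →
    order α + 1 ≤ N → IsOsc K N M c → ∀ s x,
      |partialDeriv basisE3 α (velAvg ν (angDeriv c) s) x| ≤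
        C * M * bracket s ^ (-((N : ℤ) - order α)))
    (fun α C C' h hCC' M c hM hα hc s x => (h M c hM hα hc s x).trans (by
      have := bracket_pos s
      gcongr))
    (fun α _ => by
      by_cases hα : order α + 1 ≤ N
      · obtain ⟨C, -, h⟩ := hc.exists_abs_dlist_velAvg_le N (dirList basisE3 α)
          (by rwa [length_dirList])
        refine ⟨C, fun M c _ _ hc s x => ?_⟩
        rw [partialDeriv_eq_dlist]
        simpa only [length_dirList] using h M c hc s x
      · exact ⟨0, fun _ _ _ h => absurd h hα⟩)
  refine ⟨C * D, by positivity, fun M b f hM hb hf s hs α hα x => ?_⟩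
  rw [timeDeriv_density hc (hb.of_le (by omega)) hf hs]
  refine (h α (by omega) (D * M) _ (by positivity) hα (hprof M b hb) s x).trans (le_of_eq ?_)
  ring

theorem exists_eLpNorm_partialDeriv_potential_le (hc : IsClock K ν μ) {N : ℕ} (hN : 1 ≤ N)
    {p : ℝ≥0∞} (hp : p ≠ ⊤) {R : ℝ} (hR : 0 < R) :
    ∃ C : ℝ, 0 ≤ C ∧ ∀ (M : ℝ) (b : ℝ × Phase → ℝ) (f : ℝ → Phase → ℝ), 0 ≤ M →
      IsOsc K N M b → (∀ s, 0 ≤ s → f s = fun z => b (-(s * ν z), z)) → ∀ s, 0 ≤ s →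
      ∀ α : Fin 3 → ℕ, order α ≤ N →
        eLpNorm (partialDeriv basisE3 α (timeDeriv (potential f) s)) p
          (volume.restrict (Metric.closedBall 0 R)) ≤
          ENNReal.ofReal (C * M * bracket s ^ (-(min ((N : ℤ) - order α + 2) (N : ℤ)))) := by
  obtain ⟨r, hr⟩ := hc.exists_radius
  obtain ⟨D, hD, hprof⟩ := exists_isOsc_timeProfile hc N
  obtain ⟨E, hE, hpot⟩ := exists_eLpNorm_dlist_conv_newton_le r hR hp
  obtain ⟨C, hC, h⟩ := exists_uniform_multiIndex N (P := fun α C => ∀ M c, 0 ≤ M →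
    order α ≤ N → IsOsc K N M c → ∀ s x,
      |dlist ((dirList basisE3 α).drop 2) (velAvg ν (angDeriv c) s) x| ≤
        C * M * bracket s ^ (-(min ((N : ℤ) - order α + 2) (N : ℤ))))
    (fun α C C' h hCC' M c hM hα hc s x => (h M c hM hα hc s x).trans (by
      have := bracket_pos s
      gcongr))
    (fun α hα => by
      have hlen : ((dirList basisE3 α).drop 2).length = order α - 2 := by
        rw [List.length_drop, length_dirList]
      obtain ⟨C, -, h⟩ := hc.exists_abs_dlist_velAvg_le N ((dirList basisE3 α).drop 2)
        (by rw [hlen]; omega)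
      refine ⟨C, fun M c _ _ hc s x => (h M c hc s x).trans (le_of_eq ?_)⟩
      rw [hlen]
      congr 2
      omega)
  refine ⟨E * (C * D), by positivity, fun M b f hM hb hf s hs α hα => ?_⟩
  obtain ⟨n, rfl⟩ : ∃ n, N = n + 1 := ⟨N - 1, by omega⟩
  have hb' : IsOsc K n (D * M) (angDeriv (timeProfile ν b)) :=
    IsOsc.angDeriv hc.compact.isClosed (hprof M b hb)
  rw [timeDeriv_potential hc (hb.of_le (by omega)) hf hs, partialDeriv_eq_dlist, dlist_const_mul]
  have h1 := hpot (velAvg ν (angDeriv (timeProfile ν b)) s) n _ (dirList basisE3 α)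
    (contDiff_velAvg hc.compact hc.smooth hb' s) (hr _ _ _ hb' s) (fun w hw => mem_dirList hw)
    (by rwa [length_dirList])
    (h α hα (D * M) _ (by positivity) hα (hprof M b hb) s)
  refine le_trans (eLpNorm_mono fun x => ?_) (h1.trans (ENNReal.ofReal_le_ofReal (le_of_eq ?_)))
  · rw [norm_mul]
    refine mul_le_of_le_one_left (norm_nonneg _) ?_
    rw [norm_neg, Real.norm_of_nonneg (by positivity)]
    exact div_le_one_of_le₀ (by linarith [Real.pi_gt_three]) (by positivity)
  · ring

end Profile

end

end KeplerVlasov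

end

open KeplerVlasov

theorem theorem1p1 (c₀ h₀ l₁ l₂ n₀ n₁ : ℝ) (hc₀ : 0 < c₀) (hh₀ : 0 < h₀) (hl₁ : 0 < l₁)
    (hl₂ : 0 < l₂) (hn₀ : 0 < n₀) (hn₁ : 0 < n₁) (N : ℕ) (hN : 1 ≤ N) :
    KeplerVlasov.trappedRegion c₀ h₀ l₁ l₂ n₀ n₁ ⊆ KeplerVlasov.delaunayDomain ∧
    ∃ X : (Fin 6 → ℝ) → KeplerVlasov.Phase, KeplerVlasov.IsDelaunayCoordinates X ∧
    ∃ (C : ℝ) (C' : ℝ≥0∞ → ℝ → ℝ),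
      ∀ (A : ℝ) (g : KeplerVlasov.Phase → ℝ) (f : ℝ → KeplerVlasov.Phase → ℝ), 0 < A →
        ContDiff ℝ N g →
        tsupport g ⊆ KeplerVlasov.trappedRegion c₀ h₀ l₁ l₂ n₀ n₁ →
        KeplerVlasov.cNorm N g ≤ ENNReal.ofReal A →
        KeplerVlasov.IsClassicalSolution f g →
        -- the quantities to be estimated exist
        ((∀ s : ℝ, 0 ≤ s →
            ContDiff ℝ N (f s) ∧ HasCompactSupport (f s) ∧
            ContDiff ℝ ((N - 1 : ℕ) : ℕ∞)
              (KeplerVlasov.timeDeriv (KeplerVlasov.density f) s) ∧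
            ContDiff ℝ N (KeplerVlasov.timeDeriv (KeplerVlasov.potential f) s)) ∧
          (∀ x : KeplerVlasov.E3,
            DifferentiableOn ℝ (fun s => KeplerVlasov.density f s x) (Ici 0) ∧
            DifferentiableOn ℝ (fun s => KeplerVlasov.potential f s x) (Ici 0))) ∧
        -- growth of the derivatives in position and velocity
        (∀ s : ℝ, 0 ≤ s → ∀ α β : Fin 3 → ℕ,
          KeplerVlasov.order α + KeplerVlasov.order β ≤ N → ∀ z : KeplerVlasov.Phase,
            |KeplerVlasov.phaseDeriv α β (f s) z| ≤
              C * A * KeplerVlasov.bracket s ^ (KeplerVlasov.order α + KeplerVlasov.order β)) ∧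
        -- improved estimates in Delaunay variables
        (∀ t : ℝ, 0 ≤ t → ∀ i : Fin 6 → ℕ, KeplerVlasov.order i ≤ N →
          ∀ y ∈ KeplerVlasov.delaunayRange,
            |KeplerVlasov.partialDeriv KeplerVlasov.dirDelaunay i (fun y' => f t (X y')) y| ≤
              C * A * KeplerVlasov.bracket t ^ (i 0)) ∧
        -- decay of the time derivative of the density
        (∀ s : ℝ, 0 ≤ s → ∀ α : Fin 3 → ℕ, KeplerVlasov.order α + 2 ≤ N →
          ∀ x : KeplerVlasov.E3,
            |KeplerVlasov.partialDeriv KeplerVlasov.basisE3 α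
                (KeplerVlasov.timeDeriv (KeplerVlasov.density f) s) x| ≤
              C * A * KeplerVlasov.bracket s ^ (-((N : ℤ) - KeplerVlasov.order α))) ∧
        -- decay of the time derivative of the potential
        (∀ p : ℝ≥0∞, 1 ≤ p → p ≠ ⊤ → ∀ R : ℝ, 0 < R → ∀ s : ℝ, 0 ≤ s →
          ∀ α : Fin 3 → ℕ, KeplerVlasov.order α ≤ N →
            eLpNorm (KeplerVlasov.partialDeriv KeplerVlasov.basisE3 α
                (KeplerVlasov.timeDeriv (KeplerVlasov.potential f) s)) p
                (volume.restrict (Metric.closedBall 0 R)) ≤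
              ENNReal.ofReal (C' p R * A *
                KeplerVlasov.bracket s ^
                  (-(min ((N : ℤ) - KeplerVlasov.order α + 2) (N : ℤ))))) := by
  have hX := isDelaunayCoordinates_delaunayX
  obtain ⟨ν, μ, hc, hν⟩ := exists_isClock (l₂ := l₂) hX hc₀ hh₀ hl₁ hn₀
  obtain ⟨C₀, hC₀, hnorm⟩ := exists_norm_iteratedFDeriv_le N
  obtain ⟨D, hD, hsol⟩ := exists_isOsc_solution (l₂ := l₂) hX hc₀ hh₀ hl₁ hn₀ N hν
  obtain ⟨C₁, hC₁, hgrow⟩ := hc.exists_growth N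
  obtain ⟨C₂, hC₂, hdel⟩ := exists_delaunay_growth (l₂ := l₂) hX hc₀ hh₀ hl₁ hn₀ N
  obtain ⟨C₃, hC₃, hden⟩ := exists_abs_partialDeriv_density_le hc N
  have hpot : ∀ (p : ℝ≥0∞) (R : ℝ), ∃ C : ℝ, p ≠ ⊤ → 0 < R → 0 ≤ C ∧
      ∀ (M : ℝ) (b : ℝ × Phase → ℝ) (f : ℝ → Phase → ℝ), 0 ≤ M →
      IsOsc (orbitRegion c₀ h₀ l₁ l₂ n₀) N M b →
      (∀ s, 0 ≤ s → f s = fun z => b (-(s * ν z), z)) → ∀ s, 0 ≤ s →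
      ∀ α : Fin 3 → ℕ, order α ≤ N →
        eLpNorm (partialDeriv basisE3 α (timeDeriv (potential f) s)) p
          (volume.restrict (Metric.closedBall 0 R)) ≤
          ENNReal.ofReal (C * M * bracket s ^ (-(min ((N : ℤ) - order α + 2) (N : ℤ)))) := by
    intro p R
    by_cases h : p ≠ ⊤ ∧ 0 < R
    · obtain ⟨C, hC, hC'⟩ := exists_eLpNorm_partialDeriv_potential_le hc hN h.1 h.2
      exact ⟨C, fun _ _ => ⟨hC, hC'⟩⟩
    · exact ⟨0, fun h1 h2 => absurd ⟨h1, h2⟩ h⟩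
  choose C₄ hC₄ using hpot
  refine ⟨trappedRegion_subset_orbitRegion.trans (orbitRegion_subset hc₀ hh₀ hl₁ hn₀),
    delaunayX, hX, C₁ * (D * C₀) + C₂ * C₀ + C₃ * (D * C₀), fun p R => C₄ p R * (D * C₀),
    fun A g f hA hg hgs hgA hf => ?_⟩
  have hg0 : ∀ z ∉ orbitRegion c₀ h₀ l₁ l₂ n₀, g z = 0 := fun z hz =>
    image_eq_zero_of_notMem_tsupport fun h => hz (trappedRegion_subset_orbitRegion (hgs h))
  have hgb := hnorm g A hA.le hg hgA
  have hA₀ : 0 ≤ C₀ * A := by positivity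
  obtain ⟨b, hb, hfb⟩ := hsol (C₀ * A) g f hA₀ hg hg0 hgb hf
  have hM : 0 ≤ D * (C₀ * A) := by positivity
  have hb1 := hb.of_le hN
  have hcd : ∀ s, 0 ≤ s → ContDiff ℝ N (f s) := fun s hs => by
    rw [hfb s hs]
    exact contDiff_eval hc.smooth hb.contDiff s
  have hle₁ : C₁ * (D * C₀) ≤ C₁ * (D * C₀) + C₂ * C₀ + C₃ * (D * C₀) := by
    have : 0 ≤ C₂ * C₀ + C₃ * (D * C₀) := by positivity
    linarith
  have hle₂ : C₂ * C₀ ≤ C₁ * (D * C₀) + C₂ * C₀ + C₃ * (D * C₀) := by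
    have : 0 ≤ C₁ * (D * C₀) + C₃ * (D * C₀) := by positivity
    linarith
  have hle₃ : C₃ * (D * C₀) ≤ C₁ * (D * C₀) + C₂ * C₀ + C₃ * (D * C₀) := by
    have : 0 ≤ C₁ * (D * C₀) + C₂ * C₀ := by positivity
    linarith
  refine ⟨⟨fun s hs => ⟨hcd s hs, ?_, ?_, ?_⟩, fun x => ⟨?_, ?_⟩⟩, fun s hs α β hαβ z => ?_,
    fun t ht i hi y hy => ?_, fun s hs α hα x => ?_, fun p _ hp R hR s hs α hα => ?_⟩
  · refine HasCompactSupport.intro hc.compact fun z hz => ?_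
    rw [hfb s hs]
    exact hb.eval_eq_zero hz
  · obtain ⟨n, rfl⟩ : ∃ n, N = n + 1 := ⟨N - 1, by omega⟩
    obtain ⟨D', -, hprof⟩ := exists_isOsc_timeProfile hc (n + 1)
    rw [timeDeriv_density hc hb1 hfb hs]
    exact contDiff_velAvg hc.compact hc.smooth
      (IsOsc.angDeriv hc.compact.isClosed (hprof _ b hb)) s
  · obtain ⟨n, rfl⟩ : ∃ n, N = n + 1 := ⟨N - 1, by omega⟩
    obtain ⟨D', -, hprof⟩ := exists_isOsc_timeProfile hc (n + 1)
    obtain ⟨r, hr⟩ := hc.exists_radius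
    have hb' := IsOsc.angDeriv hc.compact.isClosed (hprof _ b hb)
    rw [timeDeriv_potential hc hb1 hfb hs]
    have h1 := contDiff_conv_newton (contDiff_velAvg hc.compact hc.smooth hb' s)
      (hasCompactSupport_of_ball (hr _ _ _ hb' s))
    exact contDiff_const.mul (by exact_mod_cast h1)
  · exact fun s hs => (hasDerivWithinAt_density hc hb1 hfb hs x).differentiableWithinAt
  · exact fun s hs => (hasDerivWithinAt_potential hc hb1 hfb hs x).differentiableWithinAt
  · have hlen : (dirList dirX α ++ dirList dirV β).length = order α + order β := by
      rw [List.length_append, length_dirList, length_dirList]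
    rw [phaseDeriv_eq_dlist]
    have h1 := abs_dlist_le (g := f s) (l := dirList dirX α ++ dirList dirV β) (y := z)
      (fun w hw => by
        rcases List.mem_append.1 hw with h | h
        · obtain ⟨i, rfl⟩ := mem_dirList h
          exact (norm_dirX i).le
        · obtain ⟨i, rfl⟩ := mem_dirList h
          exact (norm_dirV i).le)
      ((hcd s hs).contDiffAt.of_le (by rw [hlen]; exact_mod_cast hαβ))
    rw [hlen, hfb s hs] at h1
    rw [hfb s hs]
    have h2 := hgrow _ b hb _ hαβ s z
    have := bracket_pos s
    refine h1.trans (h2.trans ?_)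
    calc C₁ * (D * (C₀ * A)) * bracket s ^ (order α + order β)
        = C₁ * (D * C₀) * A * bracket s ^ (order α + order β) := by ring
      _ ≤ _ := by gcongr
  · have := bracket_pos t
    refine (hdel (C₀ * A) g f hA₀ hg hg0 hgb hf t ht i hi y hy).trans ?_
    calc C₂ * (C₀ * A) * bracket t ^ (i 0) = C₂ * C₀ * A * bracket t ^ (i 0) := by ring
      _ ≤ _ := by gcongr
  · have := bracket_pos s
    refine (hden _ b f hM hb hfb s hs α (by omega) x).trans ?_
    calc C₃ * (D * (C₀ * A)) * bracket s ^ (-((N : ℤ) - order α))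
        = C₃ * (D * C₀) * A * bracket s ^ (-((N : ℤ) - order α)) := by ring
      _ ≤ _ := by gcongr
  · refine ((hC₄ p R hp hR).2 _ b f hM hb hfb s hs α hα).trans (le_of_eq ?_)
    congr 1
    ring
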